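/- Let $\mathcal G$ be a metric graph with a countable edge set $\mathsf E$ and edge lengths $\ell_{\mathsf e}\in(0,\infty)$, that is, the quotient of $\bigsqcup_{\mathsf e}[0,\ell_{\mathsf e}]$ by an equivalence relation on the set of endpoints of the edges (loops and parallel edges are allowed), with its canonical path metric. Assume that $\mathcal G$ is locally finite (every vertex has finite degree), connected, and of finite total length $L=\sum_{\mathsf e}\ell_{\mathsf e}>0$. Let $H^1(\mathcal G)$ be the space of continuous functions $f:\mathcal G\to\mathbb R$ that are absolutely continuous on every edge and satisfy $\sum_{\mathsf e}\|f\|_{H^1(0,\ell_{\mathsf e})}^2<\infty$, and let the Neumann extension $\mathcal H_{\mathrm N}$ be the self-adjoint operator on $L^2(\mathcal G)=\bigoplus_{\mathsf e}L^2(0,\ell_{\mathsf e})$ associated with the quadratic form $f\mapsto\int_{\mathcal G}|f'|^2\,dx$ with domain $H^1(\mathcal G)$. Then $\mathcal H_{\mathrm N}$ has purely discrete spectrum: $L^2(\mathcal G)$ has an orthonormal basis of eigenfunctions of $\mathcal H_{\mathrm N}$ whose eigenvalues, repeated according to multiplicity, are $\mu_1\le\mu_2\le\dots\to\infty$. Moreover,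 for every integer $k\ge 2$, $$\mu_k\ \ge\ \frac{\pi^2k^2}{4L^2},$$ and equality holds for this $k$ if and only if $\mathcal G$ is, up to isometry, a star consisting of $k$ paths of length $L/k$ each, glued together at one common point. Here each path may be finite or infinite, i.e. isometric to $[0,L/k]$ or to $[0,L/k)$ with $0$ corresponding to the common point (in the second case the path consists of infinitely many edges). -/

import Mathlib

open MeasureTheory Filter Topology
open scoped ENNReal

noncomputable section

/-- The combinatorial and metric data of a metric graph with edge set `E`. The edge `e` is a copy of
`[0, len e]`; `(e, false)` is its endpoint `0` and `(e, true)` its endpoint `len e`. The vertices are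
the classes of an arbitrary equivalence relation on the set of all endpoints, so loops and parallel
edges are allowed. -/
structure MetricGraph (E : Type*) where
  len : E → ℝ
  len_pos : ∀ e, 0 < len e
  glue : Setoid (E × Bool)

namespace MetricGraph

variable {E : Type*} (G : MetricGraph E)

/-- The set of vertices. -/
def Vertex : Type _ := Quotient G.glue

/-- The degree of a vertex: the number of edge endpoints it consists of (so loops count twice). -/
def degree (v : G.Vertex) : ℕ∞ := Set.encard {a : E × Bool | (Quotient.mk G.glue a : G.Vertex) = v}

def LocallyFinite : Prop := ∀ v : G.Vertex, G.degree v < ⊤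

/-- The disjoint union of the edges `[0, len e]`. -/
abbrev EdgePoint : Type _ := Σ e : E, Set.Icc (0 : ℝ) (G.len e)

/-- The point of the disjoint union that is given by an endpoint of an edge. -/
def endpoint (a : E × Bool) : G.EdgePoint :=
  ⟨a.1, if a.2 then ⟨G.len a.1, (G.len_pos a.1).le, le_rfl⟩ else ⟨0, le_rfl, (G.len_pos a.1).le⟩⟩

theorem endpoint_injective : Function.Injective G.endpoint := by
  rintro ⟨e, s⟩ ⟨f, t⟩ h
  obtain rfl : e = f := congrArg Sigma.fst h
  have h2 : ((G.endpoint (e, s)).2 : ℝ) = (G.endpoint (e, t)).2 := by rw [h]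
  have hp := G.len_pos e
  cases s <;> cases t <;> simp [endpoint] at h2 ⊢ <;> linarith

/-- The canonical extension of the equivalence relation on endpoints to the disjoint union. -/
def pointSetoid : Setoid G.EdgePoint where
  r p q := p = q ∨ ∃ a b, G.glue a b ∧ p = G.endpoint a ∧ q = G.endpoint b
  iseqv :=
    { refl := fun _ => Or.inl rfl
      symm := by
        rintro p q (rfl | ⟨a, b, hab, rfl, rfl⟩)
        · exact Or.inl rfl
        · exact Or.inr ⟨b, a, G.glue.symm hab, rfl, rfl⟩
      trans := by
        rintro p q r (rfl | ⟨a, b, hab, rfl, rfl⟩) h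
        · exact h
        · rcases h with rfl | ⟨c, d, hcd, hc, rfl⟩
          · exact Or.inr ⟨a, b, hab, rfl, rfl⟩
          · obtain rfl := G.endpoint_injective hc
            exact Or.inr ⟨a, d, G.glue.trans hab hcd, rfl, rfl⟩ }

/-- The metric graph as a set: the quotient of the disjoint union of its edges. -/
def Space : Type _ := Quotient G.pointSetoid

/-- The quotient map. -/
def toSpace (p : G.EdgePoint) : G.Space := Quotient.mk G.pointSetoid p

open Classical in
/-- The distance on the disjoint union of the edges. -/
def edgeDist (p q : G.EdgePoint) : ℝ≥0∞ :=
  if p.1 = q.1 then ENNReal.ofReal |(p.2 : ℝ) - (q.2 : ℝ)| else ⊤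

/-- `(a 0, b 0), …, (a n, b n)` is a chain from `x` to `y`: it starts at `x`, ends at `y`, and `b i`
is identified with `a (i + 1)`. -/
structure IsChain (n : ℕ) (a b : ℕ → G.EdgePoint) (x y : G.Space) : Prop where
  start : G.toSpace (a 0) = x
  finish : G.toSpace (b n) = y
  link : ∀ i < n, G.toSpace (b i) = G.toSpace (a (i + 1))

/-- The (extended) distance on a metric graph: the infimum of the lengths of chains. -/
def gdist (x y : G.Space) : ℝ≥0∞ :=
  sInf {r | ∃ n a b, G.IsChain n a b x y ∧ r = ∑ i ∈ Finset.range (n + 1), G.edgeDist (a i) (b i)}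

theorem edgeDist_comm (p q : G.EdgePoint) : G.edgeDist p q = G.edgeDist q p := by
  unfold edgeDist
  by_cases h : p.1 = q.1
  · rw [if_pos h, if_pos h.symm, abs_sub_comm]
  · rw [if_neg h, if_neg (Ne.symm h)]

theorem gdist_self (x : G.Space) : G.gdist x x = 0 := by
  induction x using Quotient.inductionOn with
  | _ p =>
    refine le_antisymm (sInf_le ⟨0, fun _ => p, fun _ => p, ⟨rfl, rfl, by simp⟩, ?_⟩) zero_le
    simp [edgeDist]

theorem gdist_comm_le (x y : G.Space) : G.gdist x y ≤ G.gdist y x := by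
  refine le_sInf ?_
  rintro r ⟨n, a, b, h, rfl⟩
  refine sInf_le ⟨n, fun i => b (n - i), fun i => a (n - i), ⟨?_, ?_, ?_⟩, ?_⟩
  · simpa using h.finish
  · simpa using h.start
  · intro i hi
    have := h.link (n - (i + 1)) (by omega)
    rw [show n - (i + 1) + 1 = n - i by omega] at this
    exact this.symm
  · rw [← Finset.sum_range_reflect]
    refine Finset.sum_congr rfl fun i hi => ?_
    rw [show n + 1 - 1 - i = n - i by omega, edgeDist_comm]

theorem gdist_triangle (x y z : G.Space) : G.gdist x z ≤ G.gdist x y + G.gdist y z := by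
  rw [gdist, gdist, gdist, ENNReal.sInf_add]
  refine le_iInf₂ ?_
  rintro r ⟨n, a, b, h, rfl⟩
  rw [add_comm, ENNReal.sInf_add]
  refine le_iInf₂ ?_
  rintro s ⟨m, c, d, k, rfl⟩
  refine sInf_le ⟨n + 1 + m, fun i => if i < n + 1 then a i else c (i - (n + 1)),
    fun i => if i < n + 1 then b i else d (i - (n + 1)), ⟨?_, ?_, ?_⟩, ?_⟩
  · simpa using h.start
  · rw [if_neg (by omega), Nat.add_sub_cancel_left]
    exact k.finish
  · intro i hi
    rcases lt_trichotomy i n with hlt | rfl | hgt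
    · rw [if_pos (by omega), if_pos (by omega)]
      exact h.link i hlt
    · rw [if_pos (by omega), if_neg (by omega), Nat.sub_self, h.finish, k.start]
    · rw [if_neg (by omega), if_neg (by omega),
        show i + 1 - (n + 1) = i - (n + 1) + 1 by omega]
      exact k.link _ (by omega)
  · rw [show n + 1 + m + 1 = (n + 1) + (m + 1) by omega, Finset.sum_range_add _ (n + 1) (m + 1), add_comm]
    congr 1
    · refine Finset.sum_congr rfl fun i hi => ?_
      beta_reduce
      rw [if_pos (Finset.mem_range.1 hi), if_pos (Finset.mem_range.1 hi)]
    · refine Finset.sum_congr rfl fun i _ => ?_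
      beta_reduce
      rw [if_neg (by omega), if_neg (by omega), show n + 1 + i - (n + 1) = i by omega]

/-- The canonical metric, which also provides the topology. -/
instance instPseudoEMetricSpaceSpace : PseudoEMetricSpace G.Space where
  edist := G.gdist
  edist_self := G.gdist_self
  edist_comm x y := le_antisymm (G.gdist_comm_le x y) (G.gdist_comm_le y x)
  edist_triangle := G.gdist_triangle

def Connected : Prop := ∀ x y : G.Space, edist x y < ⊤

/-- The total length is finite. -/
def FiniteLength : Prop := Summable G.len

/-- The total length (meaningful if it is finite). -/
def totalLength : ℝ := ∑' e, G.len e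

/-- Lebesgue measure on the edge `e`. -/
abbrev edgeMeasure (e : E) : Measure ℝ := volume.restrict (Set.Icc 0 (G.len e))

/-- `L²(G)`: the Hilbert sum of the spaces `L²(0, len e)`. -/
abbrev L2 : Type _ := lp (fun e : E => Lp ℝ 2 (G.edgeMeasure e)) 2

/-- The restriction of a function on the graph to the edge `e`, as a function on `[0, len e]`
(continued by constants to `ℝ`). -/
def onEdge (u : G.Space → ℝ) (e : E) (x : ℝ) : ℝ :=
  u (G.toSpace ⟨e, Set.projIcc 0 (G.len e) (G.len_pos e).le x⟩)

/-- Membership in the Sobolev space `H¹(G)`: continuous functions on `G`, absolutely continuous on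
every edge with derivative in `L²`, and with finite total `H¹` norm. -/
structure MemH1 (u : G.Space → ℝ) : Prop where
  continuous : Continuous u
  absCont : ∀ e, AbsolutelyContinuousOnInterval (G.onEdge u e) 0 (G.len e)
  deriv_memLp : ∀ e, MemLp (deriv (G.onEdge u e)) 2 (G.edgeMeasure e)
  summable : Summable fun e => ∫ x, ((G.onEdge u e x) ^ 2 + (deriv (G.onEdge u e) x) ^ 2)
    ∂(G.edgeMeasure e)

/-- The (polarised) Neumann form `∫_G u' v'` on `H¹(G)`. -/
def neumannForm (u v : G.Space → ℝ) : ℝ :=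
  ∑' e, ∫ x, deriv (G.onEdge u e) x * deriv (G.onEdge v e) x ∂(G.edgeMeasure e)

/-- The element `f` of `L²(G)` is the class of the function `u`. -/
def Represents (f : G.L2) (u : G.Space → ℝ) : Prop :=
  ∀ e, (f e : ℝ → ℝ) =ᵐ[G.edgeMeasure e] G.onEdge u e

/-- The graph of the Neumann extension, that is, of the self-adjoint operator on `L²(G)` associated
with the Neumann form: `f` lies in its domain and is mapped to `w`. -/
def NeumannExtension (f w : G.L2) : Prop :=
  ∃ u, G.MemH1 u ∧ G.Represents f u ∧
    ∀ (v : G.Space → ℝ) (g : G.L2), G.MemH1 v → G.Represents g v →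
      G.neumannForm u v = inner ℝ w g

/-- The Neumann extension has purely discrete spectrum, and `μ 0 ≤ μ 1 ≤ …` lists its eigenvalues
repeated according to their multiplicities: there is an orthonormal basis of `L²(G)` of
eigenfunctions, and `μ` tends to infinity. The `k`-th eigenvalue is `μ (k - 1)`. -/
def IsNeumannSpectrum (μ : ℕ → ℝ) : Prop :=
  Monotone μ ∧ Tendsto μ atTop atTop ∧
    ∃ ψ : HilbertBasis ℕ ℝ G.L2, ∀ n, G.NeumannExtension (ψ n) (μ n • ψ n)

/-- Up to isometry (so vertices of degree two are disregarded), `G` consists of `k` paths of length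
`totalLength / k` glued together at one common point `c`. The path `i` is the image of the interval
`J i` under an arc length parametrisation `γ i`; the interval is closed for a finite path, and open at
its far endpoint for a path of infinitely many edges. -/
def IsEquilateralStar (k : ℕ) : Prop :=
  ∃ (c : G.Space) (J : Fin k → Set ℝ) (γ : Fin k → ℝ → G.Space),
    (∀ i, J i = Set.Icc 0 (G.totalLength / k) ∨ J i = Set.Ico 0 (G.totalLength / k)) ∧
    (∀ i, γ i 0 = c) ∧
    (∀ p : G.Space, ∃ i, ∃ x ∈ J i, γ i x = p) ∧
    (∀ i, ∀ x ∈ J i, ∀ y ∈ J i, edist (γ i x) (γ i y) = ENNReal.ofReal |x - y|) ∧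
    (∀ i j, i ≠ j → ∀ x ∈ J i, ∀ y ∈ J j, edist (γ i x) (γ j y) = ENNReal.ofReal (x + y))

end MetricGraph

end

/-!
Let `L` be the total length, `ℓ = L / k` and `ω = π k / (2 L)`, so that `ω ℓ = π / 2` and the bound is
`ω²`. Everything rests on finding a *cut set*: at most `k - 1` points such that `∫ |u'|² ≥ ω² ∫ u²` for
all `u` in `H¹` that vanish there (`MetricGraph.IsCutSet`). Some nontrivial combination of the first `k`
eigenfunctions vanishes on the cut set, and therefore `μ_k ≥ ω²`.

*The Riccati bound.* On an interval, completing the square with the logarithmic derivative of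
`cos (ω x + θ)` bounds `∫ (u'² - ω² u²)` below by boundary terms (`riccati_le_integral`). If a tree of
mass `r ≤ ℓ` is attached at a point `p`, then its form is at least `-ω tan (ω r) u(p)²`, where `u(p) = 0`
is required if `r = ℓ`: along an interval this is the Riccati inequality, and at a branching point the
tangent is superadditive (`sum_tan_le`). For an infinite tree the bound follows by a passage to the limit,
since the form is an absolutely convergent sum over the edges (`Rooting.excess_nonneg`).

*Cutting.* A breadth-first search turns the graph into a rooted tree of half edges, cycles being cut open
(`exists_rooting`). All but finitely many subtrees have mass less than `ℓ`, whatever `ℓ` is. Going from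
the leaves towards the root, one keeps track of a residual mass, and cuts at a point as soon as the
residual mass there reaches `ℓ`; so each cut point uses up the mass `ℓ` (`IsBranchWith.extend`,
`IsBranchWith.cut_extend`). Going down again from the root along subtrees of mass more than `ℓ`, one finds
a point `c` at which all incident branches have residual mass at most `ℓ`, while the sum of these masses
is more than `ℓ` (`Rooting.dichotomy`). Such a *fan* needs only one more point, `c` itself, and the sum of
residual masses exceeds `ℓ`; hence there are at most `k - 1` points in total.

*Equality.* If `μ_k = ω²`, then the combination of eigenfunctions above is itself an eigenfunction, for
every cut set of at most `k - 1` points (`IsNeumannSpectrum.hasRigidity`), and equality holds in all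
Riccati bounds. Then it is a multiple of `sin (ω x)` along each branch of the fan that has residual mass
`ℓ`, no cut points and no branching, and it vanishes on all other branches, apart from those which
additional zeros kill; at `c` the amplitudes satisfy Kirchhoff's condition. If there were fewer than `k`
branches of the former kind for the number of cut points left, then by adding zeros one could make the
eigenfunction vanish altogether (`IsFan.dichotomy`). So the fan consists of `k` arms of length `ℓ`. For
two arms, zeros on all the others produce an eigenfunction that is `sin (ω x)` on one arm,
`-sin (ω x)` on the other and zero elsewhere. The associated arc length coordinate is well defined on
the graph and `1`-Lipschitz, so that the arms are isometrically embedded and form a star.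

*The converse.* On an equilateral star the functions that go from their value at the centre to `a i` along
the arm `i` as a quarter of a sine wave, the value at the centre being the mean of the `a i`, form a
`k`-dimensional space on which the Rayleigh quotient is at most `ω²` (`IsStarParam.l2Form_starTest`,
`IsStarParam.neumannForm_starTest_le`). The arms are isometrically embedded and the total length is `k ℓ`,
so the length measure on each arm is Lebesgue measure (`IsStarParam.map_radius_openArm`).

*Discreteness.* Cut sets exist for arbitrarily large frequencies, so on subspaces of finite codimension of
`H¹` the `L²` norm is arbitrarily small compared with the energy norm. Hence the embedding of `H¹` into
`L²` is compact (`isCompactOperator_fst`), and the spectral theorem applies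
(`exists_simultaneous_basis`). That `H¹` is complete is `isClosed_energySpace`.
-/

noncomputable section

namespace MetricGraph

section

/-! ### Points, chains and Lipschitz functions on a metric graph -/

variable {E : Type*} {G : MetricGraph E}

/-- The point of the metric graph at position `t` on the edge `e` (positions outside `[0, len e]` are
clamped to the nearest endpoint), so that `G.onEdge u e t = u (G.pt e t)` by definition. -/
def pt (G : MetricGraph E) (e : E) (t : ℝ) : G.Space :=
  G.toSpace ⟨e, Set.projIcc 0 (G.len e) (G.len_pos e).le t⟩

/-- The position of an endpoint on its edge. -/
def epos (G : MetricGraph E) (a : E × Bool) : ℝ := if a.2 then G.len a.1 else 0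

theorem epos_mem (a : E × Bool) : G.epos a ∈ Set.Icc 0 (G.len a.1) := by
  have := G.len_pos a.1
  unfold epos
  split_ifs
  · exact ⟨this.le, le_rfl⟩
  · exact ⟨le_rfl, this.le⟩

theorem pt_of_mem {e : E} {t : ℝ} (ht : t ∈ Set.Icc 0 (G.len e)) :
    G.pt e t = G.toSpace ⟨e, t, ht⟩ := by
  unfold pt
  rw [Set.projIcc_of_mem _ ht]

theorem toSpace_endpoint (a : E × Bool) : G.toSpace (G.endpoint a) = G.pt a.1 (G.epos a) := by
  rw [pt_of_mem (epos_mem a)]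
  obtain ⟨e, b⟩ := a
  cases b <;> rfl

theorem onEdge_eq (u : G.Space → ℝ) (e : E) (t : ℝ) : G.onEdge u e t = u (G.pt e t) := rfl

theorem exists_pt (p : G.Space) : ∃ e, ∃ t ∈ Set.Icc 0 (G.len e), G.pt e t = p := by
  induction p using Quotient.inductionOn with
  | _ q =>
    obtain ⟨e, t, ht⟩ := q
    exact ⟨e, t, ht, pt_of_mem ht⟩

theorem pt_eq_pt_of_glue {a b : E × Bool} (h : G.glue a b) :
    G.pt a.1 (G.epos a) = G.pt b.1 (G.epos b) := by
  rw [← toSpace_endpoint, ← toSpace_endpoint]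
  exact Quotient.sound (Or.inr ⟨a, b, h, rfl, rfl⟩)

theorem edist_pt_le (e : E) (s t : ℝ) :
    edist (G.pt e s) (G.pt e t) ≤ ENNReal.ofReal |s - t| := by
  refine le_trans (sInf_le ⟨0, fun _ => ⟨e, Set.projIcc 0 (G.len e) (G.len_pos e).le s⟩,
    fun _ => ⟨e, Set.projIcc 0 (G.len e) (G.len_pos e).le t⟩, ⟨rfl, rfl, by simp⟩, rfl⟩) ?_
  simp only [zero_add, Finset.range_one, Finset.sum_singleton, edgeDist, if_true]
  exact ENNReal.ofReal_le_ofReal (Set.abs_projIcc_sub_projIcc _)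

/-- A function that is `K`-Lipschitz along every edge is `K`-Lipschitz for the path metric. -/
theorem ofReal_abs_sub_le_of_edges {F : G.Space → ℝ} {K : ℝ} (hK : 0 < K)
    (hF : ∀ e, ∀ s ∈ Set.Icc 0 (G.len e), ∀ t ∈ Set.Icc 0 (G.len e),
      |F (G.pt e s) - F (G.pt e t)| ≤ K * |s - t|) (x y : G.Space) :
    ENNReal.ofReal |F x - F y| ≤ ENNReal.ofReal K * edist x y := by
  have hedge : ∀ p q : G.EdgePoint, ENNReal.ofReal |F (G.toSpace p) - F (G.toSpace q)| ≤
      ENNReal.ofReal K * G.edgeDist p q := by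
    rintro ⟨e, s, hs⟩ ⟨f, t, ht⟩
    by_cases hef : e = f
    · subst hef
      rw [edgeDist, if_pos rfl, ← ENNReal.ofReal_mul hK.le, ← pt_of_mem hs, ← pt_of_mem ht]
      exact ENNReal.ofReal_le_ofReal (hF e s hs t ht)
    · have h1 : G.edgeDist ⟨e, s, hs⟩ ⟨f, t, ht⟩ = ⊤ := if_neg hef
      rw [h1, ENNReal.mul_top (by simpa using hK)]
      exact le_top
  have hchain : ∀ (n : ℕ) (a b : ℕ → G.EdgePoint),
      (∀ i < n, G.toSpace (b i) = G.toSpace (a (i + 1))) →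
      ENNReal.ofReal |F (G.toSpace (a 0)) - F (G.toSpace (b n))| ≤
        ENNReal.ofReal K * ∑ i ∈ Finset.range (n + 1), G.edgeDist (a i) (b i) := by
    intro n a b
    induction n with
    | zero =>
      intro _
      simpa using hedge (a 0) (b 0)
    | succ n ih =>
      intro hl
      have h1 := ih (fun i hi => hl i (by omega))
      rw [Finset.sum_range_succ, mul_add]
      refine le_trans ?_ (add_le_add h1 (hedge (a (n + 1)) (b (n + 1))))
      rw [← ENNReal.ofReal_add (abs_nonneg _) (abs_nonneg _), ← hl n (by omega)]
      exact ENNReal.ofReal_le_ofReal (abs_sub_le _ _ _)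
  have hK0 : ENNReal.ofReal K ≠ 0 := by simpa using hK
  rw [mul_comm, ← ENNReal.div_le_iff_le_mul (Or.inl hK0) (Or.inl ENNReal.ofReal_ne_top)]
  refine le_sInf ?_
  rintro r ⟨n, a, b, h, rfl⟩
  rw [ENNReal.div_le_iff_le_mul (Or.inl hK0) (Or.inl ENNReal.ofReal_ne_top), mul_comm,
    ← h.start, ← h.finish]
  exact hchain n a b h.link

theorem continuous_of_edges {F : G.Space → ℝ} {K : ℝ} (hK : 0 < K)
    (hF : ∀ e, ∀ s ∈ Set.Icc 0 (G.len e), ∀ t ∈ Set.Icc 0 (G.len e),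
      |F (G.pt e s) - F (G.pt e t)| ≤ K * |s - t|) : Continuous F := by
  have : LipschitzWith K.toNNReal F := by
    intro x y
    rw [edist_dist, Real.dist_eq]
    exact ofReal_abs_sub_le_of_edges hK hF x y
  exact this.continuous

/-- A family of functions on the edges that agrees at identified endpoints descends to the graph. -/
theorem exists_lift (φ : E → ℝ → ℝ)
    (h : ∀ a b, G.glue a b → φ a.1 (G.epos a) = φ b.1 (G.epos b)) :
    ∃ F : G.Space → ℝ, ∀ e, ∀ t ∈ Set.Icc 0 (G.len e), F (G.pt e t) = φ e t := by
  have hpos : ∀ a, ((G.endpoint a).2 : ℝ) = G.epos a := by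
    rintro ⟨e, b⟩
    cases b <;> rfl
  refine ⟨fun p => Quotient.liftOn p (fun q : G.EdgePoint => φ q.1 q.2) ?_, ?_⟩
  · rintro p q (rfl | ⟨a, b, hab, rfl, rfl⟩)
    · rfl
    · rw [hpos, hpos]
      exact h a b hab
  · intro e t ht
    rw [pt_of_mem ht]
    rfl

theorem continuous_pt (e : E) : Continuous (G.pt e) := by
  have : LipschitzWith 1 (G.pt e) := by
    intro s t
    rw [ENNReal.coe_one, one_mul, edist_dist, Real.dist_eq]
    exact edist_pt_le e s t
  exact this.continuous

end

section

/-! ### The Riccati inequality on an interval -/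

section Interval

variable {w : ℝ → ℝ} {a b : ℝ}

theorem sq_sub_le_mul_integral (hab : a ≤ b) (hw : AbsolutelyContinuousOnInterval w a b)
    (hw2 : IntervalIntegrable (fun x => deriv w x ^ 2) volume a b) :
    (w b - w a) ^ 2 ≤ (b - a) * ∫ x in a..b, deriv w x ^ 2 := by
  rcases hab.eq_or_lt with rfl | hlt
  · simp
  have hba : 0 < b - a := sub_pos.2 hlt
  set c := (w b - w a) / (b - a) with hc
  have h0 : 0 ≤ ∫ x in a..b, (deriv w x - c) ^ 2 :=
    intervalIntegral.integral_nonneg hab fun x _ => sq_nonneg _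
  have h1 : ∫ x in a..b, (deriv w x - c) ^ 2 =
      (∫ x in a..b, deriv w x ^ 2) - 2 * c * (w b - w a) + c ^ 2 * (b - a) := by
    have hi := hw.intervalIntegrable_deriv
    rw [← hw.integral_deriv_eq_sub, ← intervalIntegral.integral_const_mul,
      ← intervalIntegral.integral_sub hw2 (hi.const_mul _),
      show c ^ 2 * (b - a) = ∫ x in a..b, c ^ 2 by simp [mul_comm],
      ← intervalIntegral.integral_add (hw2.sub (hi.const_mul _)) (by simp)]
    refine intervalIntegral.integral_congr fun x _ => ?_
    ring
  have h2 : c * (b - a) = w b - w a := div_mul_cancel₀ _ hba.ne'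
  rw [h1] at h0
  nlinarith

variable {ω θ : ℝ}

/-- The logarithmic derivative of `x ↦ cos (ω x + θ)`. -/
def riccati (ω θ x : ℝ) : ℝ := -ω * Real.tan (ω * x + θ)

theorem hasDerivAt_riccati {x : ℝ} (hx : Real.cos (ω * x + θ) ≠ 0) :
    HasDerivAt (riccati ω θ) (-ω ^ 2 - riccati ω θ x ^ 2) x := by
  have h1 : HasDerivAt (fun x => ω * x + θ) ω x := by
    simpa using ((hasDerivAt_id x).const_mul ω).add_const θ
  have h2 := ((Real.hasDerivAt_tan hx).comp x h1).const_mul (-ω)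
  refine h2.congr_deriv ?_
  unfold riccati
  rw [Real.tan_eq_sin_div_cos]
  have h3 := Real.sin_sq_add_cos_sq (ω * x + θ)
  field_simp
  linear_combination ω ^ 2 * h3

theorem contDiffOn_riccati (h : ∀ x ∈ Set.uIcc a b, Real.cos (ω * x + θ) ≠ 0) :
    ContDiffOn ℝ 1 (riccati ω θ) (Set.uIcc a b) := by
  intro x hx
  have h1 : ContDiffAt ℝ 1 (fun x => -ω * Real.tan (ω * x + θ)) x := by
    refine contDiffAt_const.mul ?_
    have h2 : ContDiffAt ℝ 1 (fun x : ℝ => ω * x + θ) x := by fun_prop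
    exact ContDiffAt.comp (g := Real.tan) (f := fun x : ℝ => ω * x + θ) x
      (Real.contDiffAt_tan.2 (h x hx)) h2
  exact h1.contDiffWithinAt

/-- The Riccati (Jacobi) identity: completing the square with the logarithmic derivative of a
solution of `φ'' = -ω² φ` that has no zero. -/
theorem integral_riccati (hab : a ≤ b) (hw : AbsolutelyContinuousOnInterval w a b)
    (hw2 : IntervalIntegrable (fun x => deriv w x ^ 2) volume a b)
    (h : ∀ x ∈ Set.Icc a b, Real.cos (ω * x + θ) ≠ 0) :
    IntervalIntegrable (fun x => (deriv w x - riccati ω θ x * w x) ^ 2) volume a b ∧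
    (∫ x in a..b, (deriv w x ^ 2 - ω ^ 2 * w x ^ 2)) =
      w b ^ 2 * riccati ω θ b - w a ^ 2 * riccati ω θ a +
        ∫ x in a..b, (deriv w x - riccati ω θ x * w x) ^ 2 := by
  rw [← Set.uIcc_of_le hab] at h
  have hR := (contDiffOn_riccati h).absolutelyContinuousOnInterval
  have hw' := hw.intervalIntegrable_deriv
  have hRw := hR.fun_mul hw
  have i1 : IntervalIntegrable (fun x => deriv w x * (riccati ω θ x * w x)) volume a b :=
    hw'.mul_continuousOn hRw.continuousOn
  have i2 : IntervalIntegrable (fun x => (riccati ω θ x * w x) * (riccati ω θ x * w x)) volume a b :=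
    (hRw.fun_mul hRw).continuousOn.intervalIntegrable
  have i3 : IntervalIntegrable (fun x => (deriv w x - riccati ω θ x * w x) ^ 2) volume a b := by
    refine ((hw2.sub (i1.const_mul 2)).add i2).congr (fun x _ => ?_)
    ring
  have i4 : IntervalIntegrable (fun x => ω ^ 2 * w x ^ 2) volume a b := by
    have := ((hw.fun_mul hw).continuousOn.intervalIntegrable (μ := volume)).const_mul (ω ^ 2)
    refine this.congr (fun x _ => ?_)
    ring
  refine ⟨i3, ?_⟩
  have hB := ((hw.fun_mul hw).fun_mul hR).integral_deriv_eq_sub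
  have h1 : ∫ x in a..b, deriv (fun x => w x * w x * riccati ω θ x) x =
      ∫ x in a..b, ((deriv w x ^ 2 - ω ^ 2 * w x ^ 2) - (deriv w x - riccati ω θ x * w x) ^ 2) := by
    refine intervalIntegral.integral_congr_ae ?_
    filter_upwards [hw.ae_differentiableAt] with x hx hxm
    have hxm' : x ∈ Set.uIcc a b := Set.uIoc_subset_uIcc hxm
    have hd := (hx hxm').hasDerivAt
    rw [((hd.fun_mul hd).fun_mul (hasDerivAt_riccati (h x hxm'))).deriv]
    ring
  rw [h1, intervalIntegral.integral_sub (hw2.sub i4) i3] at hB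
  linear_combination hB

/-- The boundary term of the Riccati identity is continuous even at the poles of the tangent, provided
that `w` vanishes there: near a pole `p`, `w(x)²` is at most `|x - p|` times the integral of `w'²` from
`p` to `x`, while `|x - p|` times the tangent stays bounded. -/
theorem continuousOn_sq_mul_riccati (hω : 0 < ω) (hab : a ≤ b)
    (hw : AbsolutelyContinuousOnInterval w a b)
    (hw2 : IntervalIntegrable (fun x => deriv w x ^ 2) volume a b)
    (h : ∀ x ∈ Set.Icc a b, Real.cos (ω * x + θ) = 0 → w x = 0) :
    ContinuousOn (fun x => w x ^ 2 * riccati ω θ x) (Set.Icc a b) := by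
  intro p hp
  have hwc := hw.continuousOn
  rw [Set.uIcc_of_le hab] at hwc
  by_cases hc : Real.cos (ω * p + θ) = 0
  · have hwp := h p hp hc
    unfold ContinuousWithinAt
    simp only [hwp, ne_eq, OfNat.ofNat_ne_zero, not_false_eq_true, zero_pow, zero_mul]
    have hP : ContinuousOn (fun x => ∫ y in p..x, deriv w y ^ 2) (Set.Icc a b) := by
      have := intervalIntegral.continuousOn_primitive_interval' (μ := volume) (a := p) hw2
        (by rwa [Set.uIcc_of_le hab])
      rwa [Set.uIcc_of_le hab] at this
    have hPt : Tendsto (fun x => Real.pi / 2 * |∫ y in p..x, deriv w y ^ 2|)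
        (𝓝[Set.Icc a b] p) (𝓝 0) := by
      have := ((hP p hp).abs.const_mul (Real.pi / 2))
      simpa [ContinuousWithinAt] using this
    refine squeeze_zero_norm' ?_ hPt
    have hnear : ∀ᶠ x in 𝓝[Set.Icc a b] p, |ω * (x - p)| ≤ Real.pi / 2 := by
      refine mem_nhdsWithin_of_mem_nhds ?_
      have hcont : Continuous fun x : ℝ => |ω * (x - p)| := by fun_prop
      have : ∀ᶠ x in 𝓝 p, |ω * (x - p)| < Real.pi / 2 := by
        refine hcont.continuousAt.eventually_lt continuousAt_const ?_
        simpa using Real.pi_pos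
      exact this.mono fun x hx => hx.le
    filter_upwards [hnear, self_mem_nhdsWithin] with x hx hxm
    have hsq : w x ^ 2 ≤ |x - p| * |∫ y in p..x, deriv w y ^ 2| := by
      rcases le_total p x with hpx | hpx
      · have hsub : Set.uIcc p x ⊆ Set.uIcc a b := by
          rw [Set.uIcc_of_le hpx, Set.uIcc_of_le hab]
          exact Set.Icc_subset_Icc hp.1 hxm.2
        have := sq_sub_le_mul_integral hpx (hw.mono hsub) (hw2.mono_set hsub)
        rw [hwp, sub_zero] at this
        rw [← abs_mul]
        exact this.trans (le_abs_self _)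
      · have hsub : Set.uIcc x p ⊆ Set.uIcc a b := by
          rw [Set.uIcc_of_le hpx, Set.uIcc_of_le hab]
          exact Set.Icc_subset_Icc hxm.1 hp.2
        have := sq_sub_le_mul_integral hpx (hw.mono hsub) (hw2.mono_set hsub)
        rw [hwp, zero_sub, neg_sq] at this
        rw [intervalIntegral.integral_symm, abs_neg, abs_sub_comm, ← abs_mul]
        exact this.trans (le_abs_self _)
    have hbd : |x - p| * |riccati ω θ x| ≤ Real.pi / 2 := by
      have hcos : |Real.cos (ω * x + θ)| = |Real.sin (ω * (x - p))| := by
        have e1 : ω * x + θ = (ω * p + θ) + ω * (x - p) := by ring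
        have e2 := Real.sin_sq_add_cos_sq (ω * p + θ)
        rw [hc] at e2
        have e3 : |Real.sin (ω * p + θ)| = 1 := by
          rw [← sq_eq_sq₀ (abs_nonneg _) zero_le_one, sq_abs]
          linarith
        rw [e1, Real.cos_add, hc, zero_mul, zero_sub, abs_neg, abs_mul, e3, one_mul]
      have hj : 2 / Real.pi * |ω * (x - p)| ≤ |Real.cos (ω * x + θ)| := by
        rw [hcos]
        exact Real.mul_abs_le_abs_sin hx
      unfold riccati
      rw [Real.tan_eq_sin_div_cos, abs_mul, abs_neg, abs_div]
      rw [abs_mul, abs_of_pos hω] at hj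
      rw [abs_of_pos hω]
      rcases (abs_nonneg (x - p)).eq_or_lt with h0 | h0
      · rw [← h0, zero_mul]
        positivity
      · have hpi := Real.pi_pos
        have hcpos : 0 < |Real.cos (ω * x + θ)| := lt_of_lt_of_le (by positivity) hj
        have hs := Real.abs_sin_le_one (ω * x + θ)
        rw [← mul_assoc, mul_div_assoc', div_le_iff₀ hcpos]
        have e4 : |x - p| * ω ≤ Real.pi / 2 * |Real.cos (ω * x + θ)| := by
          calc |x - p| * ω = Real.pi / 2 * (2 / Real.pi * (ω * |x - p|)) := by field_simp
            _ ≤ _ := by gcongr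
        refine le_trans (mul_le_of_le_one_right (by positivity) hs) e4
    rw [Real.norm_eq_abs, abs_mul, abs_of_nonneg (sq_nonneg (w x))]
    calc w x ^ 2 * |riccati ω θ x|
        ≤ |x - p| * |∫ y in p..x, deriv w y ^ 2| * |riccati ω θ x| := by gcongr
      _ = |x - p| * |riccati ω θ x| * |∫ y in p..x, deriv w y ^ 2| := by ring
      _ ≤ _ := by gcongr
  · exact ((hwc p hp).pow 2).mul (hasDerivAt_riccati hc).continuousAt.continuousWithinAt

/-- The Riccati inequality with its case of equality. The comparison function `cos (ω x + θ)` may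
vanish at an endpoint of the interval, provided that `w` vanishes there too. -/
theorem riccati_le_integral (hω : 0 < ω) (hab : a < b)
    (hw : AbsolutelyContinuousOnInterval w a b)
    (hw2 : IntervalIntegrable (fun x => deriv w x ^ 2) volume a b)
    (hc : ∀ x ∈ Set.Ioo a b, Real.cos (ω * x + θ) ≠ 0)
    (ha : Real.cos (ω * a + θ) = 0 → w a = 0) (hb : Real.cos (ω * b + θ) = 0 → w b = 0) :
    w b ^ 2 * riccati ω θ b - w a ^ 2 * riccati ω θ a ≤
      (∫ x in a..b, (deriv w x ^ 2 - ω ^ 2 * w x ^ 2)) ∧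
    ((∫ x in a..b, (deriv w x ^ 2 - ω ^ 2 * w x ^ 2)) =
        w b ^ 2 * riccati ω θ b - w a ^ 2 * riccati ω θ a →
      ∃ C, ∀ x ∈ Set.Icc a b, w x = C * Real.cos (ω * x + θ)) := by
  have hpole : ∀ x ∈ Set.Icc a b, Real.cos (ω * x + θ) = 0 → w x = 0 := by
    intro x hx h0
    rcases hx.1.eq_or_lt with rfl | h1
    · exact ha h0
    rcases hx.2.eq_or_lt with rfl | h2
    · exact hb h0
    exact absurd h0 (hc x ⟨h1, h2⟩)
  have hwc := hw.continuousOn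
  have iq : IntervalIntegrable (fun x => deriv w x ^ 2 - ω ^ 2 * w x ^ 2) volume a b := by
    refine hw2.sub (ContinuousOn.intervalIntegrable ?_)
    exact (hwc.pow 2).const_mul _
  rw [Set.uIcc_of_le hab.le] at hwc
  -- the defect on `[a, x]`; its increments are integrals of the square `(w' - h w)²`, where `h` is the
  -- logarithmic derivative of the comparison function
  set D : ℝ → ℝ := fun x => (∫ y in a..x, (deriv w y ^ 2 - ω ^ 2 * w y ^ 2)) -
    w x ^ 2 * riccati ω θ x with hD
  have hDc : ContinuousOn D (Set.Icc a b) := by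
    refine ContinuousOn.sub ?_ (continuousOn_sq_mul_riccati hω hab.le hw hw2 hpole)
    have := intervalIntegral.continuousOn_primitive_interval' (μ := volume) (a := a) iq (by simp)
    rwa [Set.uIcc_of_le hab.le] at this
  have key : ∀ x ∈ Set.Ioo a b, ∀ y ∈ Set.Ioo a b, x ≤ y →
      IntervalIntegrable (fun t => (deriv w t - riccati ω θ t * w t) ^ 2) volume x y ∧
      D y - D x = ∫ t in x..y, (deriv w t - riccati ω θ t * w t) ^ 2 := by
    intro x hx y hy hxy
    have hsub : Set.uIcc x y ⊆ Set.uIcc a b := by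
      rw [Set.uIcc_of_le hxy, Set.uIcc_of_le hab.le]
      exact Set.Icc_subset_Icc hx.1.le hy.2.le
    obtain ⟨h0, h1⟩ := integral_riccati (ω := ω) (θ := θ) hxy (hw.mono hsub) (hw2.mono_set hsub)
      fun t ht => hc t ⟨hx.1.trans_le ht.1, ht.2.trans_lt hy.2⟩
    refine ⟨h0, ?_⟩
    have hax : Set.uIcc a x ⊆ Set.uIcc a b := by
      rw [Set.uIcc_of_le hx.1.le, Set.uIcc_of_le hab.le]
      exact Set.Icc_subset_Icc le_rfl hx.2.le
    have h2 := intervalIntegral.integral_add_adjacent_intervals (iq.mono_set hax) (iq.mono_set hsub)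
    simp only [hD]
    linear_combination -h2 + h1
  have hmono : ∀ x ∈ Set.Ioo a b, ∀ y ∈ Set.Ioo a b, x ≤ y → D x ≤ D y := by
    intro x hx y hy hxy
    have h1 := (key x hx y hy hxy).2
    have h2 : 0 ≤ ∫ t in x..y, (deriv w t - riccati ω θ t * w t) ^ 2 :=
      intervalIntegral.integral_nonneg hxy fun x _ => sq_nonneg _
    linarith
  have hleft : ∀ y ∈ Set.Ioo a b, D a ≤ D y := by
    intro y hy
    have h1 : Tendsto D (𝓝[Set.Ioo a b] a) (𝓝 (D a)) :=
      (hDc a ⟨le_rfl, hab.le⟩).mono_left (nhdsWithin_mono _ Set.Ioo_subset_Icc_self)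
    rw [nhdsWithin_Ioo_eq_nhdsGT hab] at h1
    refine le_of_tendsto h1 ?_
    filter_upwards [Ioo_mem_nhdsGT hy.1] with x hx
    exact hmono x ⟨hx.1, hx.2.trans hy.2⟩ y hy hx.2.le
  have hright : ∀ y ∈ Set.Ioo a b, D y ≤ D b := by
    intro y hy
    have h1 : Tendsto D (𝓝[Set.Ioo a b] b) (𝓝 (D b)) :=
      (hDc b ⟨hab.le, le_rfl⟩).mono_left (nhdsWithin_mono _ Set.Ioo_subset_Icc_self)
    rw [nhdsWithin_Ioo_eq_nhdsLT hab] at h1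
    refine ge_of_tendsto h1 ?_
    filter_upwards [Ioo_mem_nhdsLT hy.2] with x hx
    exact hmono y hy x ⟨hy.1.trans hx.1, hx.2⟩ hx.1.le
  have hmid : (a + b) / 2 ∈ Set.Ioo a b := ⟨by linarith, by linarith⟩
  have hDa : D a = -(w a ^ 2 * riccati ω θ a) := by simp [hD]
  have hDb : D b = (∫ x in a..b, (deriv w x ^ 2 - ω ^ 2 * w x ^ 2)) - w b ^ 2 * riccati ω θ b := rfl
  refine ⟨?_, fun heq => ?_⟩
  · have := (hleft _ hmid).trans (hright _ hmid)
    linarith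
  -- in the case of equality the defect is constant, so `w' = h w` almost everywhere, and the quotient of
  -- `w` and the comparison function is constant
  have hconst : ∀ y ∈ Set.Ioo a b, D y = D a := by
    intro y hy
    refine le_antisymm ?_ (hleft y hy)
    have := hright y hy
    linarith
  set m := (a + b) / 2
  refine ⟨w m / Real.cos (ω * m + θ), ?_⟩
  have hcosd : ∀ x, HasDerivAt (fun x => Real.cos (ω * x + θ)) (-(ω * Real.sin (ω * x + θ))) x := by
    intro x
    have h1 : HasDerivAt (fun x => ω * x + θ) ω x := by
      simpa using ((hasDerivAt_id x).const_mul ω).add_const θ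
    exact h1.cos.congr_deriv (by ring)
  have hsub2 : ∀ x ∈ Set.Ioo a b, ∀ y ∈ Set.Ioo a b, x ≤ y →
      w y / Real.cos (ω * y + θ) = w x / Real.cos (ω * x + θ) := by
    intro x hx y hy hxy
    have hsub : Set.uIcc x y ⊆ Set.uIcc a b := by
      rw [Set.uIcc_of_le hxy, Set.uIcc_of_le hab.le]
      exact Set.Icc_subset_Icc hx.1.le hy.2.le
    have hxy' : ∀ t ∈ Set.uIcc x y, Real.cos (ω * t + θ) ≠ 0 := by
      intro t ht
      rw [Set.uIcc_of_le hxy] at ht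
      exact hc t ⟨hx.1.trans_le ht.1, ht.2.trans_lt hy.2⟩
    have hinv : AbsolutelyContinuousOnInterval (fun t => (Real.cos (ω * t + θ))⁻¹) x y := by
      refine ContDiffOn.absolutelyContinuousOnInterval fun t ht => ?_
      refine ContDiffAt.contDiffWithinAt (ContDiffAt.inv ?_ (hxy' t ht))
      exact Real.contDiff_cos.contDiffAt.comp t (by fun_prop)
    have hz := (hw.mono hsub).fun_mul hinv
    have hz0 := hz.integral_deriv_eq_sub
    obtain ⟨i0, hk⟩ := key x hx y hy hxy
    rw [hconst x hx, hconst y hy, sub_self] at hk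
    have hae : ∀ᵐ t ∂volume.restrict (Set.Ioc x y), (deriv w t - riccati ω θ t * w t) ^ 2 = 0 := by
      have := (intervalIntegral.integral_eq_zero_iff_of_le_of_nonneg_ae hxy
        (ae_of_all _ fun t => sq_nonneg _) i0).1 hk.symm
      exact this
    have h0 : ∫ t in x..y, deriv (fun t => w t * (Real.cos (ω * t + θ))⁻¹) t =
        ∫ t in x..y, (0 : ℝ) := by
      refine intervalIntegral.integral_congr_ae ?_
      rw [ae_restrict_iff' measurableSet_Ioc] at hae
      filter_upwards [(hw.mono hsub).ae_differentiableAt, hae] with t ht h1 htm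
      have htm' : t ∈ Set.uIcc x y := Set.uIoc_subset_uIcc htm
      rw [Set.uIoc_of_le hxy] at htm
      have h2 : deriv w t = riccati ω θ t * w t := by
        have := pow_eq_zero_iff (two_ne_zero) |>.1 (h1 htm)
        linarith
      have hd := (ht htm').hasDerivAt
      rw [(hd.fun_mul ((hcosd t).fun_inv (hxy' t htm'))).deriv, h2, riccati,
        Real.tan_eq_sin_div_cos]
      have := hxy' t htm'
      field_simp
      ring
    rw [h0, intervalIntegral.integral_zero] at hz0
    simp only [div_eq_mul_inv]
    linarith
  have hIoo : ∀ x ∈ Set.Ioo a b, w x = w m / Real.cos (ω * m + θ) * Real.cos (ω * x + θ) := by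
    intro x hx
    have h1 : w x / Real.cos (ω * x + θ) = w m / Real.cos (ω * m + θ) := by
      rcases le_total x m with h | h
      · exact (hsub2 x hx m hmid h).symm
      · exact hsub2 m hmid x hx h
    rw [← h1, div_mul_cancel₀ _ (hc x hx)]
  have hcl : Set.EqOn w (fun x => w m / Real.cos (ω * m + θ) * Real.cos (ω * x + θ))
      (Set.Icc a b) := by
    refine Set.EqOn.of_subset_closure (s := Set.Ioo a b) hIoo hwc (by fun_prop)
      Set.Ioo_subset_Icc_self ?_
    rw [closure_Ioo hab.ne]
  exact hcl

end Interval

end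

section

/-! ### The Sobolev space and its forms -/

variable {E : Type*} {G : MetricGraph E} {u v : G.Space → ℝ}

theorem integral_edgeMeasure (e : E) (f : ℝ → ℝ) :
    ∫ x, f x ∂(G.edgeMeasure e) = ∫ x in (0 : ℝ)..(G.len e), f x := by
  rw [intervalIntegral.integral_of_le (G.len_pos e).le, integral_Icc_eq_integral_Ioc]

theorem intervalIntegrable_iff_edge (e : E) (f : ℝ → ℝ) :
    IntervalIntegrable f volume 0 (G.len e) ↔ Integrable f (G.edgeMeasure e) := by
  rw [intervalIntegrable_iff_integrableOn_Icc_of_le (G.len_pos e).le]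
  rfl

theorem onEdge_lipschitz {K : ℝ} (hK : 0 ≤ K)
    (hF : ∀ e, ∀ s ∈ Set.Icc 0 (G.len e), ∀ t ∈ Set.Icc 0 (G.len e),
      |u (G.pt e s) - u (G.pt e t)| ≤ K * |s - t|) (e : E) :
    LipschitzWith K.toNNReal (G.onEdge u e) := by
  refine LipschitzWith.of_dist_le_mul fun s t => ?_
  rw [Real.dist_eq, Real.dist_eq, Real.coe_toNNReal _ hK]
  have h := hF e _ (Set.projIcc 0 (G.len e) (G.len_pos e).le s).2 _
    (Set.projIcc 0 (G.len e) (G.len_pos e).le t).2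
  rw [pt_of_mem (Subtype.mem _), pt_of_mem (Subtype.mem _)] at h
  exact h.trans (mul_le_mul_of_nonneg_left (Set.abs_projIcc_sub_projIcc _) hK)

/-- Bounded functions that are Lipschitz along the edges belong to `H¹` of a graph of finite total
length. -/
theorem memH1_of_lipschitz (hfin : G.FiniteLength) {K C : ℝ} (hK : 0 < K)
    (hF : ∀ e, ∀ s ∈ Set.Icc 0 (G.len e), ∀ t ∈ Set.Icc 0 (G.len e),
      |u (G.pt e s) - u (G.pt e t)| ≤ K * |s - t|) (hC : ∀ p, |u p| ≤ C) : G.MemH1 u := by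
  have hL := onEdge_lipschitz hK.le hF
  have hd : ∀ e x, |deriv (G.onEdge u e) x| ≤ K := fun e x => by
    have := norm_deriv_le_of_lipschitz (x₀ := x) (hL e)
    rwa [Real.coe_toNNReal _ hK.le] at this
  refine ⟨continuous_of_edges hK hF, fun e =>
    ((hL e).lipschitzOnWith (s := Set.uIcc 0 (G.len e))).absolutelyContinuousOnInterval, fun e => ?_, ?_⟩
  · refine MemLp.of_bound (measurable_deriv _).aestronglyMeasurable K (ae_of_all _ (hd e))
  · refine Summable.of_nonneg_of_le (fun e => integral_nonneg fun x => by positivity) (fun e => ?_)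
      (hfin.mul_left (C ^ 2 + K ^ 2))
    have h1 : ∀ x, (G.onEdge u e x) ^ 2 + (deriv (G.onEdge u e) x) ^ 2 ≤ C ^ 2 + K ^ 2 := fun x =>
      add_le_add (sq_le_sq' (neg_le_of_abs_le (hC _)) (le_of_abs_le (hC _)))
        (sq_le_sq' (neg_le_of_abs_le (hd e x)) (le_of_abs_le (hd e x)))
    refine (integral_mono_of_nonneg (ae_of_all _ fun x => by positivity) (integrable_const _)
      (ae_of_all _ h1)).trans ?_
    simp [Measure.real, (G.len_pos e).le, mul_comm]

namespace MemH1

variable (hu : G.MemH1 u) (hv : G.MemH1 v)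
include hu

theorem continuous_onEdge (e : E) : Continuous (G.onEdge u e) :=
  hu.continuous.comp (continuous_pt e)

theorem memLp_onEdge (e : E) : MemLp (G.onEdge u e) 2 (G.edgeMeasure e) := by
  obtain ⟨C, hC⟩ := (isCompact_Icc (a := 0) (b := G.len e)).exists_bound_of_continuousOn
    (hu.continuous_onEdge e).continuousOn
  refine MemLp.of_bound (hu.continuous_onEdge e).aestronglyMeasurable C ?_
  filter_upwards [ae_restrict_mem measurableSet_Icc] with x hx using hC x hx

theorem integrable_sq (e : E) : Integrable (fun x => G.onEdge u e x ^ 2) (G.edgeMeasure e) :=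
  (hu.memLp_onEdge e).integrable_sq

theorem integrable_deriv_sq (e : E) :
    Integrable (fun x => deriv (G.onEdge u e) x ^ 2) (G.edgeMeasure e) :=
  (hu.deriv_memLp e).integrable_sq

theorem summable_sq : Summable fun e => ∫ x, G.onEdge u e x ^ 2 ∂(G.edgeMeasure e) := by
  refine Summable.of_nonneg_of_le (fun e => integral_nonneg fun x => sq_nonneg _) (fun e => ?_)
    hu.summable
  exact integral_mono (hu.integrable_sq e) ((hu.integrable_sq e).add (hu.integrable_deriv_sq e))
    fun x => le_add_of_nonneg_right (sq_nonneg _)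

theorem summable_deriv_sq :
    Summable fun e => ∫ x, deriv (G.onEdge u e) x ^ 2 ∂(G.edgeMeasure e) := by
  refine Summable.of_nonneg_of_le (fun e => integral_nonneg fun x => sq_nonneg _) (fun e => ?_)
    hu.summable
  exact integral_mono (hu.integrable_deriv_sq e)
    ((hu.integrable_sq e).add (hu.integrable_deriv_sq e))
    fun x => le_add_of_nonneg_left (sq_nonneg _)

omit hu in
theorem of_parts (h1 : Continuous u)
    (h2 : ∀ e, AbsolutelyContinuousOnInterval (G.onEdge u e) 0 (G.len e))
    (h3 : ∀ e, MemLp (deriv (G.onEdge u e)) 2 (G.edgeMeasure e))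
    (h4 : Summable fun e => ∫ x, G.onEdge u e x ^ 2 ∂(G.edgeMeasure e))
    (h5 : Summable fun e => ∫ x, deriv (G.onEdge u e) x ^ 2 ∂(G.edgeMeasure e)) : G.MemH1 u := by
  refine ⟨h1, h2, h3, ?_⟩
  refine (h4.add h5).congr fun e => ?_
  rw [integral_add _ (h3 e).integrable_sq]
  have hc : ContinuousOn (G.onEdge u e) (Set.Icc 0 (G.len e)) := by
    have := (h2 e).continuousOn
    rwa [Set.uIcc_of_le (G.len_pos e).le] at this
  exact (hc.pow 2).integrableOn_Icc

theorem ae_differentiableAt (e : E) :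
    ∀ᵐ x ∂(G.edgeMeasure e), DifferentiableAt ℝ (G.onEdge u e) x := by
  rw [ae_restrict_iff' measurableSet_Icc]
  filter_upwards [(hu.absCont e).ae_differentiableAt] with x hx hm
  exact hx (by rwa [Set.uIcc_of_le (G.len_pos e).le])

theorem const_mul (c : ℝ) : G.MemH1 (fun p => c * u p) := by
  have hd : ∀ e, deriv (G.onEdge (fun p => c * u p) e) = fun x => c * deriv (G.onEdge u e) x := by
    intro e
    funext x
    exact deriv_const_mul_field c
  refine of_parts (hu.continuous.const_mul c) (fun e => (hu.absCont e).const_mul c) (fun e => ?_) ?_ ?_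
  · rw [hd]
    exact (hu.deriv_memLp e).const_mul c
  · refine (hu.summable_sq.mul_left (c ^ 2)).congr fun e => ?_
    rw [← integral_const_mul]
    refine integral_congr_ae (ae_of_all _ fun x => ?_)
    simp only [onEdge_eq]
    ring
  · refine (hu.summable_deriv_sq.mul_left (c ^ 2)).congr fun e => ?_
    rw [← integral_const_mul, hd]
    refine integral_congr_ae (ae_of_all _ fun x => ?_)
    simp only
    ring

include hv

theorem deriv_add_ae (e : E) : deriv (G.onEdge (fun p => u p + v p) e) =ᵐ[G.edgeMeasure e]
    fun x => deriv (G.onEdge u e) x + deriv (G.onEdge v e) x := by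
  filter_upwards [hu.ae_differentiableAt e, hv.ae_differentiableAt e] with x h1 h2
  exact (h1.hasDerivAt.add h2.hasDerivAt).deriv

theorem add : G.MemH1 (fun p => u p + v p) := by
  refine of_parts (hu.continuous.add hv.continuous)
    (fun e => (hu.absCont e).fun_add (hv.absCont e)) (fun e => ?_) ?_ ?_
  · exact (memLp_congr_ae (hu.deriv_add_ae hv e)).2 ((hu.deriv_memLp e).add (hv.deriv_memLp e))
  · refine Summable.of_nonneg_of_le (fun e => integral_nonneg fun x => sq_nonneg _) (fun e => ?_)
      ((hu.summable_sq.mul_left 2).add (hv.summable_sq.mul_left 2))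
    rw [← integral_const_mul, ← integral_const_mul, ← integral_add ((hu.integrable_sq e).const_mul 2)
      ((hv.integrable_sq e).const_mul 2)]
    refine integral_mono_of_nonneg (ae_of_all _ fun x => sq_nonneg _)
      (((hu.integrable_sq e).const_mul 2).add ((hv.integrable_sq e).const_mul 2))
      (ae_of_all _ fun x => ?_)
    simp only [onEdge_eq]
    nlinarith [sq_nonneg (u (G.pt e x) - v (G.pt e x))]
  · refine Summable.of_nonneg_of_le (fun e => integral_nonneg fun x => sq_nonneg _) (fun e => ?_)
      ((hu.summable_deriv_sq.mul_left 2).add (hv.summable_deriv_sq.mul_left 2))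
    rw [← integral_const_mul, ← integral_const_mul,
      ← integral_add ((hu.integrable_deriv_sq e).const_mul 2)
      ((hv.integrable_deriv_sq e).const_mul 2)]
    refine integral_mono_of_nonneg (ae_of_all _ fun x => sq_nonneg _)
      (((hu.integrable_deriv_sq e).const_mul 2).add ((hv.integrable_deriv_sq e).const_mul 2)) ?_
    filter_upwards [hu.deriv_add_ae hv e] with x hx
    rw [hx]
    nlinarith [sq_nonneg (deriv (G.onEdge u e) x - deriv (G.onEdge v e) x)]

end MemH1

/-- The `L²` inner product of two functions on the graph. -/
def l2Form (G : MetricGraph E) (u v : G.Space → ℝ) : ℝ :=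
  ∑' e, ∫ x, G.onEdge u e x * G.onEdge v e x ∂(G.edgeMeasure e)

/-- The element `f` of `L²(G)` is the class of the derivative of `u`. -/
def RepresentsDeriv (G : MetricGraph E) (f : G.L2) (u : G.Space → ℝ) : Prop :=
  ∀ e, (f e : ℝ → ℝ) =ᵐ[G.edgeMeasure e] deriv (G.onEdge u e)

theorem norm_toLp_sq {e : E} {g : ℝ → ℝ} (hg : MemLp g 2 (G.edgeMeasure e)) :
    ‖hg.toLp g‖ ^ 2 = ∫ x, g x ^ 2 ∂(G.edgeMeasure e) := by
  rw [← real_inner_self_eq_norm_sq, L2.inner_def]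
  refine integral_congr_ae ?_
  filter_upwards [hg.coeFn_toLp] with x hx
  simp [hx, sq]

theorem exists_l2_of_summable (g : E → ℝ → ℝ) (hg : ∀ e, MemLp (g e) 2 (G.edgeMeasure e))
    (hs : Summable fun e => ∫ x, g e x ^ 2 ∂(G.edgeMeasure e)) :
    ∃ f : G.L2, ∀ e, (f e : ℝ → ℝ) =ᵐ[G.edgeMeasure e] g e := by
  refine ⟨⟨fun e => (hg e).toLp (g e), memℓp_gen ?_⟩, fun e => (hg e).coeFn_toLp⟩
  refine hs.congr fun e => ?_
  simp only [ENNReal.toReal_ofNat, Real.rpow_ofNat]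
  rw [norm_toLp_sq]

theorem MemH1.exists_represents (hu : G.MemH1 u) : ∃ f, G.Represents f u :=
  exists_l2_of_summable _ hu.memLp_onEdge hu.summable_sq

theorem MemH1.exists_representsDeriv (hu : G.MemH1 u) : ∃ f, G.RepresentsDeriv f u :=
  exists_l2_of_summable _ hu.deriv_memLp hu.summable_deriv_sq

theorem Represents.unique {f g : G.L2} (hf : G.Represents f u) (hg : G.Represents g u) : f = g :=
  lp.ext (funext fun e => Lp.ext ((hf e).trans (hg e).symm))

theorem l2_inner_eq {f g : G.L2} {a b : E → ℝ → ℝ}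
    (hf : ∀ e, (f e : ℝ → ℝ) =ᵐ[G.edgeMeasure e] a e)
    (hg : ∀ e, (g e : ℝ → ℝ) =ᵐ[G.edgeMeasure e] b e) :
    HasSum (fun e => ∫ x, a e x * b e x ∂(G.edgeMeasure e)) (inner ℝ f g) := by
  refine (lp.hasSum_inner f g).congr_fun ?_
  intro e
  rw [L2.inner_def]
  refine integral_congr_ae ?_
  filter_upwards [hf e, hg e] with x h1 h2
  simp [h1, h2, mul_comm]

theorem Represents.inner_eq {f g : G.L2} (hf : G.Represents f u) (hg : G.Represents g v) :
    inner ℝ f g = G.l2Form u v := (l2_inner_eq hf hg).tsum_eq.symm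

theorem RepresentsDeriv.inner_eq {f g : G.L2} (hf : G.RepresentsDeriv f u)
    (hg : G.RepresentsDeriv g v) : inner ℝ f g = G.neumannForm u v :=
  (l2_inner_eq hf hg).tsum_eq.symm

theorem coeFn_add (f g : G.L2) (e : E) :
    (((f + g : G.L2) e : Lp ℝ 2 (G.edgeMeasure e)) : ℝ → ℝ) =ᵐ[G.edgeMeasure e]
      fun x => (f e : ℝ → ℝ) x + (g e : ℝ → ℝ) x := Lp.coeFn_add (f e) (g e)

theorem coeFn_smul (c : ℝ) (f : G.L2) (e : E) :
    (((c • f : G.L2) e : Lp ℝ 2 (G.edgeMeasure e)) : ℝ → ℝ) =ᵐ[G.edgeMeasure e]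
      fun x => c * (f e : ℝ → ℝ) x := Lp.coeFn_smul c (f e)

theorem Represents.add {f g : G.L2} (hf : G.Represents f u) (hg : G.Represents g v) :
    G.Represents (f + g) (fun p => u p + v p) := by
  intro e
  filter_upwards [coeFn_add f g e, hf e, hg e] with x h1 h2 h3
  rw [h1, h2, h3]
  rfl

theorem Represents.smul {f : G.L2} (c : ℝ) (hf : G.Represents f u) :
    G.Represents (c • f) (fun p => c * u p) := by
  intro e
  filter_upwards [coeFn_smul c f e, hf e] with x h1 h2
  rw [h1, h2]
  rfl

theorem RepresentsDeriv.add {f g : G.L2} (hf : G.RepresentsDeriv f u) (hg : G.RepresentsDeriv g v)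
    (hu : G.MemH1 u) (hv : G.MemH1 v) : G.RepresentsDeriv (f + g) (fun p => u p + v p) := by
  intro e
  filter_upwards [coeFn_add f g e, hf e, hg e, hu.deriv_add_ae hv e] with x h1 h2 h3 h4
  rw [h1, h2, h3, h4]

theorem RepresentsDeriv.smul {f : G.L2} (c : ℝ) (hf : G.RepresentsDeriv f u) :
    G.RepresentsDeriv (c • f) (fun p => c * u p) := by
  intro e
  filter_upwards [coeFn_smul c f e, hf e] with x h1 h2
  rw [h1, h2]
  exact (deriv_const_mul_field c).symm

/-- The quadratic form of the Neumann extension shifted by `ω²`. -/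
def shiftedForm (G : MetricGraph E) (ω : ℝ) (u : G.Space → ℝ) : ℝ :=
  G.neumannForm u u - ω ^ 2 * G.l2Form u u

theorem MemH1.hasSum_shiftedForm (hu : G.MemH1 u) (ω : ℝ) :
    HasSum (fun e => ∫ x in (0 : ℝ)..(G.len e),
      (deriv (G.onEdge u e) x ^ 2 - ω ^ 2 * G.onEdge u e x ^ 2)) (G.shiftedForm ω u) := by
  have h1 := hu.summable_deriv_sq.hasSum
  have h2 := hu.summable_sq.hasSum.mul_left (ω ^ 2)
  have h3 := h1.sub h2
  have e1 : (∑' e, ∫ x, deriv (G.onEdge u e) x ^ 2 ∂(G.edgeMeasure e)) = G.neumannForm u u := by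
    simp only [neumannForm, sq]
  have e2 : (∑' e, ∫ x, G.onEdge u e x ^ 2 ∂(G.edgeMeasure e)) = G.l2Form u u := by
    simp only [l2Form, sq]
  rw [e1, e2] at h3
  refine h3.congr_fun fun e => ?_
  rw [← integral_edgeMeasure, integral_sub (hu.integrable_deriv_sq e)
    ((hu.integrable_sq e).const_mul _), integral_const_mul]

/-- `u` is a weak eigenfunction of the Neumann extension for the eigenvalue `ω²` (or zero). -/
structure IsWeakEigen (G : MetricGraph E) (ω : ℝ) (u : G.Space → ℝ) : Prop where
  memH1 : G.MemH1 u
  weak : ∀ v, G.MemH1 v → G.neumannForm u v = ω ^ 2 * G.l2Form u v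

theorem IsWeakEigen.shiftedForm_eq_zero {ω : ℝ} (hu : G.IsWeakEigen ω u) : G.shiftedForm ω u = 0 :=
  sub_eq_zero.2 (hu.weak u hu.memH1)

end

section

/-! ### Germs, stars and tent functions -/

variable {E : Type*} {G : MetricGraph E}

/-- A direction at a point: a position on an edge, and the sense (`1` or `-1`) in which the edge is
traversed from there. -/
structure Germ (E : Type*) where
  edge : E
  pos : ℝ
  dir : ℝ

/-- The point at distance `t` from the base point of a germ. -/
def germPt (G : MetricGraph E) (d : Germ E) (t : ℝ) : G.Space := G.pt d.edge (d.pos + d.dir * t)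

/-- The germ `d` can be followed on its edge up to distance `b`. -/
structure Germ.Fits (G : MetricGraph E) (d : Germ E) (b : ℝ) : Prop where
  dir : d.dir = 1 ∨ d.dir = -1
  pos_mem : d.pos ∈ Set.Icc 0 (G.len d.edge)
  end_mem : d.pos + d.dir * b ∈ Set.Icc 0 (G.len d.edge)

theorem Germ.Fits.mem {d : Germ E} {b t : ℝ} (h : d.Fits G b) (ht : t ∈ Set.Icc 0 b) :
    d.pos + d.dir * t ∈ Set.Icc 0 (G.len d.edge) := by
  obtain ⟨hd, ⟨h1, h2⟩, ⟨h3, h4⟩⟩ := h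
  obtain ⟨h5, h6⟩ := ht
  rcases hd with hd | hd <;> rw [hd] at h3 h4 ⊢ <;> constructor <;> linarith

theorem Germ.Fits.mono {d : Germ E} {b c : ℝ} (h : d.Fits G b) (hc : c ∈ Set.Icc 0 b) :
    d.Fits G c := ⟨h.dir, h.pos_mem, h.mem hc⟩

/-- The germ at an endpoint of an edge that leads into the edge. -/
def vertexGerm (G : MetricGraph E) (a : E × Bool) : Germ E :=
  ⟨a.1, G.epos a, if a.2 then -1 else 1⟩

theorem vertexGerm_injective : Function.Injective (vertexGerm G) := by
  rintro ⟨e, s⟩ ⟨f, t⟩ h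
  simp only [vertexGerm, Germ.mk.injEq] at h
  obtain ⟨rfl, _, h⟩ := h
  cases s <;> cases t <;> simp at h ⊢ <;> norm_num at h

theorem vertexGerm_fits (a : E × Bool) {b : ℝ} (h0 : 0 ≤ b) (hb : b ≤ G.len a.1) :
    (vertexGerm G a).Fits G b := by
  refine ⟨?_, epos_mem a, ?_⟩
  · unfold vertexGerm
    split_ifs <;> simp
  · obtain ⟨e, s⟩ := a
    cases s <;> simp only [vertexGerm, epos] <;> constructor <;> simp at hb ⊢ <;> linarith

theorem germPt_vertexGerm_zero (a : E × Bool) :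
    G.germPt (vertexGerm G a) 0 = G.pt a.1 (G.epos a) := by
  simp [germPt, vertexGerm]

/-- `D` is the set of all germs at a point: the germs at a vertex, or the two germs at an interior
point of an edge. -/
def IsStar (G : MetricGraph E) (D : Set (Germ E)) : Prop :=
  (∃ a, D = vertexGerm G '' {b | G.glue b a}) ∨
    ∃ e, ∃ t ∈ Set.Ioo 0 (G.len e), D = {⟨e, t, 1⟩, ⟨e, t, -1⟩}

theorem LocallyFinite.finite_glue (h : G.LocallyFinite) (a : E × Bool) : {b | G.glue b a}.Finite := by
  have h1 := h (Quotient.mk G.glue a)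
  unfold degree at h1
  rw [Set.encard_lt_top_iff] at h1
  refine h1.subset fun b hb => ?_
  exact Quotient.sound hb

theorem IsStar.finite (h : G.LocallyFinite) {D : Set (Germ E)} (hD : G.IsStar D) : D.Finite := by
  rcases hD with ⟨a, rfl⟩ | ⟨e, t, _, rfl⟩
  · exact (h.finite_glue a).image _
  · simp

/-- The tent of height one and radius `ε` along the germ at an endpoint. -/
def halfTent (G : MetricGraph E) (ε : ℝ) (a : E × Bool) (t : ℝ) : ℝ :=
  max 0 (1 - |t - G.epos a| / ε)

theorem abs_max_sub_max_le {ε : ℝ} (hε : 0 < ε) (c s t : ℝ) :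
    |max 0 (1 - |s - c| / ε) - max 0 (1 - |t - c| / ε)| ≤ ε⁻¹ * |s - t| := by
  rw [max_comm 0, max_comm 0]
  refine (abs_max_sub_max_le_abs (1 - |s - c| / ε) (1 - |t - c| / ε) 0).trans ?_
  rw [show 1 - |s - c| / ε - (1 - |t - c| / ε) = ε⁻¹ * (|t - c| - |s - c|) by field_simp; ring,
    abs_mul, abs_of_pos (inv_pos.2 hε), abs_sub_comm s t]
  refine mul_le_mul_of_nonneg_left ?_ (inv_pos.2 hε).le
  refine (abs_abs_sub_abs_le (t - c) (s - c)).trans (le_of_eq ?_)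
  congr 1
  ring

/-- `v` is the tent of radius `ε` at the point whose germs are `D`: it is one at the point, decays
linearly to zero along the germs, and vanishes elsewhere. -/
structure IsTent (G : MetricGraph E) (D : Set (Germ E)) (ε : ℝ) (v : G.Space → ℝ) : Prop where
  pos : 0 < ε
  lipschitz : ∀ e, ∀ s ∈ Set.Icc 0 (G.len e), ∀ t ∈ Set.Icc 0 (G.len e),
    |v (G.pt e s) - v (G.pt e t)| ≤ (2 * ε⁻¹) * |s - t|
  fits : ∀ d ∈ D, d.Fits G ε
  eq_on : ∀ d ∈ D, ∀ t ∈ Set.Icc 0 ε, v (G.germPt d t) = 1 - t / ε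
  eq_zero_or : ∀ e, ∀ t ∈ Set.Icc 0 (G.len e), v (G.pt e t) = 0 ∨
    ∃ d ∈ D, d.edge = e ∧ ∃ s ∈ Set.Ico 0 ε, t = d.pos + d.dir * s

open Classical in
/-- Tents at a vertex. The bound by half the length of the edges keeps the two ends of a loop apart. The
explicit formula is used to compute integrals edge by edge. -/
theorem exists_tent_vertex (hlf : G.LocallyFinite) (a : E × Bool) :
    ∃ ε₀ > 0, (∀ b, G.glue b a → ε₀ ≤ G.len b.1 / 2) ∧ ∀ ε, 0 < ε → ε ≤ ε₀ → ∃ v : G.Space → ℝ,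
      IsTent G (vertexGerm G '' {b | G.glue b a}) ε v ∧
      ∀ e, ∀ t ∈ Set.Icc 0 (G.len e), v (G.pt e t) =
        (if G.glue (e, false) a then halfTent G ε (e, false) t else 0) +
        (if G.glue (e, true) a then halfTent G ε (e, true) t else 0) := by
  have hfin := hlf.finite_glue a
  obtain ⟨ε₀, h0, h1⟩ : ∃ ε₀ > 0, ∀ b, G.glue b a → ε₀ ≤ G.len b.1 / 2 := by
    obtain ⟨b, hb, hmin⟩ := Set.exists_min_image _ (fun b : E × Bool => G.len b.1 / 2) hfin
      ⟨a, G.glue.refl a⟩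
    exact ⟨G.len b.1 / 2, half_pos (G.len_pos _), hmin⟩
  refine ⟨ε₀, h0, h1, fun ε hε hle => ?_⟩
  set φ : E → ℝ → ℝ := fun e t => (if G.glue (e, false) a then halfTent G ε (e, false) t else 0) +
        (if G.glue (e, true) a then halfTent G ε (e, true) t else 0) with hφ
  have hlen : ∀ b, G.glue b a → ε ≤ G.len b.1 / 2 := fun b hb => hle.trans (h1 b hb)
  have hφe : ∀ b, φ b.1 (G.epos b) = if G.glue b a then 1 else 0 := by
    rintro ⟨e, s⟩
    have hp := G.len_pos e
    have hz : ∀ s', G.glue (e, s') a → (1 : ℝ) ≤ G.len e / ε := by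
      intro s' hs'
      have : ε ≤ G.len e / 2 := hlen _ hs'
      rw [le_div_iff₀ hε]
      linarith
    cases s <;> by_cases h2 : G.glue (e, false) a <;> by_cases h3 : G.glue (e, true) a <;>
      simp [hφ, halfTent, epos, h2, h3, abs_of_pos hp] <;> first | exact hz _ h2 | exact hz _ h3
  obtain ⟨v, hv⟩ := exists_lift φ (fun b c hbc => by
    rw [hφe, hφe]
    have : G.glue b a ↔ G.glue c a := ⟨fun h => G.glue.trans (G.glue.symm hbc) h,
      fun h => G.glue.trans hbc h⟩
    simp [this])
  refine ⟨v, ⟨hε, ?_, ?_, ?_, ?_⟩, hv⟩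
  · intro e s hs t ht
    rw [hv e s hs, hv e t ht]
    have hb : ∀ b : Bool, |(if G.glue (e, b) a then halfTent G ε (e, b) s else 0) -
        (if G.glue (e, b) a then halfTent G ε (e, b) t else 0)| ≤ ε⁻¹ * |s - t| := by
      intro b
      split_ifs
      · exact abs_max_sub_max_le hε _ _ _
      · simp
        positivity
    have := abs_add_le ((if G.glue (e, false) a then halfTent G ε (e, false) s else 0) -
        (if G.glue (e, false) a then halfTent G ε (e, false) t else 0))
        ((if G.glue (e, true) a then halfTent G ε (e, true) s else 0) -
        (if G.glue (e, true) a then halfTent G ε (e, true) t else 0))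
    have h3 := hb false
    have h4 := hb true
    rw [show φ e s - φ e t = ((if G.glue (e, false) a then halfTent G ε (e, false) s else 0) -
        (if G.glue (e, false) a then halfTent G ε (e, false) t else 0)) +
        ((if G.glue (e, true) a then halfTent G ε (e, true) s else 0) -
        (if G.glue (e, true) a then halfTent G ε (e, true) t else 0)) by simp only [hφ]; ring]
    linarith
  · rintro _ ⟨b, hb, rfl⟩
    have := hlen b hb
    have := G.len_pos b.1
    exact vertexGerm_fits b hε.le (by linarith)
  · rintro _ ⟨b, hb, rfl⟩ t ht
    have hb' : G.glue b a := hb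
    have hl := hlen b hb
    have hp := G.len_pos b.1
    have hfit := (vertexGerm_fits (G := G) b hε.le (by linarith)).mem ht
    unfold germPt
    rw [hv _ _ hfit]
    obtain ⟨e, s⟩ := b
    have h5 : t / ε ≤ 1 := (div_le_one hε).2 ht.2
    have hz : ∀ x, ε ≤ x → (1 : ℝ) - x / ε ≤ 0 := by
      intro x hx
      rw [sub_nonpos, le_div_iff₀ hε]
      linarith
    simp only at hl hp
    have h6 : (0 : ℝ) ≤ 1 - t / ε := by linarith
    have h7 : |G.len e - t| = G.len e - t := abs_of_nonneg (by linarith [ht.2])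
    have h8 : |t - G.len e| = G.len e - t := by rw [abs_sub_comm, h7]
    have h9 : (1 : ℝ) - (G.len e - t) / ε ≤ 0 := hz _ (by linarith [ht.2])
    cases s
    · by_cases h3 : G.glue (e, true) a <;>
        simp [hφ, halfTent, epos, vertexGerm, hb', h3, abs_of_nonneg ht.1, h5, h8, h9]
    · by_cases h3 : G.glue (e, false) a <;>
        simp [hφ, halfTent, epos, vertexGerm, hb', h3, abs_of_nonneg ht.1, h5, ← sub_eq_add_neg, h7, h9]
  · intro e t ht
    rw [hv e t ht]
    by_cases hA : G.glue (e, false) a ∧ t < ε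
    · right
      refine ⟨_, ⟨(e, false), hA.1, rfl⟩, rfl, t, ⟨ht.1, hA.2⟩, ?_⟩
      simp [vertexGerm, epos]
    by_cases hB : G.glue (e, true) a ∧ G.len e - t < ε
    · right
      refine ⟨_, ⟨(e, true), hB.1, rfl⟩, rfl, G.len e - t, ⟨by linarith [ht.2], hB.2⟩, ?_⟩
      simp [vertexGerm, epos]
    left
    have hz : ∀ x, ε ≤ x → max 0 ((1 : ℝ) - x / ε) = 0 := by
      intro x hx
      rw [max_eq_left]
      rw [sub_nonpos, le_div_iff₀ hε]
      linarith
    have e1 : (if G.glue (e, false) a then halfTent G ε (e, false) t else 0) = 0 := by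
      split_ifs with h
      · have : ε ≤ t := by
          by_contra hlt
          exact hA ⟨h, not_le.1 hlt⟩
        simp only [halfTent, epos]
        rw [if_neg (by simp), sub_zero, abs_of_nonneg ht.1]
        exact hz _ this
      · rfl
    have e2 : (if G.glue (e, true) a then halfTent G ε (e, true) t else 0) = 0 := by
      split_ifs with h
      · have : ε ≤ G.len e - t := by
          by_contra hlt
          exact hB ⟨h, not_le.1 hlt⟩
        simp only [halfTent, epos]
        rw [if_true, abs_sub_comm, abs_of_nonneg (by linarith [ht.2])]
        exact hz _ this
      · rfl
    simp only [hφ]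
    rw [e1, e2, add_zero]

open Classical in
/-- Tents at a point in the interior of an edge, with an explicit formula. -/
theorem exists_tent_interior {e₀ : E} {t₀ ε : ℝ} (hε : 0 < ε) (h1 : ε ≤ t₀)
    (h2 : ε ≤ G.len e₀ - t₀) : ∃ v : G.Space → ℝ,
      IsTent G {⟨e₀, t₀, 1⟩, ⟨e₀, t₀, -1⟩} ε v ∧
      ∀ e, ∀ t ∈ Set.Icc 0 (G.len e), v (G.pt e t) =
        if e = e₀ then max 0 (1 - |t - t₀| / ε) else 0 := by
  have hz : ∀ x, ε ≤ x → max 0 ((1 : ℝ) - x / ε) = 0 := by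
    intro x hx
    rw [max_eq_left]
    rw [sub_nonpos, le_div_iff₀ hε]
    linarith
  set φ : E → ℝ → ℝ := fun e t => if e = e₀ then max 0 (1 - |t - t₀| / ε) else 0 with hφ
  have hφe : ∀ b, φ b.1 (G.epos b) = 0 := by
    rintro ⟨e, s⟩
    simp only [hφ]
    split_ifs with h
    · subst h
      apply hz
      cases s
      · simp only [epos]
        rw [if_neg (by simp), zero_sub, abs_neg, abs_of_nonneg (by linarith)]
        exact h1
      · simp only [epos]
        rw [if_true, abs_of_nonneg (by linarith)]
        exact h2
    · rfl
  obtain ⟨v, hv⟩ := exists_lift φ (fun b c _ => by rw [hφe, hφe])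
  have hdir : ∀ d ∈ ({⟨e₀, t₀, 1⟩, ⟨e₀, t₀, -1⟩} : Set (Germ E)), d.Fits G ε := by
    rintro d (rfl | rfl)
    · exact ⟨Or.inl rfl, ⟨by simp only; linarith, by simp only; linarith⟩,
        ⟨by simp only; linarith, by simp only; linarith⟩⟩
    · exact ⟨Or.inr rfl, ⟨by simp only; linarith, by simp only; linarith⟩,
        ⟨by simp only; linarith, by simp only; linarith⟩⟩
  refine ⟨v, ⟨hε, ?_, hdir, ?_, ?_⟩, hv⟩
  · intro e s hs t ht
    rw [hv e s hs, hv e t ht]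
    have h0 : (0 : ℝ) ≤ ε⁻¹ * |s - t| := by positivity
    simp only [hφ]
    split_ifs
    · refine (abs_max_sub_max_le hε t₀ s t).trans ?_
      linarith
    · simp
      positivity
  · intro d hd t ht
    unfold germPt
    rw [hv _ _ ((hdir d hd).mem ht)]
    have h5 : t / ε ≤ 1 := (div_le_one hε).2 ht.2
    rcases hd with rfl | rfl <;> simp [hφ, abs_of_nonneg ht.1, h5]
  · intro e t ht
    rw [hv e t ht]
    simp only [hφ]
    split_ifs with h
    · subst h
      rcases le_or_gt ε |t - t₀| with h3 | h3
      · exact Or.inl (hz _ h3)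
      · right
        rcases le_total t₀ t with h4 | h4
        · refine ⟨⟨e, t₀, 1⟩, by simp, rfl, t - t₀, ⟨by linarith, ?_⟩, by simp⟩
          rwa [abs_of_nonneg (by linarith)] at h3
        · refine ⟨⟨e, t₀, -1⟩, by simp, rfl, t₀ - t, ⟨by linarith, ?_⟩, by simp⟩
          rwa [abs_of_nonpos (by linarith), neg_sub] at h3
    · exact Or.inl rfl

theorem IsTent.continuous {D : Set (Germ E)} {ε : ℝ} {v : G.Space → ℝ} (h : IsTent G D ε v) :
    Continuous v :=
  continuous_of_edges (by have := h.pos; positivity) h.lipschitz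

theorem IsTent.abs_le {D : Set (Germ E)} {ε : ℝ} {v : G.Space → ℝ} (h : IsTent G D ε v)
    (p : G.Space) : |v p| ≤ 1 := by
  obtain ⟨e, t, ht, rfl⟩ := exists_pt p
  rcases h.eq_zero_or e t ht with h1 | ⟨d, hd, rfl, s, hs, rfl⟩
  · simp [h1]
  · have h2 := h.eq_on d hd s ⟨hs.1, hs.2.le⟩
    have h3 : s / ε ≤ 1 := (div_le_one h.pos).2 hs.2.le
    have h4 : 0 ≤ s / ε := div_nonneg hs.1 h.pos.le
    unfold germPt at h2
    rw [h2, _root_.abs_le]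
    constructor <;> linarith

/-- Every point has a star of germs and a tent function. -/
theorem exists_star (hlf : G.LocallyFinite) (p : G.Space) : ∃ D ε v, G.IsStar D ∧ IsTent G D ε v ∧
    (∀ d ∈ D, G.germPt d 0 = p) ∧ D.Nonempty := by
  obtain ⟨e, t, ht, rfl⟩ := exists_pt p
  have hvert : ∀ a : E × Bool, G.pt e t = G.pt a.1 (G.epos a) → ∃ D ε v, G.IsStar D ∧
      IsTent G D ε v ∧ (∀ d ∈ D, G.germPt d 0 = G.pt e t) ∧ D.Nonempty := by
    intro a ha
    obtain ⟨ε, h0, _, h⟩ := exists_tent_vertex hlf a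
    obtain ⟨v, hv, _⟩ := h ε h0 le_rfl
    refine ⟨_, ε, v, Or.inl ⟨a, rfl⟩, hv, ?_, ⟨_, a, G.glue.refl a, rfl⟩⟩
    rintro _ ⟨b, hb, rfl⟩
    rw [germPt_vertexGerm_zero, ha]
    exact pt_eq_pt_of_glue hb
  rcases ht.1.eq_or_lt with rfl | h1
  · exact hvert (e, false) (by simp [epos])
  rcases ht.2.eq_or_lt with rfl | h2
  · exact hvert (e, true) (by simp [epos])
  · obtain ⟨v, hv, _⟩ := exists_tent_interior (G := G) (e₀ := e) (t₀ := t)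
      (ε := min t (G.len e - t)) (lt_min h1 (by linarith)) (min_le_left _ _) (min_le_right _ _)
    refine ⟨_, _, v, Or.inr ⟨e, t, ⟨h1, h2⟩, rfl⟩, hv, ?_, by simp⟩
    rintro d (rfl | rfl) <;> simp [germPt]

/-- The path metric of a locally finite metric graph separates points. -/
theorem eq_of_edist_eq_zero (hlf : G.LocallyFinite) {p q : G.Space} (h : edist p q = 0) : p = q := by
  obtain ⟨D, ε, v, _, hv, hD, d, hd⟩ := exists_star hlf p
  have hp : v p = 1 := by
    have := hv.eq_on d hd 0 ⟨le_rfl, hv.pos.le⟩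
    rw [hD d hd] at this
    simpa using this
  have hq : v q = 1 := by
    have := ofReal_abs_sub_le_of_edges (by have := hv.pos; positivity) hv.lipschitz p q
    rw [h, mul_zero, nonpos_iff_eq_zero, ENNReal.ofReal_eq_zero] at this
    have h0 := abs_eq_zero.1 (le_antisymm this (abs_nonneg _))
    linarith
  obtain ⟨e, t, ht, rfl⟩ := exists_pt q
  rcases hv.eq_zero_or e t ht with h1 | ⟨d, hd, rfl, s, hs, rfl⟩
  · rw [h1] at hq
    norm_num at hq
  · have h2 := hv.eq_on d hd s ⟨hs.1, hs.2.le⟩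
    unfold germPt at h2
    rw [h2] at hq
    have h3 : s / ε = 0 := by linarith
    have h4 : s = 0 := by simpa [hv.pos.ne'] using h3
    rw [h4, ← hD d hd]
    rfl

/-- On a locally finite graph, continuity may be checked edge by edge. -/
theorem continuous_of_onEdge (hlf : G.LocallyFinite) {u : G.Space → ℝ}
    (h : ∀ e, ContinuousOn (G.onEdge u e) (Set.Icc 0 (G.len e))) : Continuous u := by
  rw [continuous_iff_continuousAt]
  intro p
  obtain ⟨D, ε, v, hDs, hv, hD, d₀, hd₀⟩ := exists_star hlf p
  rw [ContinuousAt, Metric.tendsto_nhds]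
  intro η hη
  have hg : ∀ d ∈ D, ∃ δ > 0, ∀ t ∈ Set.Icc 0 ε, t < δ → |u (G.germPt d t) - u p| < η := by
    intro d hd
    have hc : ContinuousOn (fun t => u (G.germPt d t)) (Set.Icc 0 ε) :=
      (h d.edge).comp (by fun_prop) fun t ht => (hv.fits d hd).mem ht
    have := Metric.continuousOn_iff.1 hc 0 ⟨le_rfl, hv.pos.le⟩ η hη
    obtain ⟨δ, hδ, h1⟩ := this
    refine ⟨δ, hδ, fun t ht htδ => ?_⟩
    have := h1 t ht (by rw [Real.dist_eq, sub_zero, abs_of_nonneg ht.1]; exact htδ)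
    rwa [Real.dist_eq, hD d hd] at this
  choose! δ hδ hδ2 using hg
  obtain ⟨d₁, hd₁, hmin⟩ := Set.exists_min_image D δ (hDs.finite hlf) ⟨d₀, hd₀⟩
  have hp : v p = 1 := by
    have := hv.eq_on d₀ hd₀ 0 ⟨le_rfl, hv.pos.le⟩
    rw [hD d₀ hd₀] at this
    simpa using this
  set m := min (δ d₁) ε with hm
  have hmpos : 0 < m := lt_min (hδ d₁ hd₁) hv.pos
  have hev : ∀ᶠ q in 𝓝 p, 1 - m / ε < v q := by
    have : ContinuousAt v p := hv.continuous.continuousAt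
    refine this.eventually (lt_mem_nhds ?_)
    rw [hp]
    have := div_pos hmpos hv.pos
    linarith
  filter_upwards [hev] with q hq
  obtain ⟨e, t, ht, rfl⟩ := exists_pt q
  have hmε : m / ε ≤ 1 := (div_le_one hv.pos).2 (min_le_right _ _)
  rcases hv.eq_zero_or e t ht with h1 | ⟨d, hd, rfl, s, hs, rfl⟩
  · rw [h1] at hq
    linarith
  · have h2 := hv.eq_on d hd s ⟨hs.1, hs.2.le⟩
    have h3 := hδ2 d hd s ⟨hs.1, hs.2.le⟩
    unfold germPt at h2 h3
    rw [h2] at hq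
    rw [Real.dist_eq]
    refine h3 ?_
    have h4 : s / ε < m / ε := by linarith
    rw [div_lt_div_iff_of_pos_right hv.pos] at h4
    exact h4.trans_le ((min_le_left _ _).trans (hmin d hd))

end

section

/-! ### Kirchhoff's condition for weak eigenfunctions -/

variable {E : Type*} {G : MetricGraph E} {u v : G.Space → ℝ}

theorem MemH1.hasSum_bilin (hu : G.MemH1 u) (hv : G.MemH1 v) (c : ℝ) :
    HasSum (fun e => ∫ x in (0 : ℝ)..(G.len e),
      (deriv (G.onEdge u e) x * deriv (G.onEdge v e) x - c * (G.onEdge u e x * G.onEdge v e x)))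
      (G.neumannForm u v - c * G.l2Form u v) := by
  obtain ⟨f, hf⟩ := hu.exists_represents
  obtain ⟨g, hg⟩ := hv.exists_represents
  obtain ⟨f', hf'⟩ := hu.exists_representsDeriv
  obtain ⟨g', hg'⟩ := hv.exists_representsDeriv
  have h1 := l2_inner_eq hf' hg'
  have h2 := (l2_inner_eq hf hg).mul_left c
  rw [hf'.inner_eq hg'] at h1
  rw [hf.inner_eq hg] at h2
  refine (h1.sub h2).congr_fun fun e => ?_
  rw [← integral_edgeMeasure, integral_sub, integral_const_mul]
  · exact (hu.deriv_memLp e).integrable_mul (hv.deriv_memLp e)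
  · exact ((hu.memLp_onEdge e).integrable_mul (hv.memLp_onEdge e)).const_mul c

theorem MemH1.intervalIntegrable_bilin (hu : G.MemH1 u) (hv : G.MemH1 v) (c : ℝ) (e : E) :
    IntervalIntegrable (fun x => deriv (G.onEdge u e) x * deriv (G.onEdge v e) x -
      c * (G.onEdge u e x * G.onEdge v e x)) volume 0 (G.len e) := by
  rw [intervalIntegrable_iff_edge]
  exact ((hu.deriv_memLp e).integrable_mul (hv.deriv_memLp e)).sub
    (((hu.memLp_onEdge e).integrable_mul (hv.memLp_onEdge e)).const_mul c)

theorem integral_bilin_eq_zero {f g : ℝ → ℝ} {a b c : ℝ} (hab : a ≤ b)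
    (hg : ∀ x ∈ Set.Icc a b, g x = 0) :
    ∫ x in a..b, (deriv f x * deriv g x - c * (f x * g x)) = 0 := by
  rw [intervalIntegral.integral_of_le hab, integral_Ioc_eq_integral_Ioo]
  refine setIntegral_eq_zero_of_forall_eq_zero fun x hx => ?_
  have h1 : g =ᶠ[𝓝 x] fun _ => (0 : ℝ) := by
    filter_upwards [isOpen_Ioo.mem_nhds hx] with y hy using hg y ⟨hy.1.le, hy.2.le⟩
  rw [h1.deriv_eq, h1.eq_of_nhds]
  simp

/-- The shifted bilinear form of a sine and an affine function, by an explicit primitive. Here `c` is the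
position of the zero of the sine, and `s` the direction in which the affine function decays. -/
theorem integral_bilin_tent {f g : ℝ → ℝ} {a b c s A ε ω : ℝ} (hab : a ≤ b)
    (hs : s = 1 ∨ s = -1) (hf : ∀ x ∈ Set.Icc a b, f x = A * Real.sin (ω * (s * (x - c))))
    (hg : ∀ x ∈ Set.Icc a b, g x = 1 - s * (x - c) / ε) :
    ∫ x in a..b, (deriv f x * deriv g x - ω ^ 2 * (f x * g x)) =
      A * ω * s * Real.cos (ω * (s * (b - c))) * (1 - s * (b - c) / ε) -
      A * ω * s * Real.cos (ω * (s * (a - c))) * (1 - s * (a - c) / ε) := by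
  have hlin : ∀ x, HasDerivAt (fun x : ℝ => s * (x - c)) s x := fun x => by
    simpa using ((hasDerivAt_id x).sub_const c).const_mul s
  have hf' : ∀ x, HasDerivAt (fun x => A * Real.sin (ω * (s * (x - c))))
      (A * ω * s * Real.cos (ω * (s * (x - c)))) x := fun x =>
    ((((hlin x).const_mul ω).sin).const_mul A).congr_deriv (by ring)
  have hg' : ∀ x, HasDerivAt (fun x => 1 - s * (x - c) / ε) (-(s / ε)) x := fun x => by
    simpa using ((hlin x).div_const ε).const_sub 1
  have hp : ∀ x, HasDerivAt (fun x => A * ω * s * Real.cos (ω * (s * (x - c))) *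
      (1 - s * (x - c) / ε)) (A * ω * s * Real.cos (ω * (s * (x - c))) * (-(s / ε)) -
      ω ^ 2 * (A * Real.sin (ω * (s * (x - c))) * (1 - s * (x - c) / ε))) x := fun x => by
    refine (((((hlin x).const_mul ω).cos).const_mul (A * ω * s)).fun_mul (hg' x)).congr_deriv ?_
    have : s ^ 2 = 1 := by rcases hs with rfl | rfl <;> norm_num
    linear_combination (-A * ω ^ 2 * Real.sin (ω * (s * (x - c))) * (1 - s * (x - c) / ε)) * this
  have h0 := intervalIntegral.integral_eq_sub_of_hasDerivAt (a := a) (b := b)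
    (fun x _ => hp x) (Continuous.intervalIntegrable (by fun_prop) _ _)
  rw [← h0, intervalIntegral.integral_of_le hab, intervalIntegral.integral_of_le hab,
    integral_Ioc_eq_integral_Ioo, integral_Ioc_eq_integral_Ioo]
  refine setIntegral_congr_fun measurableSet_Ioo fun x hx => ?_
  have e1 : f =ᶠ[𝓝 x] fun x => A * Real.sin (ω * (s * (x - c))) := by
    filter_upwards [isOpen_Ioo.mem_nhds hx] with y hy using hf y ⟨hy.1.le, hy.2.le⟩
  have e2 : g =ᶠ[𝓝 x] fun x => 1 - s * (x - c) / ε := by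
    filter_upwards [isOpen_Ioo.mem_nhds hx] with y hy using hg y ⟨hy.1.le, hy.2.le⟩
  rw [e1.deriv_eq, e2.deriv_eq, e1.eq_of_nhds, e2.eq_of_nhds, (hf' x).deriv, (hg' x).deriv]

theorem IsTent.memH1 (hfin : G.FiniteLength) {D : Set (Germ E)} {ε : ℝ} (h : IsTent G D ε v) :
    G.MemH1 v :=
  memH1_of_lipschitz hfin (by have := h.pos; positivity) h.lipschitz h.abs_le

/-- Kirchhoff's condition at a vertex, obtained by testing against the tent at the vertex: the edge end
`b` contributes `-A b * ω` to the shifted bilinear form. -/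
theorem IsWeakEigen.sum_vertex_eq_zero (hlf : G.LocallyFinite) (hfin : G.FiniteLength) {ω : ℝ}
    (hω : 0 < ω) (hu : G.IsWeakEigen ω u) (a : E × Bool) (A : E × Bool → ℝ) {ε : ℝ} (hε : 0 < ε)
    (h : ∀ b, G.glue b a → ∀ t ∈ Set.Icc 0 ε, u (G.germPt (vertexGerm G b) t) =
      A b * Real.sin (ω * t)) :
    ∑ b ∈ (hlf.finite_glue a).toFinset, A b = 0 := by
  classical
  obtain ⟨ε₀, h0, hlen, hex⟩ := exists_tent_vertex hlf a
  set η := min ε ε₀ with hη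
  have hη0 : 0 < η := lt_min hε h0
  obtain ⟨v, hv, hvf⟩ := hex η hη0 (min_le_right _ _)
  have hvm := hv.memH1 hfin
  have hsum := hu.memH1.hasSum_bilin hvm (ω ^ 2)
  rw [sub_eq_zero.2 (hu.weak v hvm)] at hsum
  set f : E × Bool → ℝ := fun b => if G.glue b a then -(A b * ω) else 0 with hf
  have hedge : ∀ e, ∫ x in (0 : ℝ)..(G.len e), (deriv (G.onEdge u e) x * deriv (G.onEdge v e) x -
      ω ^ 2 * (G.onEdge u e x * G.onEdge v e x)) = ∑ s : Bool, f (e, s) := by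
    intro e
    have hp := G.len_pos e
    by_cases hnone : ∀ s, ¬G.glue (e, s) a
    · rw [integral_bilin_eq_zero hp.le]
      · simp [hf, hnone]
      · intro x hx
        rw [onEdge_eq, hvf e x hx]
        simp [hnone]
    push Not at hnone
    obtain ⟨s₀, hs₀⟩ := hnone
    have hηl : η ≤ G.len e / 2 := (min_le_right _ _).trans (hlen _ hs₀)
    have hi := hu.memH1.intervalIntegrable_bilin hvm (ω ^ 2) e
    have hz : ∀ x, η ≤ x → max 0 ((1 : ℝ) - x / η) = 0 := by
      intro x hx
      rw [max_eq_left]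
      rw [sub_nonpos, le_div_iff₀ hη0]
      linarith
    have hv0 : ∀ x ∈ Set.Icc 0 η, G.onEdge v e x =
        if G.glue (e, false) a then 1 - x / η else 0 := by
      intro x hx
      rw [onEdge_eq, hvf e x ⟨hx.1, by linarith [hx.2]⟩]
      have h1 : halfTent G η (e, true) x = 0 := by
        simp only [halfTent, epos, if_true]
        rw [abs_sub_comm, abs_of_nonneg (by linarith [hx.2])]
        exact hz _ (by linarith [hx.2])
      have h2 : halfTent G η (e, false) x = 1 - x / η := by
        have : x / η ≤ 1 := (div_le_one hη0).2 hx.2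
        simp [halfTent, epos, abs_of_nonneg hx.1, this]
      rw [h1, h2]
      simp
    have hv1 : ∀ x ∈ Set.Icc (G.len e - η) (G.len e), G.onEdge v e x =
        if G.glue (e, true) a then 1 - (G.len e - x) / η else 0 := by
      intro x hx
      rw [onEdge_eq, hvf e x ⟨by linarith [hx.1], hx.2⟩]
      have h1 : halfTent G η (e, false) x = 0 := by
        simp only [halfTent, epos]
        rw [if_neg (by simp), sub_zero, abs_of_nonneg (by linarith [hx.1])]
        exact hz _ (by linarith [hx.1])
      have h2 : halfTent G η (e, true) x = 1 - (G.len e - x) / η := by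
        have : (G.len e - x) / η ≤ 1 := (div_le_one hη0).2 (by linarith [hx.1])
        simp only [halfTent, epos, if_true]
        rw [abs_sub_comm, abs_of_nonneg (by linarith [hx.2]), max_eq_right (by linarith)]
      rw [h1, h2]
      simp
    have hvm' : ∀ x ∈ Set.Icc η (G.len e - η), G.onEdge v e x = 0 := by
      intro x hx
      rw [onEdge_eq, hvf e x ⟨by linarith [hx.1], by linarith [hx.2]⟩]
      have h1 : halfTent G η (e, false) x = 0 := by
        simp only [halfTent, epos]
        rw [if_neg (by simp), sub_zero, abs_of_nonneg (by linarith [hx.1])]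
        exact hz _ (by linarith [hx.1])
      have h2 : halfTent G η (e, true) x = 0 := by
        simp only [halfTent, epos, if_true]
        rw [abs_sub_comm, abs_of_nonneg (by linarith [hx.2])]
        exact hz _ (by linarith [hx.2])
      rw [h1, h2]
      simp
    have m1 : Set.uIcc 0 η ⊆ Set.uIcc 0 (G.len e) := by
      rw [Set.uIcc_of_le hη0.le, Set.uIcc_of_le hp.le]
      exact Set.Icc_subset_Icc le_rfl (by linarith)
    have m2 : Set.uIcc η (G.len e - η) ⊆ Set.uIcc 0 (G.len e) := by
      rw [Set.uIcc_of_le (by linarith), Set.uIcc_of_le hp.le]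
      exact Set.Icc_subset_Icc (by linarith) (by linarith)
    have m3 : Set.uIcc (G.len e - η) (G.len e) ⊆ Set.uIcc 0 (G.len e) := by
      rw [Set.uIcc_of_le (by linarith), Set.uIcc_of_le hp.le]
      exact Set.Icc_subset_Icc (by linarith) (by linarith)
    rw [← intervalIntegral.integral_add_adjacent_intervals
        ((hi.mono_set m1).trans (hi.mono_set m2)) (hi.mono_set m3),
      ← intervalIntegral.integral_add_adjacent_intervals (hi.mono_set m1) (hi.mono_set m2),
      integral_bilin_eq_zero (by linarith) hvm']
    have i1 : ∫ x in (0 : ℝ)..η, (deriv (G.onEdge u e) x * deriv (G.onEdge v e) x -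
        ω ^ 2 * (G.onEdge u e x * G.onEdge v e x)) = f (e, false) := by
      by_cases hg : G.glue (e, false) a
      · rw [integral_bilin_tent (s := 1) (c := 0) (A := A (e, false)) (ε := η) hη0.le (Or.inl rfl)]
        · simp [hf, hg, div_self hη0.ne']
        · intro x hx
          have := h _ hg x ⟨hx.1, hx.2.trans (min_le_left _ _)⟩
          simpa [germPt, vertexGerm, epos, onEdge_eq] using this
        · intro x hx
          rw [hv0 x hx]
          simp [hg]
      · rw [integral_bilin_eq_zero hη0.le]
        · simp [hf, hg]
        · intro x hx
          rw [hv0 x hx]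
          simp [hg]
    have i3 : ∫ x in (G.len e - η)..(G.len e), (deriv (G.onEdge u e) x * deriv (G.onEdge v e) x -
        ω ^ 2 * (G.onEdge u e x * G.onEdge v e x)) = f (e, true) := by
      by_cases hg : G.glue (e, true) a
      · rw [integral_bilin_tent (s := -1) (c := G.len e) (A := A (e, true)) (ε := η) (by linarith)
          (Or.inr rfl)]
        · simp [hf, hg, div_self hη0.ne']
        · intro x hx
          have := h _ hg (G.len e - x) ⟨by linarith [hx.2], (by linarith [hx.1] : G.len e - x ≤ η).trans
            (min_le_left _ _)⟩
          simpa [germPt, vertexGerm, epos, onEdge_eq] using this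
        · intro x hx
          rw [hv1 x hx]
          simp [hg]
      · rw [integral_bilin_eq_zero (by linarith)]
        · simp [hf, hg]
        · intro x hx
          rw [hv1 x hx]
          simp [hg]
    rw [i1, i3]
    simp [add_comm]
  have hfsum : HasSum f (∑ b ∈ (hlf.finite_glue a).toFinset, f b) :=
    hasSum_sum_of_ne_finset_zero fun b hb => by
      have : ¬G.glue b a := by simpa using hb
      simp [hf, this]
  have h2 := hfsum.prod_fiberwise (fun e => hasSum_fintype _)
  simp only [hedge] at hsum
  have h3 := hsum.unique h2
  have h4 : ∑ b ∈ (hlf.finite_glue a).toFinset, f b =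
      -ω * ∑ b ∈ (hlf.finite_glue a).toFinset, A b := by
    rw [Finset.mul_sum]
    refine Finset.sum_congr rfl fun b hb => ?_
    have : G.glue b a := by simpa using hb
    simp [hf, this, mul_comm]
  rw [h4] at h3
  have := mul_eq_zero.1 h3.symm
  exact this.resolve_left (neg_ne_zero.2 hω.ne')

/-- Kirchhoff's condition at a point in the interior of an edge. -/
theorem IsWeakEigen.add_interior_eq_zero (hfin : G.FiniteLength) {ω : ℝ}
    (hω : 0 < ω) (hu : G.IsWeakEigen ω u) {e₀ : E} {t₀ : ℝ} (ht₀ : t₀ ∈ Set.Ioo 0 (G.len e₀))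
    {A B ε : ℝ} (hε : 0 < ε)
    (hA : ∀ t ∈ Set.Icc 0 ε, u (G.germPt ⟨e₀, t₀, 1⟩ t) = A * Real.sin (ω * t))
    (hB : ∀ t ∈ Set.Icc 0 ε, u (G.germPt ⟨e₀, t₀, -1⟩ t) = B * Real.sin (ω * t)) : A + B = 0 := by
  classical
  set η := min ε (min t₀ (G.len e₀ - t₀)) with hη
  have hη0 : 0 < η := lt_min hε (lt_min ht₀.1 (by linarith [ht₀.2]))
  have hη1 : η ≤ t₀ := (min_le_right _ _).trans (min_le_left _ _)
  have hη2 : η ≤ G.len e₀ - t₀ := (min_le_right _ _).trans (min_le_right _ _)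
  obtain ⟨v, hv, hvf⟩ := exists_tent_interior (G := G) hη0 hη1 hη2
  have hvm := hv.memH1 hfin
  have hsum := hu.memH1.hasSum_bilin hvm (ω ^ 2)
  rw [sub_eq_zero.2 (hu.weak v hvm)] at hsum
  have hz : ∀ x, η ≤ x → max 0 ((1 : ℝ) - x / η) = 0 := by
    intro x hx
    rw [max_eq_left]
    rw [sub_nonpos, le_div_iff₀ hη0]
    linarith
  have hsingle := hasSum_single (f := fun e => ∫ x in (0 : ℝ)..(G.len e),
      (deriv (G.onEdge u e) x * deriv (G.onEdge v e) x -
      ω ^ 2 * (G.onEdge u e x * G.onEdge v e x))) e₀ fun e he =>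
    integral_bilin_eq_zero (G.len_pos e).le fun x hx => by
      rw [onEdge_eq, hvf e x hx, if_neg he]
  have h3 := hsum.unique hsingle
  have hi := hu.memH1.intervalIntegrable_bilin hvm (ω ^ 2) e₀
  have hp := G.len_pos e₀
  have msub : ∀ a b, 0 ≤ a → a ≤ b → b ≤ G.len e₀ → Set.uIcc a b ⊆ Set.uIcc 0 (G.len e₀) := by
    intro a b h1 h2 h3
    rw [Set.uIcc_of_le h2, Set.uIcc_of_le hp.le]
    exact Set.Icc_subset_Icc h1 h3
  have j1 := hi.mono_set (msub 0 (t₀ - η) le_rfl (by linarith) (by linarith))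
  have j2 := hi.mono_set (msub (t₀ - η) t₀ (by linarith) (by linarith) (by linarith))
  have j3 := hi.mono_set (msub t₀ (t₀ + η) (by linarith) (by linarith) (by linarith))
  have j4 := hi.mono_set (msub (t₀ + η) (G.len e₀) (by linarith) (by linarith) (by linarith))
  rw [← intervalIntegral.integral_add_adjacent_intervals ((j1.trans j2).trans j3) j4,
    ← intervalIntegral.integral_add_adjacent_intervals (j1.trans j2) j3,
    ← intervalIntegral.integral_add_adjacent_intervals j1 j2,
    integral_bilin_eq_zero (a := 0) (by linarith), integral_bilin_eq_zero (a := t₀ + η) (by linarith),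
    integral_bilin_tent (s := -1) (c := t₀) (A := B) (ε := η) (by linarith) (Or.inr rfl),
    integral_bilin_tent (s := 1) (c := t₀) (A := A) (ε := η) (by linarith) (Or.inl rfl)] at h3
  · simp [div_self hη0.ne'] at h3
    have : (A + B) * ω = 0 := by linear_combination h3
    exact (mul_eq_zero.1 this).resolve_right hω.ne'
  · intro x hx
    have := hA (x - t₀) ⟨by linarith [hx.1], (by linarith [hx.2] : x - t₀ ≤ η).trans (min_le_left _ _)⟩
    simpa [germPt, onEdge_eq] using this
  · intro x hx
    rw [onEdge_eq, hvf e₀ x ⟨by linarith [hx.1, ht₀.1], by linarith [hx.2]⟩, if_pos rfl,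
      abs_of_nonneg (by linarith [hx.1]), one_mul, max_eq_right]
    have : (x - t₀) / η ≤ 1 := (div_le_one hη0).2 (by linarith [hx.2])
    linarith
  · intro x hx
    have := hB (t₀ - x) ⟨by linarith [hx.2], (by linarith [hx.1] : t₀ - x ≤ η).trans (min_le_left _ _)⟩
    simpa [germPt, onEdge_eq] using this
  · intro x hx
    rw [onEdge_eq, hvf e₀ x ⟨by linarith [hx.1], by linarith [hx.2, ht₀.2]⟩, if_pos rfl,
      abs_of_nonpos (by linarith [hx.2]), max_eq_right]
    · ring
    have : -(x - t₀) / η ≤ 1 := (div_le_one hη0).2 (by linarith [hx.1])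
    linarith
  · intro x hx
    rw [onEdge_eq, hvf e₀ x ⟨by linarith [hx.1, ht₀.1], by linarith [hx.2]⟩, if_pos rfl,
      abs_of_nonneg (by linarith [hx.1])]
    exact hz _ (by linarith [hx.1])
  · intro x hx
    rw [onEdge_eq, hvf e₀ x ⟨by linarith [hx.1], by linarith [hx.2, ht₀.2]⟩, if_pos rfl,
      abs_of_nonpos (by linarith [hx.2])]
    exact hz _ (by linarith [hx.2])

/-- Kirchhoff's condition at a zero of a weak eigenfunction: if the function is `A sin (ω t)` along
each germ of a star, then the amplitudes add up to zero. -/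
theorem IsWeakEigen.kirchhoff (hlf : G.LocallyFinite) (hfin : G.FiniteLength) {ω : ℝ}
    (hω : 0 < ω) (hu : G.IsWeakEigen ω u) {ι : Type*} (s : Finset ι) (d : ι → Germ E)
    (hinj : Set.InjOn d s) (hD : G.IsStar (d '' s)) (A : ι → ℝ) {ε : ℝ} (hε : 0 < ε)
    (h : ∀ i ∈ s, ∀ t ∈ Set.Icc 0 ε, u (G.germPt (d i) t) = A i * Real.sin (ω * t)) :
    ∑ i ∈ s, A i = 0 := by
  classical
  rcases hD with ⟨a, ha⟩ | ⟨e, t, ht, he⟩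
  · have hex : ∀ b, G.glue b a → ∃ i ∈ s, d i = vertexGerm G b := by
      intro b hb
      have : vertexGerm G b ∈ d '' s := ha ▸ ⟨b, hb, rfl⟩
      simpa using this
    have : Nonempty ι := ⟨(hex a (G.glue.refl a)).choose⟩
    choose! j hj hjd using hex
    have h1 := hu.sum_vertex_eq_zero hlf hfin hω a (fun b => A (j b)) hε fun b hb t ht => by
      rw [← hjd b hb]
      exact h _ (hj b hb) t ht
    rw [← h1]
    symm
    refine Finset.sum_bij (fun b _ => j b) (fun b hb => hj b (by simpa using hb)) ?_ ?_
      (fun b _ => rfl)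
    · intro b hb c hc hbc
      have hb' : G.glue b a := by simpa using hb
      have hc' : G.glue c a := by simpa using hc
      refine vertexGerm_injective (G := G) ?_
      rw [← hjd b hb', ← hjd c hc', hbc]
    · intro i hi
      have : d i ∈ vertexGerm G '' {b | G.glue b a} := ha ▸ ⟨i, hi, rfl⟩
      obtain ⟨b, hb, hbi⟩ := this
      refine ⟨b, by simpa using hb, hinj (hj b hb) hi ?_⟩
      rw [hjd b hb, hbi]
  · have m1 : (⟨e, t, 1⟩ : Germ E) ∈ d '' s := by rw [he]; simp
    have m2 : (⟨e, t, -1⟩ : Germ E) ∈ d '' s := by rw [he]; simp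
    obtain ⟨i, hi, hi'⟩ := m1
    obtain ⟨j, hj, hj'⟩ := m2
    have hij : i ≠ j := by
      rintro rfl
      rw [hi'] at hj'
      simp only [Germ.mk.injEq, true_and] at hj'
      norm_num at hj'
    have hs : s = {i, j} := by
      ext k
      simp only [Finset.mem_insert, Finset.mem_singleton]
      refine ⟨fun hk => ?_, ?_⟩
      · have : d k ∈ ({⟨e, t, 1⟩, ⟨e, t, -1⟩} : Set (Germ E)) := he ▸ ⟨k, hk, rfl⟩
        rcases this with h2 | h2
        · exact Or.inl (hinj hk hi (h2.trans hi'.symm))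
        · exact Or.inr (hinj hk hj (Eq.trans h2 hj'.symm))
      · rintro (rfl | rfl)
        · exact hi
        · exact hj
    rw [hs, Finset.sum_pair hij]
    refine hu.add_interior_eq_zero hfin hω ht hε ?_ ?_
    · intro τ hτ
      rw [← hi']
      exact h i hi τ hτ
    · intro τ hτ
      rw [← hj']
      exact h j hj τ hτ

end

section

/-! ### Branches: rooted parts of the graph with a Riccati bound -/

variable {E : Type*} {G : MetricGraph E} {u : G.Space → ℝ} {ω ℓ : ℝ}

/-- A closed interval on an edge. -/
structure Piece (E : Type*) where
  edge : E
  lo : ℝ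
  hi : ℝ

/-- The position `t` on the edge `e` belongs to one of the pieces in `P`. -/
def Covers (P : Set (Piece E)) (e : E) (t : ℝ) : Prop := ∃ p ∈ P, p.edge = e ∧ t ∈ Set.Icc p.lo p.hi

/-- The germ that leads back along `d` from the point at distance `b`. -/
def Germ.rev (d : Germ E) (b : ℝ) : Germ E := ⟨d.edge, d.pos + d.dir * b, -d.dir⟩

/-- The germ that continues `d` at the point at distance `a`. -/
def Germ.shift (d : Germ E) (a : ℝ) : Germ E := ⟨d.edge, d.pos + d.dir * a, d.dir⟩

/-- The interval covered by following `d` up to distance `b`. -/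
def Germ.piece (d : Germ E) (b : ℝ) : Piece E :=
  ⟨d.edge, min d.pos (d.pos + d.dir * b), max d.pos (d.pos + d.dir * b)⟩

/-- The contribution of the interval of length `b` along `d` to the shifted quadratic form. -/
def pieceForm (G : MetricGraph E) (ω : ℝ) (d : Germ E) (b : ℝ) (u : G.Space → ℝ) : ℝ :=
  d.dir * ∫ x in d.pos..(d.pos + d.dir * b),
    (deriv (G.onEdge u d.edge) x ^ 2 - ω ^ 2 * G.onEdge u d.edge x ^ 2)

theorem germPt_rev (d : Germ E) (b t : ℝ) : G.germPt (d.rev b) t = G.germPt d (b - t) := by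
  unfold germPt Germ.rev
  congr 1
  simp only
  ring

theorem germPt_shift (d : Germ E) (a t : ℝ) : G.germPt (d.shift a) t = G.germPt d (a + t) := by
  unfold germPt Germ.shift
  congr 1
  simp only
  ring

theorem Germ.Fits.rev {d : Germ E} {b : ℝ} (h : d.Fits G b) : (d.rev b).Fits G b := by
  refine ⟨?_, h.end_mem, ?_⟩
  · rcases h.dir with h | h <;> simp [Germ.rev, h]
  · simpa [Germ.rev] using h.pos_mem

theorem Germ.Fits.shift {d : Germ E} {a b : ℝ} (h : d.Fits G (a + b)) (ha : 0 ≤ a) (hb : 0 ≤ b) :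
    (d.shift a).Fits G b := by
  refine ⟨h.dir, h.mem ⟨ha, by linarith⟩, ?_⟩
  have := h.end_mem
  rwa [mul_add, ← add_assoc] at this

theorem pieceForm_rev (d : Germ E) (b : ℝ) (u : G.Space → ℝ) :
    G.pieceForm ω (d.rev b) b u = G.pieceForm ω d b u := by
  unfold pieceForm Germ.rev
  simp only
  rw [intervalIntegral.integral_symm]
  simp

theorem mem_piece_iff {d : Germ E} {b x : ℝ} (hd : d.dir = 1 ∨ d.dir = -1) (hb : 0 ≤ b) :
    x ∈ Set.Icc (d.piece b).lo (d.piece b).hi ↔ ∃ t ∈ Set.Icc 0 b, x = d.pos + d.dir * t := by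
  unfold Germ.piece
  simp only
  rcases hd with h | h <;> rw [h]
  · rw [min_eq_left (by linarith), max_eq_right (by linarith)]
    constructor
    · intro hx
      exact ⟨x - d.pos, ⟨by linarith [hx.1], by linarith [hx.2]⟩, by ring⟩
    · rintro ⟨t, ht, rfl⟩
      exact ⟨by linarith [ht.1], by linarith [ht.2]⟩
  · rw [min_eq_right (by linarith), max_eq_left (by linarith)]
    constructor
    · intro hx
      exact ⟨d.pos - x, ⟨by linarith [hx.2], by linarith [hx.1]⟩, by ring⟩
    · rintro ⟨t, ht, rfl⟩
      exact ⟨by linarith [ht.2], by linarith [ht.1]⟩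

theorem MemH1.intervalIntegrable_shifted (hu : G.MemH1 u) (ω : ℝ) (e : E) {a b : ℝ}
    (ha : a ∈ Set.Icc 0 (G.len e)) (hb : b ∈ Set.Icc 0 (G.len e)) :
    IntervalIntegrable (fun x => deriv (G.onEdge u e) x ^ 2 - ω ^ 2 * G.onEdge u e x ^ 2)
      volume a b := by
  have h1 : IntervalIntegrable (fun x => deriv (G.onEdge u e) x ^ 2 - ω ^ 2 * G.onEdge u e x ^ 2)
      volume 0 (G.len e) := by
    rw [intervalIntegrable_iff_edge]
    exact (hu.integrable_deriv_sq e).sub ((hu.integrable_sq e).const_mul _)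
  refine h1.mono_set ?_
  rw [Set.uIcc_of_le (G.len_pos e).le]
  exact Set.uIcc_subset_Icc ha hb

theorem pieceForm_add (hu : G.MemH1 u) {d : Germ E} {a b : ℝ} (h : d.Fits G (a + b)) (ha : 0 ≤ a)
    (hb : 0 ≤ b) : G.pieceForm ω d (a + b) u =
      G.pieceForm ω d a u + G.pieceForm ω (d.shift a) b u := by
  unfold pieceForm Germ.shift
  simp only
  rw [← mul_add, intervalIntegral.integral_add_adjacent_intervals]
  · congr 2
    ring
  · exact hu.intervalIntegrable_shifted ω _ h.pos_mem (h.mem ⟨ha, by linarith⟩)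
  · have := h.end_mem
    rw [mul_add, ← add_assoc] at this
    exact hu.intervalIntegrable_shifted ω _ (h.mem ⟨ha, by linarith⟩) this

/-- The Riccati inequality along a germ: `R` is the mass hanging at the far end of the interval. -/
theorem pieceForm_ge (hω : 0 < ω) (hωℓ : ω * ℓ = Real.pi / 2) (hu : G.MemH1 u) {d : Germ E} {b R : ℝ}
    (hd : d.Fits G b) (hb : 0 < b) (hR : 0 ≤ R) (hRb : R + b ≤ ℓ)
    (h0 : R + b = ℓ → u (G.germPt d 0) = 0) :
    ω * Real.tan (ω * R) * u (G.germPt d b) ^ 2 -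
        ω * Real.tan (ω * (R + b)) * u (G.germPt d 0) ^ 2 ≤ G.pieceForm ω d b u ∧
      (G.pieceForm ω d b u = ω * Real.tan (ω * R) * u (G.germPt d b) ^ 2 -
        ω * Real.tan (ω * (R + b)) * u (G.germPt d 0) ^ 2 →
      ∃ A, ∀ t ∈ Set.Icc 0 b, u (G.germPt d t) = A * Real.cos (ω * (R + b - t))) := by
  have hpi := Real.pi_pos
  have hu2 : IntervalIntegrable (fun x => deriv (G.onEdge u d.edge) x ^ 2) volume 0 (G.len d.edge) := by
    rw [intervalIntegrable_iff_edge]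
    exact hu.integrable_deriv_sq _
  have hsub : Set.uIcc d.pos (d.pos + d.dir * b) ⊆ Set.uIcc 0 (G.len d.edge) := by
    rw [Set.uIcc_of_le (G.len_pos _).le]
    exact Set.uIcc_subset_Icc hd.pos_mem hd.end_mem
  have hw := (hu.absCont d.edge).mono hsub
  have hw2 := hu2.mono_set hsub
  have hposc : ∀ s, 0 ≤ s → s < ℓ → 0 < Real.cos (ω * s) := by
    intro s hs hs'
    have h1 : ω * s < ω * ℓ := mul_lt_mul_of_pos_left hs' hω
    refine Real.cos_pos_of_mem_Ioo ⟨?_, by linarith⟩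
    have := mul_nonneg hω.le hs
    linarith
  have hpole : ∀ s, 0 ≤ s → s ≤ ℓ → Real.cos (ω * s) = 0 → s = ℓ := by
    intro s hs hs' h
    by_contra hne
    exact (hposc s hs (lt_of_le_of_ne hs' hne)).ne' h
  rcases hd.dir with h | h
  · -- the germ runs in the direction of the edge
    rw [h, one_mul] at hw hw2
    have key := riccati_le_integral (ω := ω) (θ := -(ω * (R + b + d.pos))) hω
      (show d.pos < d.pos + b by linarith) hw hw2 ?_ ?_ ?_
    · have e1 : riccati ω (-(ω * (R + b + d.pos))) (d.pos + b) = ω * Real.tan (ω * R) := by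
        unfold riccati
        rw [show ω * (d.pos + b) + -(ω * (R + b + d.pos)) = -(ω * R) by ring, Real.tan_neg]
        ring
      have e2 : riccati ω (-(ω * (R + b + d.pos))) d.pos = ω * Real.tan (ω * (R + b)) := by
        unfold riccati
        rw [show ω * d.pos + -(ω * (R + b + d.pos)) = -(ω * (R + b)) by ring, Real.tan_neg]
        ring
      rw [e1, e2] at key
      have e3 : G.pieceForm ω d b u = ∫ x in d.pos..(d.pos + b),
          (deriv (G.onEdge u d.edge) x ^ 2 - ω ^ 2 * G.onEdge u d.edge x ^ 2) := by
        unfold pieceForm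
        rw [h, one_mul, one_mul]
      have e4 : G.germPt d b = G.pt d.edge (d.pos + b) := by unfold germPt; rw [h, one_mul]
      have e5 : G.germPt d 0 = G.pt d.edge d.pos := by unfold germPt; rw [mul_zero, add_zero]
      rw [e3, e4, e5]
      simp only [onEdge_eq] at key ⊢
      refine ⟨by linarith [key.1], fun heq => ?_⟩
      obtain ⟨A, hA⟩ := key.2 (by linarith)
      refine ⟨A, fun t ht => ?_⟩
      have := hA (d.pos + t) ⟨by linarith [ht.1], by linarith [ht.2]⟩
      unfold germPt
      rw [h, one_mul, this, ← Real.cos_neg]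
      congr 2
      ring
    · intro x hx
      rw [show ω * x + -(ω * (R + b + d.pos)) = -(ω * (R + b + d.pos - x)) by ring, Real.cos_neg]
      exact (hposc _ (by linarith [hx.2]) (by linarith [hx.1])).ne'
    · intro hc
      rw [show ω * d.pos + -(ω * (R + b + d.pos)) = -(ω * (R + b)) by ring, Real.cos_neg] at hc
      have := h0 (hpole _ (by linarith) hRb hc)
      rwa [germPt, mul_zero, add_zero] at this
    · intro hc
      rw [show ω * (d.pos + b) + -(ω * (R + b + d.pos)) = -(ω * R) by ring, Real.cos_neg] at hc
      exact absurd hc (hposc _ hR (by linarith)).ne'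
  · -- the germ runs against the direction of the edge
    rw [h, neg_one_mul, ← sub_eq_add_neg] at hw hw2
    have key := riccati_le_integral (ω := ω) (θ := ω * (R + b - d.pos)) hω
      (show d.pos - b < d.pos by linarith) hw.symm hw2.symm ?_ ?_ ?_
    · have e1 : riccati ω (ω * (R + b - d.pos)) (d.pos - b) = -(ω * Real.tan (ω * R)) := by
        unfold riccati
        rw [show ω * (d.pos - b) + ω * (R + b - d.pos) = ω * R by ring]
        ring
      have e2 : riccati ω (ω * (R + b - d.pos)) d.pos = -(ω * Real.tan (ω * (R + b))) := by
        unfold riccati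
        rw [show ω * d.pos + ω * (R + b - d.pos) = ω * (R + b) by ring]
        ring
      rw [e1, e2] at key
      have e3 : G.pieceForm ω d b u = ∫ x in (d.pos - b)..d.pos,
          (deriv (G.onEdge u d.edge) x ^ 2 - ω ^ 2 * G.onEdge u d.edge x ^ 2) := by
        unfold pieceForm
        rw [h, neg_one_mul, neg_one_mul, ← sub_eq_add_neg, ← intervalIntegral.integral_symm]
      have e4 : G.germPt d b = G.pt d.edge (d.pos - b) := by
        unfold germPt; rw [h, neg_one_mul, ← sub_eq_add_neg]
      have e5 : G.germPt d 0 = G.pt d.edge d.pos := by unfold germPt; rw [mul_zero, add_zero]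
      rw [e3, e4, e5]
      simp only [onEdge_eq] at key ⊢
      refine ⟨by linarith [key.1], fun heq => ?_⟩
      obtain ⟨A, hA⟩ := key.2 (by linarith)
      refine ⟨A, fun t ht => ?_⟩
      have := hA (d.pos - t) ⟨by linarith [ht.2], by linarith [ht.1]⟩
      unfold germPt
      rw [h, neg_one_mul, ← sub_eq_add_neg, this]
      congr 2
      ring
    · intro x hx
      rw [show ω * x + ω * (R + b - d.pos) = ω * (R + b - d.pos + x) by ring]
      exact (hposc _ (by linarith [hx.1]) (by linarith [hx.2])).ne'
    · intro hc
      rw [show ω * (d.pos - b) + ω * (R + b - d.pos) = ω * R by ring] at hc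
      exact absurd hc (hposc _ hR (by linarith)).ne'
    · intro hc
      rw [show ω * d.pos + ω * (R + b - d.pos) = ω * (R + b) by ring] at hc
      have := h0 (hpole _ (by linarith) hRb hc)
      rwa [germPt, mul_zero, add_zero] at this

theorem tan_add_tan_le {a b : ℝ} (ha : 0 ≤ a) (hb : 0 ≤ b) (hab : a + b < Real.pi / 2) :
    Real.tan a + Real.tan b ≤ Real.tan (a + b) ∧
      (0 < a → 0 < b → Real.tan a + Real.tan b < Real.tan (a + b)) := by
  have hpi := Real.pi_pos
  have ca : 0 < Real.cos a := Real.cos_pos_of_mem_Ioo ⟨by linarith, by linarith⟩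
  have cb : 0 < Real.cos b := Real.cos_pos_of_mem_Ioo ⟨by linarith, by linarith⟩
  have cab : 0 < Real.cos (a + b) := Real.cos_pos_of_mem_Ioo ⟨by linarith, by linarith⟩
  have sab : 0 ≤ Real.sin (a + b) := Real.sin_nonneg_of_nonneg_of_le_pi (by linarith) (by linarith)
  have sa : 0 ≤ Real.sin a := Real.sin_nonneg_of_nonneg_of_le_pi ha (by linarith)
  have sb : 0 ≤ Real.sin b := Real.sin_nonneg_of_nonneg_of_le_pi hb (by linarith)
  have e : Real.tan a + Real.tan b = Real.sin (a + b) / (Real.cos a * Real.cos b) := by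
    rw [Real.tan_eq_sin_div_cos, Real.tan_eq_sin_div_cos, Real.sin_add]
    field_simp
  rw [e, Real.tan_eq_sin_div_cos]
  constructor
  · refine div_le_div_of_nonneg_left sab cab ?_
    rw [Real.cos_add]
    nlinarith
  · intro ha' hb'
    have sa' : 0 < Real.sin a := Real.sin_pos_of_pos_of_lt_pi ha' (by linarith)
    have sb' : 0 < Real.sin b := Real.sin_pos_of_pos_of_lt_pi hb' (by linarith)
    have sab' : 0 < Real.sin (a + b) := Real.sin_pos_of_pos_of_lt_pi (by linarith) (by linarith)
    refine div_lt_div_of_pos_left sab' cab ?_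
    rw [Real.cos_add]
    nlinarith [mul_pos sa' sb']

theorem sum_tan_le {ι : Type*} (s : Finset ι) (r : ι → ℝ) (hr : ∀ i ∈ s, 0 < r i)
    (hs : ∑ i ∈ s, r i < Real.pi / 2) :
    ∑ i ∈ s, Real.tan (r i) ≤ Real.tan (∑ i ∈ s, r i) ∧
      (1 < s.card → ∑ i ∈ s, Real.tan (r i) < Real.tan (∑ i ∈ s, r i)) := by
  classical
  induction s using Finset.induction_on with
  | empty => simp
  | insert a s ha ih =>
    have hra := hr a (Finset.mem_insert_self _ _)
    have hrs : ∀ i ∈ s, 0 < r i := fun i hi => hr i (Finset.mem_insert_of_mem hi)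
    rw [Finset.sum_insert ha] at hs ⊢
    rw [Finset.sum_insert ha]
    have h0 : 0 ≤ ∑ i ∈ s, r i := Finset.sum_nonneg fun i hi => (hrs i hi).le
    obtain ⟨h1, _⟩ := ih hrs (by linarith)
    obtain ⟨h3, h4⟩ := tan_add_tan_le hra.le h0 hs
    refine ⟨by linarith, fun hc => ?_⟩
    rw [Finset.card_insert_of_notMem ha] at hc
    have hne : s.Nonempty := Finset.card_pos.1 (by omega)
    have := h4 hra (Finset.sum_pos hrs hne)
    linarith

end

section

variable {E : Type*} {G : MetricGraph E} {u : G.Space → ℝ} {ω ℓ : ℝ}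

/-- `γ` parametrises the pieces in `P` by arc length on `J`, which is `[0, r]` or `[0, r)`, starting
along the germ `d`. -/
structure IsArm (G : MetricGraph E) (d : Germ E) (r : ℝ) (P : Set (Piece E)) (J : Set ℝ)
    (γ : ℝ → G.Space) : Prop where
  dom : J = Set.Icc 0 r ∨ J = Set.Ico 0 r
  germ : ∃ ε > 0, ∀ t ∈ Set.Icc 0 ε, t ∈ J ∧ γ t = G.germPt d t
  pieces : ∀ p ∈ P, ∃ c s : ℝ, (s = 1 ∨ s = -1) ∧
    ∀ t ∈ Set.Icc p.lo p.hi, c + s * t ∈ J ∧ γ (c + s * t) = G.pt p.edge t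
  edist_le : ∀ x ∈ J, ∀ y ∈ J, edist (γ x) (γ y) ≤ ENNReal.ofReal |x - y|

theorem IsArm.mem_Icc {d : Germ E} {r : ℝ} {P : Set (Piece E)} {J : Set ℝ} {γ : ℝ → G.Space}
    (h : IsArm G d r P J γ) {x : ℝ} (hx : x ∈ J) : x ∈ Set.Icc 0 r := by
  rcases h.dom with h | h <;> rw [h] at hx
  · exact hx
  · exact ⟨hx.1, hx.2.le⟩

/-- The function vanishes on the set `S`, and at the base of the germ `d` if the residual mass `r`
equals the critical mass `ℓ`. -/
structure Admissible (G : MetricGraph E) (ℓ : ℝ) (d : Germ E) (r : ℝ) (S : Finset G.Space)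
    (u : G.Space → ℝ) : Prop where
  vanish : ∀ p ∈ S, u p = 0
  base : r = ℓ → u (G.germPt d 0) = 0

/-- The Riccati bound `-ω tan (ω r) u(base)²` for the form of a branch with residual mass `r`. -/
def branchBound (G : MetricGraph E) (ω : ℝ) (d : Germ E) (r : ℝ) (u : G.Space → ℝ) : ℝ :=
  -(ω * Real.tan (ω * r) * u (G.germPt d 0) ^ 2)

/-- Weak eigenfunctions for which the Riccati bound of a branch is attained. -/
structure IsTight (G : MetricGraph E) (ω ℓ : ℝ) (d : Germ E) (Q : (G.Space → ℝ) → ℝ) (r : ℝ)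
    (S : Finset G.Space) (u : G.Space → ℝ) : Prop where
  eigen : G.IsWeakEigen ω u
  adm : Admissible G ℓ d r S u
  eq : Q u = G.branchBound ω d r u

/-- The function vanishes on all pieces in `P`. -/
def VanishesOn (G : MetricGraph E) (P : Set (Piece E)) (u : G.Space → ℝ) : Prop :=
  ∀ p ∈ P, ∀ t ∈ Set.Icc p.lo p.hi, u (G.pt p.edge t) = 0

/-- No weak eigenfunction other than zero attains the bound of the branch. -/
def IsDead (G : MetricGraph E) (ω ℓ : ℝ) (d : Germ E) (Q : (G.Space → ℝ) → ℝ) (r : ℝ)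
    (P : Set (Piece E)) (S : Finset G.Space) : Prop :=
  ∀ u, IsTight G ω ℓ d Q r S u → VanishesOn G P u

/-- The branch is a path without cut points, on which functions that attain the bound are multiples
of `x ↦ cos (ω (r - x))`. -/
def IsAlive (G : MetricGraph E) (ω ℓ : ℝ) (d : Germ E) (Q : (G.Space → ℝ) → ℝ) (r : ℝ)
    (P : Set (Piece E)) (S : Finset G.Space) : Prop :=
  S = ∅ ∧ ∃ J γ, IsArm G d r P J γ ∧
    ∀ u, IsTight G ω ℓ d Q r S u → ∃ A, ∀ x ∈ J, u (γ x) = A * Real.cos (ω * (r - x))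

/-- The data of a branch with the cut set `S`: a part of the graph that is attached along the germ
`d`, with form `Q`, mass `m`, pieces `P` and residual mass `r ∈ (0, ℓ]`. Each cut point uses up at
least the mass `ℓ`. -/
structure IsBranchWith (G : MetricGraph E) (ω ℓ : ℝ) (d : Germ E) (Q : (G.Space → ℝ) → ℝ) (m r : ℝ)
    (P : Set (Piece E)) (S : Finset G.Space) : Prop where
  r_pos : 0 < r
  r_le : r ≤ ℓ
  countable : P.Countable
  germ : ∃ ε > 0, ∀ t ∈ Set.Icc 0 ε, Covers P d.edge (d.pos + d.dir * t)
  mass : S.card * ℓ + r ≤ m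
  bound : ∀ u, G.MemH1 u → Admissible G ℓ d r S u → G.branchBound ω d r u ≤ Q u
  dead_or_alive : IsDead G ω ℓ d Q r P S ∨ IsAlive G ω ℓ d Q r P S

/-- A branch for some cut set. -/
def IsBranch (G : MetricGraph E) (ω ℓ : ℝ) (d : Germ E) (Q : (G.Space → ℝ) → ℝ) (m r : ℝ)
    (P : Set (Piece E)) : Prop := ∃ S, IsBranchWith G ω ℓ d Q m r P S

theorem VanishesOn.germ {P : Set (Piece E)} (h : VanishesOn G P u) {d : Germ E} {t : ℝ}
    (ht : Covers P d.edge (d.pos + d.dir * t)) : u (G.germPt d t) = 0 := by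
  obtain ⟨p, hp, he, ht⟩ := ht
  have := h p hp _ ht
  rwa [he] at this

theorem IsArm.vanishesOn {d : Germ E} {r : ℝ} {P : Set (Piece E)} {J : Set ℝ}
    {γ : ℝ → G.Space} (h : IsArm G d r P J γ) (h0 : ∀ x ∈ J, u (γ x) = 0) : VanishesOn G P u := by
  intro p hp t ht
  obtain ⟨c, s, _, hc⟩ := h.pieces p hp
  obtain ⟨h1, h2⟩ := hc t ht
  rw [← h2]
  exact h0 _ h1

theorem IsBranchWith.congr {d : Germ E} {Q Q' : (G.Space → ℝ) → ℝ} {m r : ℝ} {P : Set (Piece E)}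
    {S : Finset G.Space} (h : IsBranchWith G ω ℓ d Q m r P S)
    (hQ : ∀ u, G.MemH1 u → Q u = Q' u) : IsBranchWith G ω ℓ d Q' m r P S := by
  have ht : ∀ u, IsTight G ω ℓ d Q' r S u → IsTight G ω ℓ d Q r S u := fun u hu =>
    ⟨hu.eigen, hu.adm, by rw [hQ u hu.eigen.memH1, hu.eq]⟩
  refine ⟨h.r_pos, h.r_le, h.countable, h.germ, h.mass, fun u hu ha => ?_, ?_⟩
  · rw [← hQ u hu]
    exact h.bound u hu ha
  · rcases h.dead_or_alive with hd | ⟨h1, J, γ, h2, h3⟩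
    · exact Or.inl fun u hu => hd u (ht u hu)
    · exact Or.inr ⟨h1, J, γ, h2, fun u hu => h3 u (ht u hu)⟩

theorem cos_pos_of_lt (hω : 0 < ω) (hωℓ : ω * ℓ = Real.pi / 2) {s : ℝ} (hs : 0 ≤ s) (hs' : s < ℓ) :
    0 < Real.cos (ω * s) := by
  have h1 : ω * s < ω * ℓ := mul_lt_mul_of_pos_left hs' hω
  refine Real.cos_pos_of_mem_Ioo ⟨?_, by linarith⟩
  have := mul_nonneg hω.le hs
  linarith [Real.pi_pos]

theorem sin_pos_of_le (hω : 0 < ω) (hωℓ : ω * ℓ = Real.pi / 2) {s : ℝ} (hs : 0 < s) (hs' : s ≤ ℓ) :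
    0 < Real.sin (ω * s) := by
  have h1 : ω * s ≤ ω * ℓ := mul_le_mul_of_nonneg_left hs' hω.le
  exact Real.sin_pos_of_pos_of_lt_pi (mul_pos hω hs) (by linarith [Real.pi_pos])

section Branch

variable {d : Germ E} {Q : (G.Space → ℝ) → ℝ} {m r : ℝ} {P : Set (Piece E)} {S : Finset G.Space}

/-- Below the critical mass, a function that attains the bound and vanishes at the base vanishes on
the whole branch. -/
theorem IsBranchWith.vanishesOn (hω : 0 < ω) (hωℓ : ω * ℓ = Real.pi / 2)
    (h : IsBranchWith G ω ℓ d Q m r P S) (hu : IsTight G ω ℓ d Q r S u) (hr : r < ℓ)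
    (h0 : u (G.germPt d 0) = 0) : VanishesOn G P u := by
  rcases h.dead_or_alive with hd | ⟨_, J, γ, hγ, hA⟩
  · exact hd u hu
  · obtain ⟨A, hA⟩ := hA u hu
    obtain ⟨ε, hε, hg⟩ := hγ.germ
    obtain ⟨h1, h2⟩ := hg 0 ⟨le_rfl, hε.le⟩
    have h3 := hA 0 h1
    rw [h2, h0, sub_zero] at h3
    have h4 : A = 0 :=
      (mul_eq_zero.1 h3.symm).resolve_right (cos_pos_of_lt hω hωℓ h.r_pos.le hr).ne'
    exact hγ.vanishesOn fun x hx => by rw [hA x hx, h4, zero_mul]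

/-- At the critical mass, a function that attains the bound is a multiple of `sin (ω x)` along the
germ, and one further zero makes it vanish on the whole branch. -/
theorem IsBranchWith.exists_amplitude (hω : 0 < ω) (hωℓ : ω * ℓ = Real.pi / 2)
    (h : IsBranchWith G ω ℓ d Q m r P S) (hr : r = ℓ) : ∃ ε > 0, ∀ u, IsTight G ω ℓ d Q r S u →
      ∃ A, (∀ t ∈ Set.Icc 0 ε, u (G.germPt d t) = A * Real.sin (ω * t)) ∧
        (u (G.germPt d ε) = 0 → VanishesOn G P u) ∧ (A = 0 → VanishesOn G P u) := by
  rcases h.dead_or_alive with hd | ⟨_, J, γ, hγ, hA⟩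
  · obtain ⟨ε, hε, hg⟩ := h.germ
    refine ⟨ε, hε, fun u hu => ⟨0, fun t ht => ?_, fun _ => hd u hu, fun _ => hd u hu⟩⟩
    rw [zero_mul]
    exact (hd u hu).germ (hg t ht)
  · obtain ⟨ε, hε, hg⟩ := hγ.germ
    refine ⟨ε, hε, fun u hu => ?_⟩
    obtain ⟨A, hA⟩ := hA u hu
    have hsin : ∀ x, Real.cos (ω * (r - x)) = Real.sin (ω * x) := by
      intro x
      rw [hr, mul_sub, hωℓ, Real.cos_pi_div_two_sub]
    have hz : A = 0 → VanishesOn G P u := fun h4 =>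
      hγ.vanishesOn fun x hx => by rw [hA x hx, h4, zero_mul]
    have hform : ∀ t ∈ Set.Icc 0 ε, u (G.germPt d t) = A * Real.sin (ω * t) := by
      intro t ht
      obtain ⟨h1, h2⟩ := hg t ht
      rw [← h2, hA t h1, hsin]
    refine ⟨A, hform, fun h0 => hz ?_, hz⟩
    obtain ⟨h1, _⟩ := hg ε ⟨hε.le, le_rfl⟩
    have h2 := hform ε ⟨hε.le, le_rfl⟩
    rw [h0] at h2
    have h3 : ε ≤ ℓ := (hγ.mem_Icc h1).2.trans hr.le
    exact (mul_eq_zero.1 h2.symm).resolve_right (sin_pos_of_le hω hωℓ hε h3).ne'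

/-- A branch consisting of one interval without anything beyond it. -/
theorem isArm_piece {d : Germ E} {b : ℝ} (hd : d.Fits G b) (hb : 0 < b) :
    IsArm G d b {d.piece b} (Set.Icc 0 b) (G.germPt d) := by
  refine ⟨Or.inl rfl, ⟨b, hb, fun t ht => ⟨ht, rfl⟩⟩, ?_, ?_⟩
  · rintro p rfl
    refine ⟨-(d.dir * d.pos), d.dir, hd.dir, fun t ht => ?_⟩
    obtain ⟨τ, hτ, h⟩ := (mem_piece_iff hd.dir hb.le).1 ht
    have hs : d.dir * d.dir = 1 := by rcases hd.dir with h | h <;> rw [h] <;> norm_num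
    have e1 : -(d.dir * d.pos) + d.dir * t = τ := by rw [h]; linear_combination τ * hs
    rw [e1]
    refine ⟨hτ, ?_⟩
    unfold germPt Germ.piece
    rw [h]
  · intro x _ y _
    refine (edist_pt_le _ _ _).trans (le_of_eq ?_)
    congr 1
    rw [show d.pos + d.dir * x - (d.pos + d.dir * y) = d.dir * (x - y) by ring, abs_mul]
    rcases hd.dir with h | h <;> rw [h] <;> simp

/-- An arm extended at its base by an interval. -/
theorem IsArm.extend {d d' : Germ E} {r b : ℝ} {P : Set (Piece E)} {J : Set ℝ} {γ : ℝ → G.Space}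
    (h : IsArm G d r P J γ) (hd : d'.Fits G b) (hb : 0 < b) (hbase : G.germPt d' b = G.germPt d 0) :
    IsArm G d' (r + b) (insert (d'.piece b) P) {x | x ∈ Set.Icc 0 b ∨ (b ≤ x ∧ x - b ∈ J)}
      (fun x => if x ≤ b then G.germPt d' x else γ (x - b)) := by
  obtain ⟨ε, hε, hg⟩ := h.germ
  obtain ⟨h0J, h0γ⟩ := hg 0 ⟨le_rfl, hε.le⟩
  have hr : 0 < r := by
    have h1 := (hg ε ⟨hε.le, le_rfl⟩).1
    exact hε.trans_le (h.mem_Icc h1).2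
  have harm := isArm_piece hd hb
  have hval : ∀ x ∈ {x | x ∈ Set.Icc 0 b ∨ (b ≤ x ∧ x - b ∈ J)}, b ≤ x → x - b ∈ J ∧
      (if x ≤ b then G.germPt d' x else γ (x - b)) = γ (x - b) := by
    intro x hx hbx
    rcases hbx.eq_or_lt with rfl | hlt
    · rw [sub_self, if_pos le_rfl, h0γ]
      exact ⟨h0J, hbase⟩
    · rw [if_neg (not_le.2 hlt)]
      rcases hx with hx | hx
      · exact absurd hx.2 (not_le.2 hlt)
      · exact ⟨hx.2, rfl⟩
  have hle : ∀ x ∈ {x | x ∈ Set.Icc 0 b ∨ (b ≤ x ∧ x - b ∈ J)},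
      ∀ y ∈ {x | x ∈ Set.Icc 0 b ∨ (b ≤ x ∧ x - b ∈ J)}, x ≤ y →
      edist (if x ≤ b then G.germPt d' x else γ (x - b)) (if y ≤ b then G.germPt d' y else γ (y - b))
        ≤ ENNReal.ofReal |x - y| := by
    intro x hx y hy hxy
    have hx0 : 0 ≤ x := by
      rcases hx with hx | hx
      · exact hx.1
      · linarith [hx.1]
    rcases le_total y b with hyb | hyb
    · rw [if_pos (hxy.trans hyb), if_pos hyb]
      exact harm.edist_le x ⟨hx0, hxy.trans hyb⟩ y ⟨hx0.trans hxy, hyb⟩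
    · obtain ⟨hyJ, hyv⟩ := hval y hy hyb
      rw [hyv]
      rcases le_total x b with hxb | hxb
      · rw [if_pos hxb]
        refine (edist_triangle _ (γ 0) _).trans ?_
        have e1 : edist (G.germPt d' x) (γ 0) ≤ ENNReal.ofReal |x - b| := by
          rw [h0γ, ← hbase]
          exact harm.edist_le x ⟨hx0, hxb⟩ b ⟨hb.le, le_rfl⟩
        have e2 := h.edist_le 0 h0J (y - b) hyJ
        refine (add_le_add e1 e2).trans (le_of_eq ?_)
        rw [← ENNReal.ofReal_add (abs_nonneg _) (abs_nonneg _)]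
        congr 1
        rw [abs_of_nonpos (by linarith), abs_of_nonpos (by linarith), abs_of_nonpos (by linarith)]
        ring
      · obtain ⟨hxJ, hxv⟩ := hval x hx hxb
        rw [hxv]
        refine (h.edist_le _ hxJ _ hyJ).trans (le_of_eq ?_)
        congr 2
        ring
  refine ⟨?_, ⟨b, hb, fun t ht => ⟨Or.inl ht, by simp only [if_pos ht.2]⟩⟩, ?_, ?_⟩
  · rcases h.dom with hJ | hJ
    · left
      ext x
      simp only [Set.mem_ofPred_eq, hJ, Set.mem_Icc]
      constructor
      · rintro (hx | hx)
        · exact ⟨hx.1, by linarith [hx.2]⟩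
        · exact ⟨by linarith [hx.1], by linarith [hx.2.2]⟩
      · rintro ⟨h1, h2⟩
        rcases le_total x b with h3 | h3
        · exact Or.inl ⟨h1, h3⟩
        · exact Or.inr ⟨h3, by linarith, by linarith⟩
    · right
      ext x
      simp only [Set.mem_ofPred_eq, hJ, Set.mem_Icc, Set.mem_Ico]
      constructor
      · rintro (hx | hx)
        · exact ⟨hx.1, by linarith [hx.2]⟩
        · exact ⟨by linarith [hx.1], by linarith [hx.2.2]⟩
      · rintro ⟨h1, h2⟩
        rcases le_total x b with h3 | h3
        · exact Or.inl ⟨h1, h3⟩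
        · exact Or.inr ⟨h3, by linarith, by linarith⟩
  · intro p hp
    rcases hp with rfl | hp
    · obtain ⟨c, s, hs, hc⟩ := harm.pieces _ rfl
      refine ⟨c, s, hs, fun t ht => ?_⟩
      obtain ⟨h1, h2⟩ := hc t ht
      refine ⟨Or.inl h1, ?_⟩
      rw [if_pos h1.2, h2]
    · obtain ⟨c, s, hs, hc⟩ := h.pieces p hp
      refine ⟨c + b, s, hs, fun t ht => ?_⟩
      obtain ⟨h1, h2⟩ := hc t ht
      have h3 : b ≤ c + b + s * t := by linarith [(h.mem_Icc h1).1]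
      have e : c + b + s * t - b = c + s * t := by ring
      have hm : c + b + s * t ∈ {x | x ∈ Set.Icc 0 b ∨ (b ≤ x ∧ x - b ∈ J)} :=
        Or.inr ⟨h3, by rwa [e]⟩
      refine ⟨hm, ?_⟩
      rw [(hval _ hm h3).2, e, h2]
  · intro x hx y hy
    rcases le_total x y with hxy | hxy
    · exact hle x hx y hy hxy
    · rw [edist_comm, abs_sub_comm]
      exact hle y hy x hx hxy

end Branch

end

section

/-! ### Joining, extending and cutting branches -/

variable {E : Type*} {G : MetricGraph E} {ω ℓ : ℝ}

/-- The germs of the family `d`, together with `d₀`, form the star of a point. -/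
structure IsStarWith {ι : Type*} (G : MetricGraph E) (s : Finset ι) (d : ι → Germ E)
    (d₀ : Germ E) : Prop where
  injOn : Set.InjOn d s
  notMem : d₀ ∉ d '' s
  star : G.IsStar (insert d₀ (d '' s))

section Star

variable {ι : Type*} {s : Finset ι} {d : ι → Germ E} {d₀ : Germ E}

theorem IsStarWith.injOn_insertNone (h : IsStarWith G s d d₀) :
    Set.InjOn (fun o : Option ι => o.elim d₀ d) (Finset.insertNone s) := by
  intro a ha b hb hab
  have ha := Finset.mem_coe.1 ha
  have hb := Finset.mem_coe.1 hb
  cases a with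
  | none =>
    cases b with
    | none => rfl
    | some j =>
      exact absurd ⟨j, by simpa using hb, Eq.symm hab⟩ h.notMem
  | some i =>
    cases b with
    | none => exact absurd ⟨i, by simpa using ha, hab⟩ h.notMem
    | some j => exact congrArg some (h.injOn (by simpa using ha) (by simpa using hb) hab)

theorem IsStarWith.star_insertNone (h : IsStarWith G s d d₀) :
    G.IsStar ((fun o : Option ι => o.elim d₀ d) '' (Finset.insertNone s)) := by
  convert! h.star using 1
  ext x
  simp only [Set.mem_image, Finset.mem_coe, Set.mem_insert_iff]
  constructor
  · rintro ⟨o, ho, rfl⟩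
    cases o with
    | none => exact Or.inl rfl
    | some i => exact Or.inr ⟨i, by simpa using ho, rfl⟩
  · rintro (rfl | ⟨i, hi, rfl⟩)
    · exact ⟨none, by simp, rfl⟩
    · exact ⟨some i, by simpa using hi, rfl⟩

end Star

/-- Kirchhoff's condition with a single germ along which the function does not vanish. -/
theorem IsStarWith.amplitude_eq_zero (hlf : G.LocallyFinite) (hfin : G.FiniteLength) (hω : 0 < ω)
    {ι : Type*} {s : Finset ι} {d : ι → Germ E} {d₀ : Germ E} (h : IsStarWith G s d d₀)
    {u : G.Space → ℝ} (hu : G.IsWeakEigen ω u) {i₀ : ι} (hi₀ : i₀ ∈ s) {ε A : ℝ} (hε : 0 < ε)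
    (h0 : ∀ t ∈ Set.Icc 0 ε, u (G.germPt d₀ t) = 0)
    (h1 : ∀ i ∈ s, i ≠ i₀ → ∀ t ∈ Set.Icc 0 ε, u (G.germPt (d i) t) = 0)
    (h2 : ∀ t ∈ Set.Icc 0 ε, u (G.germPt (d i₀) t) = A * Real.sin (ω * t)) : A = 0 := by
  classical
  have key := hu.kirchhoff hlf hfin hω (Finset.insertNone s) (fun o => o.elim d₀ d) h.injOn_insertNone
    h.star_insertNone (fun o => o.elim 0 fun i => if i = i₀ then A else 0) hε ?_
  · rw [Finset.sum_insertNone] at key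
    simpa [hi₀] using key
  · intro o ho t ht
    cases o with
    | none => simpa using h0 t ht
    | some i =>
      by_cases hi : i = i₀
      · subst hi
        simpa using h2 t ht
      · simpa [hi] using h1 i (by simpa using ho) hi t ht

section Step

variable {ι : Type*} {s : Finset ι} {d : ι → Germ E} {Q : ι → (G.Space → ℝ) → ℝ} {m r : ι → ℝ}
  {P : ι → Set (Piece E)} {S : ι → Finset G.Space} {d₀ : Germ E} {b : ℝ}

theorem countable_insert_iUnion (h : ∀ i ∈ s, IsBranchWith G ω ℓ (d i) (Q i) (m i) (r i) (P i) (S i)) :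
    (insert (d₀.piece b) (⋃ i ∈ s, P i)).Countable :=
  (Set.Countable.biUnion s.countable_toSet fun i hi => (h i hi).countable).insert _

theorem covers_rev (hd₀ : d₀.Fits G b) (hb : 0 < b) (T : Set (Piece E)) :
    ∀ t ∈ Set.Icc 0 b, Covers (insert (d₀.piece b) T) (d₀.rev b).edge
      ((d₀.rev b).pos + (d₀.rev b).dir * t) := by
  intro t ht
  refine ⟨_, Set.mem_insert _ _, rfl, (mem_piece_iff hd₀.dir hb.le).2 ⟨b - t,
    ⟨by linarith [ht.2], by linarith [ht.1]⟩, ?_⟩⟩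
  simp only [Germ.rev]
  ring

theorem vanishesOn_piece (hd₀ : d₀.Fits G b) (hb : 0 < b) {u : G.Space → ℝ}
    (h : ∀ t ∈ Set.Icc 0 b, u (G.germPt (d₀.rev b) t) = 0) {p : Piece E} (hp : p = d₀.piece b) :
    ∀ t ∈ Set.Icc p.lo p.hi, u (G.pt p.edge t) = 0 := by
  subst hp
  intro t ht
  obtain ⟨τ, hτ, rfl⟩ := (mem_piece_iff hd₀.dir hb.le).1 ht
  have := h (b - τ) ⟨by linarith [hτ.2], by linarith [hτ.1]⟩
  rw [germPt_rev, sub_sub_cancel] at this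
  exact this

/-- Branches of total residual mass less than `ℓ` that are attached at a common point are joined and
extended by an interval. -/
theorem IsBranchWith.extend [DecidableEq G.Space] (hω : 0 < ω) (hωℓ : ω * ℓ = Real.pi / 2)
    (h : ∀ i ∈ s, IsBranchWith G ω ℓ (d i) (Q i) (m i) (r i) (P i) (S i))
    (hbase : ∀ i ∈ s, G.germPt (d i) 0 = G.germPt d₀ 0) (hd₀ : d₀.Fits G b) (hb : 0 < b)
    (hR : ∑ i ∈ s, r i < ℓ) (hRb : ∑ i ∈ s, r i + b ≤ ℓ) :
    IsBranchWith G ω ℓ (d₀.rev b) (fun u => G.pieceForm ω d₀ b u + ∑ i ∈ s, Q i u)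
      (b + ∑ i ∈ s, m i) (∑ i ∈ s, r i + b) (insert (d₀.piece b) (⋃ i ∈ s, P i))
      (s.biUnion S) := by
  set R := ∑ i ∈ s, r i with hRdef
  have hrpos : ∀ i ∈ s, 0 < r i := fun i hi => (h i hi).r_pos
  have hR0 : 0 ≤ R := Finset.sum_nonneg fun i hi => (hrpos i hi).le
  have hri : ∀ i ∈ s, r i < ℓ := fun i hi =>
    (Finset.single_le_sum (fun j hj => (hrpos j hj).le) hi).trans_lt hR
  have hfar : G.germPt (d₀.rev b) b = G.germPt d₀ 0 := by rw [germPt_rev, sub_self]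
  have hadm : ∀ u, Admissible G ℓ (d₀.rev b) (R + b) (s.biUnion S) u → ∀ i ∈ s,
      Admissible G ℓ (d i) (r i) (S i) u := fun u hu i hi =>
    ⟨fun p hp => hu.vanish p (Finset.mem_biUnion.2 ⟨i, hi, hp⟩), fun he => absurd he (hri i hi).ne⟩
  have htan := sum_tan_le s (fun i => ω * r i) (fun i hi => mul_pos hω (hrpos i hi))
    (by rw [← Finset.mul_sum, ← hωℓ]; exact mul_lt_mul_of_pos_left hR hω)
  simp only [← Finset.mul_sum] at htan
  have hpiece : ∀ u, G.MemH1 u → Admissible G ℓ (d₀.rev b) (R + b) (s.biUnion S) u → _ :=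
    fun u hu ha => pieceForm_ge hω hωℓ hu hd₀.rev hb hR0 hRb ha.base
  simp only [pieceForm_rev, hfar] at hpiece
  have hchild : ∀ u, G.MemH1 u → Admissible G ℓ (d₀.rev b) (R + b) (s.biUnion S) u → ∀ i ∈ s,
      -(ω * Real.tan (ω * r i) * u (G.germPt d₀ 0) ^ 2) ≤ Q i u := by
    intro u hu ha i hi
    have := (h i hi).bound u hu (hadm u ha i hi)
    rwa [branchBound, hbase i hi] at this
  have hsumQ : ∀ u, G.MemH1 u → Admissible G ℓ (d₀.rev b) (R + b) (s.biUnion S) u →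
      -(ω * (∑ i ∈ s, Real.tan (ω * r i)) * u (G.germPt d₀ 0) ^ 2) ≤ ∑ i ∈ s, Q i u := by
    intro u hu ha
    have := Finset.sum_le_sum (hchild u hu ha)
    rwa [Finset.sum_neg_distrib, ← Finset.sum_mul, ← Finset.mul_sum] at this
  have htan2 : ∀ u : G.Space → ℝ, ω * (∑ i ∈ s, Real.tan (ω * r i)) * u (G.germPt d₀ 0) ^ 2 ≤
      ω * Real.tan (ω * R) * u (G.germPt d₀ 0) ^ 2 := fun u =>
    mul_le_mul_of_nonneg_right (mul_le_mul_of_nonneg_left htan.1 hω.le) (sq_nonneg _)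
  -- the consequences of equality: it holds along the interval, in the superadditivity of the tangent
  -- and in each of the joined branches
  have htight : ∀ u, IsTight G ω ℓ (d₀.rev b) (fun u => G.pieceForm ω d₀ b u + ∑ i ∈ s, Q i u) (R + b)
      (s.biUnion S) u → (∃ A, ∀ t ∈ Set.Icc 0 b, u (G.germPt (d₀.rev b) t) =
        A * Real.cos (ω * (R + b - t))) ∧ (1 < s.card → u (G.germPt d₀ 0) = 0) ∧
        ∀ i ∈ s, IsTight G ω ℓ (d i) (Q i) (r i) (S i) u := by
    intro u hu
    have hu1 := hu.eigen.memH1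
    obtain ⟨p1, p2⟩ := hpiece u hu1 hu.adm
    have q1 := hsumQ u hu1 hu.adm
    have q2 := htan2 u
    have heq := hu.eq
    simp only [branchBound] at heq
    refine ⟨p2 (by linarith), fun hc => ?_, fun i hi => ⟨hu.eigen, hadm u hu.adm i hi, ?_⟩⟩
    · by_contra hne
      have h1 := mul_lt_mul_of_pos_right (mul_lt_mul_of_pos_left (htan.2 hc) hω)
        (pow_pos (abs_pos.2 hne) 2)
      rw [sq_abs] at h1
      linarith
    · have h1 : ∑ i ∈ s, -(ω * Real.tan (ω * r i) * u (G.germPt d₀ 0) ^ 2) = ∑ i ∈ s, Q i u := by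
        rw [Finset.sum_neg_distrib, ← Finset.sum_mul, ← Finset.mul_sum]
        linarith
      have h2 := (Finset.sum_eq_sum_iff_of_le (hchild u hu1 hu.adm)).1 h1 i hi
      rw [branchBound, hbase i hi, h2]
  refine ⟨by linarith, hRb, countable_insert_iUnion h, ⟨b, hb, covers_rev hd₀ hb _⟩, ?_, ?_, ?_⟩
  · have h1 : ((s.biUnion S).card : ℝ) ≤ ∑ i ∈ s, ((S i).card : ℝ) := by
      exact_mod_cast Finset.card_biUnion_le
    have hℓ : 0 < ℓ := by linarith
    have h2 := Finset.sum_le_sum fun i hi => (h i hi).mass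
    rw [Finset.sum_add_distrib, ← Finset.sum_mul] at h2
    nlinarith
  · intro u hu ha
    have p1 := (hpiece u hu ha).1
    have q1 := hsumQ u hu ha
    have q2 := htan2 u
    simp only [branchBound]
    linarith
  · rcases Nat.lt_or_ge 1 s.card with hc | hc
    · -- two or more branches: strict superadditivity forces a zero at the branching point
      left
      intro u hu
      obtain ⟨⟨A, hA⟩, h2, h3⟩ := htight u hu
      have h0 := h2 hc
      have hA0 : A = 0 := by
        have := hA b ⟨hb.le, le_rfl⟩
        rw [hfar, h0, add_sub_cancel_right] at this
        exact (mul_eq_zero.1 this.symm).resolve_right (cos_pos_of_lt hω hωℓ hR0 hR).ne'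
      intro p hp
      rcases hp with hp | hp
      · refine vanishesOn_piece hd₀ hb (fun t ht => ?_) hp
        rw [hA t ht, hA0, zero_mul]
      · simp only [Set.mem_iUnion] at hp
        obtain ⟨i, hi, hp⟩ := hp
        exact (h i hi).vanishesOn hω hωℓ (h3 i hi) (hri i hi) (by rw [hbase i hi, h0]) p hp
    · rcases s.eq_empty_or_nonempty with rfl | hne
      · right
        have hR' : R = 0 := by simp [hRdef]
        refine ⟨by simp, Set.Icc 0 b, G.germPt (d₀.rev b), ?_, fun u hu => ?_⟩
        · have := isArm_piece hd₀.rev hb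
          rw [hR', zero_add]
          have e : (d₀.rev b).piece b = d₀.piece b := by
            simp only [Germ.piece, Germ.rev, Piece.mk.injEq, true_and]
            rw [show d₀.pos + d₀.dir * b + -d₀.dir * b = d₀.pos by ring]
            exact ⟨min_comm _ _, max_comm _ _⟩
          simpa [e] using this
        · exact (htight u hu).1
      · obtain ⟨i, rfl⟩ := Finset.card_eq_one.1 (le_antisymm hc (Finset.card_pos.2 hne))
        have hi : i ∈ ({i} : Finset ι) := Finset.mem_singleton_self i
        have hRi : R = r i := by simp [hRdef]
        have hcosR := cos_pos_of_lt hω hωℓ hR0 hR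
        rcases (h i hi).dead_or_alive with hdead | ⟨hSi, J, γ, hγ, hA'⟩
        · left
          intro u hu
          obtain ⟨⟨A, hA⟩, _, h3⟩ := htight u hu
          have hv := hdead u (h3 i hi)
          obtain ⟨ε, hε, hg⟩ := (h i hi).germ
          have h0 := hv.germ (hg 0 ⟨le_rfl, hε.le⟩)
          rw [hbase i hi] at h0
          have hA0 : A = 0 := by
            have := hA b ⟨hb.le, le_rfl⟩
            rw [hfar, h0, add_sub_cancel_right] at this
            exact (mul_eq_zero.1 this.symm).resolve_right hcosR.ne'
          intro p hp
          rcases hp with hp | hp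
          · refine vanishesOn_piece hd₀ hb (fun t ht => ?_) hp
            rw [hA t ht, hA0, zero_mul]
          · exact hv p (by simpa using hp)
        · right
          have hfar' : G.germPt (d₀.rev b) b = G.germPt (d i) 0 := by rw [hfar, hbase i hi]
          refine ⟨by simpa using hSi, {x | x ∈ Set.Icc 0 b ∨ (b ≤ x ∧ x - b ∈ J)},
            fun x => if x ≤ b then G.germPt (d₀.rev b) x else γ (x - b), ?_, fun u hu => ?_⟩
          · have := hγ.extend hd₀.rev hb hfar'
            have e : (d₀.rev b).piece b = d₀.piece b := by
              simp only [Germ.piece, Germ.rev, Piece.mk.injEq, true_and]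
              rw [show d₀.pos + d₀.dir * b + -d₀.dir * b = d₀.pos by ring]
              exact ⟨min_comm _ _, max_comm _ _⟩
            rw [hRi]
            simpa [e] using this
          · obtain ⟨⟨A, hA⟩, _, h3⟩ := htight u hu
            obtain ⟨A', hA'⟩ := hA' u (h3 i hi)
            obtain ⟨ε, hε, hg⟩ := hγ.germ
            obtain ⟨h0J, h0γ⟩ := hg 0 ⟨le_rfl, hε.le⟩
            have hAA : A = A' := by
              have e1 := hA b ⟨hb.le, le_rfl⟩
              have e2 := hA' 0 h0J
              rw [h0γ, ← hfar', e1, add_sub_cancel_right, sub_zero, ← hRi] at e2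
              exact mul_right_cancel₀ hcosR.ne' e2
            refine ⟨A, fun x hx => ?_⟩
            by_cases hxb : x ≤ b
            · simp only [if_pos hxb]
              have hx0 : 0 ≤ x := by
                rcases hx with hx | hx
                · exact hx.1
                · linarith [hx.1]
              exact hA x ⟨hx0, hxb⟩
            · simp only [if_neg hxb]
              have hxJ : x - b ∈ J := by
                rcases hx with hx | hx
                · exact absurd hx.2 hxb
                · exact hx.2
              rw [hA' _ hxJ, hAA, hRi]
              congr 2
              ring

/-- Branches of total residual mass at least `ℓ` that are attached at a common point are cut off
there, and the cut point is extended by an interval. For a weak eigenfunction that attains the bound,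
a zero on all but one of the full paths that hang at the cut point suffices to make the function
vanish, by Kirchhoff's condition. -/
theorem IsBranchWith.cut_extend (hlf : G.LocallyFinite) (hfin : G.FiniteLength)
    (hω : 0 < ω) (hωℓ : ω * ℓ = Real.pi / 2)
    (h : ∀ i ∈ s, IsBranchWith G ω ℓ (d i) (Q i) (m i) (r i) (P i) (S i))
    (hbase : ∀ i ∈ s, G.germPt (d i) 0 = G.germPt d₀ 0) (hstar : IsStarWith G s d d₀)
    (hd₀ : d₀.Fits G b) (hb : 0 < b) (hR : ℓ ≤ ∑ i ∈ s, r i) (hbℓ : b ≤ ℓ) :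
    IsBranch G ω ℓ (d₀.rev b) (fun u => G.pieceForm ω d₀ b u + ∑ i ∈ s, Q i u)
      (b + ∑ i ∈ s, m i) b (insert (d₀.piece b) (⋃ i ∈ s, P i)) := by
  classical
  have hℓ : 0 < ℓ := hb.trans_le hbℓ
  have hrpos : ∀ i ∈ s, 0 < r i := fun i hi => (h i hi).r_pos
  have hfar : G.germPt (d₀.rev b) b = G.germPt d₀ 0 := by rw [germPt_rev, sub_self]
  -- the full paths; all of them except one are to be killed by additional zeros at the points `K`
  set F := s.filter fun i => r i = ℓ with hF
  have hamp : ∀ i ∈ F, ∃ ε > 0, ∀ u, IsTight G ω ℓ (d i) (Q i) (r i) (S i) u →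
      ∃ A, (∀ t ∈ Set.Icc 0 ε, u (G.germPt (d i) t) = A * Real.sin (ω * t)) ∧
        (u (G.germPt (d i) ε) = 0 → VanishesOn G (P i) u) ∧ (A = 0 → VanishesOn G (P i) u) :=
    fun i hi => (h i (Finset.mem_filter.1 hi).1).exists_amplitude hω hωℓ (Finset.mem_filter.1 hi).2
  choose! ε hε hεu using hamp
  obtain ⟨K, hKF, hKcard, hKone⟩ : ∃ K ⊆ F, (K.card + 1) * ℓ ≤ ∑ i ∈ s, r i ∧
      ∀ i ∈ F, ∀ j ∈ F, i ∉ K → j ∉ K → i = j := by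
    rcases F.eq_empty_or_nonempty with hFe | ⟨i₀, hi₀⟩
    · exact ⟨∅, Finset.empty_subset _, by simpa using hR, by simp [hFe]⟩
    · refine ⟨F.erase i₀, Finset.erase_subset _ _, ?_, ?_⟩
      · rw [Finset.card_erase_of_mem hi₀]
        have h1 : 1 ≤ F.card := Finset.card_pos.2 ⟨i₀, hi₀⟩
        have h2 : ((F.card - 1 : ℕ) : ℝ) + 1 = F.card := by
          push_cast [Nat.cast_sub h1]
          ring
        rw [h2]
        calc (F.card : ℝ) * ℓ = ∑ i ∈ F, r i := by
              rw [Finset.sum_congr rfl fun i hi => (Finset.mem_filter.1 hi).2]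
              rw [Finset.sum_const, nsmul_eq_mul]
          _ ≤ _ := Finset.sum_le_sum_of_subset_of_nonneg (Finset.filter_subset _ _)
              fun i hi _ => (hrpos i hi).le
      · intro i hi j hj hiK hjK
        have e1 : i = i₀ := by
          by_contra hne
          exact hiK (Finset.mem_erase.2 ⟨hne, hi⟩)
        have e2 : j = i₀ := by
          by_contra hne
          exact hjK (Finset.mem_erase.2 ⟨hne, hj⟩)
        rw [e1, e2]
  -- the new cut set: the old cut points, the cut point, and one zero on each path in `K`; the
  -- residual mass `(K.card + 1) * ℓ` pays for these `K.card + 1` additional points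
  set T : Finset G.Space := s.biUnion S ∪ insert (G.germPt d₀ 0) (K.image fun i => G.germPt (d i) (ε i))
    with hT
  have hP0 : ∀ u, Admissible G ℓ (d₀.rev b) b T u → u (G.germPt d₀ 0) = 0 := fun u hu =>
    hu.vanish _ (by simp [hT])
  have hadm : ∀ u, Admissible G ℓ (d₀.rev b) b T u → ∀ i ∈ s,
      Admissible G ℓ (d i) (r i) (S i) u := fun u hu i hi =>
    ⟨fun p hp => hu.vanish p (Finset.mem_union_left _ (Finset.mem_biUnion.2 ⟨i, hi, hp⟩)),
      fun _ => by rw [hbase i hi, hP0 u hu]⟩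
  have hchild : ∀ u, G.MemH1 u → Admissible G ℓ (d₀.rev b) b T u → ∀ i ∈ s, 0 ≤ Q i u := by
    intro u hu ha i hi
    have := (h i hi).bound u hu (hadm u ha i hi)
    rw [branchBound, hbase i hi, hP0 u ha] at this
    simpa using this
  have hpiece : ∀ u, G.MemH1 u → Admissible G ℓ (d₀.rev b) b T u → _ :=
    fun u hu ha => pieceForm_ge (R := 0) hω hωℓ hu hd₀.rev hb le_rfl (by rwa [zero_add])
      (by rw [zero_add]; exact ha.base)
  simp only [pieceForm_rev, hfar, mul_zero, Real.tan_zero, zero_mul, zero_add, zero_sub] at hpiece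
  refine ⟨T, hb, hbℓ, countable_insert_iUnion h, ⟨b, hb, covers_rev hd₀ hb _⟩, ?_, ?_, Or.inl ?_⟩
  · have h1 : (T.card : ℝ) ≤ ∑ i ∈ s, ((S i).card : ℝ) + (K.card + 1) := by
      have a1 : T.card ≤ _ := Finset.card_union_le (s.biUnion S)
        (insert (G.germPt d₀ 0) (K.image fun i => G.germPt (d i) (ε i)))
      have a2 : (s.biUnion S).card ≤ ∑ i ∈ s, (S i).card := Finset.card_biUnion_le
      have a3 := Finset.card_insert_le (G.germPt d₀ 0) (K.image fun i => G.germPt (d i) (ε i))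
      have a4 : (K.image fun i => G.germPt (d i) (ε i)).card ≤ K.card := Finset.card_image_le
      have : T.card ≤ ∑ i ∈ s, (S i).card + (K.card + 1) := by omega
      exact_mod_cast this
    have h2 := Finset.sum_le_sum fun i hi => (h i hi).mass
    rw [Finset.sum_add_distrib, ← Finset.sum_mul] at h2
    nlinarith
  · intro u hu ha
    have h1 := (hpiece u hu ha).1
    have h2 := Finset.sum_nonneg (hchild u hu ha)
    simp only [branchBound]
    linarith
  · intro u hu
    have hu1 := hu.eigen.memH1
    obtain ⟨p1, p2⟩ := hpiece u hu1 hu.adm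
    have h2 := hchild u hu1 hu.adm
    have h3 := Finset.sum_nonneg h2
    have heq := hu.eq
    simp only [branchBound] at heq
    obtain ⟨A, hA⟩ := p2 (by linarith)
    have hP := hP0 u hu.adm
    have hA0 : A = 0 := by
      have := hA b ⟨hb.le, le_rfl⟩
      rw [hfar, hP] at this
      simpa using this.symm
    have hup : ∀ t ∈ Set.Icc 0 b, u (G.germPt (d₀.rev b) t) = 0 := fun t ht => by
      rw [hA t ht, hA0, zero_mul]
    have hQ0 : ∀ i ∈ s, Q i u = 0 := (Finset.sum_eq_zero_iff_of_nonneg h2).1 (by linarith)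
    have htight : ∀ i ∈ s, IsTight G ω ℓ (d i) (Q i) (r i) (S i) u := fun i hi =>
      ⟨hu.eigen, hadm u hu.adm i hi, by rw [branchBound, hbase i hi, hP, hQ0 i hi]; simp⟩
    have hdead : ∀ i ∈ s, ¬(i ∈ F ∧ i ∉ K) → VanishesOn G (P i) u := by
      intro i hi hiFK
      by_cases hiF : i ∈ F
      · have hiK : i ∈ K := by
          by_contra hiK
          exact hiFK ⟨hiF, hiK⟩
        obtain ⟨A, _, h5, _⟩ := hεu i hiF u (htight i hi)
        exact h5 (hu.adm.vanish _ (Finset.mem_union_right _ (Finset.mem_insert_of_mem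
          (Finset.mem_image_of_mem _ hiK))))
      · have : r i < ℓ := lt_of_le_of_ne (h i hi).r_le fun he => hiF (Finset.mem_filter.2 ⟨hi, he⟩)
        exact (h i hi).vanishesOn hω hωℓ (htight i hi) this (by rw [hbase i hi, hP])
    have hall : ∀ i ∈ s, VanishesOn G (P i) u := by
      intro i hi
      by_cases hiFK : i ∈ F ∧ i ∉ K
      · -- the remaining full path: all other germs at the cut point carry the zero function
        obtain ⟨A, h4, _, h6⟩ := hεu i hiFK.1 u (htight i hi)
        refine h6 ?_
        have hgerm : ∀ j ∈ s, ∃ η > 0, ∀ t ∈ Set.Icc 0 η, Covers (P j) (d j).edge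
            ((d j).pos + (d j).dir * t) := fun j hj => (h j hj).germ
        choose! η hη hηc using hgerm
        obtain ⟨j₀, hj₀, hmin⟩ := Finset.exists_min_image s η ⟨i, hi⟩
        refine hstar.amplitude_eq_zero hlf hfin hω hu.eigen hi
          (ε := min (min (η j₀) (ε i)) b) (lt_min (lt_min (hη j₀ hj₀) (hε i hiFK.1)) hb) ?_ ?_ ?_
        · intro t ht
          have ht' : t ≤ b := ht.2.trans (min_le_right _ _)
          have := hup (b - t) ⟨by linarith, by linarith [ht.1]⟩
          rwa [germPt_rev, sub_sub_cancel] at this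
        · intro j hj hji t ht
          have hv := hdead j hj fun hjFK => hji (hKone j hjFK.1 i hiFK.1 hjFK.2 hiFK.2)
          exact hv.germ (hηc j hj t ⟨ht.1, ht.2.trans (((min_le_left _ _).trans
            (min_le_left _ _)).trans (hmin j hj))⟩)
        · intro t ht
          exact h4 t ⟨ht.1, ht.2.trans ((min_le_left _ _).trans (min_le_right _ _))⟩
      · exact hdead i hi hiFK
    intro p hp
    rcases hp with hp | hp
    · exact vanishesOn_piece hd₀ hb hup hp
    · simp only [Set.mem_iUnion] at hp
      obtain ⟨i, hi, hp⟩ := hp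
      exact hall i hi p hp

end Step

end

section

variable {E : Type*} {G : MetricGraph E} {ω ℓ : ℝ}

theorem Germ.shift_rev (d : Germ E) (a b : ℝ) : (d.shift a).rev b = d.rev (a + b) := by
  simp only [Germ.shift, Germ.rev, Germ.mk.injEq, true_and, and_true]
  ring

theorem Germ.shift_shift (d : Germ E) (a b : ℝ) : (d.shift a).shift b = d.shift (a + b) := by
  simp only [Germ.shift, Germ.mk.injEq, true_and, and_true]
  ring

/-- The two germs at a point in the interior of an edge. -/
theorem isStarWith_shift {d : Germ E} {a b : ℝ} (hd : d.Fits G (a + b)) (ha : 0 < a) (hb : 0 < b) :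
    IsStarWith G {()} (fun _ => d.rev a) (d.shift a) := by
  refine ⟨by simp, ?_, ?_⟩
  · rintro ⟨_, _, h⟩
    have := congrArg Germ.dir h
    simp only [Germ.rev, Germ.shift] at this
    rcases hd.dir with h | h <;> rw [h] at this <;> norm_num at this
  · right
    have h1 := hd.pos_mem
    have h2 := hd.end_mem
    have hmem : d.pos + d.dir * a ∈ Set.Ioo 0 (G.len d.edge) := by
      rcases hd.dir with h | h <;> rw [h] at h2 ⊢ <;> constructor <;> linarith [h1.1, h1.2, h2.1, h2.2]
    refine ⟨d.edge, d.pos + d.dir * a, hmem, ?_⟩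
    rcases hd.dir with h | h
    · simp [Germ.rev, Germ.shift, h]
    · simp only [Germ.rev, Germ.shift, h, Finset.coe_singleton, Set.image_singleton, neg_neg]
      exact Set.pair_comm _ _

theorem IsBranch.congr {d : Germ E} {Q Q' : (G.Space → ℝ) → ℝ} {m m' r : ℝ} {P : Set (Piece E)}
    (h : IsBranch G ω ℓ d Q m r P) (hQ : ∀ u, G.MemH1 u → Q u = Q' u) (hm : m = m') :
    IsBranch G ω ℓ d Q' m' r P := by
  subst hm
  obtain ⟨S, h⟩ := h
  exact ⟨S, h.congr hQ⟩

theorem covers_insert_piece {d : Germ E} {b : ℝ} (hd : d.Fits G b) (hb : 0 < b)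
    (T : Set (Piece E)) : ∀ t ∈ Set.Icc 0 b,
      Covers (insert (d.piece b) T) d.edge (d.pos + d.dir * t) := fun t ht =>
  ⟨_, Set.mem_insert _ _, rfl, (mem_piece_iff hd.dir hb.le).2 ⟨t, ht, rfl⟩⟩

theorem Covers.mono {P P' : Set (Piece E)} (h : P ⊆ P') {e : E} {t : ℝ} (hc : Covers P e t) :
    Covers P' e t := by
  obtain ⟨p, hp, h1⟩ := hc
  exact ⟨p, h hp, h1⟩

/-- A branch of residual mass `ℓ` continued along an interval of arbitrary length. -/
theorem IsBranch.exists_continue (hlf : G.LocallyFinite) (hfin : G.FiniteLength) (hω : 0 < ω)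
    (hωℓ : ω * ℓ = Real.pi / 2) (hℓ : 0 < ℓ) {d : Germ E} (n : ℕ) : ∀ {a b m : ℝ}
    {Q : (G.Space → ℝ) → ℝ} {P : Set (Piece E)}, IsBranch G ω ℓ (d.rev a) Q m ℓ P → 0 < a → 0 < b →
    d.Fits G (a + b) → b ≤ n * ℓ → ∃ r P', IsBranch G ω ℓ (d.rev (a + b))
      (fun u => G.pieceForm ω (d.shift a) b u + Q u) (b + m) r P' ∧ P ⊆ P' ∧
      ∀ t ∈ Set.Icc a (a + b), Covers P' d.edge (d.pos + d.dir * t) := by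
  induction n with
  | zero =>
    intro a b m Q P _ _ hb _ hbn
    simp only [Nat.cast_zero, zero_mul] at hbn
    linarith
  | succ n ih =>
    intro a b m Q P h ha hb hd hbn
    have step : ∀ c, 0 < c → c ≤ ℓ → c ≤ b → IsBranch G ω ℓ (d.rev (a + c))
        (fun u => G.pieceForm ω (d.shift a) c u + Q u) (c + m) c
        (insert ((d.shift a).piece c) P) := by
      intro c hc hcℓ hcb
      obtain ⟨S, h⟩ := h
      have hdc := hd.mono (c := a + c) ⟨by linarith, by linarith⟩
      have := IsBranchWith.cut_extend (s := {()}) (d := fun _ => d.rev a) (Q := fun _ => Q)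
        (m := fun _ => m) (r := fun _ => ℓ) (P := fun _ => P) (S := fun _ => S) hlf hfin hω hωℓ
        (fun _ _ => h) (fun _ _ => by rw [germPt_rev, germPt_shift, sub_zero, add_zero])
        (isStarWith_shift hdc ha hc) (hdc.shift ha.le hc.le) hc (by simp) hcℓ
      simpa [Germ.shift_rev, Set.iUnion_const] using this
    have hcov : ∀ c, 0 < c → c ≤ b → ∀ T, ∀ t ∈ Set.Icc a (a + c),
        Covers (insert ((d.shift a).piece c) T) d.edge (d.pos + d.dir * t) := by
      intro c hc hcb T t ht
      have hdc := (hd.mono (c := a + c) ⟨by linarith, by linarith⟩).shift ha.le hc.le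
      have := covers_insert_piece hdc hc T (t - a) ⟨by linarith [ht.1], by linarith [ht.2]⟩
      have e : (d.shift a).pos + (d.shift a).dir * (t - a) = d.pos + d.dir * t := by
        simp only [Germ.shift]
        ring
      rwa [e] at this
    rcases le_or_gt b ℓ with hbℓ | hbℓ
    · exact ⟨b, _, step b hb hbℓ le_rfl, Set.subset_insert _ _, hcov b hb le_rfl _⟩
    · have hd' : d.Fits G (a + ℓ + (b - ℓ)) := by convert hd using 1; ring
      obtain ⟨r, P', h1, h2, h3⟩ := ih (step ℓ hℓ le_rfl hbℓ.le) (by linarith) (by linarith)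
        hd' (by push_cast at hbn; linarith)
      have e : a + ℓ + (b - ℓ) = a + b := by ring
      rw [e] at h1
      refine ⟨r, P', h1.congr (fun u hu => ?_) (by ring), (Set.subset_insert _ _).trans h2, ?_⟩
      · have hd2 : d.Fits G (a + (ℓ + (b - ℓ))) := by convert hd using 1; ring
        have := pieceForm_add (ω := ω) hu (hd2.shift ha.le (by linarith)) hℓ.le (by linarith)
        rw [Germ.shift_shift, add_sub_cancel] at this
        linarith
      · intro t ht
        rcases le_total t (a + ℓ) with h | h
        · exact (hcov ℓ hℓ hbℓ.le P t ⟨ht.1, h⟩).mono h2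
        · exact h3 t ⟨h, by rw [e]; exact ht.2⟩

section Segment

variable {ι : Type*} {s : Finset ι} {d : ι → Germ E} {Q : ι → (G.Space → ℝ) → ℝ} {m r : ι → ℝ}
  {P : ι → Set (Piece E)} {d₀ : Germ E} {b : ℝ}

/-- Branches that are attached at a common point are continued along an interval that starts there. -/
theorem exists_branch_rev (hlf : G.LocallyFinite) (hfin : G.FiniteLength) (hω : 0 < ω)
    (hωℓ : ω * ℓ = Real.pi / 2) (hℓ : 0 < ℓ)
    (h : ∀ i ∈ s, IsBranch G ω ℓ (d i) (Q i) (m i) (r i) (P i))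
    (hbase : ∀ i ∈ s, G.germPt (d i) 0 = G.germPt d₀ 0) (hstar : s.Nonempty → IsStarWith G s d d₀)
    (hd₀ : d₀.Fits G b) (hb : 0 < b) : ∃ r P', IsBranch G ω ℓ (d₀.rev b)
      (fun u => G.pieceForm ω d₀ b u + ∑ i ∈ s, Q i u) (b + ∑ i ∈ s, m i) r P' ∧
      (∀ i ∈ s, P i ⊆ P') ∧ ∀ t ∈ Set.Icc 0 b, Covers P' d₀.edge (d₀.pos + d₀.dir * t) := by
  classical
  choose! S h using h
  have hsub : ∀ c, ∀ i ∈ s, P i ⊆ insert (d₀.piece c) (⋃ i ∈ s, P i) := fun c i hi =>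
    (Set.subset_biUnion_of_mem (u := fun i => P i) hi).trans (Set.subset_insert _ _)
  have hcov : ∀ c, 0 < c → c ≤ b → ∀ t ∈ Set.Icc 0 c,
      Covers (insert (d₀.piece c) (⋃ i ∈ s, P i)) d₀.edge (d₀.pos + d₀.dir * t) :=
    fun c hc hcb => covers_insert_piece (hd₀.mono ⟨hc.le, hcb⟩) hc _
  -- after an interval of length `c` at the end of which the residual mass is `ℓ`
  have hcont : ∀ c, 0 < c → c < b → IsBranch G ω ℓ (d₀.rev c)
      (fun u => G.pieceForm ω d₀ c u + ∑ i ∈ s, Q i u) (c + ∑ i ∈ s, m i) ℓ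
      (insert (d₀.piece c) (⋃ i ∈ s, P i)) → ∃ r P', IsBranch G ω ℓ (d₀.rev b)
      (fun u => G.pieceForm ω d₀ b u + ∑ i ∈ s, Q i u) (b + ∑ i ∈ s, m i) r P' ∧
      (∀ i ∈ s, P i ⊆ P') ∧ ∀ t ∈ Set.Icc 0 b, Covers P' d₀.edge (d₀.pos + d₀.dir * t) := by
    intro c hc hcb hB
    have hd' : d₀.Fits G (c + (b - c)) := by rwa [add_sub_cancel]
    obtain ⟨n, hn⟩ := exists_nat_ge ((b - c) / ℓ)
    obtain ⟨r, P', h1, h2, h3⟩ := hB.exists_continue hlf hfin hω hωℓ hℓ n hc (sub_pos.2 hcb) hd'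
      ((div_le_iff₀ hℓ).1 hn)
    rw [add_sub_cancel] at h1 h3
    refine ⟨r, P', h1.congr (fun u hu => ?_) (by ring), fun i hi => (hsub c i hi).trans h2, ?_⟩
    · have := pieceForm_add (ω := ω) hu hd' hc.le (by linarith)
      rw [add_sub_cancel] at this
      linarith
    · intro t ht
      rcases le_total t c with h | h
      · exact (hcov c hc hcb.le t ⟨ht.1, h⟩).mono h2
      · exact h3 t ⟨h, ht.2⟩
  have hR0 : 0 ≤ ∑ i ∈ s, r i := Finset.sum_nonneg fun i hi => (h i hi).r_pos.le
  rcases lt_or_ge (∑ i ∈ s, r i) ℓ with hR | hR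
  · have step : ∀ c, 0 < c → c ≤ b → ∑ i ∈ s, r i + c ≤ ℓ → IsBranch G ω ℓ (d₀.rev c)
      (fun u => G.pieceForm ω d₀ c u + ∑ i ∈ s, Q i u) (c + ∑ i ∈ s, m i) (∑ i ∈ s, r i + c)
      (insert (d₀.piece c) (⋃ i ∈ s, P i)) := fun c hc hcb hRc =>
        ⟨_, IsBranchWith.extend hω hωℓ h hbase (hd₀.mono ⟨hc.le, hcb⟩) hc hR hRc⟩
    rcases le_or_gt (∑ i ∈ s, r i + b) ℓ with hRb | hRb
    · exact ⟨_, _, step b hb le_rfl hRb, hsub b, hcov b hb le_rfl⟩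
    · have := step (ℓ - ∑ i ∈ s, r i) (by linarith) (by linarith) (by linarith)
      rw [add_sub_cancel] at this
      exact hcont _ (by linarith) (by linarith) this
  · have hne : s.Nonempty := by
      rw [Finset.nonempty_iff_ne_empty]
      rintro rfl
      simp only [Finset.sum_empty] at hR
      linarith
    have step : ∀ c, 0 < c → c ≤ b → c ≤ ℓ → IsBranch G ω ℓ (d₀.rev c)
      (fun u => G.pieceForm ω d₀ c u + ∑ i ∈ s, Q i u) (c + ∑ i ∈ s, m i) c
      (insert (d₀.piece c) (⋃ i ∈ s, P i)) := fun c hc hcb hcℓ =>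
        IsBranchWith.cut_extend hlf hfin hω hωℓ h hbase (hstar hne) (hd₀.mono ⟨hc.le, hcb⟩) hc hR hcℓ
    rcases le_or_gt b ℓ with hbℓ | hbℓ
    · exact ⟨_, _, step b hb le_rfl hbℓ, hsub b, hcov b hb le_rfl⟩
    · exact hcont _ hℓ hbℓ (step ℓ hℓ hbℓ.le le_rfl)

end Segment

end

section

/-! ### Fans and the rigidity of the star -/

variable {E : Type*} {G : MetricGraph E} {ω ℓ : ℝ}

/-- A continuous function that is affine with slope at most one on each of countably many intervals
that cover an edge is `1`-Lipschitz on the edge. -/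
theorem abs_sub_le_of_affine {P : Set (Piece E)} (hP : P.Countable) {e : E} {L : ℝ}
    (hcov : ∀ t ∈ Set.Icc 0 L, Covers P e t) {g : ℝ → ℝ} (hg : ContinuousOn g (Set.Icc 0 L))
    (h : ∀ p ∈ P, p.edge = e →
      ∃ c s : ℝ, |s| ≤ 1 ∧ ∀ t ∈ Set.Icc p.lo p.hi, g t = c + s * t)
    {a b : ℝ} (ha : a ∈ Set.Icc 0 L) (hb : b ∈ Set.Icc 0 L) : |g a - g b| ≤ |a - b| := by
  set B : Set ℝ := (Piece.lo '' P) ∪ (Piece.hi '' P) with hB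
  have hBc : B.Countable := (hP.image _).union (hP.image _)
  have hder : ∀ x ∈ Set.Icc 0 L, x ∉ B → ∃ s : ℝ, |s| ≤ 1 ∧ HasDerivAt g s x := by
    intro x hx hxB
    obtain ⟨p, hp, he, hxp⟩ := hcov x hx
    obtain ⟨c, s, hs, hcs⟩ := h p hp he
    refine ⟨s, hs, ?_⟩
    have h1 : p.lo < x := hxp.1.lt_of_ne fun h => hxB (Or.inl ⟨p, hp, h⟩)
    have h2 : x < p.hi := hxp.2.lt_of_ne fun h => hxB (Or.inr ⟨p, hp, h.symm⟩)
    have h3 : HasDerivAt (fun t => c + s * t) s x := by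
      simpa using ((hasDerivAt_id x).const_mul s).const_add c
    refine h3.congr_of_eventuallyEq ?_
    filter_upwards [Ioo_mem_nhds h1 h2] with t ht
    exact hcs t ⟨ht.1.le, ht.2.le⟩
  have hsub : Set.uIcc b a ⊆ Set.Icc 0 L := Set.uIcc_subset_Icc hb ha
  have hbound : ∀ x ∈ Set.Icc 0 L, x ∉ B → ‖deriv g x‖ ≤ 1 := by
    intro x hx hxB
    obtain ⟨s, hs, hd⟩ := hder x hx hxB
    rwa [hd.deriv, Real.norm_eq_abs]
  have hae : ∀ᵐ x, x ∈ Set.uIoc b a → ‖deriv g x‖ ≤ 1 := by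
    filter_upwards [hBc.ae_notMem volume] with x hxB hx
    exact hbound x (hsub (Set.uIoc_subset_uIcc hx)) hxB
  have hint : IntervalIntegrable (deriv g) volume b a := by
    rw [intervalIntegrable_iff]
    refine Measure.integrableOn_of_bounded (M := 1) (by simp [Set.uIoc])
      (measurable_deriv g).aestronglyMeasurable ?_
    rw [ae_restrict_iff' measurableSet_uIoc]
    exact hae
  have key := integral_eq_of_hasDerivAt_off_countable g (deriv g) hBc (hg.mono hsub)
    (fun x hx => by
      obtain ⟨s, hs, hd⟩ := hder x (hsub ⟨hx.1.1.le, hx.1.2.le⟩) hx.2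
      exact hd.differentiableAt.hasDerivAt) hint
  have := intervalIntegral.norm_integral_le_of_norm_le_const_ae hae
  rwa [key, one_mul, Real.norm_eq_abs] at this

/-- On functions that vanish on `S` the shifted form is nonnegative. -/
def IsCutSet (G : MetricGraph E) (ω : ℝ) (S : Finset G.Space) : Prop :=
  ∀ v, G.MemH1 v → (∀ p ∈ S, v p = 0) → 0 ≤ G.shiftedForm ω v

/-- On each set of at most `k - 1` points that is a cut set, some nonzero weak eigenfunction
vanishes. -/
def HasRigidity (G : MetricGraph E) (ω : ℝ) (k : ℕ) : Prop :=
  ∀ S : Finset G.Space, S.card + 1 ≤ k → IsCutSet G ω S →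
    ∃ u, G.IsWeakEigen ω u ∧ (∀ p ∈ S, u p = 0) ∧ u ≠ 0

/-- There is a cut set of at most `k - 1` points, and the graph is an equilateral star if the bound
given by cut sets is attained. -/
def Dichotomy (G : MetricGraph E) (ω : ℝ) (k : ℕ) : Prop :=
  (∃ S : Finset G.Space, S.card + 1 ≤ k ∧ IsCutSet G ω S) ∧
    (HasRigidity G ω k → G.IsEquilateralStar k)

/-- A decomposition of the graph into branches that are attached at the point `c`. -/
structure IsFan {ι : Type*} (G : MetricGraph E) (ω ℓ : ℝ) (s : Finset ι) (d : ι → Germ E)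
    (Q : ι → (G.Space → ℝ) → ℝ) (m r : ι → ℝ) (P : ι → Set (Piece E)) (S : ι → Finset G.Space)
    (c : G.Space) : Prop where
  injOn : Set.InjOn d s
  star : G.IsStar (d '' s)
  base : ∀ i ∈ s, G.germPt (d i) 0 = c
  branch : ∀ i ∈ s, IsBranchWith G ω ℓ (d i) (Q i) (m i) (r i) (P i) (S i)
  form : ∀ u, G.MemH1 u → G.shiftedForm ω u = ∑ i ∈ s, Q i u
  cover : ∀ e, ∀ t ∈ Set.Icc 0 (G.len e), ∃ i ∈ s, Covers (P i) e t

section Fan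

variable {ι : Type*} {s : Finset ι} {d : ι → Germ E} {Q : ι → (G.Space → ℝ) → ℝ} {m r : ι → ℝ}
  {P : ι → Set (Piece E)} {S : ι → Finset G.Space} {c : G.Space} {u : G.Space → ℝ}

theorem IsFan.nonneg (h : IsFan G ω ℓ s d Q m r P S c) (hu : G.MemH1 u)
    (hS : ∀ i ∈ s, ∀ p ∈ S i, u p = 0) (hc : u c = 0) : ∀ i ∈ s, 0 ≤ Q i u := by
  intro i hi
  have := (h.branch i hi).bound u hu ⟨hS i hi, fun _ => by rw [h.base i hi, hc]⟩
  rw [branchBound, h.base i hi, hc] at this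
  simpa using this

theorem IsFan.isCutSet (h : IsFan G ω ℓ s d Q m r P S c) {T : Finset G.Space} (hc : c ∈ T)
    (hT : ∀ i ∈ s, S i ⊆ T) : IsCutSet G ω T := fun v hv hv0 => by
  rw [h.form v hv]
  exact Finset.sum_nonneg (h.nonneg hv (fun i hi p hp => hv0 p (hT i hi hp)) (hv0 c hc))

theorem IsFan.isTight (h : IsFan G ω ℓ s d Q m r P S c) (hu : G.IsWeakEigen ω u)
    (hS : ∀ i ∈ s, ∀ p ∈ S i, u p = 0) (hc : u c = 0) :
    ∀ i ∈ s, IsTight G ω ℓ (d i) (Q i) (r i) (S i) u := by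
  intro i hi
  refine ⟨hu, ⟨hS i hi, fun _ => by rw [h.base i hi, hc]⟩, ?_⟩
  have h1 := hu.shiftedForm_eq_zero
  rw [h.form u hu.memH1] at h1
  rw [(Finset.sum_eq_zero_iff_of_nonneg (h.nonneg hu.memH1 hS hc)).1 h1 i hi, branchBound,
    h.base i hi, hc]
  simp

theorem IsFan.eq_zero_of_vanishesOn (h : IsFan G ω ℓ s d Q m r P S c)
    (hv : ∀ i ∈ s, VanishesOn G (P i) u) : u = 0 := by
  funext p
  obtain ⟨e, t, ht, rfl⟩ := exists_pt p
  obtain ⟨i, hi, q, hq, rfl, hqt⟩ := h.cover e t ht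
  exact hv i hi q hq t hqt

/-- On each branch, one suitable zero makes functions that attain the bound vanish. -/
theorem IsFan.exists_kill (h : IsFan G ω ℓ s d Q m r P S c) (hω : 0 < ω)
    (hωℓ : ω * ℓ = Real.pi / 2) : ∃ q : ι → G.Space, ∀ i ∈ s, ∀ u,
      IsTight G ω ℓ (d i) (Q i) (r i) (S i) u → u (q i) = 0 → VanishesOn G (P i) u := by
  have : ∀ i, ∃ q : G.Space, i ∈ s → ∀ u,
      IsTight G ω ℓ (d i) (Q i) (r i) (S i) u → u q = 0 → VanishesOn G (P i) u := by
    intro i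
    by_cases hi : i ∈ s
    · rcases (h.branch i hi).r_le.eq_or_lt with hr | hr
      · obtain ⟨ε, _, hε⟩ := (h.branch i hi).exists_amplitude hω hωℓ hr
        refine ⟨G.germPt (d i) ε, fun _ u hu hu0 => ?_⟩
        obtain ⟨A, _, h1, _⟩ := hε u hu
        exact h1 hu0
      · refine ⟨c, fun _ u hu hu0 => ?_⟩
        exact (h.branch i hi).vanishesOn hω hωℓ hu hr (by rw [h.base i hi, hu0])
    · exact ⟨c, fun hi' => absurd hi' hi⟩
  choose q hq using this
  exact ⟨q, fun i hi => hq i hi⟩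

/-- Amplitudes at the common point along all germs of the fan; they add up to zero. -/
theorem IsFan.exists_amplitude (hlf : G.LocallyFinite) (hfin : G.FiniteLength)
    (h : IsFan G ω ℓ s d Q m r P S c) (hω : 0 < ω) (hωℓ : ω * ℓ = Real.pi / 2)
    (hu : G.IsWeakEigen ω u) (hS : ∀ i ∈ s, ∀ p ∈ S i, u p = 0) (hc : u c = 0) :
    ∃ A : ι → ℝ, ∃ ε > 0, (∀ i ∈ s, ∀ t ∈ Set.Icc 0 ε, u (G.germPt (d i) t) = A i * Real.sin (ω * t))
      ∧ (∀ i ∈ s, A i = 0 ↔ VanishesOn G (P i) u) ∧ ∑ i ∈ s, A i = 0 := by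
  have ht := h.isTight hu hS hc
  have : ∀ i ∈ s, ∃ ε > 0, ∃ A, (∀ t ∈ Set.Icc 0 ε, u (G.germPt (d i) t) = A * Real.sin (ω * t)) ∧
      (A = 0 → VanishesOn G (P i) u) := by
    intro i hi
    rcases (h.branch i hi).r_le.eq_or_lt with hr | hr
    · obtain ⟨ε, hε, h1⟩ := (h.branch i hi).exists_amplitude hω hωℓ hr
      obtain ⟨A, h2, _, h3⟩ := h1 u (ht i hi)
      exact ⟨ε, hε, A, h2, h3⟩
    · have hv := (h.branch i hi).vanishesOn hω hωℓ (ht i hi) hr (by rw [h.base i hi, hc])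
      obtain ⟨ε, hε, hg⟩ := (h.branch i hi).germ
      exact ⟨ε, hε, 0, fun t ht => by rw [hv.germ (hg t ht), zero_mul], fun _ => hv⟩
  choose! ε hε A hA hA0 using this
  have hmin : ∃ η > 0, ∀ i ∈ s, η ≤ ε i := by
    rcases s.eq_empty_or_nonempty with rfl | hne
    · exact ⟨1, one_pos, by simp⟩
    · obtain ⟨j, hj, hm⟩ := Finset.exists_min_image s ε hne
      exact ⟨ε j, hε j hj, hm⟩
  obtain ⟨η, hη, hηε⟩ := hmin
  have hA' : ∀ i ∈ s, ∀ t ∈ Set.Icc 0 η, u (G.germPt (d i) t) = A i * Real.sin (ω * t) :=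
    fun i hi t ht => hA i hi t ⟨ht.1, ht.2.trans (hηε i hi)⟩
  refine ⟨A, η, hη, hA', fun i hi => ⟨hA0 i hi, fun hv => ?_⟩,
    hu.kirchhoff hlf hfin hω s d h.injOn h.star A hη hA'⟩
  obtain ⟨ε', hε', hg⟩ := (h.branch i hi).germ
  have hmin : 0 < min (min η ε') ℓ := lt_min (lt_min hη hε')
    ((h.branch i hi).r_pos.trans_le (h.branch i hi).r_le)
  have e1 := hA' i hi _ ⟨hmin.le, (min_le_left _ _).trans (min_le_left _ _)⟩
  rw [hv.germ (hg _ ⟨hmin.le, (min_le_left _ _).trans (min_le_right _ _)⟩)] at e1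
  exact (mul_eq_zero.1 e1.symm).resolve_right (sin_pos_of_le hω hωℓ hmin (min_le_right _ _)).ne'

/-- By Kirchhoff's condition, a weak eigenfunction that vanishes at the cut points, at the common point
and on all branches of a fan except one vanishes everywhere. -/
theorem IsFan.eq_zero (hlf : G.LocallyFinite) (hfin : G.FiniteLength)
    (h : IsFan G ω ℓ s d Q m r P S c) (hω : 0 < ω) (hωℓ : ω * ℓ = Real.pi / 2)
    (hu : G.IsWeakEigen ω u) (hS : ∀ i ∈ s, ∀ p ∈ S i, u p = 0) (hc : u c = 0) {i₀ : ι}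
    (hv : ∀ i ∈ s, i ≠ i₀ → VanishesOn G (P i) u) : u = 0 := by
  obtain ⟨A, ε, hε, h1, h2, h3⟩ := h.exists_amplitude hlf hfin hω hωℓ hu hS hc
  have hz : ∀ i ∈ s, i ≠ i₀ → A i = 0 := fun i hi hne => (h2 i hi).2 (hv i hi hne)
  refine h.eq_zero_of_vanishesOn fun i hi => ?_
  by_cases hne : i = i₀
  · subst hne
    rw [Finset.sum_eq_single_of_mem i hi hz] at h3
    exact (h2 i hi).1 h3
  · exact hv i hi hne

end Fan

end

section

section Fan

variable {E : Type*} {G : MetricGraph E} {ω ℓ : ℝ} {ι : Type*} {s : Finset ι} {d : ι → Germ E}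
  {Q : ι → (G.Space → ℝ) → ℝ} {m r : ι → ℝ} {P : ι → Set (Piece E)} {S : ι → Finset G.Space}
  {c : G.Space} {u : G.Space → ℝ}

/-- The coordinate function on a fan of arms that is the identity on one arm, its negative on a
second one and zero elsewhere is `1`-Lipschitz. It is obtained from a weak eigenfunction that is
`± A sin (ω x)` on two arms and zero elsewhere. -/
theorem IsFan.ofReal_abs_sub_le (h : IsFan G ω ℓ s d Q m r P S c) (hω : 0 < ω)
    (hωℓ : ω * ℓ = Real.pi / 2) {J : ι → Set ℝ} {γ : ι → ℝ → G.Space}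
    (harm : ∀ i ∈ s, IsArm G (d i) ℓ (P i) (J i) (γ i)) (hu : Continuous u) {σ : ι → ℝ}
    (hσ : ∀ i ∈ s, σ i = 0 ∨ σ i = 1 ∨ σ i = -1)
    (hus : ∀ i ∈ s, ∀ x ∈ J i, u (γ i x) = σ i * Real.sin (ω * x)) {i j : ι} (hi : i ∈ s)
    (hj : j ∈ s) {x y : ℝ} (hx : x ∈ J i) (hy : y ∈ J j) :
    ENNReal.ofReal |σ i * x - σ j * y| ≤ edist (γ i x) (γ j y) := by
  set F : G.Space → ℝ := fun p => Real.arcsin (u p) / ω with hF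
  have hFγ : ∀ i ∈ s, ∀ x ∈ J i, F (γ i x) = σ i * x := by
    intro i hi x hx
    have hx' := (harm i hi).mem_Icc hx
    have h1 : 0 ≤ ω * x := mul_nonneg hω.le hx'.1
    have h2 : ω * x ≤ Real.pi / 2 := hωℓ ▸ mul_le_mul_of_nonneg_left hx'.2 hω.le
    have h3 := Real.arcsin_sin (by linarith) h2
    simp only [hF, hus i hi x hx]
    rcases hσ i hi with h0 | h0 | h0 <;> rw [h0]
    · simp
    · rw [one_mul, h3, one_mul, mul_div_cancel_left₀ _ hω.ne']
    · rw [neg_one_mul, Real.arcsin_neg, h3, neg_one_mul, neg_div, mul_div_cancel_left₀ _ hω.ne']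
  have key := ofReal_abs_sub_le_of_edges (F := F) one_pos (fun e a ha b hb => ?_) (γ i x) (γ j y)
  · rwa [hFγ i hi x hx, hFγ j hj y hy, ENNReal.ofReal_one, one_mul] at key
  · rw [one_mul]
    refine abs_sub_le_of_affine (P := ⋃ i ∈ s, P i) (e := e) (g := fun t => F (G.pt e t))
      (Set.Countable.biUnion s.countable_toSet fun i hi => (h.branch i hi).countable)
      (fun t ht => ?_) ?_ (fun p hp he => ?_) ha hb
    · obtain ⟨i, hi, hc⟩ := h.cover e t ht
      exact hc.mono (Set.subset_biUnion_of_mem (u := fun i => P i) hi)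
    · exact ((Real.continuous_arcsin.comp (hu.comp (continuous_pt e))).div_const ω).continuousOn
    · simp only [Set.mem_iUnion] at hp
      obtain ⟨l, hl, hp⟩ := hp
      obtain ⟨a, τ, hτ, hc⟩ := (harm l hl).pieces p hp
      refine ⟨σ l * a, σ l * τ, ?_, fun t ht => ?_⟩
      · rw [abs_mul]
        have h1 : |τ| = 1 := by rcases hτ with h | h <;> rw [h] <;> simp
        rw [h1, mul_one]
        rcases hσ l hl with h0 | h0 | h0 <;> rw [h0] <;> simp
      · obtain ⟨h1, h2⟩ := hc t ht
        rw [← he, ← h2, hFγ l hl _ h1]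
        ring

/-- For two arms of a fan there is a function that distinguishes them, provided that the graph has
the rigidity property: it vanishes at the common point and on all other arms. -/
theorem IsFan.exists_signs (hlf : G.LocallyFinite) (hfin : G.FiniteLength)
    (h : IsFan G ω ℓ s d Q m r P S c) (hω : 0 < ω) (hωℓ : ω * ℓ = Real.pi / 2) {J : ι → Set ℝ}
    {γ : ι → ℝ → G.Space} (harm : ∀ i ∈ s, IsArm G (d i) ℓ (P i) (J i) (γ i))
    (hS : ∀ i ∈ s, S i = ∅)
    (hcos : ∀ i ∈ s, ∀ u, IsTight G ω ℓ (d i) (Q i) (r i) (S i) u →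
      ∃ A, ∀ x ∈ J i, u (γ i x) = A * Real.cos (ω * (ℓ - x)))
    (hrig : HasRigidity G ω s.card) {i j : ι} (hi : i ∈ s) (hj : j ∈ s) (hij : i ≠ j) :
    ∃ u : G.Space → ℝ, ∃ σ : ι → ℝ, Continuous u ∧ (∀ l ∈ s, σ l = 0 ∨ σ l = 1 ∨ σ l = -1) ∧
      (∀ l ∈ s, ∀ x ∈ J l, u (γ l x) = σ l * Real.sin (ω * x)) ∧ σ i = 1 ∧ σ j = -1 := by
  classical
  -- zeros at the common point and on all arms except `i` and `j` are `k - 1` points; on the eigenfunction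
  -- that vanishes there, Kirchhoff's condition leaves only `A i + A j = 0`
  obtain ⟨q, hq⟩ := h.exists_kill hω hωℓ
  set K := (s.erase i).erase j with hK
  have hKcard : K.card + 2 = s.card := by
    have hj' : j ∈ s.erase i := Finset.mem_erase.2 ⟨hij.symm, hj⟩
    have h1 : K.card = _ := Finset.card_erase_of_mem hj'
    have h2 := Finset.card_erase_of_mem hi
    have h3 : 0 < (s.erase i).card := Finset.card_pos.2 ⟨j, hj'⟩
    omega
  obtain ⟨u, hu, hu0, hne⟩ := hrig (insert c (K.image q)) (by
      have h1 := Finset.card_insert_le c (K.image q)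
      have h2 : (K.image q).card ≤ K.card := Finset.card_image_le
      omega)
    (h.isCutSet (Finset.mem_insert_self _ _) fun i hi => by rw [hS i hi]; exact Finset.empty_subset _)
  have hSu : ∀ i ∈ s, ∀ p ∈ S i, u p = 0 := fun i hi p hp => by
    rw [hS i hi] at hp
    exact absurd hp (Finset.notMem_empty _)
  have hc : u c = 0 := hu0 c (Finset.mem_insert_self _ _)
  have ht := h.isTight hu hSu hc
  obtain ⟨A, ε, hε, hA, hA0, hsum⟩ := h.exists_amplitude hlf hfin hω hωℓ hu hSu hc
  have hother : ∀ l ∈ s, l ≠ i → l ≠ j → A l = 0 := fun l hl hli hlj =>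
    (hA0 l hl).2 (hq l hl u (ht l hl) (hu0 _ (Finset.mem_insert_of_mem (Finset.mem_image_of_mem _
      (Finset.mem_erase.2 ⟨hlj, Finset.mem_erase.2 ⟨hli, hl⟩⟩)))))
  have hAij : A i + A j = 0 := by
    rw [← Finset.sum_pair hij, ← hsum]
    refine Finset.sum_subset (fun l hl => ?_) fun l hl hl' => ?_
    · rcases Finset.mem_insert.1 hl with rfl | hl
      · exact hi
      · rwa [Finset.mem_singleton.1 hl]
    · simp only [Finset.mem_insert, Finset.mem_singleton, not_or] at hl'
      exact hother l hl hl'.1 hl'.2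
  have hAi : A i ≠ 0 := by
    intro hAi
    refine hne (h.eq_zero_of_vanishesOn fun l hl => (hA0 l hl).1 ?_)
    by_cases hli : l = i
    · rw [hli, hAi]
    by_cases hlj : l = j
    · rw [hlj]
      linarith
    exact hother l hl hli hlj
  have hsin : ∀ l ∈ s, ∀ x ∈ J l, u (γ l x) = A l * Real.sin (ω * x) := by
    intro l hl x hx
    obtain ⟨B, hB⟩ := hcos l hl u (ht l hl)
    have hcs : ∀ x, Real.cos (ω * (ℓ - x)) = Real.sin (ω * x) := fun x => by
      rw [mul_sub, hωℓ, Real.cos_pi_div_two_sub]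
    obtain ⟨η, hη, hg⟩ := (harm l hl).germ
    have hpos : 0 < min η ε := lt_min hη hε
    obtain ⟨h1, h2⟩ := hg (min η ε) ⟨hpos.le, min_le_left _ _⟩
    have h3 := hA l hl (min η ε) ⟨hpos.le, min_le_right _ _⟩
    rw [← h2, hB _ h1, hcs] at h3
    rw [hB x hx, hcs, mul_right_cancel₀ (sin_pos_of_le hω hωℓ hpos ((harm l hl).mem_Icc h1).2).ne' h3]
  refine ⟨fun p => u p / A i, fun l => A l / A i, hu.memH1.continuous.div_const _, fun l hl => ?_,
    fun l hl x hx => ?_, div_self hAi, ?_⟩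
  · by_cases hli : l = i
    · exact Or.inr (Or.inl (by simp only [hli, div_self hAi]))
    by_cases hlj : l = j
    · exact Or.inr (Or.inr (by simp only [hlj, div_eq_iff hAi]; linarith))
    · exact Or.inl (by simp only [hother l hl hli hlj, zero_div])
  · simp only [hsin l hl x hx]
    ring
  · simp only [div_eq_iff hAi]
    linarith

/-- A fan of total residual mass more than `ℓ` shows that there are few cut points. If the number of
cut points cannot be lowered further, all branches are alive and have residual mass `ℓ`, so that the
fan is a star. -/
theorem IsFan.dichotomy (hlf : G.LocallyFinite) (hfin : G.FiniteLength)
    (h : IsFan G ω ℓ s d Q m r P S c) (hω : 0 < ω) (hωℓ : ω * ℓ = Real.pi / 2) (hℓ : 0 < ℓ)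
    {k : ℕ} (hk : 2 ≤ k) (hR : ℓ < ∑ i ∈ s, r i) (hm : ∑ i ∈ s, m i = k * ℓ)
    (hL : G.totalLength = k * ℓ) : Dichotomy G ω k := by
  classical
  set N := ∑ i ∈ s, (S i).card with hN
  have hmass : N * ℓ + ∑ i ∈ s, r i ≤ k * ℓ := by
    have := Finset.sum_le_sum fun i hi => (h.branch i hi).mass
    rw [Finset.sum_add_distrib, ← Finset.sum_mul, hm] at this
    rw [hN]
    push_cast
    exact this
  -- each cut point has mass `ℓ` to itself, and the residual mass exceeds `ℓ`: so even with the common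
  -- point added there are at most `k - 1` points
  have hNk : N + 2 ≤ k := by
    have : ((N + 1 : ℕ) : ℝ) < k := by
      push_cast
      nlinarith
    have := Nat.cast_lt.1 this
    omega
  have hcard : (s.biUnion S).card ≤ N := Finset.card_biUnion_le
  have hsub : ∀ T : Finset G.Space, ∀ i ∈ s, S i ⊆ s.biUnion S ∪ T := fun T i hi =>
    (Finset.subset_biUnion_of_mem S hi).trans Finset.subset_union_left
  refine ⟨⟨s.biUnion S ∪ {c}, ?_, h.isCutSet (by simp) (hsub _)⟩, fun hrig => ?_⟩
  · have := Finset.card_union_le (s.biUnion S) {c}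
    rw [Finset.card_singleton] at this
    omega
  -- the branches that can carry an eigenfunction which vanishes at the common point
  set F := s.filter fun i => r i = ℓ ∧ ¬IsDead G ω ℓ (d i) (Q i) (r i) (P i) (S i) with hF
  have hsne : s.Nonempty := by
    rw [Finset.nonempty_iff_ne_empty]
    rintro rfl
    simp only [Finset.sum_empty] at hR
    linarith
  -- otherwise there are enough points left to kill all branches in `F` except one, and then Kirchhoff's
  -- condition kills the last one
  have hNF : k ≤ N + F.card := by
    by_contra hlt
    obtain ⟨q, hq⟩ := h.exists_kill hω hωℓ
    obtain ⟨i₀, hi₀⟩ : ∃ i₀, (F.erase i₀).card ≤ F.card - 1 := by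
      rcases F.eq_empty_or_nonempty with hFe | ⟨i₀, hi₀⟩
      · exact ⟨hsne.choose, by simp [hFe]⟩
      · exact ⟨i₀, (Finset.card_erase_of_mem hi₀).le⟩
    obtain ⟨u, hu, hu0, hne⟩ := hrig (s.biUnion S ∪ insert c ((F.erase i₀).image q)) (by
        have h1 := Finset.card_union_le (s.biUnion S) (insert c ((F.erase i₀).image q))
        have h2 := Finset.card_insert_le c ((F.erase i₀).image q)
        have h3 : ((F.erase i₀).image q).card ≤ (F.erase i₀).card := Finset.card_image_le
        omega)
      (h.isCutSet (by simp) (hsub _))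
    have hSu : ∀ i ∈ s, ∀ p ∈ S i, u p = 0 := fun i hi p hp => hu0 p (hsub _ i hi hp)
    have hc : u c = 0 := hu0 c (by simp)
    have ht := h.isTight hu hSu hc
    refine hne (h.eq_zero hlf hfin hω hωℓ hu hSu hc (i₀ := i₀) fun i hi hii₀ => ?_)
    by_cases hiF : i ∈ F
    · exact hq i hi u (ht i hi) (hu0 _ (Finset.mem_union_right _ (Finset.mem_insert_of_mem
        (Finset.mem_image_of_mem _ (Finset.mem_erase.2 ⟨hii₀, hiF⟩)))))
    · rcases (h.branch i hi).r_le.eq_or_lt with hri | hri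
      · have hdead : IsDead G ω ℓ (d i) (Q i) (r i) (P i) (S i) := by
          by_contra hdead
          exact hiF (Finset.mem_filter.2 ⟨hi, hri, hdead⟩)
        exact hdead u (ht i hi)
      · exact (h.branch i hi).vanishesOn hω hωℓ (ht i hi) hri (by rw [h.base i hi, hc])
  have hFr : ∑ i ∈ F, r i = F.card * ℓ := by
    rw [Finset.sum_congr rfl fun i hi => (Finset.mem_filter.1 hi).2.1, Finset.sum_const, nsmul_eq_mul]
  have hNF' : (k : ℝ) * ℓ ≤ N * ℓ + F.card * ℓ := by
    rw [← add_mul]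
    exact mul_le_mul_of_nonneg_right (by exact_mod_cast hNF) hℓ.le
  -- the branches in `F` use up the whole mass, so nothing else is there
  have hFs : F = s := by
    refine (Finset.filter_subset _ _).antisymm fun i hi => ?_
    by_contra hiF
    have : ∑ i ∈ F, r i < ∑ i ∈ s, r i := Finset.sum_lt_sum_of_subset (Finset.filter_subset _ _) hi hiF
      (h.branch i hi).r_pos fun j hj _ => (h.branch j hj).r_pos.le
    linarith
  have hsF : ∀ i ∈ s, r i = ℓ ∧ IsAlive G ω ℓ (d i) (Q i) (r i) (P i) (S i) := by
    intro i hi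
    rw [← hFs] at hi
    obtain ⟨h1, h2, h3⟩ := Finset.mem_filter.1 hi
    exact ⟨h2, (h.branch i h1).dead_or_alive.resolve_left h3⟩
  have hr : ∀ i ∈ s, r i = ℓ := fun i hi => (hsF i hi).1
  have hS : ∀ i ∈ s, S i = ∅ := fun i hi => (hsF i hi).2.1
  have hN0 : N = 0 := Finset.sum_eq_zero fun i hi => by rw [hS i hi, Finset.card_empty]
  have hsk : s.card = k := by
    rw [hFs] at hNF hFr
    rw [hFr, hN0] at hmass
    have : ((s.card : ℕ) : ℝ) ≤ k := by
      refine le_of_mul_le_mul_right ?_ hℓ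
      simpa using hmass
    have := Nat.cast_le.1 this
    omega
  have hal : ∀ i ∈ s, ∃ J γ, IsArm G (d i) ℓ (P i) J γ ∧
      ∀ u, IsTight G ω ℓ (d i) (Q i) (r i) (S i) u →
        ∃ A, ∀ x ∈ J, u (γ x) = A * Real.cos (ω * (ℓ - x)) := by
    intro i hi
    obtain ⟨J, γ, h1, h2⟩ := (hsF i hi).2.2
    rw [hr i hi] at h1 h2
    rw [hr i hi]
    exact ⟨J, γ, h1, h2⟩
  have : Nonempty G.Space := ⟨c⟩
  choose! J γ harm hcos using hal
  rw [← hsk] at hrig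
  have hJ0 : ∀ i ∈ s, (0 : ℝ) ∈ J i ∧ γ i 0 = c := by
    intro i hi
    obtain ⟨ε, hε, hg⟩ := (harm i hi).germ
    rw [← h.base i hi]
    exact hg 0 ⟨le_rfl, hε.le⟩
  -- the distances are bounded below by means of the eigenfunctions on pairs of arms
  have hdist : ∀ i ∈ s, ∀ x ∈ J i, ∀ y ∈ J i, edist (γ i x) (γ i y) = ENNReal.ofReal |x - y| := by
    intro i hi x hx y hy
    refine le_antisymm ((harm i hi).edist_le x hx y hy) ?_
    obtain ⟨j, hj, hji⟩ := Finset.exists_mem_ne (by omega : 1 < s.card) i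
    obtain ⟨u, σ, hu, hσ, hus, hσi, _⟩ := h.exists_signs hlf hfin hω hωℓ harm hS hcos hrig hi hj
      hji.symm
    have := h.ofReal_abs_sub_le hω hωℓ harm hu hσ hus hi hi hx hy
    rwa [hσi, one_mul, one_mul] at this
  have hdist' : ∀ i ∈ s, ∀ j ∈ s, i ≠ j → ∀ x ∈ J i, ∀ y ∈ J j,
      edist (γ i x) (γ j y) = ENNReal.ofReal (x + y) := by
    intro i hi j hj hij x hx y hy
    have hx0 := ((harm i hi).mem_Icc hx).1
    have hy0 := ((harm j hj).mem_Icc hy).1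
    refine le_antisymm ?_ ?_
    · refine (edist_triangle _ c _).trans ?_
      have e1 := (harm i hi).edist_le x hx 0 (hJ0 i hi).1
      have e2 := (harm j hj).edist_le 0 (hJ0 j hj).1 y hy
      rw [(hJ0 i hi).2, sub_zero, abs_of_nonneg hx0] at e1
      rw [(hJ0 j hj).2, zero_sub, abs_neg, abs_of_nonneg hy0] at e2
      rw [ENNReal.ofReal_add hx0 hy0]
      exact add_le_add e1 e2
    · obtain ⟨u, σ, hu, hσ, hus, hσi, hσj⟩ := h.exists_signs hlf hfin hω hωℓ harm hS hcos hrig hi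
        hj hij
      have := h.ofReal_abs_sub_le hω hωℓ harm hu hσ hus hi hj hx hy
      rwa [hσi, hσj, one_mul, neg_one_mul, sub_neg_eq_add, abs_of_nonneg (by positivity)] at this
  have hLk : G.totalLength / k = ℓ := by
    rw [hL, mul_div_cancel_left₀]
    exact_mod_cast (by omega : k ≠ 0)
  let φ : Fin k ≃ s := (Fintype.equivFinOfCardEq (by rw [Fintype.card_coe, hsk])).symm
  refine ⟨c, fun i => J (φ i), fun i => γ (φ i), fun i => ?_, fun i => (hJ0 _ (φ i).2).2, fun p => ?_,
    fun i => hdist _ (φ i).2, fun i j hij => hdist' _ (φ i).2 _ (φ j).2 fun he =>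
      hij (φ.injective (Subtype.ext he))⟩
  · rw [hLk]
    exact (harm _ (φ i).2).dom
  · obtain ⟨e, t, ht, rfl⟩ := exists_pt p
    obtain ⟨i, hi, q, hq, rfl, hqt⟩ := h.cover e t ht
    obtain ⟨a, τ, _, hc⟩ := (harm i hi).pieces q hq
    obtain ⟨h1, h2⟩ := hc t hqt
    exact ⟨φ.symm ⟨i, hi⟩, a + τ * t, by simpa using h1, by simpa using h2⟩

end Fan

end

section

/-! ### Rooted decompositions and sums over descendants -/

variable {E : Type*} {G : MetricGraph E} {ω ℓ : ℝ}

/-- A decomposition of the graph into intervals that are arranged in a rooted tree. The interval `i`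
starts along `germ i` and has length `length i`; the intervals that continue it at its far end are the
`j` with `par j = some i`, and those at the root have `par j = none`. An interval either has no
continuation at all, or is continued along all other germs at its far end; so where a cycle closes,
the graph is cut open. -/
structure Rooting {E : Type*} (G : MetricGraph E) (I : Type*) where
  germ : I → Germ E
  length : I → ℝ
  par : I → Option I
  level : I → ℕ
  length_pos : ∀ i, 0 < length i
  fits : ∀ i, (germ i).Fits G (length i)
  level_par : ∀ {i j}, par j = some i → level j = level i + 1
  finite_par : ∀ o, {i | par i = o}.Finite
  base : ∀ {i j}, par j = some i → G.germPt (germ j) 0 = G.germPt (germ i) (length i)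
  star : ∀ i, (finite_par (some i)).toFinset.Nonempty →
    IsStarWith G (finite_par (some i)).toFinset germ ((germ i).rev (length i))
  root_base : ∀ {i j}, par i = none → par j = none → G.germPt (germ i) 0 = G.germPt (germ j) 0
  root_injOn : Set.InjOn germ {i | par i = none}
  root_star : G.IsStar (germ '' {i | par i = none})
  hasSum_length : HasSum length G.totalLength
  hasSum_form : ∀ ω u, G.MemH1 u →
    HasSum (fun i => G.pieceForm ω (germ i) (length i) u) (G.shiftedForm ω u)
  cover : ∀ e, ∀ t ∈ Set.Icc 0 (G.len e), ∃ i, (germ i).edge = e ∧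
    ∃ τ ∈ Set.Icc 0 (length i), (germ i).pos + (germ i).dir * τ = t

namespace Rooting

variable {I : Type*} (T : Rooting G I)

/-- The intervals that continue the interval `i`, or start at the root if `o = none`. -/
def children (o : Option I) : Finset I := (T.finite_par o).toFinset

variable {T}

theorem mem_children {o : Option I} {i : I} : i ∈ T.children o ↔ T.par i = o := by
  simp [children]

variable (T)

/-- `j` is a descendant of `i` (or `i` itself). -/
def Desc : I → I → Prop := Relation.ReflTransGen fun i j => T.par j = some i

variable {T}

theorem Desc.level_le {i j : I} (h : T.Desc i j) : T.level i ≤ T.level j := by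
  induction h with
  | refl => exact le_rfl
  | tail _ h ih => exact ih.trans (by rw [T.level_par h]; exact Nat.le_succ _)

theorem Desc.refl (i : I) : T.Desc i i := Relation.ReflTransGen.refl

/-- The ancestors of a node are linearly ordered. -/
theorem Desc.total {i i' j : I} (h : T.Desc i j) (h' : T.Desc i' j) :
    T.Desc i i' ∨ T.Desc i' i := by
  induction h with
  | refl => exact Or.inr h'
  | tail hip hp ih =>
    rcases Relation.ReflTransGen.cases_tail h' with h | ⟨p, h1, h2⟩
    · subst h
      exact Or.inl (hip.tail hp)
    · rw [hp] at h2
      obtain rfl := Option.some.inj h2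
      exact ih h1

theorem desc_iff {i j : I} : T.Desc i j ↔ i = j ∨ ∃ c ∈ T.children (some i), T.Desc c j := by
  unfold Desc
  rw [Relation.ReflTransGen.cases_head_iff]
  simp only [mem_children]

theorem exists_root_desc (j : I) : ∃ c ∈ T.children none, T.Desc c j := by
  induction hn : T.level j using Nat.strong_induction_on generalizing j with
  | _ n ih =>
    cases hp : T.par j with
    | none => exact ⟨j, mem_children.2 hp, Relation.ReflTransGen.refl⟩
    | some p =>
      have := T.level_par hp
      obtain ⟨c, hc, h⟩ := ih (T.level p) (by omega) p rfl
      exact ⟨c, hc, h.tail hp⟩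

theorem Desc.eq_of_par {i j : I} (h : T.Desc i j) (hij : T.par i = T.par j) : i = j := by
  rcases Relation.ReflTransGen.cases_tail h with h | ⟨p, h1, h2⟩
  · exact h.symm
  · have := Desc.level_le (T := T) h1
    have := T.level_par (hij.trans h2)
    omega

theorem eq_of_desc_children {o : Option I} {c c' j : I} (hc : c ∈ T.children o)
    (hc' : c' ∈ T.children o) (h : T.Desc c j) (h' : T.Desc c' j) : c = c' := by
  rw [mem_children] at hc hc'
  rcases h.total h' with h1 | h1
  · exact h1.eq_of_par (hc.trans hc'.symm)
  · exact (h1.eq_of_par (hc'.trans hc.symm)).symm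

open Classical in
variable (T) in
/-- The sum of `g` over all descendants of `i`. -/
def descSum (g : I → ℝ) (i : I) : ℝ := ∑' j, if T.Desc i j then g j else 0

open Classical in
theorem summable_desc {g : I → ℝ} (hg : Summable g) (i : I) :
    Summable fun j => if T.Desc i j then g j else 0 :=
  (hg.indicator {j | T.Desc i j}).congr fun j => by simp [Set.indicator]

open Classical in
/-- The recursion for sums over descendants. -/
theorem descSum_eq {g : I → ℝ} (hg : Summable g) (i : I) :
    T.descSum g i = g i + ∑ c ∈ T.children (some i), T.descSum g c := by
  have h1 : ∀ j, (if T.Desc i j then g j else 0) = (if j = i then g j else 0) +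
      ∑ c ∈ T.children (some i), if T.Desc c j then g j else 0 := by
    intro j
    by_cases hij : j = i
    · subst hij
      rw [if_pos (Desc.refl j), if_pos rfl, Finset.sum_eq_zero, add_zero]
      intro c hc
      rw [if_neg]
      intro h
      have := h.level_le
      have := T.level_par (mem_children.1 hc)
      omega
    · rw [if_neg hij, zero_add]
      by_cases hd : T.Desc i j
      · obtain ⟨c, hc, hcj⟩ := (desc_iff.1 hd).resolve_left (Ne.symm hij)
        rw [if_pos hd, Finset.sum_eq_single_of_mem c hc, if_pos hcj]
        intro c' hc' hne
        rw [if_neg]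
        exact fun h => hne (eq_of_desc_children hc' hc h hcj)
      · rw [if_neg hd, Finset.sum_eq_zero]
        intro c hc
        rw [if_neg]
        exact fun h => hd (desc_iff.2 (Or.inr ⟨c, hc, h⟩))
  unfold descSum
  rw [tsum_congr h1, Summable.tsum_add, tsum_ite_eq, Summable.tsum_finsetSum]
  · exact fun c _ => summable_desc hg c
  · exact (hasSum_ite_eq i (g i)).summable.congr fun j => by
      by_cases h : j = i <;> simp [h]
  · exact summable_sum fun c _ => summable_desc hg c

open Classical in
/-- Every interval descends from exactly one child of the root. -/
theorem sum_descSum_root {g : I → ℝ} (hg : Summable g) :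
    ∑ c ∈ T.children none, T.descSum g c = ∑' j, g j := by
  unfold descSum
  rw [← Summable.tsum_finsetSum fun c _ => summable_desc hg c]
  refine tsum_congr fun j => ?_
  obtain ⟨c, hc, hcj⟩ := T.exists_root_desc j
  rw [Finset.sum_eq_single_of_mem c hc, if_pos hcj]
  intro c' hc' hne
  rw [if_neg]
  exact fun h => hne (eq_of_desc_children hc' hc h hcj)

theorem descSum_mono {f g : I → ℝ} (hf : Summable f) (hg : Summable g) {i : I}
    (h : ∀ j, T.Desc i j → f j ≤ g j) : T.descSum f i ≤ T.descSum g i := by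
  classical
  refine Summable.tsum_le_tsum (fun j => ?_) (summable_desc hf i) (summable_desc hg i)
  by_cases hj : T.Desc i j
  · rw [if_pos hj, if_pos hj]
    exact h j hj
  · rw [if_neg hj, if_neg hj]

/-- The part of `g` from the level `n` on. -/
def tail (T : Rooting G I) (g : I → ℝ) (n : ℕ) : I → ℝ := {j | n ≤ T.level j}.indicator g

theorem summable_tail {g : I → ℝ} (hg : Summable g) (n : ℕ) : Summable (T.tail g n) :=
  hg.indicator _

theorem tendsto_tsum_tail {g : I → ℝ} (hg : Summable g) :
    Tendsto (fun n => ∑' j, T.tail g n j) atTop (𝓝 0) := by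
  have := tendsto_tsum_of_dominated_convergence (𝓕 := atTop) (f := fun n j => T.tail g n j)
    (g := fun _ => (0 : ℝ)) hg.abs (fun j => ?_) (Eventually.of_forall fun n j => ?_)
  · simpa using this
  · refine tendsto_const_nhds.congr' ?_
    filter_upwards [eventually_gt_atTop (T.level j)] with n hn
    rw [tail, Set.indicator_of_notMem]
    simpa using hn
  · unfold tail
    rw [Real.norm_eq_abs]
    by_cases hj : j ∈ {j | n ≤ T.level j}
    · rw [Set.indicator_of_mem hj]
    · rw [Set.indicator_of_notMem hj, abs_zero]
      exact abs_nonneg _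

theorem descSum_le_tsum {g : I → ℝ} (hg : Summable g) (h0 : ∀ j, 0 ≤ g j) (i : I) :
    T.descSum g i ≤ ∑' j, g j := by
  classical
  refine Summable.tsum_le_tsum (fun j => ?_) (summable_desc hg i) hg
  by_cases hj : T.Desc i j
  · rw [if_pos hj]
  · rw [if_neg hj]
    exact h0 j

theorem descSum_tail {g : I → ℝ} {n : ℕ} {i : I} (hn : n ≤ T.level i) :
    T.descSum (T.tail g n) i = T.descSum g i := by
  classical
  refine tsum_congr fun j => ?_
  by_cases hj : T.Desc i j
  · rw [if_pos hj, if_pos hj, tail, Set.indicator_of_mem]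
    exact hn.trans hj.level_le
  · rw [if_neg hj, if_neg hj]

variable (T)

/-- The total length of the descendants of `i`. -/
def mass (i : I) : ℝ := T.descSum T.length i

variable {T}

theorem mass_eq (i : I) : T.mass i = T.length i + ∑ c ∈ T.children (some i), T.mass c :=
  descSum_eq T.hasSum_length.summable i

theorem length_le_mass (i : I) : T.length i ≤ T.mass i := by
  classical
  have := (summable_desc (T := T) T.hasSum_length.summable i).le_tsum i fun j _ => by
    by_cases hj : T.Desc i j
    · rw [if_pos hj]
      exact (T.length_pos j).le
    · rw [if_neg hj]
  rwa [if_pos (Desc.refl i)] at this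

theorem mass_pos (i : I) : 0 < T.mass i := (T.length_pos i).trans_le (length_le_mass i)

theorem exists_mass_lt {ε : ℝ} (hε : 0 < ε) : ∃ N, ∀ i, N ≤ T.level i → T.mass i < ε := by
  have hs := T.hasSum_length.summable
  obtain ⟨N, hN⟩ := ((tendsto_tsum_tail (T := T) hs).eventually (gt_mem_nhds hε)).exists
  refine ⟨N, fun i hi => lt_of_le_of_lt ?_ hN⟩
  rw [mass, ← descSum_tail hi]
  refine descSum_le_tsum (summable_tail hs N) (fun j => ?_) i
  exact Set.indicator_nonneg (fun j _ => (T.length_pos j).le) j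

end Rooting

end

section

/-! ### Subtrees of at most critical mass -/

variable {E : Type*} {G : MetricGraph E} {ω ℓ : ℝ}

namespace Rooting

variable {I : Type*} {T : Rooting G I} {u : G.Space → ℝ}

variable (T) in
/-- The contribution of the descendants of `i` to the shifted quadratic form. -/
def form (ω : ℝ) (i : I) (u : G.Space → ℝ) : ℝ :=
  T.descSum (fun j => G.pieceForm ω (T.germ j) (T.length j) u) i

variable (T) in
/-- The intervals that belong to the descendants of `i`. -/
def pieces (i : I) : Set (Piece E) := (fun j => (T.germ j).piece (T.length j)) '' {j | T.Desc i j}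

variable (T) in
/-- The amount by which the form of the descendants of `i` exceeds the Riccati bound. -/
def excess (ω : ℝ) (u : G.Space → ℝ) (i : I) : ℝ :=
  T.form ω i u + ω * Real.tan (ω * T.mass i) * u (G.germPt (T.germ i) 0) ^ 2

variable (T) in
/-- The subtree at `i` has at most the mass `ℓ`, and the function vanishes at its base if the mass is
equal to `ℓ`. -/
structure IsLight (ℓ : ℝ) (u : G.Space → ℝ) (i : I) : Prop where
  le : T.mass i ≤ ℓ
  base : T.mass i = ℓ → u (G.germPt (T.germ i) 0) = 0

theorem summable_pieceForm (ω : ℝ) (hu : G.MemH1 u) :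
    Summable fun j => G.pieceForm ω (T.germ j) (T.length j) u := (T.hasSum_form ω u hu).summable

theorem form_eq (hu : G.MemH1 u) (i : I) : T.form ω i u =
    G.pieceForm ω (T.germ i) (T.length i) u + ∑ c ∈ T.children (some i), T.form ω c u :=
  descSum_eq (summable_pieceForm ω hu) i

theorem sum_mass_lt {i : I} (hi : T.mass i ≤ ℓ) : ∑ c ∈ T.children (some i), T.mass c < ℓ := by
  have := T.mass_eq i
  have := T.length_pos i
  linarith

theorem mass_lt_of_child {i c : I} (hi : T.mass i ≤ ℓ) (hc : c ∈ T.children (some i)) :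
    T.mass c < ℓ :=
  (Finset.single_le_sum (fun j _ => (T.mass_pos j).le) hc).trans_lt (sum_mass_lt hi)

theorem IsLight.child {i c : I} (h : T.IsLight ℓ u i) (hc : c ∈ T.children (some i)) :
    T.IsLight ℓ u c :=
  ⟨(mass_lt_of_child h.le hc).le, fun he => absurd he (mass_lt_of_child h.le hc).ne⟩

theorem IsLight.desc {i j : I} (h : T.IsLight ℓ u i) (hj : T.Desc i j) : T.IsLight ℓ u j := by
  induction hj with
  | refl => exact h
  | tail _ hp ih => exact ih.child (mem_children.2 hp)

/-- The excess is superadditive along the tree; this combines the Riccati inequality on an interval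
with the superadditivity of the tangent. -/
theorem sum_excess_le (hω : 0 < ω) (hωℓ : ω * ℓ = Real.pi / 2) (hu : G.MemH1 u) {i : I}
    (h : T.IsLight ℓ u i) :
    ∑ c ∈ T.children (some i), T.excess ω u c ≤ T.excess ω u i ∧
    (T.excess ω u i = ∑ c ∈ T.children (some i), T.excess ω u c →
      (∃ A, ∀ t ∈ Set.Icc 0 (T.length i), u (G.germPt (T.germ i) t) =
        A * Real.cos (ω * (T.mass i - t))) ∧
      (1 < (T.children (some i)).card → u (G.germPt (T.germ i) (T.length i)) = 0)) := by
  set s := T.children (some i) with hs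
  set R := ∑ c ∈ s, T.mass c with hR
  have hm : T.mass i = R + T.length i := by rw [T.mass_eq i, add_comm]
  have hRℓ : R < ℓ := sum_mass_lt h.le
  have hR0 : 0 ≤ R := Finset.sum_nonneg fun j _ => (T.mass_pos j).le
  have htan := sum_tan_le s (fun c => ω * T.mass c) (fun c _ => mul_pos hω (T.mass_pos c))
    (by rw [← Finset.mul_sum, ← hωℓ]; exact mul_lt_mul_of_pos_left hRℓ hω)
  simp only [← Finset.mul_sum, ← hR] at htan
  obtain ⟨p1, p2⟩ := pieceForm_ge (R := R) hω hωℓ hu (T.fits i) (T.length_pos i) hR0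
    (by rw [← hm]; exact h.le) (by rw [← hm]; exact h.base)
  rw [← hm] at p1 p2
  have hsum : ∑ c ∈ s, T.excess ω u c = ∑ c ∈ s, T.form ω c u +
      ω * (∑ c ∈ s, Real.tan (ω * T.mass c)) * u (G.germPt (T.germ i) (T.length i)) ^ 2 := by
    simp only [excess]
    rw [Finset.sum_add_distrib, Finset.mul_sum, Finset.sum_mul]
    congr 1
    refine Finset.sum_congr rfl fun c hc => ?_
    rw [T.base (mem_children.1 hc)]
  have hform := T.form_eq (ω := ω) hu i
  have ht : ω * (∑ c ∈ s, Real.tan (ω * T.mass c)) * u (G.germPt (T.germ i) (T.length i)) ^ 2 ≤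
      ω * Real.tan (ω * R) * u (G.germPt (T.germ i) (T.length i)) ^ 2 :=
    mul_le_mul_of_nonneg_right (mul_le_mul_of_nonneg_left htan.1 hω.le) (sq_nonneg _)
  rw [hsum]
  unfold excess
  refine ⟨by linarith, fun he => ⟨p2 (by linarith), fun hc => ?_⟩⟩
  by_contra hne
  have h1 := mul_lt_mul_of_pos_right (mul_lt_mul_of_pos_left (htan.2 hc) hω)
    (pow_pos (abs_pos.2 hne) 2)
  rw [sq_abs] at h1
  linarith

theorem tan_mass_nonneg (hω : 0 < ω) (hωℓ : ω * ℓ = Real.pi / 2) {i : I} (h : T.mass i ≤ ℓ) :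
    0 ≤ Real.tan (ω * T.mass i) :=
  Real.tan_nonneg_of_nonneg_of_le_pi_div_two (mul_nonneg hω.le (T.mass_pos i).le)
    (hωℓ ▸ mul_le_mul_of_nonneg_left h hω.le)

/-- The excess is at least minus the total of the absolute forms from the level `n` on: this is trivial
at the level `n`, and superadditivity carries it towards the root. -/
theorem neg_descSum_tail_le (hω : 0 < ω) (hωℓ : ω * ℓ = Real.pi / 2) (hu : G.MemH1 u) (n k : ℕ) :
    ∀ i, T.IsLight ℓ u i → n ≤ T.level i + k →
      -T.descSum (T.tail (fun j => |G.pieceForm ω (T.germ j) (T.length j) u|) n) i ≤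
        T.excess ω u i := by
  have hs := summable_pieceForm (T := T) ω hu
  have hdeep : ∀ i, T.IsLight ℓ u i → n ≤ T.level i →
      -T.descSum (T.tail (fun j => |G.pieceForm ω (T.germ j) (T.length j) u|) n) i ≤
        T.excess ω u i := by
    intro i hi hn
    have h1 : T.descSum (fun j => -|G.pieceForm ω (T.germ j) (T.length j) u|) i ≤ T.form ω i u :=
      descSum_mono hs.abs.neg hs fun j _ => neg_abs_le _
    have h2 : T.descSum (fun j => -|G.pieceForm ω (T.germ j) (T.length j) u|) i =
        -T.descSum (fun j => |G.pieceForm ω (T.germ j) (T.length j) u|) i := by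
      unfold descSum
      rw [← tsum_neg]
      refine tsum_congr fun j => ?_
      split_ifs <;> simp
    have h3 : 0 ≤ ω * Real.tan (ω * T.mass i) * u (G.germPt (T.germ i) 0) ^ 2 :=
      mul_nonneg (mul_nonneg hω.le (tan_mass_nonneg hω hωℓ hi.le)) (sq_nonneg _)
    rw [descSum_tail hn]
    unfold excess
    linarith
  induction k with
  | zero => exact fun i hi hn => hdeep i hi hn
  | succ k ih =>
    intro i hi hn
    rcases Nat.lt_or_ge (T.level i) n with hlt | hge
    · have h1 := (sum_excess_le hω hωℓ hu hi).1
      have h2 : -∑ c ∈ T.children (some i),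
          T.descSum (T.tail (fun j => |G.pieceForm ω (T.germ j) (T.length j) u|) n) c ≤
          ∑ c ∈ T.children (some i), T.excess ω u c := by
        rw [← Finset.sum_neg_distrib]
        refine Finset.sum_le_sum fun c hc => ih c (hi.child hc) ?_
        rw [T.level_par (mem_children.1 hc)]
        omega
      rw [descSum_eq (summable_tail hs.abs n) i, tail, Set.indicator_of_notMem (by simpa using hlt),
        zero_add]
      exact h2.trans h1
    · exact hdeep i hi hge

/-- The Riccati bound for a subtree, which may be infinite: the error committed by stopping at the level
`n` tends to zero. -/
theorem excess_nonneg (hω : 0 < ω) (hωℓ : ω * ℓ = Real.pi / 2) (hu : G.MemH1 u) {i : I}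
    (h : T.IsLight ℓ u i) : 0 ≤ T.excess ω u i := by
  have hs := (summable_pieceForm (T := T) ω hu).abs
  have h1 := (tendsto_tsum_tail (T := T) hs).neg
  rw [neg_zero] at h1
  refine le_of_tendsto h1 (Eventually.of_forall fun n => ?_)
  refine le_trans (neg_le_neg ?_) (neg_descSum_tail_le hω hωℓ hu n n i h (by omega))
  exact descSum_le_tsum (summable_tail hs n)
    (fun j => Set.indicator_nonneg (fun j _ => abs_nonneg _) j) i

/-- If the Riccati bound is attained on a subtree, it is attained on all smaller subtrees. -/
theorem excess_desc_eq_zero (hω : 0 < ω) (hωℓ : ω * ℓ = Real.pi / 2) (hu : G.MemH1 u) {i j : I}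
    (h : T.IsLight ℓ u i) (h0 : T.excess ω u i = 0) (hj : T.Desc i j) : T.excess ω u j = 0 := by
  induction hj with
  | refl => exact h0
  | @tail p c hip hp ih =>
    have hlp := h.desc hip
    have hc := mem_children.2 hp
    have h1 := (sum_excess_le hω hωℓ hu hlp).1
    rw [ih] at h1
    have h2 : ∀ c ∈ T.children (some p), 0 ≤ T.excess ω u c := fun c hc =>
      excess_nonneg hω hωℓ hu (hlp.child hc)
    exact (Finset.sum_eq_zero_iff_of_nonneg h2).1 (le_antisymm h1 (Finset.sum_nonneg h2)) c hc

/-- If the Riccati bound is attained, the function is given by one cosine on all descendants, and its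
amplitude is zero if the tree branches. -/
theorem exists_amplitude (hω : 0 < ω) (hωℓ : ω * ℓ = Real.pi / 2) (hu : G.MemH1 u) {i : I}
    (h : T.IsLight ℓ u i) (h0 : T.excess ω u i = 0) :
    ∃ A, (∀ j, T.Desc i j → ∀ t ∈ Set.Icc 0 (T.length j),
      u (G.germPt (T.germ j) t) = A * Real.cos (ω * (T.mass j - t))) ∧
      ∀ j, T.Desc i j → 1 < (T.children (some j)).card → A = 0 := by
  have hloc : ∀ j, T.Desc i j → (∃ A, ∀ t ∈ Set.Icc 0 (T.length j), u (G.germPt (T.germ j) t) =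
        A * Real.cos (ω * (T.mass j - t))) ∧
      (1 < (T.children (some j)).card → u (G.germPt (T.germ j) (T.length j)) = 0) := by
    intro j hj
    refine (sum_excess_le hω hωℓ hu (h.desc hj)).2 ?_
    rw [excess_desc_eq_zero hω hωℓ hu h h0 hj, Finset.sum_eq_zero]
    intro c hc
    exact excess_desc_eq_zero hω hωℓ hu h h0 (hj.tail (mem_children.1 hc))
  have hcos : ∀ j, T.Desc i j → 0 < Real.cos (ω * (T.mass j - T.length j)) := by
    intro j hj
    have h1 := T.mass_eq j
    refine cos_pos_of_lt hω hωℓ (sub_nonneg.2 (length_le_mass j)) ?_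
    linarith [(h.desc hj).le, T.length_pos j]
  obtain ⟨A, hA⟩ := (hloc i (Desc.refl i)).1
  have hend : ∀ j, T.length j ∈ Set.Icc 0 (T.length j) := fun j => ⟨(T.length_pos j).le, le_rfl⟩
  have hbranch : ∀ j, T.Desc i j → (∀ t ∈ Set.Icc 0 (T.length j), u (G.germPt (T.germ j) t) =
      A * Real.cos (ω * (T.mass j - t))) → 1 < (T.children (some j)).card → A = 0 := by
    intro j hj hjA hc
    have h1 := hjA _ (hend j)
    rw [(hloc j hj).2 hc] at h1
    exact (mul_eq_zero.1 h1.symm).resolve_right (hcos j hj).ne'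
  have hall : ∀ j, T.Desc i j → ∀ t ∈ Set.Icc 0 (T.length j),
      u (G.germPt (T.germ j) t) = A * Real.cos (ω * (T.mass j - t)) := by
    intro j hj
    induction hj with
    | refl => exact hA
    | @tail p c hip hp ih =>
      obtain ⟨B, hB⟩ := (hloc c (hip.tail hp)).1
      have hc := mem_children.2 hp
      have h1 := hB 0 ⟨le_rfl, (T.length_pos c).le⟩
      have hmc := mass_lt_of_child (h.desc hip).le hc
      have hcos' := cos_pos_of_lt hω hωℓ (T.mass_pos c).le hmc
      rw [T.base hp, ih _ (hend p), sub_zero] at h1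
      have hBA : B = A := by
        rcases Nat.lt_or_ge 1 (T.children (some p)).card with hcard | hcard
        · have hA0 := hbranch p hip ih hcard
          rw [hA0, zero_mul] at h1
          rw [hA0]
          exact (mul_eq_zero.1 h1.symm).resolve_right hcos'.ne'
        · obtain ⟨c', hc'⟩ := Finset.card_eq_one.1 (le_antisymm hcard (Finset.card_pos.2 ⟨c, hc⟩))
          have h2 := T.mass_eq p
          rw [hc', Finset.mem_singleton] at hc
          rw [hc', Finset.sum_singleton, ← hc] at h2
          rw [h2, add_sub_cancel_left] at h1
          exact (mul_right_cancel₀ hcos'.ne' h1).symm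
      rw [← hBA]
      exact hB
  exact ⟨A, hall, fun j hj => hbranch j hj (hall j hj)⟩

end Rooting

end

section

/-! ### Subtrees that do not branch -/

variable {E : Type*} {G : MetricGraph E} {ω ℓ : ℝ}

namespace Rooting

variable {I : Type*} {T : Rooting G I}

variable (T) in
/-- No descendant of `i` has more than one child. -/
def IsPath (i : I) : Prop := ∀ j, T.Desc i j → (T.children (some j)).card ≤ 1

/-- On a path, the masses decrease by the length. -/
theorem IsPath.mass_eq {i j c : I} (h : T.IsPath i) (hj : T.Desc i j)
    (hc : T.par c = some j) : T.mass j = T.length j + T.mass c := by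
  have hc' := mem_children.2 hc
  obtain ⟨c', hc''⟩ := Finset.card_eq_one.1 (le_antisymm (h j hj) (Finset.card_pos.2 ⟨c, hc'⟩))
  rw [hc'', Finset.mem_singleton] at hc'
  rw [T.mass_eq j, hc'', Finset.sum_singleton, hc']

theorem IsPath.desc {i j : I} (h : T.IsPath i) (hj : T.Desc i j) : T.IsPath j :=
  fun k hk => h k (hj.trans hk)

theorem IsPath.total {i j k : I} (h : T.IsPath i) (hj : T.Desc i j) (hk : T.Desc i k) :
    T.Desc j k ∨ T.Desc k j := by
  induction hj with
  | refl => exact Or.inl hk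
  | @tail p c hip hp ih =>
    rcases ih with h1 | h1
    · rcases desc_iff.1 h1 with h2 | ⟨c', hc', h2⟩
      · subst h2
        exact Or.inr ((Desc.refl p).tail hp)
      · have := Finset.card_le_one.1 (h p hip) c (mem_children.2 hp) c' hc'
        subst this
        exact Or.inl h2
    · exact Or.inr (h1.tail hp)

/-- Along a path, distances are bounded by differences of the arc length `mass i - mass j + t`. -/
theorem IsPath.edist_le {i j : I} (h : T.IsPath i) (hij : T.Desc i j) {s t : ℝ}
    (hs : s ∈ Set.Icc 0 (T.length i)) (ht : t ∈ Set.Icc 0 (T.length j))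
    (hst : s - T.mass i ≤ t - T.mass j) :
    edist (G.germPt (T.germ i) s) (G.germPt (T.germ j) t) ≤
      ENNReal.ofReal (t - T.mass j - (s - T.mass i)) := by
  have hseg : ∀ (i : I) (s t : ℝ), s ≤ t →
      edist (G.germPt (T.germ i) s) (G.germPt (T.germ i) t) ≤ ENNReal.ofReal (t - s) := by
    intro i s t hst
    refine (edist_pt_le _ _ _).trans (le_of_eq ?_)
    congr 1
    rw [show (T.germ i).pos + (T.germ i).dir * s - ((T.germ i).pos + (T.germ i).dir * t) =
      (T.germ i).dir * (s - t) by ring, abs_mul, abs_of_nonpos (by linarith : s - t ≤ 0)]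
    rcases (T.fits i).dir with h | h <;> rw [h] <;> norm_num
  induction hij using Relation.ReflTransGen.head_induction_on generalizing s with
  | refl =>
    refine (hseg _ s t (by linarith)).trans (le_of_eq ?_)
    congr 1
    ring
  | @head i c hp hcj ih =>
    have hm := h.mass_eq (Desc.refl i) hp
    have hmj : T.mass j ≤ T.mass c - 0 := by
      have : ∀ {a b}, T.Desc a b → T.IsPath a → T.mass b ≤ T.mass a := by
        intro a b hab ha
        induction hab with
        | refl => exact le_rfl
        | @tail p c hip hp ih => linarith [ha.mass_eq hip hp, T.length_pos p]
      rw [sub_zero]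
      exact this hcj (h.desc ((Desc.refl i).tail hp))
    have h1 := ih (h.desc ((Desc.refl i).tail hp)) (s := 0) ⟨le_rfl, (T.length_pos c).le⟩
      (by linarith [ht.1])
    refine (edist_triangle _ (G.germPt (T.germ i) (T.length i)) _).trans ?_
    rw [T.base hp] at h1
    refine (add_le_add (hseg i s _ hs.2) h1).trans (le_of_eq ?_)
    rw [← ENNReal.ofReal_add (by linarith [hs.2]) (by linarith [ht.1])]
    congr 1
    linarith

theorem exists_desc_mass_lt {i : I} (h : ∀ j, T.Desc i j → (T.children (some j)).Nonempty) {ε : ℝ}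
    (hε : 0 < ε) : ∃ j, T.Desc i j ∧ T.mass j < ε := by
  obtain ⟨N, hN⟩ := T.exists_mass_lt hε
  have : ∀ n, ∃ j, T.Desc i j ∧ n ≤ T.level j := by
    intro n
    induction n with
    | zero => exact ⟨i, Desc.refl i, Nat.zero_le _⟩
    | succ n ih =>
      obtain ⟨j, hj, hn⟩ := ih
      obtain ⟨c, hc⟩ := h j hj
      have hp := mem_children.1 hc
      exact ⟨c, hj.tail hp, by rw [T.level_par hp]; omega⟩
  obtain ⟨j, hj, hn⟩ := this N
  exact ⟨j, hj, hN j hn⟩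

/-- The set of arc length coordinates on a path. -/
theorem IsPath.coordinates {i : I} (h : T.IsPath i) :
    {x | ∃ j, T.Desc i j ∧ x - (T.mass i - T.mass j) ∈ Set.Icc 0 (T.length j)} =
        Set.Icc 0 (T.mass i) ∨
      {x | ∃ j, T.Desc i j ∧ x - (T.mass i - T.mass j) ∈ Set.Icc 0 (T.length j)} =
        Set.Ico 0 (T.mass i) := by
  set J := {x | ∃ j, T.Desc i j ∧ x - (T.mass i - T.mass j) ∈ Set.Icc 0 (T.length j)} with hJ
  have hinit : ∀ j, T.Desc i j → ∀ x, 0 ≤ x → x ≤ T.mass i - T.mass j + T.length j → x ∈ J := by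
    intro j hj
    induction hj with
    | refl =>
      intro x hx0 hx
      exact ⟨i, Desc.refl i, by rwa [sub_self, sub_zero], by linarith⟩
    | @tail p c hip hp ih =>
      intro x hx0 hx
      have hm := h.mass_eq hip hp
      rcases le_total x (T.mass i - T.mass p + T.length p) with hle | hle
      · exact ih x hx0 hle
      · exact ⟨c, hip.tail hp, by linarith, by linarith⟩
  have hmono : ∀ j, T.Desc i j → T.mass j ≤ T.mass i := by
    intro j hj
    induction hj with
    | refl => exact le_rfl
    | @tail p c hip hp ih => linarith [h.mass_eq hip hp, T.length_pos p]
  have h0 : ∀ x ∈ J, 0 ≤ x := by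
    rintro x ⟨j, hj, hx⟩
    linarith [hx.1, hmono j hj]
  -- an infinite path does not reach its end, a finite one does
  by_cases hleaf : ∀ j, T.Desc i j → (T.children (some j)).Nonempty
  · right
    ext x
    refine ⟨fun hx => ⟨h0 x hx, ?_⟩, fun hx => ?_⟩
    · obtain ⟨j, hj, hxj⟩ := hx
      obtain ⟨c, hc⟩ := hleaf j hj
      have := h.mass_eq hj (mem_children.1 hc)
      linarith [hxj.2, T.mass_pos c]
    · obtain ⟨j, hj, hm⟩ := exists_desc_mass_lt hleaf (sub_pos.2 hx.2)
      exact hinit j hj x hx.1 (by linarith [T.length_pos j])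
  · left
    push Not at hleaf
    obtain ⟨j, hj, hl⟩ := hleaf
    ext x
    refine ⟨fun hx => ⟨h0 x hx, ?_⟩, fun hx => hinit j hj x hx.1 ?_⟩
    · obtain ⟨j, hj, hxj⟩ := hx
      linarith [hxj.2, T.length_le_mass j]
    · have := T.mass_eq j
      rw [hl, Finset.sum_empty, add_zero] at this
      linarith [hx.2]

/-- A subtree that does not branch is parametrised by arc length. -/
theorem IsPath.exists_arm (hlf : G.LocallyFinite) {i : I} (h : T.IsPath i) :
    ∃ J γ, IsArm G (T.germ i) (T.mass i) (T.pieces i) J γ ∧ ∀ x ∈ J, ∃ j, T.Desc i j ∧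
      x - (T.mass i - T.mass j) ∈ Set.Icc 0 (T.length j) ∧
      γ x = G.germPt (T.germ j) (x - (T.mass i - T.mass j)) := by
  set J := {x | ∃ j, T.Desc i j ∧ x - (T.mass i - T.mass j) ∈ Set.Icc 0 (T.length j)} with hJ
  have hchoice : ∀ x, ∃ j, x ∈ J → T.Desc i j ∧ x - (T.mass i - T.mass j) ∈ Set.Icc 0 (T.length j) := by
    intro x
    by_cases hx : x ∈ J
    · obtain ⟨j, hj⟩ := hx
      exact ⟨j, fun _ => hj⟩
    · exact ⟨i, fun hx' => absurd hx' hx⟩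
  choose n hn using hchoice
  -- the distance bound, for arbitrary representations of the two points
  have hdist : ∀ x y j k, T.Desc i j → T.Desc i k →
      x - (T.mass i - T.mass j) ∈ Set.Icc 0 (T.length j) →
      y - (T.mass i - T.mass k) ∈ Set.Icc 0 (T.length k) →
      edist (G.germPt (T.germ j) (x - (T.mass i - T.mass j)))
        (G.germPt (T.germ k) (y - (T.mass i - T.mass k))) ≤ ENNReal.ofReal |x - y| := by
    have hle : ∀ x y j k, T.Desc i j → T.Desc j k →
        x - (T.mass i - T.mass j) ∈ Set.Icc 0 (T.length j) →
        y - (T.mass i - T.mass k) ∈ Set.Icc 0 (T.length k) →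
        edist (G.germPt (T.germ j) (x - (T.mass i - T.mass j)))
          (G.germPt (T.germ k) (y - (T.mass i - T.mass k))) ≤ ENNReal.ofReal |x - y| := by
      intro x y j k hj hjk hx hy
      rcases le_total x y with hxy | hxy
      · refine ((h.desc hj).edist_le hjk hx hy (by linarith)).trans (le_of_eq ?_)
        rw [abs_of_nonpos (by linarith)]
        congr 1
        ring
      · rcases desc_iff.1 hjk with rfl | ⟨c, hc, hck⟩
        · rw [edist_comm, abs_of_nonneg (by linarith)]
          refine ((h.desc hj).edist_le (Desc.refl j) hy hx (by linarith)).trans (le_of_eq ?_)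
          congr 1
          ring
        · -- the intervals only have an endpoint in common
          have hm := h.mass_eq hj (mem_children.1 hc)
          have hkc : T.mass k ≤ T.mass c := by
            have hpc := h.desc (hj.tail (mem_children.1 hc))
            clear hy hjk hxy
            induction hck with
            | refl => exact le_rfl
            | @tail p c hip hp ih => linarith [hpc.mass_eq hip hp, T.length_pos p]
          have hxy' : x = y := by linarith [hx.2, hy.1]
          subst hxy'
          refine ((h.desc hj).edist_le hjk hx hy (by linarith)).trans (le_of_eq ?_)
          rw [sub_self, abs_zero]
          congr 1
          ring
    intro x y j k hj hk hx hy
    rcases h.total hj hk with hjk | hkj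
    · exact hle x y j k hj hjk hx hy
    · rw [edist_comm, abs_sub_comm]
      exact hle y x k j hk hkj hy hx
  set γ : ℝ → G.Space := fun x => G.germPt (T.germ (n x)) (x - (T.mass i - T.mass (n x))) with hγ
  have hval : ∀ x j, T.Desc i j → x - (T.mass i - T.mass j) ∈ Set.Icc 0 (T.length j) →
      x ∈ J ∧ γ x = G.germPt (T.germ j) (x - (T.mass i - T.mass j)) := by
    intro x j hj hx
    have hxJ : x ∈ J := ⟨j, hj, hx⟩
    refine ⟨hxJ, eq_of_edist_eq_zero hlf ?_⟩
    have := hdist x x _ j (hn x hxJ).1 hj (hn x hxJ).2 hx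
    simpa using this
  refine ⟨J, γ, ⟨h.coordinates, ⟨T.length i, T.length_pos i, fun t ht => ?_⟩, ?_, ?_⟩,
    fun x hx => ⟨n x, (hn x hx).1, (hn x hx).2, rfl⟩⟩
  · have := hval t i (Desc.refl i) (by rwa [sub_self, sub_zero])
    rwa [sub_self, sub_zero] at this
  · rintro _ ⟨j, hj, rfl⟩
    obtain ⟨c, s, hs, hc⟩ := (isArm_piece (T.fits j) (T.length_pos j)).pieces _ rfl
    refine ⟨T.mass i - T.mass j + c, s, hs, fun t ht => ?_⟩
    obtain ⟨h1, h2⟩ := hc t ht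
    have e : T.mass i - T.mass j + c + s * t - (T.mass i - T.mass j) = c + s * t := by ring
    obtain ⟨h3, h4⟩ := hval (T.mass i - T.mass j + c + s * t) j hj (by rwa [e])
    rw [h4, e, h2]
    exact ⟨h3, rfl⟩
  · intro x hx y hy
    exact hdist x y _ _ (hn x hx).1 (hn y hy).1 (hn x hx).2 (hn y hy).2

theorem covers_pieces {i j : I} (h : T.Desc i j) {t : ℝ} (ht : t ∈ Set.Icc 0 (T.length j)) :
    Covers (T.pieces i) (T.germ j).edge ((T.germ j).pos + (T.germ j).dir * t) :=
  ⟨_, ⟨j, h, rfl⟩, rfl, (mem_piece_iff (T.fits j).dir (T.length_pos j).le).2 ⟨t, ht, rfl⟩⟩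

/-- A subtree of mass at most `ℓ` is a branch without cut points. -/
theorem isBranchWith_of_le [Countable I] (hlf : G.LocallyFinite) (hω : 0 < ω)
    (hωℓ : ω * ℓ = Real.pi / 2) {i : I} (hi : T.mass i ≤ ℓ) :
    IsBranchWith G ω ℓ (T.germ i) (T.form ω i) (T.mass i) (T.mass i) (T.pieces i) ∅ := by
  have hlight : ∀ u, Admissible G ℓ (T.germ i) (T.mass i) ∅ u → T.IsLight ℓ u i :=
    fun u hu => ⟨hi, hu.base⟩
  have hexc : ∀ u, IsTight G ω ℓ (T.germ i) (T.form ω i) (T.mass i) ∅ u → T.excess ω u i = 0 := by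
    intro u hu
    have := hu.eq
    unfold branchBound at this
    unfold excess
    linarith
  refine ⟨T.mass_pos i, hi, (Set.to_countable _).image _,
    ⟨T.length i, T.length_pos i, fun t ht => covers_pieces (Desc.refl i) ht⟩, by simp,
    fun u hu ha => ?_, ?_⟩
  · have := excess_nonneg hω hωℓ hu (hlight u ha)
    unfold excess at this
    unfold branchBound
    linarith
  · by_cases hpath : T.IsPath i
    · right
      obtain ⟨J, γ, h1, h2⟩ := hpath.exists_arm hlf
      refine ⟨rfl, J, γ, h1, fun u hu => ?_⟩
      obtain ⟨A, hA, _⟩ := exists_amplitude hω hωℓ hu.eigen.memH1 (hlight u hu.adm) (hexc u hu)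
      refine ⟨A, fun x hx => ?_⟩
      obtain ⟨j, hj, hxj, hγ⟩ := h2 x hx
      rw [hγ, hA j hj _ hxj]
      congr 2
      ring
    · left
      unfold IsPath at hpath
      push Not at hpath
      obtain ⟨j, hj, hc⟩ := hpath
      intro u hu
      obtain ⟨A, hA, hA0⟩ := exists_amplitude hω hωℓ hu.eigen.memH1 (hlight u hu.adm) (hexc u hu)
      rintro _ ⟨k, hk, rfl⟩ t ht
      obtain ⟨τ, hτ, rfl⟩ := (mem_piece_iff (T.fits k).dir (T.length_pos k).le).1 ht
      have := hA k hk τ hτ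
      rw [hA0 j hj hc, zero_mul] at this
      exact this

end Rooting

end

section

/-! ### Cutting a rooted decomposition -/

universe v

variable {E : Type*} {G : MetricGraph E} {ω ℓ : ℝ}

theorem Germ.rev_rev (d : Germ E) (b : ℝ) : (d.rev b).rev b = d := by
  unfold Germ.rev
  simp

section Star

variable {ι : Type*} {s : Finset ι} {d : ι → Germ E} {d₀ : Germ E}

theorem isStarWith_erase [DecidableEq ι] (hinj : Set.InjOn d s) (h : G.IsStar (d '' s)) {c : ι}
    (hc : c ∈ s) : IsStarWith G (s.erase c) d (d c) := by
  refine ⟨hinj.mono (by simp), ?_, ?_⟩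
  · rintro ⟨i, hi, he⟩
    have hi := Finset.mem_erase.1 (Finset.mem_coe.1 hi)
    exact hi.1 (hinj hi.2 hc he)
  · convert! h using 1
    rw [← Set.image_insert_eq, ← Finset.coe_insert, Finset.insert_erase hc]

/-- The dichotomy for a fan of branches with unspecified cut sets. -/
theorem dichotomy_of_isBranch (hlf : G.LocallyFinite) (hfin : G.FiniteLength) (hω : 0 < ω)
    (hωℓ : ω * ℓ = Real.pi / 2) (hℓ : 0 < ℓ) {k : ℕ} (hk : 2 ≤ k) (hL : G.totalLength = k * ℓ)
    {Q : ι → (G.Space → ℝ) → ℝ} {m r : ι → ℝ} {P : ι → Set (Piece E)} {c : G.Space}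
    (hinj : Set.InjOn d s) (hstar : G.IsStar (d '' s)) (hbase : ∀ i ∈ s, G.germPt (d i) 0 = c)
    (h : ∀ i ∈ s, IsBranch G ω ℓ (d i) (Q i) (m i) (r i) (P i))
    (hform : ∀ u, G.MemH1 u → G.shiftedForm ω u = ∑ i ∈ s, Q i u)
    (hcover : ∀ e, ∀ t ∈ Set.Icc 0 (G.len e), ∃ i ∈ s, Covers (P i) e t)
    (hR : ℓ < ∑ i ∈ s, r i) (hm : ∑ i ∈ s, m i = G.totalLength) : Dichotomy G ω k := by
  choose! S hS using h
  have hfan : IsFan G ω ℓ s d Q m r P S c := ⟨hinj, hstar, hbase, hS, hform, hcover⟩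
  exact hfan.dichotomy hlf hfin hω hωℓ hℓ hk hR (hm.trans hL) hL

end Star

namespace Rooting

variable {I : Type v} {T : Rooting G I}

variable (T) in
/-- The interval `j` is contained in the pieces `P`. -/
def NodeIn (P : Set (Piece E)) (j : I) : Prop := ∀ t ∈ Set.Icc 0 (T.length j),
  Covers P (T.germ j).edge ((T.germ j).pos + (T.germ j).dir * t)

theorem NodeIn.mono {P P' : Set (Piece E)} {j : I} (h : T.NodeIn P j) (hP : P ⊆ P') :
    T.NodeIn P' j := fun t ht => (h t ht).mono hP

/-- Every subtree is a branch; the cut points are found by going from the leaves towards the root. -/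
theorem exists_branch [Countable I] (hlf : G.LocallyFinite) (hfin : G.FiniteLength) (hω : 0 < ω)
    (hωℓ : ω * ℓ = Real.pi / 2) (hℓ : 0 < ℓ) (i : I) : ∃ r P,
      IsBranch G ω ℓ (T.germ i) (T.form ω i) (T.mass i) r P ∧ ∀ j, T.Desc i j → T.NodeIn P j := by
  obtain ⟨N, hN⟩ := T.exists_mass_lt hℓ
  have hlight : ∀ i, N ≤ T.level i → ∃ r P,
      IsBranch G ω ℓ (T.germ i) (T.form ω i) (T.mass i) r P ∧ ∀ j, T.Desc i j → T.NodeIn P j :=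
    fun i hi => ⟨_, _, ⟨∅, isBranchWith_of_le hlf hω hωℓ (hN i hi).le⟩,
      fun j hj t ht => covers_pieces hj ht⟩
  -- induction on the number of levels between `i` and the level from which on subtrees are light
  have key : ∀ k i, N ≤ T.level i + k → ∃ r P,
      IsBranch G ω ℓ (T.germ i) (T.form ω i) (T.mass i) r P ∧ ∀ j, T.Desc i j → T.NodeIn P j := by
    intro k
    induction k with
    | zero => exact fun i hi => hlight i hi
    | succ k ih =>
      intro i hi
      have hc : ∀ c ∈ T.children (some i), ∃ r P,
          IsBranch G ω ℓ (T.germ c) (T.form ω c) (T.mass c) r P ∧ ∀ j, T.Desc c j → T.NodeIn P j := by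
        intro c hc
        refine ih c ?_
        rw [T.level_par (mem_children.1 hc)]
        omega
      choose! r P hB hcov using hc
      obtain ⟨r', P', h1, h2, h3⟩ := exists_branch_rev hlf hfin hω hωℓ hℓ hB
        (d₀ := (T.germ i).rev (T.length i))
        (fun c hc => by rw [T.base (mem_children.1 hc), germPt_rev, sub_zero]) (T.star i)
        (T.fits i).rev (T.length_pos i)
      rw [Germ.rev_rev] at h1
      refine ⟨r', P', h1.congr (fun u hu => ?_) (T.mass_eq i).symm, fun j hj => ?_⟩
      · rw [pieceForm_rev, T.form_eq hu]
      · rcases desc_iff.1 hj with rfl | ⟨c, hc, hcj⟩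
        · intro t ht
          have := h3 (T.length i - t) ⟨by linarith [ht.2], by linarith [ht.1]⟩
          simp only [Germ.rev] at this
          convert this using 1
          ring
        · exact (hcov c hc j hcj).mono (h2 c hc)
  exact key N i (by omega)

/-- The part of the graph outside the subtree at `i` is decomposed into branches that are attached
where `i` starts. -/
structure IsOuter {ι : Type*} (T : Rooting G I) (ω ℓ : ℝ) (i : I) (s : Finset ι) (d : ι → Germ E)
    (Q : ι → (G.Space → ℝ) → ℝ) (m r : ι → ℝ) (P : ι → Set (Piece E)) : Prop where
  star : IsStarWith G s d (T.germ i)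
  base : ∀ o ∈ s, G.germPt (d o) 0 = G.germPt (T.germ i) 0
  branch : ∀ o ∈ s, IsBranch G ω ℓ (d o) (Q o) (m o) (r o) (P o)
  form : ∀ u, G.MemH1 u → G.shiftedForm ω u = ∑ o ∈ s, Q o u + T.form ω i u
  mass : ∑ o ∈ s, m o + T.mass i = G.totalLength
  cover : ∀ j, T.Desc i j ∨ ∃ o ∈ s, T.NodeIn (P o) j

section Down

variable {ι : Type*} {i : I} {s : Finset ι} {d : ι → Germ E} {Q : ι → (G.Space → ℝ) → ℝ}
  {m r : ι → ℝ} {P : ι → Set (Piece E)}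

/-- If the subtree at `i` has more than the mass `ℓ` but the part beyond the interval `i` has less, a
fan is found at the point of the interval where the mass beyond is `ℓ`. -/
theorem IsOuter.dichotomy_of_sum_lt [Countable I] (h : T.IsOuter ω ℓ i s d Q m r P)
    (hlf : G.LocallyFinite) (hfin : G.FiniteLength) (hω : 0 < ω)
    (hωℓ : ω * ℓ = Real.pi / 2) (hℓ : 0 < ℓ) {k : ℕ} (hk : 2 ≤ k) (hL : G.totalLength = k * ℓ)
    (hi : ℓ < T.mass i) (hR : ∑ c ∈ T.children (some i), T.mass c < ℓ) : Dichotomy G ω k := by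
  classical
  set R := ∑ c ∈ T.children (some i), T.mass c with hRdef
  have hmi : T.mass i = T.length i + R := T.mass_eq i
  have hR0 : 0 ≤ R := Finset.sum_nonneg fun c _ => (T.mass_pos c).le
  -- the point at distance `a` from the start of `i` has exactly the mass `ℓ` beyond it
  obtain ⟨a, ha⟩ : ∃ a, a = T.length i - (ℓ - R) := ⟨_, rfl⟩
  have ha0 : 0 < a := by linarith
  have hb : 0 < ℓ - R := by linarith
  have hlen : T.length i = a + (ℓ - R) := by linarith
  have hfits : (T.germ i).Fits G (a + (ℓ - R)) := hlen ▸ T.fits i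
  obtain ⟨r', P', h1, h2, h3⟩ := exists_branch_rev hlf hfin hω hωℓ hℓ h.branch h.base
    (fun _ => h.star) (hfits.mono (c := a) ⟨ha0.le, by linarith⟩) ha0
  have hr' : 0 < r' := by
    obtain ⟨S, hS⟩ := h1
    exact hS.r_pos
  set D := (T.germ i).shift a with hD
  have hDf : D.Fits G (ℓ - R) := hfits.shift ha0.le hb.le
  have hfar : G.germPt (D.rev (ℓ - R)) 0 = G.germPt (T.germ i) (T.length i) := by
    rw [germPt_rev, sub_zero, hD, germPt_shift, hlen]
  have h4 := IsBranchWith.extend (s := T.children (some i)) (d := T.germ) (Q := T.form ω) (m := T.mass)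
    (r := T.mass) (P := T.pieces) (S := fun _ => ∅) (d₀ := D.rev (ℓ - R)) (b := ℓ - R) hω hωℓ
    (fun c hc => isBranchWith_of_le hlf hω hωℓ ((Finset.single_le_sum
      (fun j _ => (T.mass_pos j).le) hc).trans hR.le))
    (fun c hc => by rw [hfar, T.base (mem_children.1 hc)]) hDf.rev hb hR (by linarith)
  simp only [Germ.rev_rev, pieceForm_rev] at h4
  rw [← hRdef, add_sub_cancel] at h4
  have hst := isStarWith_shift hfits ha0 hb
  set P₁ := insert ((D.rev (ℓ - R)).piece (ℓ - R)) (⋃ c ∈ T.children (some i), T.pieces c) with hP₁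
  -- the fan consists of the two germs at that point: `none` leads away from the root, and has residual
  -- mass `ℓ`; `some ()` leads back, and has positive residual mass
  refine dichotomy_of_isBranch (s := Finset.insertNone {()})
    (d := fun o => o.elim D fun _ => (T.germ i).rev a)
    (Q := fun o => o.elim (fun u => G.pieceForm ω D (ℓ - R) u + ∑ c ∈ T.children (some i), T.form ω c u)
      fun _ u => G.pieceForm ω (T.germ i) a u + ∑ o ∈ s, Q o u)
    (m := fun o => o.elim (ℓ - R + R) fun _ => a + ∑ o ∈ s, m o)
    (r := fun o => o.elim ℓ fun _ => r') (P := fun o => o.elim P₁ fun _ => P')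
    (c := G.germPt (T.germ i) a) hlf hfin hω hωℓ hℓ hk hL hst.injOn_insertNone hst.star_insertNone
    ?_ ?_ ?_ ?_ ?_ ?_
  · rintro (_ | o) _
    · change G.germPt D 0 = _
      rw [hD, germPt_shift, add_zero]
    · change G.germPt ((T.germ i).rev a) 0 = _
      rw [germPt_rev, sub_zero]
  · rintro (_ | o) _
    · exact ⟨_, h4⟩
    · exact h1
  · intro u hu
    rw [Finset.sum_insertNone, Finset.sum_singleton, h.form u hu, T.form_eq hu, hlen,
      pieceForm_add hu hfits ha0.le hb.le]
    simp only [Option.elim]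
    ring
  · intro e t ht
    obtain ⟨j, rfl, τ, hτ, rfl⟩ := T.cover e t ht
    rcases h.cover j with hj | ⟨o, ho, hj⟩
    · rcases desc_iff.1 hj with rfl | ⟨c, hc, hcj⟩
      · rcases le_total τ a with hτa | hτa
        · exact ⟨some (), by simp, h3 τ ⟨hτ.1, hτa⟩⟩
        · refine ⟨none, by simp, ?_⟩
          have := covers_insert_piece hDf.rev hb (⋃ c ∈ T.children (some i), T.pieces c)
            (a + (ℓ - R) - τ) ⟨by linarith [hτ.2], by linarith⟩
          have e : (T.germ i).pos + (T.germ i).dir * τ = (D.rev (ℓ - R)).pos +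
              (D.rev (ℓ - R)).dir * (a + (ℓ - R) - τ) := by
            simp only [Germ.rev, hD, Germ.shift]
            ring
          rw [e]
          exact this
      · refine ⟨none, by simp, (covers_pieces hcj hτ).mono ?_⟩
        exact (Set.subset_biUnion_of_mem (u := fun c => T.pieces c) hc).trans (Set.subset_insert _ _)
    · exact ⟨some (), by simp, (hj τ hτ).mono (h2 o ho)⟩
  · rw [Finset.sum_insertNone, Finset.sum_singleton]
    simp only [Option.elim]
    linarith
  · rw [Finset.sum_insertNone, Finset.sum_singleton, ← h.mass]
    simp only [Option.elim]
    linarith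

end Down

/-- Starting from a subtree of mass more than `ℓ`, a suitable point for a fan is found by going down
the tree. -/
theorem IsOuter.dichotomy [Countable I] (hlf : G.LocallyFinite) (hfin : G.FiniteLength) (hω : 0 < ω)
    (hωℓ : ω * ℓ = Real.pi / 2) (hℓ : 0 < ℓ) {k : ℕ} (hk : 2 ≤ k) (hL : G.totalLength = k * ℓ)
    {N : ℕ} (hN : ∀ i, N ≤ T.level i → T.mass i < ℓ) (n : ℕ) : ∀ {ι : Type v} {i : I} {s : Finset ι}
    {d : ι → Germ E} {Q : ι → (G.Space → ℝ) → ℝ} {m r : ι → ℝ} {P : ι → Set (Piece E)},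
    T.IsOuter ω ℓ i s d Q m r P → ℓ < T.mass i → N ≤ T.level i + n → Dichotomy G ω k := by
  classical
  induction n with
  | zero =>
    intro ι i s d Q m r P _ hi hn
    exact absurd (hN i hn) hi.not_gt
  | succ n ih =>
    intro ι i s d Q m r P h hi hn
    rcases lt_or_ge (∑ c ∈ T.children (some i), T.mass c) ℓ with hR | hR
    · exact h.dichotomy_of_sum_lt hlf hfin hω hωℓ hℓ hk hL hi hR
    have hne : (T.children (some i)).Nonempty := by
      rw [Finset.nonempty_iff_ne_empty]
      intro he
      rw [he, Finset.sum_empty] at hR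
      linarith
    have hst := T.star i hne
    obtain ⟨r₀, P₀, h1, h2, h3⟩ := exists_branch_rev hlf hfin hω hωℓ hℓ h.branch h.base
      (fun _ => h.star) (T.fits i) (T.length_pos i)
    have hr₀ : 0 < r₀ := by
      obtain ⟨S, hS⟩ := h1
      exact hS.r_pos
    set d' : Option I → Germ E := fun o => o.elim ((T.germ i).rev (T.length i)) T.germ with hd'
    set Q' : Option I → (G.Space → ℝ) → ℝ := fun o => o.elim
      (fun u => G.pieceForm ω (T.germ i) (T.length i) u + ∑ o ∈ s, Q o u) (T.form ω) with hQ'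
    set m' : Option I → ℝ := fun o => o.elim (T.length i + ∑ o ∈ s, m o) T.mass with hm'
    set s' := Finset.insertNone (T.children (some i)) with hs'
    have hbase : ∀ o ∈ s', G.germPt (d' o) 0 = G.germPt (T.germ i) (T.length i) := by
      rintro (_ | c) hc
      · change G.germPt ((T.germ i).rev _) 0 = _
        rw [germPt_rev, sub_zero]
      · exact T.base (mem_children.1 (by simpa [hs'] using hc))
    have hform : ∀ u, G.MemH1 u → G.shiftedForm ω u = ∑ o ∈ s', Q' o u := by
      intro u hu
      rw [hs', Finset.sum_insertNone, h.form u hu, T.form_eq hu]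
      simp only [hQ', Option.elim]
      ring
    have hmass : ∑ o ∈ s', m' o = G.totalLength := by
      rw [hs', Finset.sum_insertNone, ← h.mass, T.mass_eq i]
      simp only [hm', Option.elim]
      ring
    have hcov : ∀ {P' : I → Set (Piece E)}, (∀ c ∈ T.children (some i), ∀ j, T.Desc c j →
        T.NodeIn (P' c) j) → ∀ j, T.NodeIn P₀ j ∨ ∃ c ∈ T.children (some i), T.Desc c j ∧
          T.NodeIn (P' c) j := by
      intro P' hP' j
      rcases h.cover j with hj | ⟨o, ho, hj⟩
      · rcases desc_iff.1 hj with rfl | ⟨c, hc, hcj⟩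
        · exact Or.inl h3
        · exact Or.inr ⟨c, hc, hcj, hP' c hc j hcj⟩
      · exact Or.inl (hj.mono (h2 o ho))
    -- descend into a child of mass more than `ℓ`, if there is one, counting everything else as outer part;
    -- otherwise all children are light, and the far end of `i` is the centre of a fan
    by_cases hheavy : ∃ c ∈ T.children (some i), ℓ < T.mass c
    · obtain ⟨c, hc, hcm⟩ := hheavy
      have hup := fun i => T.exists_branch hlf hfin hω hωℓ hℓ i
      choose r' P' hB hPc using hup
      have hcs : some c ∈ s' := by simpa [hs'] using hc
      refine ih (i := c) (s := s'.erase (some c)) (d := d') (Q := Q') (m := m')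
        (r := fun o => o.elim r₀ r') (P := fun o => o.elim P₀ P') ⟨?_, ?_, ?_, ?_, ?_, ?_⟩ hcm ?_
      · exact isStarWith_erase hst.injOn_insertNone hst.star_insertNone hcs
      · intro o ho
        rw [hbase o (Finset.mem_of_mem_erase ho), T.base (mem_children.1 hc)]
      · rintro (_ | c') _
        · exact h1
        · exact hB c'
      · intro u hu
        rw [hform u hu, ← Finset.sum_erase_add _ _ hcs]
        rfl
      · rw [← hmass, ← Finset.sum_erase_add _ _ hcs]
        rfl
      · intro j
        rcases hcov (fun c _ => hPc c) j with hj | ⟨c', hc', hd, hj⟩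
        · exact Or.inr ⟨none, by simp [hs'], hj⟩
        · by_cases hcc : c' = c
          · exact Or.inl (hcc ▸ hd)
          · exact Or.inr ⟨some c', by simp [hs', hcc, hc'], hj⟩
      · rw [T.level_par (mem_children.1 hc)]
        omega
    · push Not at hheavy
      refine dichotomy_of_isBranch (s := s') (d := d') (Q := Q') (m := m')
        (r := fun o => o.elim r₀ T.mass) (P := fun o => o.elim P₀ T.pieces) hlf hfin hω hωℓ hℓ hk hL
        hst.injOn_insertNone hst.star_insertNone hbase ?_ hform ?_ ?_ hmass
      · rintro (_ | c) hc
        · exact h1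
        · exact ⟨∅, isBranchWith_of_le hlf hω hωℓ (hheavy c (by simpa [hs'] using hc))⟩
      · intro e t ht
        obtain ⟨j, rfl, τ, hτ, rfl⟩ := T.cover e t ht
        rcases hcov (P' := T.pieces) (fun c _ j hj t ht => covers_pieces hj ht) j with
          hj | ⟨c, hc, _, hj⟩
        · exact ⟨none, by simp [hs'], hj τ hτ⟩
        · exact ⟨some c, by simpa [hs'] using hc, hj τ hτ⟩
      · rw [hs', Finset.sum_insertNone]
        simp only [Option.elim]
        linarith

/-- The dichotomy for a graph with a rooted decomposition. -/
theorem dichotomy [Countable I] (T : Rooting G I) (hlf : G.LocallyFinite) (hfin : G.FiniteLength)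
    (hω : 0 < ω) (hωℓ : ω * ℓ = Real.pi / 2) (hℓ : 0 < ℓ) {k : ℕ} (hk : 2 ≤ k)
    (hL : G.totalLength = k * ℓ) : Dichotomy G ω k := by
  classical
  obtain ⟨N, hN⟩ := T.exists_mass_lt hℓ
  have hcoe : ((T.children none : Finset I) : Set I) = {i | T.par i = none} := by
    ext i
    simp [mem_children]
  have hinj : Set.InjOn T.germ (T.children none) := hcoe ▸ T.root_injOn
  have hstar : G.IsStar (T.germ '' (T.children none)) := hcoe ▸ T.root_star
  have hform : ∀ u, G.MemH1 u → G.shiftedForm ω u = ∑ i ∈ T.children none, T.form ω i u := by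
    intro u hu
    rw [← (T.hasSum_form ω u hu).tsum_eq]
    exact (sum_descSum_root (summable_pieceForm ω hu)).symm
  have hmass : ∑ i ∈ T.children none, T.mass i = G.totalLength := by
    rw [← T.hasSum_length.tsum_eq]
    exact sum_descSum_root T.hasSum_length.summable
  -- if all subtrees at the root are light, the root itself is the centre of a fan, since `ℓ < k ℓ`
  by_cases hheavy : ∃ c ∈ T.children none, ℓ < T.mass c
  · obtain ⟨c, hc, hcm⟩ := hheavy
    have hup := fun i => T.exists_branch hlf hfin hω hωℓ hℓ i
    choose r P hB hP using hup
    refine IsOuter.dichotomy hlf hfin hω hωℓ hℓ hk hL hN N (i := c) (s := (T.children none).erase c)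
      (d := T.germ) (Q := T.form ω) (m := T.mass) (r := r) (P := P) ⟨isStarWith_erase hinj hstar hc,
        fun o ho => T.root_base (mem_children.1 (Finset.mem_of_mem_erase ho)) (mem_children.1 hc),
        fun o _ => hB o, fun u hu => ?_, ?_, fun j => ?_⟩ hcm (by omega)
    · rw [hform u hu, ← Finset.sum_erase_add _ _ hc]
    · rw [← hmass, ← Finset.sum_erase_add _ _ hc]
    · obtain ⟨c', hc', hj⟩ := T.exists_root_desc j
      by_cases hcc : c' = c
      · exact Or.inl (hcc ▸ hj)
      · exact Or.inr ⟨c', Finset.mem_erase.2 ⟨hcc, hc'⟩, hP c' j hj⟩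
  · push Not at hheavy
    have hR : ℓ < ∑ i ∈ T.children none, T.mass i := by
      rw [hmass, hL]
      have : (2 : ℝ) ≤ k := by exact_mod_cast hk
      nlinarith
    have hne : (T.children none).Nonempty := by
      rw [Finset.nonempty_iff_ne_empty]
      intro he
      rw [he, Finset.sum_empty] at hR
      linarith
    obtain ⟨c, hc⟩ := hne
    refine dichotomy_of_isBranch (s := T.children none) (d := T.germ) (Q := T.form ω) (m := T.mass)
      (r := T.mass) (P := T.pieces) hlf hfin hω hωℓ hℓ hk hL hinj hstar
      (fun i hi => T.root_base (mem_children.1 hi) (mem_children.1 hc))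
      (fun i hi => ⟨∅, isBranchWith_of_le hlf hω hωℓ (hheavy i hi)⟩) hform (fun e t ht => ?_) hR hmass
    obtain ⟨j, rfl, τ, hτ, rfl⟩ := T.cover e t ht
    obtain ⟨c', hc', hj⟩ := T.exists_root_desc j
    exact ⟨c', hc', covers_pieces hj hτ⟩

end Rooting

end

section

/-! ### The breadth-first tree -/

variable {E : Type*} {G : MetricGraph E}

/-- The vertex at an endpoint of an edge. -/
def vtx (G : MetricGraph E) (i : E × Bool) : G.Vertex := Quotient.mk G.glue i

/-- The other endpoint of the same edge. -/
def flip (i : E × Bool) : E × Bool := (i.1, !i.2)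

theorem flip_flip (i : E × Bool) : flip (flip i) = i := by
  simp [flip]

theorem vtx_eq_iff {i j : E × Bool} : G.vtx i = G.vtx j ↔ G.glue i j := Quotient.eq

/-- The vertex `v` is reached from `r` along at most `n` edges. -/
def ReachedIn (G : MetricGraph E) (r : G.Vertex) : ℕ → G.Vertex → Prop
  | 0, v => v = r
  | n + 1, v => ReachedIn G r n v ∨ ∃ i, G.vtx i = v ∧ ReachedIn G r n (G.vtx (flip i))

/-- Finite distance is witnessed by a chain of finite length, which runs through adjacent edges. -/
theorem exists_reachedIn (hconn : G.Connected) (i₀ i : E × Bool) :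
    ∃ n, ReachedIn G (G.vtx i₀) n (G.vtx i) := by
  have hflip : ∀ i, (∃ n, ReachedIn G (G.vtx i₀) n (G.vtx i)) →
      ∃ n, ReachedIn G (G.vtx i₀) n (G.vtx (flip i)) := by
    rintro i ⟨n, hn⟩
    exact ⟨n + 1, Or.inr ⟨flip i, rfl, by rwa [flip_flip]⟩⟩
  have hedge : ∀ i j : E × Bool, i.1 = j.1 → (∃ n, ReachedIn G (G.vtx i₀) n (G.vtx i)) →
      ∃ n, ReachedIn G (G.vtx i₀) n (G.vtx j) := by
    rintro ⟨e, b⟩ ⟨f, c⟩ (rfl : e = f) h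
    by_cases hbc : b = c
    · exact hbc ▸ h
    · have := hflip _ h
      have e1 : flip (e, b) = (e, c) := by
        cases b <;> cases c <;> simp_all [flip]
      rwa [e1] at this
  -- the edge that contains a point of the disjoint union has a vertex that is reached
  set R : G.EdgePoint → Prop := fun p => ∃ n, ReachedIn G (G.vtx i₀) n (G.vtx (p.1, false)) with hR
  have hspace : ∀ p q : G.EdgePoint, G.toSpace p = G.toSpace q → R p → R q := by
    intro p q hpq hp
    rcases Quotient.exact hpq with rfl | ⟨a, b, hab, rfl, rfl⟩
    · exact hp
    · have h1 := hedge (a.1, false) a rfl hp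
      rw [vtx_eq_iff.2 hab] at h1
      exact hedge b (b.1, false) rfl h1
  have hlt : G.gdist (G.toSpace (G.endpoint i₀)) (G.toSpace (G.endpoint i)) < ⊤ := hconn _ _
  unfold gdist at hlt
  rw [sInf_lt_iff] at hlt
  obtain ⟨_, ⟨n, a, b, hchain, rfl⟩, hlt⟩ := hlt
  have hab : ∀ m ≤ n, (a m).1 = (b m).1 := by
    intro m hm
    by_contra hne
    have h1 := ENNReal.sum_lt_top.1 hlt m (Finset.mem_range.2 (by omega))
    rw [edgeDist, if_neg hne] at h1
    exact lt_irrefl _ h1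
  have hb : ∀ m ≤ n, R (b m) := by
    intro m
    induction m with
    | zero =>
      intro hm
      have h1 : R (a 0) := hspace _ _ hchain.start.symm (hedge i₀ (i₀.1, false) rfl ⟨0, rfl⟩)
      rwa [hR, hab 0 hm] at h1
    | succ m ih =>
      intro hm
      have h1 := hspace _ _ (hchain.link m (by omega)) (ih (by omega))
      rwa [hR, hab _ hm] at h1
  have h1 := hspace _ _ hchain.finish (hb n le_rfl)
  exact hedge (i.1, false) i rfl h1

/-- The combinatorial distance from a vertex, and for each other vertex an edge endpoint there whose
edge leads closer to that vertex. -/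
theorem exists_level (hconn : G.Connected) (i₀ : E × Bool) :
    ∃ (lev : G.Vertex → ℕ) (pv : G.Vertex → Option (E × Bool)),
      (∀ v, pv v = none ↔ v = G.vtx i₀) ∧
      ∀ v i, pv v = some i → G.vtx i = v ∧ lev v = lev (G.vtx (flip i)) + 1 := by
  classical
  have hex : ∀ v : G.Vertex, ∃ n, ReachedIn G (G.vtx i₀) n v := by
    intro v
    induction v using Quotient.inductionOn with
    | _ i => exact exists_reachedIn hconn i₀ i
  set lev : G.Vertex → ℕ := fun v => Nat.find (hex v) with hlev
  have hstep : ∀ v, v ≠ G.vtx i₀ → ∃ i, G.vtx i = v ∧ lev v = lev (G.vtx (flip i)) + 1 := by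
    intro v hv
    have h1 := Nat.find_spec (hex v)
    obtain ⟨n, hn⟩ : ∃ n, lev v = n + 1 := by
      refine Nat.exists_eq_succ_of_ne_zero fun h0 => hv ?_
      rw [show Nat.find (hex v) = 0 from h0] at h1
      exact h1
    rw [show Nat.find (hex v) = n + 1 from hn] at h1
    rcases h1 with h1 | ⟨i, hi, h1⟩
    · exact absurd h1 (Nat.find_min (hex v) (by change n < lev v; omega))
    · refine ⟨i, hi, ?_⟩
      have h2 : lev (G.vtx (flip i)) ≤ n := Nat.find_min' _ h1
      have h3 : lev v ≤ lev (G.vtx (flip i)) + 1 :=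
        Nat.find_min' _ (Or.inr ⟨i, hi, Nat.find_spec (hex (G.vtx (flip i)))⟩)
      omega
  have : Nonempty (E × Bool) := ⟨i₀⟩
  choose! p hp using hstep
  refine ⟨lev, fun v => if v = G.vtx i₀ then none else some (p v), fun v => ?_, fun v i hvi => ?_⟩
  · by_cases hv : v = G.vtx i₀ <;> simp [hv]
  · by_cases hv : v = G.vtx i₀
    · simp [hv] at hvi
    · simp only [hv, if_false, Option.some.injEq] at hvi
      rw [← hvi]
      exact hp v hv

theorem vertexGerm_rev_false (e : E) :
    (vertexGerm G (e, false)).rev (G.len e / 2) = ⟨e, G.len e / 2, -1⟩ := by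
  simp [vertexGerm, Germ.rev, epos]

theorem vertexGerm_rev_true (e : E) :
    (vertexGerm G (e, true)).rev (G.len e / 2) = ⟨e, G.len e / 2, 1⟩ := by
  simp only [vertexGerm, Germ.rev, epos, Germ.mk.injEq, true_and, if_true, neg_neg, and_true]
  ring

theorem half_fits (i : E × Bool) : (vertexGerm G i).Fits G (G.len i.1 / 2) :=
  vertexGerm_fits i (by linarith [G.len_pos i.1]) (by linarith [G.len_pos i.1])

theorem hasSum_prod_bool {f : E × Bool → ℝ} {a b : ℝ} (ha : HasSum (fun e => f (e, false)) a)
    (hb : HasSum (fun e => f (e, true)) b) : HasSum f (a + b) := by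
  let φ : E ⊕ E ≃ E × Bool := (Equiv.boolProdEquivSum E).symm.trans (Equiv.prodComm _ _)
  rw [← φ.hasSum_iff]
  exact HasSum.sum ha hb

/-- The shifted form is the sum of the contributions of all halves of edges. -/
theorem hasSum_half_form (ω : ℝ) {u : G.Space → ℝ} (hu : G.MemH1 u) :
    HasSum (fun i : E × Bool => G.pieceForm ω (vertexGerm G i) (G.len i.1 / 2) u)
      (G.shiftedForm ω u) := by
  have hsum : Summable fun e => ∫ x, (deriv (G.onEdge u e) x ^ 2 + ω ^ 2 * G.onEdge u e x ^ 2)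
      ∂(G.edgeMeasure e) := by
    refine (hu.summable_deriv_sq.add (hu.summable_sq.mul_left (ω ^ 2))).congr fun e => ?_
    rw [integral_add (hu.integrable_deriv_sq e) ((hu.integrable_sq e).const_mul _),
      integral_const_mul]
  have hbound : ∀ b : Bool, Summable fun e : E =>
      G.pieceForm ω (vertexGerm G (e, b)) (G.len e / 2) u := by
    intro b
    refine Summable.of_norm_bounded hsum fun e => ?_
    have hf := half_fits (G := G) (e, b)
    unfold pieceForm
    rw [norm_mul]
    have h1 : ‖(vertexGerm G (e, b)).dir‖ = 1 := by
      rcases hf.dir with h | h <;> rw [h] <;> simp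
    rw [h1, one_mul]
    refine (intervalIntegral.norm_integral_le_integral_norm_uIoc).trans ?_
    have hint := (hu.integrable_deriv_sq e).add ((hu.integrable_sq e).const_mul (ω ^ 2))
    have hsub : Set.uIoc (vertexGerm G (e, b)).pos ((vertexGerm G (e, b)).pos +
        (vertexGerm G (e, b)).dir * (G.len e / 2)) ⊆ Set.Icc 0 (G.len e) :=
      Set.uIoc_subset_uIcc.trans (Set.uIcc_subset_Icc hf.pos_mem hf.end_mem)
    refine le_trans ?_ (setIntegral_mono_set hint (Eventually.of_forall fun x => ?_) hsub.eventuallyLE)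
    · refine integral_mono_of_nonneg (Eventually.of_forall fun x => norm_nonneg _)
        (hint.mono_measure (Measure.restrict_mono hsub le_rfl)) (Eventually.of_forall fun x => ?_)
      simp only [Real.norm_eq_abs]
      refine (abs_sub _ _).trans (le_of_eq ?_)
      rw [abs_of_nonneg (sq_nonneg _), abs_of_nonneg (by positivity)]
      rfl
    · simp only [Pi.zero_apply]
      positivity
  have hpair : ∀ e, G.pieceForm ω (vertexGerm G (e, false)) (G.len e / 2) u +
      G.pieceForm ω (vertexGerm G (e, true)) (G.len e / 2) u =
      ∫ x in (0 : ℝ)..(G.len e), (deriv (G.onEdge u e) x ^ 2 - ω ^ 2 * G.onEdge u e x ^ 2) := by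
    intro e
    have hl := G.len_pos e
    have h1 := pieceForm_add (ω := ω) hu (d := vertexGerm G (e, false)) (a := G.len e / 2)
      (b := G.len e / 2) (vertexGerm_fits _ (by linarith) (by simp)) (by linarith) (by linarith)
    have h2 : (vertexGerm G (e, false)).shift (G.len e / 2) =
        (vertexGerm G (e, true)).rev (G.len e / 2) := by
      rw [vertexGerm_rev_true]
      simp [vertexGerm, Germ.shift, epos]
    rw [h2, pieceForm_rev, add_halves] at h1
    rw [← h1]
    simp [pieceForm, vertexGerm, epos]
  have h1 := (hbound false).hasSum.add (hbound true).hasSum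
  simp only [hpair] at h1
  rw [(hu.hasSum_shiftedForm ω).unique h1]
  exact hasSum_prod_bool (hbound false).hasSum (hbound true).hasSum

/-- A locally finite connected graph of finite length has a rooted decomposition into halves of edges.
At each vertex other than the root, one half edge of a breadth-first tree leads to it, and all others
start there. -/
theorem exists_rooting (hlf : G.LocallyFinite) (hconn : G.Connected) (hfin : G.FiniteLength) (e₀ : E) :
    Nonempty (Rooting G (E × Bool)) := by
  classical
  obtain ⟨lev, pv, hroot, hpv⟩ := exists_level hconn (e₀, false)
  -- `i` is the half edge that leads to its vertex
  set inw : E × Bool → Prop := fun i => pv (G.vtx i) = some i with hinw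
  have inw_of_pv : ∀ {v i}, pv v = some i → inw i := fun {v i} h => by
    have := (hpv v i h).1
    rw [hinw]
    beta_reduce
    rw [this, h]
  have inw_level : ∀ {i}, inw i → lev (G.vtx i) = lev (G.vtx (flip i)) + 1 := fun h => (hpv _ _ h).2
  have not_inw_flip : ∀ {i}, inw i → ¬inw (flip i) := by
    intro i h h'
    have h1 := inw_level h
    have h2 := inw_level h'
    rw [flip_flip] at h2
    omega
  set germ : E × Bool → Germ E := fun i =>
    if inw i then (vertexGerm G i).rev (G.len i.1 / 2) else vertexGerm G i with hgerm
  set par : E × Bool → Option (E × Bool) := fun i => if inw i then some (flip i) else pv (G.vtx i)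
    with hpar
  have germ_inw : ∀ {i}, inw i → germ i = (vertexGerm G i).rev (G.len i.1 / 2) := fun h => if_pos h
  have germ_out : ∀ {i}, ¬inw i → germ i = vertexGerm G i := fun h => if_neg h
  have fits : ∀ i, (germ i).Fits G (G.len i.1 / 2) := by
    intro i
    by_cases h : inw i
    · rw [germ_inw h]
      exact (half_fits i).rev
    · rw [germ_out h]
      exact half_fits i
  -- the half edges that continue `i`
  have par_inw : ∀ {i j}, inw i → (par j = some i ↔ G.glue j i ∧ j ≠ i) := by
    intro i j hi
    by_cases hj : inw j
    · have h1 : par j = some (flip j) := if_pos hj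
      rw [h1]
      constructor
      · intro h
        have h2 := Option.some.inj h
        rw [← h2] at hi
        exact absurd hi (not_inw_flip hj)
      · rintro ⟨h, hne⟩
        refine absurd ?_ hne
        have h2 : pv (G.vtx j) = some j := hj
        rw [vtx_eq_iff.2 h, show pv (G.vtx i) = some i from hi] at h2
        exact (Option.some.inj h2).symm
    · have h1 : par j = pv (G.vtx j) := if_neg hj
      rw [h1]
      constructor
      · intro h
        refine ⟨vtx_eq_iff.1 (hpv _ _ h).1.symm, ?_⟩
        rintro rfl
        exact hj hi
      · rintro ⟨h, _⟩
        rw [vtx_eq_iff.2 h]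
        exact hi
  have par_out : ∀ {i j}, ¬inw i → (par j = some i ↔ inw j ∧ flip j = i) := by
    intro i j hi
    by_cases hj : inw j
    · have h1 : par j = some (flip j) := if_pos hj
      rw [h1, Option.some.injEq]
      simp [hj]
    · have h1 : par j = pv (G.vtx j) := if_neg hj
      rw [h1]
      exact ⟨fun h => absurd (inw_of_pv h) hi, fun h => absurd h.1 hj⟩
  have par_none : ∀ {j}, par j = none ↔ G.glue j (e₀, false) := by
    intro j
    by_cases hj : inw j
    · have h1 : par j = some (flip j) := if_pos hj
      rw [h1]
      constructor
      · intro h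
        cases h
      · intro h
        have h2 := (hroot (G.vtx j)).2 (vtx_eq_iff.2 h)
        rw [show pv (G.vtx j) = some j from hj] at h2
        cases h2
    · have h1 : par j = pv (G.vtx j) := if_neg hj
      rw [h1, hroot, vtx_eq_iff]
  have out_of_none : ∀ {j}, par j = none → germ j = vertexGerm G j := by
    intro j hj
    refine germ_out fun h => ?_
    have h1 : par j = some (flip j) := if_pos h
    rw [h1] at hj
    cases hj
  have out_of_glue : ∀ {i j}, inw i → G.glue j i ∧ j ≠ i → germ j = vertexGerm G j := by
    intro i j hi hj
    refine germ_out fun h => hj.2 ?_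
    have h2 : pv (G.vtx j) = some j := h
    rw [vtx_eq_iff.2 hj.1, show pv (G.vtx i) = some i from hi] at h2
    exact (Option.some.inj h2).symm
  have finite_par : ∀ o, {i | par i = o}.Finite := by
    rintro (_ | i)
    · simp only [par_none]
      exact hlf.finite_glue _
    · by_cases hi : inw i
      · simp only [par_inw hi]
        exact (hlf.finite_glue i).subset fun j hj => hj.1
      · simp only [par_out hi]
        refine (Set.finite_singleton (flip i)).subset fun j hj => ?_
        rw [Set.mem_singleton_iff, ← hj.2, flip_flip]
  -- the level counts half edges: those that start at a vertex of level `n` have level `2 n`, the one that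
  -- leads to it has level `2 n - 1`
  refine ⟨⟨germ, fun i => G.len i.1 / 2, par,
    fun i => if inw i then 2 * lev (G.vtx i) - 1 else 2 * lev (G.vtx i),
    fun i => by linarith [G.len_pos i.1], fits, ?_, finite_par, ?_, ?_, ?_, ?_, ?_, ?_, ?_, ?_⟩⟩
  · intro i j hj
    by_cases hi : inw i
    · have h1 := (par_inw hi).1 hj
      have h2 : ¬inw j := by
        intro h
        have h2 : pv (G.vtx j) = some j := h
        rw [vtx_eq_iff.2 h1.1, show pv (G.vtx i) = some i from hi] at h2
        exact h1.2 (Option.some.inj h2).symm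
      have h3 := inw_level hi
      simp only [if_pos hi, if_neg h2, vtx_eq_iff.2 h1.1]
      omega
    · obtain ⟨h1, rfl⟩ := (par_out hi).1 hj
      have h3 := inw_level h1
      simp only [if_pos h1, if_neg hi]
      omega
  · intro i j hj
    by_cases hi : inw i
    · have h1 := (par_inw hi).1 hj
      rw [out_of_glue hi h1, germ_inw hi, germPt_rev, sub_self, germPt_vertexGerm_zero,
        germPt_vertexGerm_zero]
      exact pt_eq_pt_of_glue h1.1
    · obtain ⟨h1, rfl⟩ := (par_out hi).1 hj
      rw [germ_inw h1, germ_out hi, germPt_rev, sub_zero]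
      obtain ⟨e, b⟩ := j
      cases b <;> simp only [germPt, vertexGerm, flip, epos] <;> congr 1 <;> simp <;> ring
  · intro i hne
    have hmem : ∀ j, j ∈ (finite_par (some i)).toFinset ↔ par j = some i := fun j => by simp
    by_cases hi : inw i
    · have hg : ∀ j, par j = some i → germ j = vertexGerm G j := fun j hj =>
        out_of_glue hi ((par_inw hi).1 hj)
      have h0 : (germ i).rev (G.len i.1 / 2) = vertexGerm G i := by
        rw [germ_inw hi, Germ.rev_rev]
      refine ⟨fun a ha b hb hab => ?_, ?_, Or.inl ⟨i, ?_⟩⟩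
      · have ha := (hmem a).1 ha
        have hb := (hmem b).1 hb
        rw [hg a ha, hg b hb] at hab
        exact vertexGerm_injective hab
      · rintro ⟨j, hj, he⟩
        have hj := (hmem j).1 hj
        rw [hg j hj, h0] at he
        exact ((par_inw hi).1 hj).2 (vertexGerm_injective he)
      · ext x
        simp only [Set.mem_insert_iff, Set.mem_image, Finset.mem_coe, hmem, Set.mem_ofPred_eq]
        constructor
        · rintro (rfl | ⟨j, hj, rfl⟩)
          · exact ⟨i, G.glue.refl i, h0.symm⟩
          · exact ⟨j, ((par_inw hi).1 hj).1, (hg j hj).symm⟩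
        · rintro ⟨j, hj, rfl⟩
          by_cases hji : j = i
          · exact Or.inl (by rw [hji, h0])
          · have hj' := (par_inw hi).2 ⟨hj, hji⟩
            exact Or.inr ⟨j, hj', hg j hj'⟩
    · obtain ⟨j, hj⟩ := hne
      obtain ⟨hjin, rfl⟩ := (par_out hi).1 ((hmem j).1 hj)
      have hs : (finite_par (some (flip j))).toFinset = {j} := by
        ext c
        rw [hmem, par_out hi, Finset.mem_singleton]
        constructor
        · rintro ⟨_, h⟩
          rw [← flip_flip c, h, flip_flip]
        · rintro rfl
          exact ⟨hjin, rfl⟩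
      have hl := G.len_pos j.1
      have hmid : G.len j.1 / 2 ∈ Set.Ioo 0 (G.len j.1) := ⟨by linarith, by linarith⟩
      rw [hs]
      obtain ⟨e, b⟩ := j
      refine ⟨by simp, ?_, Or.inr ⟨e, _, hmid, ?_⟩⟩
      · rintro ⟨c, hc, h⟩
        rw [Finset.coe_singleton, Set.mem_singleton_iff] at hc
        subst hc
        rw [germ_inw hjin, germ_out hi] at h
        have h1 := congrArg Germ.dir h
        cases b <;> simp [Germ.rev, vertexGerm, flip] at h1 <;> norm_num at h1
      · rw [Finset.coe_singleton, Set.image_singleton, germ_inw hjin, germ_out hi]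
        cases b
        · change ({(vertexGerm G (e, true)).rev (G.len e / 2),
            (vertexGerm G (e, false)).rev (G.len e / 2)} : Set (Germ E)) = _
          rw [vertexGerm_rev_true, vertexGerm_rev_false]
        · change ({(vertexGerm G (e, false)).rev (G.len e / 2),
            (vertexGerm G (e, true)).rev (G.len e / 2)} : Set (Germ E)) = _
          rw [vertexGerm_rev_true, vertexGerm_rev_false]
          exact Set.pair_comm _ _
  · intro i j hi hj
    rw [out_of_none hi, out_of_none hj, germPt_vertexGerm_zero, germPt_vertexGerm_zero]
    exact pt_eq_pt_of_glue (G.glue.trans (par_none.1 hi) (G.glue.symm (par_none.1 hj)))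
  · intro i hi j hj hij
    rw [out_of_none hi, out_of_none hj] at hij
    exact vertexGerm_injective hij
  · refine Or.inl ⟨(e₀, false), ?_⟩
    ext x
    constructor
    · rintro ⟨j, hj, rfl⟩
      exact ⟨j, par_none.1 hj, (out_of_none hj).symm⟩
    · rintro ⟨j, hj, rfl⟩
      exact ⟨j, par_none.2 hj, out_of_none (par_none.2 hj)⟩
  · have h1 : HasSum (fun e => G.len e / 2) (G.totalLength / 2) :=
      Summable.hasSum hfin |>.div_const 2
    have h2 := hasSum_prod_bool (f := fun i : E × Bool => G.len i.1 / 2) h1 h1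
    rwa [add_halves] at h2
  · intro ω u hu
    convert! hasSum_half_form ω hu using 2 with i
    by_cases h : inw i
    · rw [germ_inw h, pieceForm_rev]
    · rw [germ_out h]
  · intro e t ht
    have key : ∀ b, ∀ τ ∈ Set.Icc 0 (G.len e / 2), (vertexGerm G (e, b)).pos +
        (vertexGerm G (e, b)).dir * τ = t → ∃ i, (germ i).edge = e ∧
        ∃ τ ∈ Set.Icc 0 (G.len i.1 / 2), (germ i).pos + (germ i).dir * τ = t := by
      intro b τ hτ h
      by_cases hi : inw (e, b)
      · refine ⟨(e, b), by rw [germ_inw hi]; rfl, G.len e / 2 - τ,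
          ⟨by linarith [hτ.2], by linarith [hτ.1]⟩, ?_⟩
        rw [germ_inw hi, ← h]
        simp only [Germ.rev]
        ring
      · exact ⟨(e, b), by rw [germ_out hi]; rfl, τ, hτ, by rw [germ_out hi, h]⟩
    rcases le_total t (G.len e / 2) with h | h
    · exact key false t ⟨ht.1, h⟩ (by simp [vertexGerm, epos])
    · exact key true (G.len e - t) ⟨by linarith [ht.2], by linarith⟩ (by simp [vertexGerm, epos])

end

section

/-! ### The energy space -/

variable {E : Type*} {G : MetricGraph E} {u v : G.Space → ℝ}

/-- A function in `H¹` is determined by its class in `L²`. -/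
theorem Represents.function_eq {f : G.L2} (hf : G.Represents f u) (hf' : G.Represents f v)
    (hu : G.MemH1 u) (hv : G.MemH1 v) : u = v := by
  funext p
  obtain ⟨e, t, ht, rfl⟩ := exists_pt p
  have h := Measure.eqOn_Icc_of_ae_eq volume (G.len_pos e).ne ((hf e).symm.trans (hf' e))
    (hu.continuous_onEdge e).continuousOn (hv.continuous_onEdge e).continuousOn ht
  simpa only [onEdge_eq] using h

/-- The pairs `(f, f')` of functions in `H¹` and their derivatives, as a subspace of the Hilbert space
`L² × L²`. -/
def energySpace (G : MetricGraph E) : Submodule ℝ (WithLp 2 (G.L2 × G.L2)) where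
  carrier := {z | ∃ u, G.MemH1 u ∧ G.Represents z.fst u ∧ G.RepresentsDeriv z.snd u}
  add_mem' := by
    rintro y z ⟨u, h1, h2, h3⟩ ⟨v, h4, h5, h6⟩
    exact ⟨_, h1.add h4, h2.add h5, h3.add h6 h1 h4⟩
  zero_mem' := by
    refine ⟨fun _ => 0, ?_, ?_, ?_⟩
    · refine ⟨continuous_const, fun e => ?_, fun e => ?_, ?_⟩
      · exact (LipschitzWith.const (0 : ℝ)).lipschitzOnWith.absolutelyContinuousOnInterval
      · have : deriv (G.onEdge (fun _ => (0 : ℝ)) e) = fun _ => 0 := by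
          funext x
          exact deriv_const x 0
        rw [this]
        exact MemLp.zero'
      · have : ∀ e, deriv (G.onEdge (fun _ => (0 : ℝ)) e) = fun _ => 0 := by
          intro e
          funext x
          exact deriv_const x 0
        simp [this, onEdge, summable_zero]
    · intro e
      exact Lp.coeFn_zero _ _ _
    · intro e
      refine (Lp.coeFn_zero _ _ _).trans (Eventually.of_forall fun x => ?_)
      exact (deriv_const x (0 : ℝ)).symm
  smul_mem' := by
    rintro c z ⟨u, h1, h2, h3⟩
    exact ⟨_, h1.const_mul c, h2.smul c, h3.smul c⟩

/-- The function that belongs to an element of the energy space. -/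
def toFunction (G : MetricGraph E) : G.energySpace →ₗ[ℝ] G.Space → ℝ where
  toFun z := z.2.choose
  map_add' y z := by
    have hy := y.2.choose_spec
    have hz := z.2.choose_spec
    have hyz := (y + z).2.choose_spec
    exact hyz.2.1.function_eq (hy.2.1.add hz.2.1) hyz.1 (hy.1.add hz.1)
  map_smul' c z := by
    have hz := z.2.choose_spec
    have hcz := (c • z).2.choose_spec
    exact hcz.2.1.function_eq (hz.2.1.smul c) hcz.1 (hz.1.const_mul c)

section Basic

variable (z y : G.energySpace)

theorem memH1_toFunction : G.MemH1 (G.toFunction z) := z.2.choose_spec.1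

theorem represents_toFunction : G.Represents z.1.fst (G.toFunction z) := z.2.choose_spec.2.1

theorem representsDeriv_toFunction : G.RepresentsDeriv z.1.snd (G.toFunction z) :=
  z.2.choose_spec.2.2

theorem l2Form_toFunction : G.l2Form (G.toFunction z) (G.toFunction y) = inner ℝ z.1.fst y.1.fst :=
  ((represents_toFunction z).inner_eq (represents_toFunction y)).symm

theorem neumannForm_toFunction :
    G.neumannForm (G.toFunction z) (G.toFunction y) = inner ℝ z.1.snd y.1.snd :=
  ((representsDeriv_toFunction z).inner_eq (representsDeriv_toFunction y)).symm

theorem shiftedForm_toFunction (ω : ℝ) :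
    G.shiftedForm ω (G.toFunction z) = ‖z.1.snd‖ ^ 2 - ω ^ 2 * ‖z.1.fst‖ ^ 2 := by
  rw [shiftedForm, l2Form_toFunction, neumannForm_toFunction, real_inner_self_eq_norm_sq,
    real_inner_self_eq_norm_sq]

theorem norm_sq_energy : ‖z‖ ^ 2 = ‖z.1.fst‖ ^ 2 + ‖z.1.snd‖ ^ 2 :=
  WithLp.prod_norm_sq_eq_of_L2 z.1

end Basic

theorem MemH1.exists_energy (hu : G.MemH1 u) : ∃ z : G.energySpace, G.toFunction z = u := by
  obtain ⟨f, hf⟩ := hu.exists_represents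
  obtain ⟨g, hg⟩ := hu.exists_representsDeriv
  have hz : WithLp.toLp 2 (f, g) ∈ G.energySpace := ⟨u, hu, hf, hg⟩
  refine ⟨⟨_, hz⟩, ?_⟩
  have h := represents_toFunction (⟨_, hz⟩ : G.energySpace)
  exact h.function_eq hf (memH1_toFunction _) hu

theorem norm_sq_edge_le (f : G.L2) (e : E) : ‖f e‖ ^ 2 ≤ ‖f‖ ^ 2 :=
  pow_le_pow_left₀ (norm_nonneg _) (lp.norm_apply_le_norm (by norm_num) f e) 2

theorem norm_sq_eq_integral {e : E} {f : Lp ℝ 2 (G.edgeMeasure e)} {g : ℝ → ℝ}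
    (h : (f : ℝ → ℝ) =ᵐ[G.edgeMeasure e] g) : ‖f‖ ^ 2 = ∫ x, g x ^ 2 ∂(G.edgeMeasure e) := by
  have hg : MemLp g 2 (G.edgeMeasure e) := (memLp_congr_ae h).1 (Lp.memLp f)
  have : f = hg.toLp g := Lp.ext (h.trans hg.coeFn_toLp.symm)
  rw [this, norm_toLp_sq]

/-- Pointwise evaluation is bounded by the energy norm. -/
theorem sq_toFunction_le (z : G.energySpace) (e : E) {t : ℝ} (ht : t ∈ Set.Icc 0 (G.len e)) :
    G.toFunction z (G.pt e t) ^ 2 ≤ (2 / G.len e + 2 * G.len e) * ‖z‖ ^ 2 := by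
  set u := G.toFunction z with hu
  have hl := G.len_pos e
  have hu1 := memH1_toFunction z
  have hD : ∫ x, deriv (G.onEdge u e) x ^ 2 ∂(G.edgeMeasure e) ≤ ‖z.1.snd‖ ^ 2 := by
    rw [← norm_sq_eq_integral (representsDeriv_toFunction z e)]
    exact norm_sq_edge_le _ e
  have hF : ∫ x, G.onEdge u e x ^ 2 ∂(G.edgeMeasure e) ≤ ‖z.1.fst‖ ^ 2 := by
    rw [← norm_sq_eq_integral (represents_toFunction z e)]
    exact norm_sq_edge_le _ e
  have hdiff : ∀ a ∈ Set.Icc 0 (G.len e), ∀ b ∈ Set.Icc 0 (G.len e), a ≤ b →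
      (G.onEdge u e b - G.onEdge u e a) ^ 2 ≤ G.len e * ‖z.1.snd‖ ^ 2 := by
    intro a ha b hb hab
    have hint : IntervalIntegrable (fun x => deriv (G.onEdge u e) x ^ 2) volume 0 (G.len e) :=
      (intervalIntegrable_iff_edge e _).2 (hu1.integrable_deriv_sq e)
    have hsub : Set.uIcc a b ⊆ Set.uIcc 0 (G.len e) := by
      rw [Set.uIcc_of_le hab, Set.uIcc_of_le hl.le]
      exact Set.Icc_subset_Icc ha.1 hb.2
    refine (sq_sub_le_mul_integral hab ((hu1.absCont e).mono hsub) (hint.mono_set hsub)).trans ?_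
    refine mul_le_mul (by linarith [ha.1, hb.2]) (le_trans ?_ hD)
      (intervalIntegral.integral_nonneg hab fun x _ => sq_nonneg _) hl.le
    rw [integral_edgeMeasure]
    exact intervalIntegral.integral_mono_interval ha.1 hab hb.2
      (Eventually.of_forall fun x => sq_nonneg _) hint
  have hpt : ∀ y ∈ Set.Icc 0 (G.len e), G.onEdge u e t ^ 2 ≤
      2 * G.onEdge u e y ^ 2 + 2 * (G.len e * ‖z.1.snd‖ ^ 2) := by
    intro y hy
    have h1 : (G.onEdge u e t - G.onEdge u e y) ^ 2 ≤ G.len e * ‖z.1.snd‖ ^ 2 := by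
      rcases le_total y t with h | h
      · exact hdiff y hy t ht h
      · rw [sub_sq_comm]
        exact hdiff t ht y hy h
    nlinarith [sq_nonneg (G.onEdge u e t - 2 * G.onEdge u e y)]
  have hint := (hu1.integrable_sq e).const_mul 2
  have h1 : ∫ _, G.onEdge u e t ^ 2 ∂(G.edgeMeasure e) ≤
      ∫ y, (2 * G.onEdge u e y ^ 2 + 2 * (G.len e * ‖z.1.snd‖ ^ 2)) ∂(G.edgeMeasure e) := by
    refine integral_mono_ae (integrable_const _) (hint.add (integrable_const _)) ?_
    filter_upwards [ae_restrict_mem measurableSet_Icc] with y hy using hpt y hy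
  rw [integral_add hint (integrable_const _), integral_const, integral_const, integral_const_mul] at h1
  simp only [Measure.real, Measure.restrict_apply MeasurableSet.univ, Set.univ_inter, Real.volume_Icc,
    sub_zero, ENNReal.toReal_ofReal hl.le, smul_eq_mul] at h1
  rw [norm_sq_energy, div_add' _ _ _ hl.ne', div_mul_eq_mul_div, le_div_iff₀ hl]
  have e1 : G.onEdge u e t = u (G.pt e t) := by rw [onEdge_eq]
  rw [e1] at h1
  nlinarith [sq_nonneg ‖z.1.fst‖, sq_nonneg ‖z.1.snd‖, mul_pos hl hl,
    mul_nonneg (mul_pos hl hl).le (sq_nonneg ‖z.1.fst‖)]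

/-- Pointwise evaluation as a continuous functional on the energy space. -/
theorem exists_eval (p : G.Space) : ∃ φ : G.energySpace →L[ℝ] ℝ, ∀ z, φ z = G.toFunction z p := by
  obtain ⟨e, t, ht, rfl⟩ := exists_pt p
  have hl := G.len_pos e
  refine ⟨LinearMap.mkContinuous ((LinearMap.proj (G.pt e t)).comp G.toFunction)
    (Real.sqrt (2 / G.len e + 2 * G.len e)) fun z => ?_, fun z => rfl⟩
  rw [Real.norm_eq_abs, ← Real.sqrt_sq (norm_nonneg z), ← Real.sqrt_mul (by positivity)]
  exact Real.abs_le_sqrt (sq_toFunction_le z e ht)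

end

section

/-! ### Completeness of the energy space -/

variable {E : Type*} {G : MetricGraph E}

theorem intervalIntegrable_coeFn {e : E} (f : Lp ℝ 2 (G.edgeMeasure e)) :
    IntervalIntegrable f volume 0 (G.len e) :=
  (intervalIntegrable_iff_edge e _).2 ((Lp.memLp f).integrable (by norm_num))

theorem integral_eq_inner {e : E} (f : Lp ℝ 2 (G.edgeMeasure e)) {t : ℝ}
    (ht : t ∈ Set.Icc 0 (G.len e)) : ∫ x in (0 : ℝ)..t, f x =
      inner ℝ (indicatorConstLp 2 (measurableSet_Ioc (a := 0) (b := t))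
        (measure_ne_top (G.edgeMeasure e) _) (1 : ℝ)) f := by
  rw [L2.inner_indicatorConstLp_one, Measure.restrict_restrict measurableSet_Ioc,
    Set.inter_eq_left.2 (show Set.Ioc 0 t ⊆ Set.Icc 0 (G.len e) from
      fun x hx => ⟨hx.1.le, hx.2.trans ht.2⟩),
    intervalIntegral.integral_of_le ht.1]

theorem _root_.AbsolutelyContinuousOnInterval.congr {f g : ℝ → ℝ} {a b : ℝ}
    (hf : AbsolutelyContinuousOnInterval f a b) (h : Set.EqOn f g (Set.uIcc a b)) :
    AbsolutelyContinuousOnInterval g a b := by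
  rw [absolutelyContinuousOnInterval_iff] at hf ⊢
  intro ε hε
  obtain ⟨δ, hδ, H⟩ := hf ε hε
  refine ⟨δ, hδ, fun F hF hlt => ?_⟩
  refine lt_of_eq_of_lt (Finset.sum_congr rfl fun i hi => ?_) (H F hF hlt)
  rw [h (hF.1 i hi).1, h (hF.1 i hi).2]

/-- A continuous function whose restrictions to the edges are primitives of the components of an
element of `L²`, and which itself represents an element of `L²`, belongs to `H¹`. -/
theorem memH1_of_primitive (hlf : G.LocallyFinite) {w : G.Space → ℝ} {f g : G.L2}
    (hf : G.Represents f w) (hw : ∀ e, ∀ t ∈ Set.Icc 0 (G.len e),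
      w (G.pt e t) = w (G.pt e 0) + ∫ x in (0 : ℝ)..t, (g e : ℝ → ℝ) x) :
    G.MemH1 w ∧ G.RepresentsDeriv g w := by
  have hint : ∀ e, IntervalIntegrable (g e : ℝ → ℝ) volume 0 (G.len e) := fun e =>
    intervalIntegrable_coeFn (g e)
  have hAC : ∀ e, AbsolutelyContinuousOnInterval
      (fun t => w (G.pt e 0) + ∫ x in (0 : ℝ)..t, (g e : ℝ → ℝ) x) 0 (G.len e) := by
    intro e
    have h1 := (hint e).absolutelyContinuousOnInterval_intervalIntegral (c := 0) (by simp)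
    exact ((LipschitzWith.const (w (G.pt e 0))).lipschitzOnWith.absolutelyContinuousOnInterval).fun_add h1
  have hw' : ∀ e, Set.EqOn (fun t => w (G.pt e 0) + ∫ x in (0 : ℝ)..t, (g e : ℝ → ℝ) x)
      (G.onEdge w e) (Set.uIcc 0 (G.len e)) := by
    intro e t ht
    rw [Set.uIcc_of_le (G.len_pos e).le] at ht
    rw [onEdge_eq]
    exact (hw e t ht).symm
  have hACw : ∀ e, AbsolutelyContinuousOnInterval (G.onEdge w e) 0 (G.len e) := fun e =>
    (hAC e).congr (hw' e)
  have hderiv : G.RepresentsDeriv g w := by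
    intro e
    have h1 := (hint e).ae_hasDerivAt_integral
    have h2 : ∀ᵐ x, x ≠ (0 : ℝ) := by simp [ae_iff, measure_singleton]
    have h3 : ∀ᵐ x, x ≠ G.len e := by simp [ae_iff, measure_singleton]
    rw [Filter.EventuallyEq, ae_restrict_iff' measurableSet_Icc]
    filter_upwards [h1, h2, h3] with x h1 h2 h3 hx
    have h4 := (h1 (by rwa [Set.uIcc_of_le (G.len_pos e).le]) 0 (by simp)).const_add (w (G.pt e 0))
    refine (h4.congr_of_eventuallyEq ?_).deriv.symm
    filter_upwards [Ioo_mem_nhds (lt_of_le_of_ne hx.1 (Ne.symm h2)) (lt_of_le_of_ne hx.2 h3)]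
      with y hy
    refine (hw' e ?_).symm
    rw [Set.uIcc_of_le (G.len_pos e).le]
    exact Set.Ioo_subset_Icc_self hy
  refine ⟨?_, hderiv⟩
  have hsum : ∀ {f : G.L2} {a : E → ℝ → ℝ}, (∀ e, (f e : ℝ → ℝ) =ᵐ[G.edgeMeasure e] a e) →
      Summable fun e => ∫ x, a e x ^ 2 ∂(G.edgeMeasure e) := by
    intro f a h
    have h1 := (l2_inner_eq h h).summable
    simpa only [← sq] using h1
  refine MemH1.of_parts (continuous_of_onEdge hlf fun e => ?_) hACw (fun e => ?_) (hsum hf)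
    (hsum hderiv)
  · have := (hACw e).continuousOn
    rwa [Set.uIcc_of_le (G.len_pos e).le] at this
  · exact (memLp_congr_ae (hderiv e)).1 (Lp.memLp (g e))

theorem tendsto_coe {zs : ℕ → G.L2} {z : G.L2} (h : Tendsto zs atTop (𝓝 z)) (e : E) :
    Tendsto (fun n => zs n e) atTop (𝓝 (z e)) := by
  rw [tendsto_iff_norm_sub_tendsto_zero] at h ⊢
  refine squeeze_zero (fun n => norm_nonneg _) (fun n => ?_) h
  exact lp.norm_apply_le_norm (by norm_num) (zs n - z) e

/-- The energy space is closed: point evaluations converge, and so do the primitives of the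
derivatives. -/
theorem isClosed_energySpace (hlf : G.LocallyFinite) :
    IsClosed (G.energySpace : Set (WithLp 2 (G.L2 × G.L2))) := by
  refine IsSeqClosed.isClosed fun zs z hzs hlim => ?_
  set y : ℕ → G.energySpace := fun n => ⟨zs n, hzs n⟩ with hy
  have hcau : CauchySeq y := by
    have h := Metric.cauchySeq_iff.1 hlim.cauchySeq
    rw [Metric.cauchySeq_iff]
    exact h
  have hpt : ∀ p, ∃ c, Tendsto (fun n => G.toFunction (y n) p) atTop (𝓝 c) := by
    intro p
    obtain ⟨φ, hφ⟩ := exists_eval (G := G) p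
    simp only [← hφ]
    exact cauchySeq_tendsto_of_complete (hcau.map φ.uniformContinuous)
  choose w hw using hpt
  have hfst : Tendsto (fun n => (zs n).fst) atTop (𝓝 z.fst) :=
    ((WithLp.fstL 2 ℝ G.L2 G.L2).continuous.tendsto z).comp hlim
  have hsnd : Tendsto (fun n => (zs n).snd) atTop (𝓝 z.snd) :=
    ((WithLp.sndL 2 ℝ G.L2 G.L2).continuous.tendsto z).comp hlim
  have hrep : G.Represents z.fst w := by
    intro e
    obtain ⟨ns, hns, hae⟩ := (tendstoInMeasure_of_tendsto_Lp (tendsto_coe hfst e)).exists_seq_tendsto_ae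
    have h1 : ∀ᵐ x ∂(G.edgeMeasure e), ∀ n, ((zs n).fst e : ℝ → ℝ) x =
        G.onEdge (G.toFunction (y n)) e x := ae_all_iff.2 fun n => represents_toFunction (y n) e
    filter_upwards [hae, h1] with x h2 h3
    refine tendsto_nhds_unique h2 ?_
    simp only [h3, onEdge_eq]
    exact (hw (G.pt e x)).comp hns.tendsto_atTop
  have hprim : ∀ e, ∀ t ∈ Set.Icc 0 (G.len e),
      w (G.pt e t) = w (G.pt e 0) + ∫ x in (0 : ℝ)..t, (z.snd e : ℝ → ℝ) x := by
    intro e t ht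
    have h1 : ∀ n, G.toFunction (y n) (G.pt e t) - G.toFunction (y n) (G.pt e 0) =
        ∫ x in (0 : ℝ)..t, ((zs n).snd e : ℝ → ℝ) x := by
      intro n
      have hsub : Set.uIcc 0 t ⊆ Set.uIcc 0 (G.len e) := by
        rw [Set.uIcc_of_le ht.1, Set.uIcc_of_le (G.len_pos e).le]
        exact Set.Icc_subset_Icc le_rfl ht.2
      have h2 := (((memH1_toFunction (y n)).absCont e).mono hsub).integral_deriv_eq_sub
      rw [onEdge_eq, onEdge_eq] at h2
      rw [← h2, intervalIntegral.integral_of_le ht.1, intervalIntegral.integral_of_le ht.1]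
      refine integral_congr_ae ?_
      have h3 : ((zs n).snd e : ℝ → ℝ) =ᵐ[volume.restrict (Set.Ioc 0 t)]
          deriv (G.onEdge (G.toFunction (y n)) e) := ae_restrict_of_ae_restrict_of_subset (μ := volume) (s := Set.Ioc 0 t)
        (t := Set.Icc 0 (G.len e)) (fun x hx => ⟨hx.1.le, hx.2.trans ht.2⟩)
        (representsDeriv_toFunction (y n) e)
      exact h3.symm
    have h2 : Tendsto (fun n => ∫ x in (0 : ℝ)..t, ((zs n).snd e : ℝ → ℝ) x) atTop
        (𝓝 (∫ x in (0 : ℝ)..t, (z.snd e : ℝ → ℝ) x)) := by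
      simp only [integral_eq_inner _ ht]
      exact tendsto_const_nhds.inner (tendsto_coe hsnd e)
    simp only [← h1] at h2
    have h3 := tendsto_nhds_unique h2 ((hw (G.pt e t)).sub (hw (G.pt e 0)))
    linarith
  obtain ⟨h1, h2⟩ := memH1_of_primitive hlf hrep hprim
  exact ⟨w, h1, hrep, h2⟩

end

section

/-! ### Compact embeddings of Hilbert spaces -/

section Embedding

variable {V H : Type*} [NormedAddCommGroup V] [InnerProductSpace ℝ V] [CompleteSpace V]
  [NormedAddCommGroup H] [InnerProductSpace ℝ H] [CompleteSpace H]

/-- An operator that is arbitrarily small on subspaces of finite codimension is compact. -/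
theorem isCompactOperator_of_small_on_ker (T : V →L[ℝ] H)
    (h : ∀ ε > 0, ∃ s : Finset (V →L[ℝ] ℝ), ∀ z, (∀ φ ∈ s, φ z = 0) → ‖T z‖ ≤ ε * ‖z‖) :
    IsCompactOperator T := by
  have hcl := isClosed_setOfPred_isCompactOperator (σ₁₂ := RingHom.id ℝ) (M₁ := V) (M₂ := H)
  refine (Metric.mem_of_closed' hcl).2 fun ε hε => ?_
  obtain ⟨s, hs⟩ := h (ε / 2) (by positivity)
  set Φ : V →L[ℝ] (s → ℝ) := ContinuousLinearMap.pi fun φ => φ.1 with hΦ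
  set K : Submodule ℝ V := LinearMap.ker (Φ : V →ₗ[ℝ] (s → ℝ)) with hK
  have hKc : IsClosed (K : Set V) := Φ.isClosed_ker
  have : CompleteSpace K := hKc.completeSpace_coe
  have hfd : FiniteDimensional ℝ Kᗮ := by
    refine FiniteDimensional.of_injective ((Φ : V →ₗ[ℝ] (s → ℝ)).domRestrict Kᗮ) ?_
    rw [← LinearMap.ker_eq_bot, LinearMap.ker_eq_bot']
    intro z hz
    have h1 : (z : V) ∈ K ⊓ Kᗮ := ⟨hz, z.2⟩
    rw [K.inf_orthogonal_eq_bot] at h1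
    exact Subtype.ext h1
  have hcomp : IsCompactOperator (T.comp Kᗮ.starProjection) :=
    (isCompactOperator_of_locallyCompactSpace_dom Kᗮ.orthogonalProjectionOnto).clm_comp
      (T.comp Kᗮ.subtypeL)
  refine ⟨T.comp Kᗮ.starProjection, hcomp, ?_⟩
  rw [dist_eq_norm]
  refine lt_of_le_of_lt (ContinuousLinearMap.opNorm_le_bound _ (half_pos hε).le fun z => ?_)
    (half_lt_self hε)
  have h1 : (T - T.comp Kᗮ.starProjection) z = T (K.starProjection z) := by
    rw [sub_apply, ContinuousLinearMap.comp_apply, ← map_sub,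
      Submodule.starProjection_orthogonal_val, sub_sub_cancel]
  rw [h1]
  refine (hs _ fun φ hφ => ?_).trans
    (mul_le_mul_of_nonneg_left (K.norm_starProjection_apply_le z) (half_pos hε).le)
  exact congrFun (K.starProjection_apply_mem z : Φ (K.starProjection z) = 0) ⟨φ, hφ⟩

/-- A compact embedding with dense range diagonalises the two inner products simultaneously. -/
theorem exists_simultaneous_basis (T : V →L[ℝ] H) (hT : IsCompactOperator T)
    (hdense : ∀ f : H, (∀ z, inner ℝ f (T z) = 0) → f = 0) :
    ∃ (J : Type) (b : HilbertBasis J ℝ H) (c : J → ℝ) (z : J → V),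
      ∀ j, T (z j) = b j ∧ ∀ y, inner ℝ (z j) y = c j * inner ℝ (b j) (T y) := by
  -- `T T*` is compact, symmetric and injective; for an eigenvector `w` with eigenvalue `l`, the vector
  -- `z = l⁻¹ T* w` satisfies `T z = w` and `⟪z, y⟫ = l⁻¹ ⟪w, T y⟫`
  set A : H →L[ℝ] H := T.comp T.adjoint with hA
  have hAc : IsCompactOperator A := hT.comp_clm T.adjoint
  have hAs : A.IsSymmetric := fun f g => by
    change inner ℝ (T (T.adjoint f)) g = inner ℝ f (T (T.adjoint g))
    exact (T.adjoint_inner_right _ _).symm.trans (T.adjoint_inner_left _ _)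
  have hinj : ∀ f, A f = 0 → f = 0 := by
    intro f hf
    have h1 : inner ℝ (T.adjoint f) (T.adjoint f) = (0 : ℝ) := by
      rw [ContinuousLinearMap.adjoint_inner_left]
      change inner ℝ f (A f) = (0 : ℝ)
      rw [hf, inner_zero_right]
    refine hdense f fun z => ?_
    rw [← ContinuousLinearMap.adjoint_inner_left, inner_self_eq_zero.1 h1, inner_zero_left]
  have hfd : ∀ l : ℝ, FiniteDimensional ℝ (Module.End.eigenspace (A : H →ₗ[ℝ] H) l) := by
    intro l
    by_cases hl : l = 0
    · have : Module.End.eigenspace (A : H →ₗ[ℝ] H) l = ⊥ := by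
        rw [eq_bot_iff]
        intro f hf
        rw [Module.End.mem_eigenspace_iff, hl, zero_smul] at hf
        exact hinj f hf
      rw [this]
      infer_instance
    · exact ContinuousLinearMap.finite_dimensional_eigenspace hAc l hl
  set J : Type := Σ l : ℝ, Fin (Module.finrank ℝ (Module.End.eigenspace (A : H →ₗ[ℝ] H) l)) with hJ
  set w : J → H := fun j => (stdOrthonormalBasis ℝ _ j.2 :
    Module.End.eigenspace (A : H →ₗ[ℝ] H) j.1) with hw
  have hon : Orthonormal ℝ w := hAs.orthogonalFamily_eigenspaces.orthonormal_sigma_orthonormal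
    fun l => (stdOrthonormalBasis ℝ _).orthonormal
  have hspan : (Submodule.span ℝ (Set.range w))ᗮ = ⊥ := by
    rw [eq_bot_iff, ← ContinuousLinearMap.orthogonalComplement_iSup_eigenspaces_eq_bot hAc hAs]
    refine Submodule.orthogonal_le (iSup_le fun l => ?_)
    intro f hf
    have h1 := (stdOrthonormalBasis ℝ (Module.End.eigenspace (A : H →ₗ[ℝ] H) l)).sum_repr ⟨f, hf⟩
    have h2 := congrArg Subtype.val h1
    rw [Submodule.coe_sum] at h2
    change _ = f at h2
    rw [← h2]
    refine Submodule.sum_mem _ fun i _ => ?_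
    rw [Submodule.coe_smul]
    exact Submodule.smul_mem _ _ (Submodule.subset_span ⟨⟨l, i⟩, rfl⟩)
  have heig : ∀ j : J, A (w j) = j.1 • w j := fun j =>
    Module.End.mem_eigenspace_iff.1 (Subtype.mem _)
  have hne : ∀ j : J, j.1 ≠ 0 := fun j hj => by
    have h1 := heig j
    rw [hj, zero_smul] at h1
    exact hon.ne_zero j (hinj _ h1)
  refine ⟨J, HilbertBasis.mkOfOrthogonalEqBot hon hspan, fun j => j.1⁻¹,
    fun j => j.1⁻¹ • T.adjoint (w j), fun j => ⟨?_, fun y => ?_⟩⟩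
  · rw [HilbertBasis.coe_mkOfOrthogonalEqBot, map_smul]
    change j.1⁻¹ • A (w j) = w j
    rw [heig, smul_smul, inv_mul_cancel₀ (hne j), one_smul]
  · rw [HilbertBasis.coe_mkOfOrthogonalEqBot, real_inner_smul_left,
      ContinuousLinearMap.adjoint_inner_left]

end Embedding

/-- A function on an infinite type all of whose sublevel sets are finite can be listed in increasing
order. -/
theorem exists_monotone_enumeration {J : Type*} [Infinite J] (c : J → ℝ)
    (h : ∀ C, {j | c j ≤ C}.Finite) :
    ∃ e : ℕ ≃ J, Monotone (c ∘ e) ∧ Tendsto (c ∘ e) atTop atTop := by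
  have hcount : Countable J := by
    have : (Set.univ : Set J) = ⋃ n : ℕ, {j | c j ≤ n} := by
      refine (Set.eq_univ_of_forall fun j => ?_).symm
      exact Set.mem_iUnion.2 (exists_nat_ge (c j))
    rw [← Set.countable_univ_iff, this]
    exact Set.countable_iUnion fun n => (h n).countable
  obtain ⟨enc, henc⟩ := hcount.exists_injective_nat
  let : LinearOrder J := LinearOrder.lift' (fun j => toLex (c j, enc j)) fun i j hij =>
    henc (congrArg (fun p => (ofLex p).2) hij)
  have hle : ∀ i j : J, i ≤ j → c i ≤ c j := fun i j hij => by
    rcases (Prod.Lex.le_iff.1 hij) with h1 | h1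
    · exact h1.le
    · exact h1.1.le
  have hfin : ∀ j : J, (Set.Iio j).Finite := fun j => (h (c j)).subset fun i hi => hle i j hi.le
  have hr : StrictMono fun j : J => (Set.Iio j).ncard := fun i j hij =>
    Set.ncard_lt_ncard (Set.Iio_ssubset_Iio hij) (hfin j)
  set r := fun j : J => (Set.Iio j).ncard
  have : Infinite (Set.range r) := (Set.infinite_range_of_injective hr.injective).to_subtype
  classical
  let e : ℕ ≃o J := (Nat.Subtype.orderIsoOfNat (Set.range r)).trans (hr.orderIso r).symm
  have hmono : Monotone (c ∘ e) := fun m n hmn => hle _ _ (e.monotone hmn)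
  refine ⟨e.toEquiv, hmono, tendsto_atTop_atTop_of_monotone hmono fun C => ?_⟩
  by_contra! hC
  refine (h C).not_infinite ((Set.infinite_range_of_injective e.injective).mono ?_)
  rintro _ ⟨n, rfl⟩
  exact (hC n).le

end

section

/-! ### Discreteness of the spectrum -/

variable {E : Type*} {G : MetricGraph E}

theorem energy_inner (y z : G.energySpace) :
    inner ℝ y z = inner ℝ y.1.fst z.1.fst + inner ℝ y.1.snd z.1.snd :=
  WithLp.prod_inner_apply y.1 z.1

/-- The functions in `H¹` are dense in `L²`. -/
theorem eq_zero_of_inner_energy (hfin : G.FiniteLength) (f : G.L2)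
    (hf : ∀ z : G.energySpace, inner ℝ f z.1.fst = 0) : f = 0 := by
  classical
  refine lp.ext (funext fun e => Lp.ext ?_)
  have hint : Integrable (f e : ℝ → ℝ) (G.edgeMeasure e) := (Lp.memLp (f e)).integrable (by norm_num)
  have key : ∀ᵐ x ∂(G.edgeMeasure e), x ∈ Set.Ioo 0 (G.len e) → (f e : ℝ → ℝ) x = 0 := by
    refine isOpen_Ioo.ae_eq_zero_of_integral_contDiff_smul_eq_zero
      (hint.locallyIntegrable.locallyIntegrableOn _) fun g hg hgc hgs => ?_
    -- `g` extended by zero is a function on the graph, since its support avoids the endpoints of `e`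
    have hend : ∀ a : E × Bool, (if a.1 = e then g (G.epos a) else 0) = 0 := by
      intro a
      split_ifs with ha
      · refine image_eq_zero_of_notMem_tsupport fun hmem => ?_
        have h := hgs hmem
        subst ha
        rw [epos] at h
        split_ifs at h
        · exact lt_irrefl _ h.2
        · exact lt_irrefl _ h.1
      · rfl
    obtain ⟨F, hF⟩ := exists_lift (G := G) (fun e' t => if e' = e then g t else 0)
      fun a b _ => by rw [hend, hend]
    obtain ⟨K, hK⟩ := hg.lipschitzWith_of_hasCompactSupport hgc (by simp)
    obtain ⟨C, hC⟩ := hgc.exists_bound_of_continuous hg.continuous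
    have hFm : G.MemH1 F := by
      refine memH1_of_lipschitz hfin (K := K + 1) (C := max C 0) (by positivity)
        (fun e' s hs t ht => ?_) fun p => ?_
      · rw [hF e' s hs, hF e' t ht]
        split_ifs
        · have := hK.dist_le_mul s t
          rw [Real.dist_eq, Real.dist_eq] at this
          nlinarith [abs_nonneg (s - t)]
        · rw [sub_self, abs_zero]
          positivity
      · obtain ⟨e', t, ht, rfl⟩ := exists_pt p
        rw [hF e' t ht]
        split_ifs
        · exact (hC t).trans (le_max_left _ _)
        · simp
    obtain ⟨z, rfl⟩ := hFm.exists_energy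
    have h1 := l2_inner_eq (fun e' => EventuallyEq.refl _ (f e' : ℝ → ℝ)) (represents_toFunction z)
    rw [hf z] at h1
    have h2 : ∀ e' ≠ e, ∫ x, (f e' : ℝ → ℝ) x * G.onEdge (G.toFunction z) e' x
        ∂(G.edgeMeasure e') = 0 := by
      intro e' he'
      refine integral_eq_zero_of_ae ?_
      filter_upwards [ae_restrict_mem measurableSet_Icc] with x hx
      rw [onEdge_eq, hF e' x hx, if_neg he', mul_zero]
      rfl
    refine Eq.trans (integral_congr_ae ?_) (h1.unique (hasSum_single e h2)).symm
    filter_upwards [ae_restrict_mem measurableSet_Icc] with x hx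
    rw [onEdge_eq, hF e x hx, if_pos rfl, smul_eq_mul, mul_comm]
  have h2 : ∀ᵐ x ∂(G.edgeMeasure e), x ≠ (0 : ℝ) := ae_restrict_of_ae (by simp [ae_iff])
  have h3 : ∀ᵐ x ∂(G.edgeMeasure e), x ≠ G.len e := ae_restrict_of_ae (by simp [ae_iff])
  filter_upwards [key, h2, h3, ae_restrict_mem measurableSet_Icc, Lp.coeFn_zero ℝ 2 (G.edgeMeasure e)]
    with x h1 h2 h3 hx h4
  rw [h1 ⟨hx.1.lt_of_ne (Ne.symm h2), hx.2.lt_of_ne h3⟩]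
  exact h4.symm

/-- The dichotomy at the frequency `π k / (2 L)`, the square of which is the bound. -/
theorem dichotomy [Countable E] (hlf : G.LocallyFinite) (hconn : G.Connected)
    (hfin : G.FiniteLength) (hpos : 0 < G.totalLength) {k : ℕ} (hk : 2 ≤ k) :
    Dichotomy G (Real.pi * k / (2 * G.totalLength)) k := by
  have hE : Nonempty E := by
    by_contra h
    rw [not_nonempty_iff] at h
    rw [totalLength, tsum_empty] at hpos
    exact lt_irrefl _ hpos
  obtain ⟨e₀⟩ := hE
  obtain ⟨T⟩ := exists_rooting hlf hconn hfin e₀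
  have hk0 : (0 : ℝ) < k := by
    have : 0 < k := by omega
    exact_mod_cast this
  refine T.dichotomy (ℓ := G.totalLength / k) hlf hfin (by positivity) ?_ (by positivity) hk ?_
  · field_simp
  · field_simp

theorem exists_large_frequency (hpos : 0 < G.totalLength) (C : ℝ) :
    ∃ k : ℕ, 2 ≤ k ∧ C < Real.pi * k / (2 * G.totalLength) := by
  obtain ⟨n, hn⟩ := exists_nat_gt (C * (2 * G.totalLength))
  refine ⟨n + 2, by omega, ?_⟩
  rw [lt_div_iff₀ (by positivity)]
  push_cast
  nlinarith [Real.pi_gt_three, (Nat.cast_nonneg n : (0 : ℝ) ≤ n)]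

/-- The embedding of the energy space into `L²` is compact, since cut sets make the `L²` norm small
compared with the energy norm. -/
theorem isCompactOperator_fst [Countable E] (hlf : G.LocallyFinite) (hconn : G.Connected)
    (hfin : G.FiniteLength) (hpos : 0 < G.totalLength) :
    IsCompactOperator ((WithLp.fstL 2 ℝ G.L2 G.L2).comp G.energySpace.subtypeL) := by
  classical
  have : CompleteSpace G.energySpace := (isClosed_energySpace hlf).completeSpace_coe
  refine isCompactOperator_of_small_on_ker _ fun ε hε => ?_
  -- on functions that vanish on a cut set for `ω`, `ω² ‖f‖² ≤ ‖f'‖²`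
  obtain ⟨k, hk, hω⟩ := exists_large_frequency hpos (1 / ε)
  set ω := Real.pi * k / (2 * G.totalLength)
  obtain ⟨⟨S, _, hS⟩, _⟩ := dichotomy hlf hconn hfin hpos hk
  choose φ hφ using exists_eval (G := G)
  refine ⟨S.image φ, fun z hz => ?_⟩
  have h1 := hS (G.toFunction z) (memH1_toFunction z) fun p hp => by
    rw [← hφ]
    exact hz _ (Finset.mem_image_of_mem φ hp)
  rw [shiftedForm_toFunction] at h1
  have h2 := norm_sq_energy z
  have hω1 : 1 ≤ ε * ω := by
    rw [div_lt_iff₀ hε] at hω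
    linarith
  change ‖z.1.fst‖ ≤ ε * ‖z‖
  refine le_of_sq_le_sq ?_ (by positivity)
  have h3 : 1 ≤ (ε * ω) ^ 2 := one_le_pow₀ hω1
  nlinarith [mul_le_mul_of_nonneg_right h3 (sq_nonneg ‖z.1.fst‖), sq_nonneg ε,
    mul_nonneg (sq_nonneg ε) h1, mul_nonneg (sq_nonneg ε) (sq_nonneg ‖z.1.fst‖)]

/-- An element of the energy space satisfies the weak eigenvalue equation. -/
def IsEnergyEigen (z : G.energySpace) (c : ℝ) : Prop :=
  ∀ y : G.energySpace, inner ℝ z.1.snd y.1.snd = c * inner ℝ z.1.fst y.1.fst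

theorem neumannExtension_smul_iff {f : G.L2} {c : ℝ} :
    G.NeumannExtension f (c • f) ↔ ∃ z : G.energySpace, z.1.fst = f ∧ IsEnergyEigen z c := by
  constructor
  · rintro ⟨u, hu, hf, h⟩
    obtain ⟨z, rfl⟩ := hu.exists_energy
    refine ⟨z, (represents_toFunction z).unique hf, fun y => ?_⟩
    rw [← neumannForm_toFunction, h _ _ (memH1_toFunction y) (represents_toFunction y),
      (represents_toFunction z).unique hf, real_inner_smul_left]
  · rintro ⟨z, rfl, hz⟩
    refine ⟨_, memH1_toFunction z, represents_toFunction z, fun v g hv hg => ?_⟩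
    obtain ⟨y, rfl⟩ := hv.exists_energy
    rw [neumannForm_toFunction, hz, real_inner_smul_left, (represents_toFunction y).unique hg]

section Family

variable {ι : Type*} [Fintype ι] {z : ι → G.energySpace} {c : ι → ℝ}

theorem fst_sum (a : ι → ℝ) : (∑ i, a i • z i).1.fst = ∑ i, a i • (z i).1.fst := by
  refine (map_sum ((WithLp.fstL 2 ℝ G.L2 G.L2).comp G.energySpace.subtypeL) _ _).trans
    (Finset.sum_congr rfl fun i _ => ?_)
  rw [map_smul]
  rfl

theorem snd_sum (a : ι → ℝ) : (∑ i, a i • z i).1.snd = ∑ i, a i • (z i).1.snd := by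
  refine (map_sum ((WithLp.sndL 2 ℝ G.L2 G.L2).comp G.energySpace.subtypeL) _ _).trans
    (Finset.sum_congr rfl fun i _ => ?_)
  rw [map_smul]
  rfl

theorem norm_sq_fst_sum (hon : Orthonormal ℝ fun i => (z i).1.fst) (a : ι → ℝ) :
    ‖(∑ i, a i • z i).1.fst‖ ^ 2 = ∑ i, a i ^ 2 := by
  rw [← real_inner_self_eq_norm_sq, fst_sum, hon.inner_sum]
  simp [sq]

theorem norm_sq_snd_sum (hon : Orthonormal ℝ fun i => (z i).1.fst)
    (hz : ∀ i, IsEnergyEigen (z i) (c i)) (a : ι → ℝ) :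
    ‖(∑ i, a i • z i).1.snd‖ ^ 2 = ∑ i, c i * a i ^ 2 := by
  rw [← real_inner_self_eq_norm_sq]
  nth_rw 1 [snd_sum]
  rw [sum_inner]
  refine Finset.sum_congr rfl fun i _ => ?_
  rw [real_inner_smul_left, hz, fst_sum, hon.inner_right_fintype]
  ring

/-- If there are more eigenfunctions than points in a cut set, then a nontrivial combination vanishes
on the cut set; its shifted form is nonnegative. -/
theorem IsCutSet.exists_combination {ω : ℝ} {S : Finset G.Space} (hS : IsCutSet G ω S)
    (hcard : S.card < Fintype.card ι) (hon : Orthonormal ℝ fun i => (z i).1.fst)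
    (hz : ∀ i, IsEnergyEigen (z i) (c i)) :
    ∃ a : ι → ℝ, a ≠ 0 ∧ (∀ p ∈ S, G.toFunction (∑ i, a i • z i) p = 0) ∧
      0 ≤ ∑ i, (c i - ω ^ 2) * a i ^ 2 := by
  set Φ : (ι → ℝ) →ₗ[ℝ] (S → ℝ) :=
    LinearMap.pi fun p => (LinearMap.proj p.1).comp (G.toFunction.comp (Fintype.linearCombination ℝ z))
    with hΦ
  have hker : LinearMap.ker Φ ≠ ⊥ := by
    refine LinearMap.ker_ne_bot_of_finrank_lt ?_
    simpa using hcard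
  obtain ⟨a, ha, ha0⟩ := (Submodule.ne_bot_iff _).1 hker
  have h0 : ∀ p ∈ S, G.toFunction (∑ i, a i • z i) p = 0 := fun p hp => by
    have h1 := congrFun (LinearMap.mem_ker.1 ha) ⟨p, hp⟩
    simpa [hΦ, Fintype.linearCombination_apply] using h1
  refine ⟨a, ha0, h0, ?_⟩
  have h1 := hS _ (memH1_toFunction _) h0
  rw [shiftedForm_toFunction, norm_sq_fst_sum hon, norm_sq_snd_sum hon hz, Finset.mul_sum,
    ← Finset.sum_sub_distrib] at h1
  simpa only [sub_mul] using h1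

end Family

end

section

/-! ### The spectrum and the lower bound -/

variable {E : Type*} {G : MetricGraph E}

/-- `L²` of a graph with an edge is infinite-dimensional: it contains the polynomials on the edge. -/
theorem not_finiteDimensional_l2 (e : E) : ¬ FiniteDimensional ℝ G.L2 := by
  classical
  intro hfd
  have hp : ∀ p : Polynomial ℝ, MemLp (fun x => p.eval x) 2 (G.edgeMeasure e) := fun p => by
    obtain ⟨C, hC⟩ := isCompact_Icc.exists_bound_of_continuousOn
      (p.continuous.continuousOn (s := Set.Icc 0 (G.len e)))
    refine MemLp.of_bound p.continuous.measurable.aestronglyMeasurable C ?_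
    filter_upwards [ae_restrict_mem measurableSet_Icc] with x hx using hC x hx
  set Φ : Polynomial ℝ →ₗ[ℝ] G.L2 :=
    { toFun := fun p => lp.single 2 e ((hp p).toLp _)
      map_add' := fun p q => by
        rw [← lp.single_add, ← MemLp.toLp_add]
        congr 2
        funext x
        exact Polynomial.eval_add
      map_smul' := fun a p => by
        rw [RingHom.id_apply, ← lp.single_smul, ← MemLp.toLp_const_smul]
        congr 2
        funext x
        simp } with hΦ
  have hinj : Function.Injective Φ := by
    rw [← LinearMap.ker_eq_bot, LinearMap.ker_eq_bot']
    intro p hpz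
    have h1 : (hp p).toLp _ = 0 := by
      have := congrArg (fun f : G.L2 => f e) hpz
      simpa [hΦ] using this
    have h2 := (hp p).coeFn_toLp
    rw [h1] at h2
    have h3 := Measure.eqOn_Icc_of_ae_eq volume (G.len_pos e).ne
      (h2.symm.trans (Lp.coeFn_zero ℝ 2 (G.edgeMeasure e))) p.continuous.continuousOn
      continuousOn_const
    exact Polynomial.eq_zero_of_infinite_isRoot p
      ((Set.Icc_infinite (G.len_pos e)).mono fun x hx => h3 hx)
  exact Polynomial.not_finite (R := ℝ) (FiniteDimensional.of_injective Φ hinj)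

/-- The spectrum is discrete. The compact embedding of the energy space gives the eigenfunctions, the
energy norm being the form norm so that the eigenvalues are shifted by one. There are finitely many
eigenvalues below every bound, since there are at most as many as there are points in a cut set for a
large frequency. -/
theorem exists_neumannSpectrum [Countable E] (hlf : G.LocallyFinite) (hconn : G.Connected)
    (hfin : G.FiniteLength) (hpos : 0 < G.totalLength) : ∃ μ, G.IsNeumannSpectrum μ := by
  have : CompleteSpace G.energySpace := (isClosed_energySpace hlf).completeSpace_coe
  obtain ⟨J, b, c, z, hz⟩ := exists_simultaneous_basis _ (isCompactOperator_fst hlf hconn hfin hpos)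
    (eq_zero_of_inner_energy hfin)
  have hfst : ∀ j, (z j).1.fst = b j := fun j => (hz j).1
  have heig : ∀ j, IsEnergyEigen (z j) (c j - 1) := fun j y => by
    have h1 : inner ℝ (z j) y = c j * inner ℝ (b j) y.1.fst := (hz j).2 y
    rw [energy_inner, hfst] at h1
    rw [hfst]
    linarith
  have hlevel : ∀ C, {j | c j - 1 ≤ C}.Finite := by
    intro C
    by_contra hinf
    obtain ⟨k, hk, hω⟩ := exists_large_frequency hpos (max C 1)
    set ω := Real.pi * k / (2 * G.totalLength)
    obtain ⟨⟨S, hcard, hS⟩, _⟩ := dichotomy hlf hconn hfin hpos hk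
    obtain ⟨t, ht, htc⟩ := Set.Infinite.exists_subset_card_eq hinf k
    obtain ⟨a, ha, _, h⟩ := hS.exists_combination (z := fun j : t => z j) (c := fun j : t => c j - 1)
      (by rw [Fintype.card_coe]; omega)
      (by
        simp only [hfst]
        exact b.orthonormal.comp _ Subtype.val_injective)
      (fun j => heig j)
    have hω2 : C < ω ^ 2 := by
      have h1 := le_max_left C 1
      have h2 := le_max_right C 1
      nlinarith
    obtain ⟨i, hi⟩ := Function.ne_iff.1 ha
    have hlt : ∀ j : t, c j - 1 - ω ^ 2 < 0 := fun j => by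
      have := ht j.2
      change c j - 1 ≤ C at this
      linarith
    refine h.not_gt (Finset.sum_neg' (fun j _ => ?_) ⟨i, Finset.mem_univ _, ?_⟩)
    · exact mul_nonpos_of_nonpos_of_nonneg (hlt j).le (sq_nonneg _)
    · exact mul_neg_of_neg_of_pos (hlt i) (sq_pos_of_ne_zero hi)
  have hJ : Infinite J := by
    by_contra h
    rw [not_infinite_iff_finite] at h
    obtain ⟨e⟩ : Nonempty E := by
      by_contra h
      rw [not_nonempty_iff] at h
      rw [totalLength, tsum_empty] at hpos
      exact lt_irrefl _ hpos
    have := Fintype.ofFinite J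
    exact not_finiteDimensional_l2 e b.toOrthonormalBasis.toBasis.finiteDimensional_of_finite
  obtain ⟨e, hmono, htop⟩ := exists_monotone_enumeration _ hlevel
  have hspan : (Submodule.span ℝ (Set.range (b ∘ e)))ᗮ = ⊥ := by
    rw [e.surjective.range_comp, ← Submodule.orthogonal_closure, b.dense_span,
      Submodule.top_orthogonal_eq_bot]
  refine ⟨_, hmono, htop, HilbertBasis.mkOfOrthogonalEqBot (b.orthonormal.comp e e.injective) hspan,
    fun n => ?_⟩
  rw [HilbertBasis.coe_mkOfOrthogonalEqBot]
  exact neumannExtension_smul_iff.2 ⟨z (e n), hfst _, heig _⟩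

/-- Elements of the energy space whose classes in `L²` are the eigenfunctions. -/
theorem IsNeumannSpectrum.exists_energy {μ : ℕ → ℝ} (hμ : G.IsNeumannSpectrum μ) :
    ∃ (ψ : HilbertBasis ℕ ℝ G.L2) (z : ℕ → G.energySpace),
      (∀ n, (z n).1.fst = ψ n) ∧ ∀ n, IsEnergyEigen (z n) (μ n) := by
  obtain ⟨_, _, ψ, hψ⟩ := hμ
  choose z hz using fun n => neumannExtension_smul_iff.1 (hψ n)
  exact ⟨ψ, z, fun n => (hz n).1, fun n => (hz n).2⟩

section Lower

variable {μ : ℕ → ℝ} {ω : ℝ} {k : ℕ}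

/-- The first `k` eigenfunctions have a nontrivial combination `y` that vanishes on a cut set of fewer
than `k` points. -/
theorem IsNeumannSpectrum.exists_combination (hμ : G.IsNeumannSpectrum μ) {S : Finset G.Space}
    (hS : IsCutSet G ω S) (hcard : S.card + 1 ≤ k) :
    ∃ (y : G.energySpace) (z : Fin k → G.energySpace) (a : Fin k → ℝ), y = ∑ i, a i • z i ∧
      a ≠ 0 ∧ (∀ i, IsEnergyEigen (z i) (μ i)) ∧ ‖y.1.fst‖ ^ 2 = ∑ i, a i ^ 2 ∧
      (∀ p ∈ S, G.toFunction y p = 0) ∧ 0 ≤ ∑ i : Fin k, (μ i - ω ^ 2) * a i ^ 2 := by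
  obtain ⟨ψ, z, hz, heig⟩ := hμ.exists_energy
  have hon : Orthonormal ℝ fun i : Fin k => (z i).1.fst := by
    simp only [hz]
    exact ψ.orthonormal.comp _ Fin.val_injective
  obtain ⟨a, ha, h0, h⟩ := hS.exists_combination (by rw [Fintype.card_fin]; omega) hon
    (c := fun i : Fin k => μ i) fun i => heig i
  exact ⟨_, fun i => z i, a, rfl, ha, fun i => heig i, norm_sq_fst_sum hon a, h0, h⟩

/-- The lower bound for the eigenvalue of index `k - 1`, counted from zero. -/
theorem IsNeumannSpectrum.le_of_isCutSet (hμ : G.IsNeumannSpectrum μ) {S : Finset G.Space}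
    (hS : IsCutSet G ω S) (hcard : S.card + 1 ≤ k) : ω ^ 2 ≤ μ (k - 1) := by
  obtain ⟨_, _, a, _, ha, _, _, _, h⟩ := hμ.exists_combination hS hcard
  by_contra! hlt
  have hneg : ∀ i : Fin k, μ i - ω ^ 2 < 0 := fun i => by
    have := hμ.1 (show (i : ℕ) ≤ k - 1 by omega)
    linarith
  obtain ⟨i, hi⟩ := Function.ne_iff.1 ha
  refine h.not_gt (Finset.sum_neg' (fun j _ => ?_) ⟨i, Finset.mem_univ _, ?_⟩)
  · exact mul_nonpos_of_nonpos_of_nonneg (hneg j).le (sq_nonneg _)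
  · exact mul_neg_of_neg_of_pos (hneg i) (sq_pos_of_ne_zero hi)

/-- If the bound is attained, then the combination of eigenfunctions that vanishes on the cut set is
itself an eigenfunction. -/
theorem IsNeumannSpectrum.hasRigidity (hμ : G.IsNeumannSpectrum μ) (h : μ (k - 1) ≤ ω ^ 2) :
    HasRigidity G ω k := by
  intro S hcard hS
  obtain ⟨y, z, a, hy, ha, heig, hnorm, h0, hsum⟩ := hμ.exists_combination hS hcard
  have hle : ∀ i : Fin k, μ i ≤ ω ^ 2 := fun i => (hμ.1 (by omega)).trans h
  have hterm : ∀ i ∈ Finset.univ, (μ (i : Fin k) - ω ^ 2) * a i ^ 2 ≤ 0 := fun i _ =>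
    mul_nonpos_of_nonpos_of_nonneg (sub_nonpos.2 (hle i)) (sq_nonneg _)
  have hzero := (Finset.sum_eq_zero_iff_of_nonpos hterm).1
    (le_antisymm (Finset.sum_nonpos hterm) hsum)
  have hcoef : ∀ i, a i * μ i = ω ^ 2 * a i := fun i => by
    rcases mul_eq_zero.1 (hzero i (Finset.mem_univ i)) with h1 | h1
    · rw [sub_eq_zero.1 h1, mul_comm]
    · rw [pow_eq_zero_iff two_ne_zero] at h1
      rw [h1, zero_mul, mul_zero]
  have hyeig : IsEnergyEigen y (ω ^ 2) := fun v => by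
    rw [hy, fst_sum, snd_sum, sum_inner, sum_inner, Finset.mul_sum]
    refine Finset.sum_congr rfl fun i _ => ?_
    rw [real_inner_smul_left, real_inner_smul_left, heig, ← mul_assoc, hcoef, mul_assoc]
  refine ⟨G.toFunction y, ⟨memH1_toFunction y, fun v hv => ?_⟩, h0, fun hy0 => ?_⟩
  · obtain ⟨v, rfl⟩ := hv.exists_energy
    rw [neumannForm_toFunction, l2Form_toFunction, hyeig]
  · have h1 : l2Form G (G.toFunction y) (G.toFunction y) = 0 := by
      simp [hy0, l2Form, onEdge]
    rw [l2Form_toFunction, real_inner_self_eq_norm_sq, hnorm,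
      Finset.sum_eq_zero_iff_of_nonneg fun i _ => sq_nonneg _] at h1
    refine ha (funext fun i => ?_)
    have := h1 i (Finset.mem_univ i)
    rwa [pow_eq_zero_iff two_ne_zero] at this

end Lower

end

section

/-! ### The min-max principle -/

variable {E : Type*} {G : MetricGraph E} {μ : ℕ → ℝ}

/-- On the orthogonal complement of the first eigenfunctions the form is bounded below by the next
eigenvalue. -/
theorem IsNeumannSpectrum.mul_norm_sq_le {ψ : HilbertBasis ℕ ℝ G.L2} {z : ℕ → G.energySpace}
    (hmono : Monotone μ) (hz : ∀ n, (z n).1.fst = ψ n) (heig : ∀ n, IsEnergyEigen (z n) (μ n))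
    {m : ℕ} (y : G.energySpace) (hy : ∀ n < m, inner ℝ (ψ n) y.1.fst = 0) :
    μ m * ‖y.1.fst‖ ^ 2 ≤ ‖y.1.snd‖ ^ 2 := by
  -- Bessel's inequality for the derivatives of the eigenfunctions, which are orthogonal in `L²`
  set a : ℕ → ℝ := fun n => inner ℝ (ψ n) y.1.fst with ha
  have hfinite : ∀ N : ℕ, ∑ n ∈ Finset.range N, μ m * a n ^ 2 ≤ ‖y.1.snd‖ ^ 2 := by
    intro N
    have hon : Orthonormal ℝ fun i : Fin N => (z i).1.fst := by
      simp only [hz]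
      exact ψ.orthonormal.comp _ Fin.val_injective
    have h1 := norm_sq_snd_sum hon (c := fun i : Fin N => μ i) (fun i => heig i) fun i => a i
    have h2 : inner ℝ (∑ i : Fin N, a i • z i).1.snd y.1.snd = ∑ i : Fin N, μ i * a i ^ 2 := by
      rw [snd_sum, sum_inner]
      refine Finset.sum_congr rfl fun i _ => ?_
      rw [real_inner_smul_left, heig, hz]
      ring
    have h3 := norm_sub_sq_real (∑ i : Fin N, a i • z i).1.snd y.1.snd
    rw [h1, h2] at h3
    have h4 : ∑ i : Fin N, μ i * a i ^ 2 ≤ ‖y.1.snd‖ ^ 2 := by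
      have := sq_nonneg ‖(∑ i : Fin N, a i • z i).1.snd - y.1.snd‖
      linarith
    refine le_trans ?_ h4
    rw [Fin.sum_univ_eq_sum_range fun n => μ n * a n ^ 2]
    refine Finset.sum_le_sum fun n _ => ?_
    rcases lt_or_ge n m with hn | hn
    · have : a n = 0 := hy n hn
      rw [this]
      simp
    · exact mul_le_mul_of_nonneg_right (hmono hn) (sq_nonneg _)
  have hsum : HasSum (fun n => μ m * a n ^ 2) (μ m * ‖y.1.fst‖ ^ 2) := by
    refine HasSum.mul_left _ ?_
    have := ψ.hasSum_inner_mul_inner y.1.fst y.1.fst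
    rw [real_inner_self_eq_norm_sq] at this
    refine this.congr_fun fun n => ?_
    rw [real_inner_comm, ha, sq]
  exact le_of_tendsto' hsum.tendsto_sum_nat hfinite

/-- An eigenvalue is bounded above by the Rayleigh quotients on a space of test functions. -/
theorem IsNeumannSpectrum.le_of_test (hμ : G.IsNeumannSpectrum μ) {ω : ℝ} {k : ℕ} (hk : 1 ≤ k)
    (U : (Fin k → ℝ) →ₗ[ℝ] G.Space → ℝ) (hU : ∀ a, G.MemH1 (U a))
    (hpos : ∀ a, a ≠ 0 → 0 < G.l2Form (U a) (U a))
    (hle : ∀ a, a ≠ 0 → G.neumannForm (U a) (U a) ≤ ω ^ 2 * G.l2Form (U a) (U a)) :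
    μ (k - 1) ≤ ω ^ 2 := by
  classical
  obtain ⟨ψ, z, hz, heig⟩ := hμ.exists_energy
  choose w hw using fun i : Fin k => (hU (Pi.single i 1)).exists_energy
  have hwU : ∀ a, G.toFunction (Fintype.linearCombination ℝ w a) = U a := by
    intro a
    rw [Fintype.linearCombination_apply, map_sum]
    conv_rhs => rw [pi_eq_sum_univ' a, map_sum]
    refine Finset.sum_congr rfl fun i _ => ?_
    rw [map_smul, map_smul, hw]
  -- some test function is orthogonal to the first `k - 1` eigenfunctions
  set Φ : (Fin k → ℝ) →ₗ[ℝ] (Fin (k - 1) → ℝ) := LinearMap.pi fun n =>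
    ((innerSL ℝ (ψ n)).comp ((WithLp.fstL 2 ℝ G.L2 G.L2).comp G.energySpace.subtypeL) :
      G.energySpace →ₗ[ℝ] ℝ).comp (Fintype.linearCombination ℝ w) with hΦ
  have hker : LinearMap.ker Φ ≠ ⊥ := by
    refine LinearMap.ker_ne_bot_of_finrank_lt ?_
    simp only [Module.finrank_fin_fun]
    omega
  obtain ⟨a, ha, ha0⟩ := (Submodule.ne_bot_iff _).1 hker
  have h1 := IsNeumannSpectrum.mul_norm_sq_le hμ.1 hz heig (m := k - 1)
    (Fintype.linearCombination ℝ w a) fun n hn => congrFun (LinearMap.mem_ker.1 ha) ⟨n, hn⟩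
  have h2 := hle a ha0
  have h3 := hpos a ha0
  rw [← hwU, neumannForm_toFunction, l2Form_toFunction, real_inner_self_eq_norm_sq,
    real_inner_self_eq_norm_sq] at h2
  rw [← hwU, l2Form_toFunction, real_inner_self_eq_norm_sq] at h3
  exact le_of_mul_le_mul_right (h1.trans h2) h3

end

section

/-! ### The length measure -/

variable {E : Type*} {G : MetricGraph E}

instance : MeasurableSpace G.Space := borel G.Space

instance : BorelSpace G.Space := ⟨rfl⟩

/-- The measure on the graph that restricts to Lebesgue measure on every edge. -/
def lengthMeasure (G : MetricGraph E) : Measure G.Space :=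
  Measure.sum fun e => (G.edgeMeasure e).map (G.pt e)

theorem lengthMeasure_apply {s : Set G.Space} (hs : MeasurableSet s) :
    G.lengthMeasure s = ∑' e, G.edgeMeasure e (G.pt e ⁻¹' s) := by
  rw [lengthMeasure, Measure.sum_apply _ hs]
  exact tsum_congr fun e => Measure.map_apply (continuous_pt e).measurable hs

theorem lengthMeasure_univ (hfin : G.FiniteLength) :
    G.lengthMeasure Set.univ = ENNReal.ofReal G.totalLength := by
  rw [lengthMeasure_apply MeasurableSet.univ, totalLength,
    ENNReal.ofReal_tsum_of_nonneg (fun e => (G.len_pos e).le) hfin]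
  refine tsum_congr fun e => ?_
  rw [Set.preimage_univ, Measure.restrict_apply_univ, Real.volume_Icc, sub_zero]

theorem hasSum_integral_lengthMeasure {f : G.Space → ℝ} (hf : Integrable f G.lengthMeasure) :
    HasSum (fun e => ∫ x, f (G.pt e x) ∂(G.edgeMeasure e)) (∫ p, f p ∂G.lengthMeasure) := by
  refine (hasSum_integral_measure hf).congr_fun fun e => ?_
  refine (integral_map (continuous_pt e).aemeasurable ?_).symm
  exact hf.aestronglyMeasurable.mono_measure (Measure.le_sum _ e)

theorem ae_edge_of_ae_lengthMeasure {P : G.Space → Prop} (h : ∀ᵐ p ∂G.lengthMeasure, P p) (e : E) :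
    ∀ᵐ x ∂(G.edgeMeasure e), P (G.pt e x) :=
  ae_of_ae_map (continuous_pt e).aemeasurable ((Measure.absolutelyContinuous_of_le
    (Measure.le_sum (fun e => (G.edgeMeasure e).map (G.pt e)) e)).ae_le h)

/-- The length measure dominates the measure of the image under a function that is `1`-Lipschitz
along the edges. -/
theorem volume_image_le [Countable E] {ρ : G.Space → ℝ}
    (hρ : ∀ e, ∀ s ∈ Set.Icc 0 (G.len e), ∀ t ∈ Set.Icc 0 (G.len e),
      |ρ (G.pt e s) - ρ (G.pt e t)| ≤ 1 * |s - t|) {s : Set G.Space} (hs : MeasurableSet s) :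
    volume (ρ '' s) ≤ G.lengthMeasure s := by
  have hsub : ρ '' s ⊆ ⋃ e, G.onEdge ρ e '' (G.pt e ⁻¹' s ∩ Set.Icc 0 (G.len e)) := by
    rintro _ ⟨p, hp, rfl⟩
    obtain ⟨e, t, ht, rfl⟩ := exists_pt p
    exact Set.mem_iUnion.2 ⟨e, t, ⟨hp, ht⟩, onEdge_eq ρ e t⟩
  rw [lengthMeasure_apply hs]
  refine (measure_mono hsub).trans ((measure_iUnion_le _).trans (ENNReal.tsum_le_tsum fun e => ?_))
  have h := (onEdge_lipschitz zero_le_one hρ e).hausdorffMeasure_image_le zero_le_one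
    (G.pt e ⁻¹' s ∩ Set.Icc 0 (G.len e))
  rw [hausdorffMeasure_real] at h
  rw [Measure.restrict_apply ((continuous_pt e).measurable hs)]
  simpa using h

/-! ### Test functions on equilateral stars -/

/-- `G` is a star with arms of length `ℓ` and centre `c`, the arms being parametrised by `γ` on the
intervals `J`. -/
structure IsStarParam {k : ℕ} (G : MetricGraph E) (ℓ : ℝ) (c : G.Space) (J : Fin k → Set ℝ)
    (γ : Fin k → ℝ → G.Space) : Prop where
  dom : ∀ i, J i = Set.Icc 0 ℓ ∨ J i = Set.Ico 0 ℓ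
  base : ∀ i, γ i 0 = c
  surj : ∀ p : G.Space, ∃ i, ∃ x ∈ J i, γ i x = p
  same : ∀ i, ∀ x ∈ J i, ∀ y ∈ J i, edist (γ i x) (γ i y) = ENNReal.ofReal |x - y|
  diff : ∀ i j, i ≠ j → ∀ x ∈ J i, ∀ y ∈ J j, edist (γ i x) (γ j y) = ENNReal.ofReal (x + y)

/-- The distance to the point `c`. -/
def radius (c p : G.Space) : ℝ := (edist p c).toReal

/-- The points other than the centre on one arm of a star. -/
def openArm {k : ℕ} (J : Fin k → Set ℝ) (γ : Fin k → ℝ → G.Space) (i : Fin k) : Set G.Space :=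
  {p | ∃ x ∈ J i, 0 < x ∧ γ i x = p}

namespace IsStarParam

variable {k : ℕ} {ℓ : ℝ} {c : G.Space} {J : Fin k → Set ℝ} {γ : Fin k → ℝ → G.Space}
  (h : IsStarParam G ℓ c J γ) (hℓ : 0 < ℓ)

include h

theorem mem_Icc {i : Fin k} {x : ℝ} (hx : x ∈ J i) : x ∈ Set.Icc 0 ℓ := by
  rcases h.dom i with h1 | h1 <;> rw [h1] at hx
  · exact hx
  · exact Set.Ico_subset_Icc_self hx

theorem mem_of_Ico {i : Fin k} {x : ℝ} (hx : x ∈ Set.Ico 0 ℓ) : x ∈ J i := by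
  rcases h.dom i with h1 | h1 <;> rw [h1]
  · exact Set.Ico_subset_Icc_self hx
  · exact hx

include hℓ

theorem edist_center {i : Fin k} {x : ℝ} (hx : x ∈ J i) : edist (γ i x) c = ENNReal.ofReal x := by
  rw [← h.base i, h.same i x hx 0 (h.mem_of_Ico ⟨le_rfl, hℓ⟩), sub_zero,
    abs_of_nonneg (h.mem_Icc hx).1]

theorem radius_eq {i : Fin k} {x : ℝ} (hx : x ∈ J i) : radius c (γ i x) = x := by
  rw [radius, h.edist_center hℓ hx, ENNReal.toReal_ofReal (h.mem_Icc hx).1]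

theorem abs_radius_sub_le (p q : G.Space) : |radius c p - radius c q| ≤ (edist p q).toReal := by
  obtain ⟨i, x, hx, rfl⟩ := h.surj p
  obtain ⟨j, y, hy, rfl⟩ := h.surj q
  rw [h.radius_eq hℓ hx, h.radius_eq hℓ hy]
  have h1 := (h.mem_Icc hx).1
  have h2 := (h.mem_Icc hy).1
  by_cases hij : i = j
  · subst hij
    rw [h.same i x hx y hy, ENNReal.toReal_ofReal (abs_nonneg _)]
  · rw [h.diff i j hij x hx y hy, ENNReal.toReal_ofReal (by positivity), abs_le]
    constructor <;> linarith

omit h hℓ in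
theorem toReal_edist_pt_le (e : E) (s t : ℝ) : (edist (G.pt e s) (G.pt e t)).toReal ≤ |s - t| := by
  have h1 := ENNReal.toReal_mono ENNReal.ofReal_ne_top (edist_pt_le (G := G) e s t)
  rwa [ENNReal.toReal_ofReal (abs_nonneg _)] at h1

theorem radius_lipschitz (e : E) : ∀ s ∈ Set.Icc 0 (G.len e), ∀ t ∈ Set.Icc 0 (G.len e),
    |radius c (G.pt e s) - radius c (G.pt e t)| ≤ 1 * |s - t| := fun s _ t _ => by
  rw [one_mul]
  exact (h.abs_radius_sub_le hℓ _ _).trans (toReal_edist_pt_le e s t)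

theorem continuous_radius : Continuous (radius c) :=
  continuous_of_edges one_pos (h.radius_lipschitz hℓ)

omit hℓ in
theorem isOpen_openArm (i : Fin k) : IsOpen (openArm J γ i) := by
  rw [EMetric.isOpen_iff]
  rintro _ ⟨x, hx, hx0, rfl⟩
  refine ⟨ENNReal.ofReal x, by simpa using hx0, fun q hq => ?_⟩
  obtain ⟨j, y, hy, rfl⟩ := h.surj q
  rw [Metric.mem_eball] at hq
  have h2 := (h.mem_Icc hy).1
  by_cases hij : j = i
  · subst hij
    rw [h.same j y hy x hx, ENNReal.ofReal_lt_ofReal_iff hx0, abs_lt] at hq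
    exact ⟨y, hy, by linarith, rfl⟩
  · rw [h.diff j i hij y hy x hx, ENNReal.ofReal_lt_ofReal_iff hx0] at hq
    linarith

omit hℓ in
theorem disjoint_openArm {i j : Fin k} (hij : i ≠ j) : Disjoint (openArm J γ i) (openArm J γ j) := by
  rw [Set.disjoint_left]
  rintro _ ⟨x, hx, hx0, rfl⟩ ⟨y, hy, hy0, hxy⟩
  have h1 := h.diff i j hij x hx y hy
  rw [hxy, edist_self] at h1
  have h2 := ENNReal.ofReal_eq_zero.1 h1.symm
  linarith

theorem volume_le [Countable E] (i : Fin k) {A : Set ℝ} (hA : MeasurableSet A)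
    (hsub : A ⊆ Set.Ioo 0 ℓ) :
    volume A ≤ G.lengthMeasure (radius c ⁻¹' A ∩ openArm J γ i) := by
  refine le_trans (measure_mono fun x hx => ?_) (volume_image_le (h.radius_lipschitz hℓ)
    (((h.continuous_radius hℓ).measurable hA).inter (h.isOpen_openArm i).measurableSet))
  have hx1 := hsub hx
  have hxJ : x ∈ J i := h.mem_of_Ico ⟨hx1.1.le, hx1.2⟩
  have hr := h.radius_eq hℓ hxJ
  refine ⟨γ i x, ⟨?_, x, hxJ, hx1.1, rfl⟩, hr⟩
  rwa [Set.mem_preimage, hr]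

/-- Each arm has length at least `ℓ`, and the total length is `k ℓ`; so the arms have exactly length
`ℓ` and make up the whole graph. -/
theorem lengthMeasure_openArm [Countable E] (hfin : G.FiniteLength) (hL : G.totalLength = k * ℓ) :
    (∀ i, G.lengthMeasure (openArm J γ i) = ENNReal.ofReal ℓ) ∧
      ∀ᵐ p ∂G.lengthMeasure, ∃ i, p ∈ openArm J γ i := by
  have huniv := lengthMeasure_univ hfin
  have hfinite : IsFiniteMeasure G.lengthMeasure := ⟨by rw [huniv]; exact ENNReal.ofReal_lt_top⟩
  have hmeas : ∀ i, MeasurableSet (openArm J γ i) := fun i => (h.isOpen_openArm i).measurableSet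
  have hge : ∀ i, ENNReal.ofReal ℓ ≤ G.lengthMeasure (openArm J γ i) := by
    intro i
    have h1 := h.volume_le hℓ i measurableSet_Ioo le_rfl
    rw [Real.volume_Ioo, sub_zero] at h1
    exact h1.trans (measure_mono Set.inter_subset_right)
  have hU : G.lengthMeasure (⋃ i, openArm J γ i) = ∑ i, G.lengthMeasure (openArm J γ i) := by
    rw [measure_iUnion (fun i j hij => h.disjoint_openArm hij) hmeas, tsum_fintype]
  have hle : ∑ i, G.lengthMeasure (openArm J γ i) ≤ ∑ _i : Fin k, ENNReal.ofReal ℓ := by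
    rw [← hU, Finset.sum_const, Finset.card_univ, Fintype.card_fin, nsmul_eq_mul]
    refine (measure_mono (Set.subset_univ _)).trans ?_
    rw [huniv, hL, ENNReal.ofReal_mul (by positivity), ENNReal.ofReal_natCast]
  have hsum : ∑ i, G.lengthMeasure (openArm J γ i) = ∑ _i : Fin k, ENNReal.ofReal ℓ :=
    le_antisymm hle (Finset.sum_le_sum fun i _ => hge i)
  have heq : ∀ i, G.lengthMeasure (openArm J γ i) = ENNReal.ofReal ℓ := by
    intro i
    refine le_antisymm ?_ (hge i)
    have hfin' : ∑ _j ∈ Finset.univ.erase i, ENNReal.ofReal ℓ ≠ ⊤ :=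
      ENNReal.sum_ne_top.2 fun _ _ => ENNReal.ofReal_ne_top
    rw [← ENNReal.add_le_add_iff_right hfin',
      Finset.add_sum_erase _ (fun _ => ENNReal.ofReal ℓ) (Finset.mem_univ i), ← hsum,
      ← Finset.add_sum_erase _ (fun j => G.lengthMeasure (openArm J γ j)) (Finset.mem_univ i)]
    exact add_le_add le_rfl (Finset.sum_le_sum fun j _ => hge j)
  refine ⟨heq, ?_⟩
  have hcompl : G.lengthMeasure (⋃ i, openArm J γ i)ᶜ = 0 := by
    rw [measure_compl (MeasurableSet.iUnion hmeas) (measure_ne_top _ _), hU, hsum, huniv, hL,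
      Finset.sum_const, Finset.card_univ, Fintype.card_fin, nsmul_eq_mul,
      ENNReal.ofReal_mul (by positivity), ENNReal.ofReal_natCast, tsub_self]
  refine measure_mono_null (fun p hp => ?_) hcompl
  simpa using hp

/-- The distance to the centre carries the length measure on an arm to Lebesgue measure. -/
theorem map_radius_openArm [Countable E] (hfin : G.FiniteLength) (hL : G.totalLength = k * ℓ)
    (i : Fin k) : (G.lengthMeasure.restrict (openArm J γ i)).map (radius c) =
      volume.restrict (Set.Ioo 0 ℓ) := by
  have hrad := (h.continuous_radius hℓ).measurable
  symm
  refine Measure.eq_of_le_of_measure_univ_eq (Measure.le_iff.2 fun s hs => ?_) ?_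
  · rw [Measure.map_apply hrad hs, Measure.restrict_apply hs, Measure.restrict_apply (hrad hs)]
    refine (h.volume_le hℓ i (hs.inter measurableSet_Ioo) Set.inter_subset_right).trans
      (measure_mono ?_)
    exact Set.inter_subset_inter_left _ (Set.preimage_mono Set.inter_subset_left)
  · rw [Measure.map_apply hrad MeasurableSet.univ, Set.preimage_univ, Measure.restrict_apply_univ,
      Measure.restrict_apply_univ, (h.lengthMeasure_openArm hℓ hfin hL).1 i, Real.volume_Ioo, sub_zero]

end IsStarParam

end

section

variable {E : Type*} {G : MetricGraph E}

/-- The function that is given by `f i` of the distance to the centre on the arm `i`, and vanishes at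
the centre. -/
def armSum {k : ℕ} (c : G.Space) (J : Fin k → Set ℝ) (γ : Fin k → ℝ → G.Space) (f : Fin k → ℝ → ℝ)
    (p : G.Space) : ℝ :=
  ∑ i, (openArm J γ i).indicator (fun q => f i (radius c q)) p

/-- The test function whose values on the arm `i` go from the mean of `a` to `a i`, along a sine. -/
def starTest {k : ℕ} (ω : ℝ) (c : G.Space) (J : Fin k → Set ℝ) (γ : Fin k → ℝ → G.Space) :
    (Fin k → ℝ) →ₗ[ℝ] G.Space → ℝ where
  toFun a p := (∑ i, a i) / k +
    ∑ i, (a i - (∑ i, a i) / k) * (openArm J γ i).indicator (fun q => Real.sin (ω * radius c q)) p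
  map_add' a b := by
    funext p
    have hs : ∑ i, (a i + b i) = ∑ i, a i + ∑ i, b i := Finset.sum_add_distrib
    simp only [Pi.add_apply, hs, add_div]
    rw [add_add_add_comm, ← Finset.sum_add_distrib]
    congr 1
    refine Finset.sum_congr rfl fun i _ => ?_
    ring
  map_smul' r a := by
    funext p
    simp only [Pi.smul_apply, smul_eq_mul, ← Finset.mul_sum, RingHom.id_apply, mul_add, mul_div_assoc]
    congr 1
    rw [Finset.mul_sum]
    refine Finset.sum_congr rfl fun i _ => ?_
    ring

theorem starTest_apply {k : ℕ} (ω : ℝ) (c : G.Space) (J : Fin k → Set ℝ)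
    (γ : Fin k → ℝ → G.Space) (a : Fin k → ℝ) (p : G.Space) :
    starTest ω c J γ a p = (∑ i, a i) / k + ∑ i, (a i - (∑ i, a i) / k) *
      (openArm J γ i).indicator (fun q => Real.sin (ω * radius c q)) p := rfl

theorem integrable_comp_pt {f : G.Space → ℝ} (hf : Integrable f G.lengthMeasure) (e : E) :
    Integrable (fun x => f (G.pt e x)) (G.edgeMeasure e) := by
  have h1 := hf.mono_measure (Measure.le_sum (fun e => (G.edgeMeasure e).map (G.pt e)) e)
  exact (integrable_map_measure h1.aestronglyMeasurable (continuous_pt e).aemeasurable).1 h1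

theorem integral_cos_sq_eq {ω ℓ : ℝ} (hωℓ : ω * ℓ = Real.pi / 2) :
    ∫ x in (0 : ℝ)..ℓ, Real.cos (ω * x) ^ 2 = ∫ x in (0 : ℝ)..ℓ, Real.sin (ω * x) ^ 2 := by
  have h1 : ∀ x, Real.cos (ω * x) ^ 2 = (fun y => Real.sin (ω * y) ^ 2) (ℓ - x) := fun x => by
    simp only [mul_sub, hωℓ, Real.sin_pi_div_two_sub]
  simp only [h1]
  rw [intervalIntegral.integral_comp_sub_left (fun y => Real.sin (ω * y) ^ 2), sub_self, sub_zero]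

theorem integral_sin_sq_eq {ω ℓ : ℝ} (hωℓ : ω * ℓ = Real.pi / 2) :
    ∫ x in (0 : ℝ)..ℓ, Real.sin (ω * x) ^ 2 = ℓ / 2 := by
  have h1 : (∫ x in (0 : ℝ)..ℓ, Real.sin (ω * x) ^ 2) + ∫ x in (0 : ℝ)..ℓ, Real.cos (ω * x) ^ 2 = ℓ := by
    rw [← intervalIntegral.integral_add (Continuous.intervalIntegrable (by fun_prop) _ _)
      (Continuous.intervalIntegrable (by fun_prop) _ _)]
    simp
  rw [integral_cos_sq_eq hωℓ] at h1
  linarith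

namespace IsStarParam

variable {k : ℕ} {ℓ ω : ℝ} {c : G.Space} {J : Fin k → Set ℝ} {γ : Fin k → ℝ → G.Space}
  (h : IsStarParam G ℓ c J γ) (hℓ : 0 < ℓ)

include h

theorem armSum_of_mem (f : Fin k → ℝ → ℝ) {i : Fin k} {p : G.Space} (hp : p ∈ openArm J γ i) :
    armSum c J γ f p = f i (radius c p) := by
  rw [armSum, Finset.sum_eq_single i]
  · exact Set.indicator_of_mem hp _
  · intro j _ hj
    exact Set.indicator_of_notMem (Set.disjoint_left.1 (h.disjoint_openArm hj.symm) hp) _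
  · exact fun hi => absurd (Finset.mem_univ i) hi

theorem starTest_of_mem (a : Fin k → ℝ) {i : Fin k} {p : G.Space} (hp : p ∈ openArm J γ i) :
    starTest ω c J γ a p =
      (∑ i, a i) / k + (a i - (∑ i, a i) / k) * Real.sin (ω * radius c p) := by
  rw [starTest_apply]
  generalize (∑ i, a i) / k = m
  rw [Finset.sum_eq_single i]
  · rw [Set.indicator_of_mem hp]
  · intro j _ hj
    rw [Set.indicator_of_notMem (Set.disjoint_left.1 (h.disjoint_openArm hj.symm) hp), mul_zero]
  · exact fun hi => absurd (Finset.mem_univ i) hi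

include hℓ

theorem starTest_eq (a : Fin k → ℝ) {i : Fin k} {x : ℝ} (hx : x ∈ J i) :
    starTest ω c J γ a (γ i x) = (∑ i, a i) / k + (a i - (∑ i, a i) / k) * Real.sin (ω * x) := by
  rcases (h.mem_Icc hx).1.eq_or_lt with h0 | h0
  · subst h0
    rw [mul_zero, Real.sin_zero, mul_zero, h.base, starTest_apply]
    congr 1
    refine Finset.sum_eq_zero fun j _ => ?_
    rw [Set.indicator_of_notMem, mul_zero]
    rintro ⟨y, hy, hy0, hyc⟩
    have h1 := h.edist_center hℓ hy
    rw [hyc, edist_self] at h1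
    exact absurd (ENNReal.ofReal_eq_zero.1 h1.symm) hy0.not_ge
  · rw [h.starTest_of_mem a ⟨x, hx, h0, rfl⟩, h.radius_eq hℓ hx]

/-- The test functions are Lipschitz for the path metric. -/
theorem memH1_starTest (hfin : G.FiniteLength) (hω : 0 < ω) (a : Fin k → ℝ) :
    G.MemH1 (starTest ω c J γ a) := by
  obtain ⟨m, hm⟩ : ∃ m, m = (∑ i, a i) / k := ⟨_, rfl⟩
  obtain ⟨K, hK⟩ : ∃ K, K = ∑ i, |a i - m| := ⟨_, rfl⟩
  have hK0 : 0 ≤ K := hK ▸ Finset.sum_nonneg fun i _ => abs_nonneg _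
  have hle : ∀ i, |a i - m| ≤ K := fun i => hK ▸
    Finset.single_le_sum (f := fun i => |a i - m|) (fun j _ => abs_nonneg _) (Finset.mem_univ i)
  have hsin : ∀ x y : ℝ, |Real.sin (ω * x) - Real.sin (ω * y)| ≤ ω * |x - y| := fun x y => by
    have := Real.lipschitzWith_sin.dist_le_mul (ω * x) (ω * y)
    rw [Real.dist_eq, Real.dist_eq, ← mul_sub, abs_mul, abs_of_pos hω] at this
    simpa using this
  have hsin0 : ∀ i x, 0 ≤ x → |(a i - m) * Real.sin (ω * x)| ≤ K * (ω * x) := fun i x hx => by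
    have := hsin x 0
    rw [mul_zero, Real.sin_zero, sub_zero, sub_zero, abs_of_nonneg hx] at this
    rw [abs_mul]
    exact mul_le_mul (hle i) this (abs_nonneg _) hK0
  have hlip : ∀ p q : G.Space, |starTest ω c J γ a p - starTest ω c J γ a q| ≤
      K * ω * (edist p q).toReal := by
    intro p q
    obtain ⟨i, x, hx, rfl⟩ := h.surj p
    obtain ⟨j, y, hy, rfl⟩ := h.surj q
    rw [h.starTest_eq hℓ a hx, h.starTest_eq hℓ a hy, add_sub_add_left_eq_sub, ← hm]
    have h1 := (h.mem_Icc hx).1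
    have h2 := (h.mem_Icc hy).1
    by_cases hij : i = j
    · subst hij
      rw [h.same i x hx y hy, ENNReal.toReal_ofReal (abs_nonneg _), ← mul_sub, abs_mul, mul_assoc]
      exact mul_le_mul (hle i) (hsin x y) (abs_nonneg _) hK0
    · rw [h.diff i j hij x hx y hy, ENNReal.toReal_ofReal (by positivity)]
      have h3 := hsin0 i x h1
      have h4 := hsin0 j y h2
      rw [abs_le] at h3 h4 ⊢
      constructor <;> nlinarith
  refine memH1_of_lipschitz hfin (K := K * ω + 1) (C := |m| + K) (by positivity)
    (fun e s _ t _ => ?_) fun p => ?_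
  · refine (hlip _ _).trans ?_
    have h1 := toReal_edist_pt_le (G := G) e s t
    have h2 : 0 ≤ K * ω := by positivity
    nlinarith [abs_nonneg (s - t), mul_le_mul_of_nonneg_left h1 h2]
  · obtain ⟨i, x, hx, rfl⟩ := h.surj p
    rw [h.starTest_eq hℓ a hx, ← hm]
    refine (abs_add_le _ _).trans (add_le_add le_rfl ?_)
    rw [abs_mul]
    exact (mul_le_mul (hle i) (Real.abs_sin_le_one _) (abs_nonneg _) hK0).trans (mul_one K).le

variable [Countable E] (hfin : G.FiniteLength) (hL : G.totalLength = k * ℓ)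

include hfin hL

theorem integral_armSum {f : Fin k → ℝ → ℝ} (hf : ∀ i, Continuous (f i)) :
    Integrable (armSum c J γ f) G.lengthMeasure ∧
      ∫ p, armSum c J γ f p ∂G.lengthMeasure = ∑ i, ∫ x in (0 : ℝ)..ℓ, f i x := by
  have hmeas : ∀ i, MeasurableSet (openArm J γ i) := fun i => (h.isOpen_openArm i).measurableSet
  have hrad := (h.continuous_radius hℓ).measurable
  have hint : ∀ i, IntegrableOn (fun q => f i (radius c q)) (openArm J γ i) G.lengthMeasure := by
    intro i
    refine (integrable_map_measure (hf i).aestronglyMeasurable hrad.aemeasurable).1 ?_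
    rw [h.map_radius_openArm hℓ hfin hL i]
    exact (((hf i).continuousOn (s := Set.Icc 0 ℓ)).integrableOn_Icc).mono_set Set.Ioo_subset_Icc_self
  refine ⟨integrable_finsetSum _ fun i _ => (hint i).integrable_indicator (hmeas i), ?_⟩
  simp only [armSum]
  rw [integral_finsetSum _ fun i _ => (hint i).integrable_indicator (hmeas i)]
  refine Finset.sum_congr rfl fun i _ => ?_
  rw [integral_indicator (hmeas i), ← integral_map hrad.aemeasurable (hf i).aestronglyMeasurable,
    h.map_radius_openArm hℓ hfin hL i, intervalIntegral.integral_of_le hℓ.le, integral_Ioc_eq_integral_Ioo]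

/-- The `L²` norm of the test functions; the mixed terms cancel because the deviations from the mean add
up to zero. -/
theorem l2Form_starTest (hωℓ : ω * ℓ = Real.pi / 2) (hk : 1 ≤ k) (a : Fin k → ℝ) :
    G.l2Form (starTest ω c J γ a) (starTest ω c J γ a) = k * ((∑ i, a i) / k) ^ 2 * ℓ +
      (∑ i, (a i - (∑ i, a i) / k) ^ 2) * (ℓ / 2) := by
  obtain ⟨m, hm⟩ : ∃ m, m = (∑ i, a i) / k := ⟨_, rfl⟩
  have hae : ∀ᵐ p ∂G.lengthMeasure, armSum c J γ
      (fun i x => (m + (a i - m) * Real.sin (ω * x)) ^ 2) p = starTest ω c J γ a p ^ 2 := by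
    filter_upwards [(h.lengthMeasure_openArm hℓ hfin hL).2] with p hp
    obtain ⟨i, hi⟩ := hp
    rw [h.armSum_of_mem _ hi, h.starTest_of_mem a hi, hm]
  obtain ⟨h1, h2⟩ := h.integral_armSum hℓ hfin hL
    (f := fun i x => (m + (a i - m) * Real.sin (ω * x)) ^ 2) fun i => by fun_prop
  rw [integral_congr_ae hae] at h2
  have h3 := (hasSum_integral_lengthMeasure (h1.congr hae)).tsum_eq
  have h4 : G.l2Form (starTest ω c J γ a) (starTest ω c J γ a) =
      ∑ i, ∫ x in (0 : ℝ)..ℓ, (m + (a i - m) * Real.sin (ω * x)) ^ 2 := by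
    rw [← h2, ← h3]
    simp only [l2Form, onEdge_eq, sq]
  have h5 : ∀ i, ∫ x in (0 : ℝ)..ℓ, (m + (a i - m) * Real.sin (ω * x)) ^ 2 = m ^ 2 * ℓ +
      (a i - m) * (2 * m * ∫ x in (0 : ℝ)..ℓ, Real.sin (ω * x)) + (a i - m) ^ 2 * (ℓ / 2) := by
    intro i
    rw [← integral_sin_sq_eq hωℓ, ← mul_assoc, ← intervalIntegral.integral_const_mul,
      ← intervalIntegral.integral_const_mul]
    have h6 : m ^ 2 * ℓ = ∫ _ in (0 : ℝ)..ℓ, m ^ 2 := by simp [mul_comm]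
    rw [h6, ← intervalIntegral.integral_add (Continuous.intervalIntegrable (by fun_prop) _ _)
        (Continuous.intervalIntegrable (by fun_prop) _ _),
      ← intervalIntegral.integral_add (Continuous.intervalIntegrable (by fun_prop) _ _)
        (Continuous.intervalIntegrable (by fun_prop) _ _)]
    refine intervalIntegral.integral_congr fun x _ => ?_
    ring
  have h7 : ∑ i, (a i - m) = 0 := by
    have hk0 : (k : ℝ) ≠ 0 := by
      have : k ≠ 0 := by omega
      exact_mod_cast this
    rw [Finset.sum_sub_distrib, Finset.sum_const, Finset.card_univ, Fintype.card_fin, nsmul_eq_mul, hm]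
    field_simp
    ring
  rw [h4, Finset.sum_congr rfl fun i _ => h5 i, Finset.sum_add_distrib, Finset.sum_add_distrib,
    ← Finset.sum_mul, ← Finset.sum_mul, h7, Finset.sum_const, Finset.card_univ, Fintype.card_fin,
    nsmul_eq_mul, ← hm, ← Finset.sum_mul, zero_mul, add_zero, mul_assoc]

/-- The energy of the test functions. The distance to the centre is `1`-Lipschitz, so the derivative on
the arm `i` is at most `|a i - m| ω cos (ω x)` in absolute value, where `m` is the mean of `a`. -/
theorem neumannForm_starTest_le (hω : 0 < ω) (hωℓ : ω * ℓ = Real.pi / 2) (a : Fin k → ℝ) :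
    G.neumannForm (starTest ω c J γ a) (starTest ω c J γ a) ≤
      ω ^ 2 * ((∑ i, (a i - (∑ i, a i) / k) ^ 2) * (ℓ / 2)) := by
  obtain ⟨m, hm⟩ : ∃ m, m = (∑ i, a i) / k := ⟨_, rfl⟩
  set f : Fin k → ℝ → ℝ := fun i x => ω ^ 2 * (a i - m) ^ 2 * Real.cos (ω * x) ^ 2 with hf
  obtain ⟨h1, h2⟩ := h.integral_armSum hℓ hfin hL (f := f) fun i => by fun_prop
  have h3 := hasSum_integral_lengthMeasure h1
  have hu := h.memH1_starTest hℓ hfin hω a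
  have h4 : ∫ p, armSum c J γ f p ∂G.lengthMeasure =
      ω ^ 2 * ((∑ i, (a i - m) ^ 2) * (ℓ / 2)) := by
    rw [h2, Finset.sum_mul, Finset.mul_sum]
    refine Finset.sum_congr rfl fun i _ => ?_
    rw [intervalIntegral.integral_const_mul, integral_cos_sq_eq hωℓ, integral_sin_sq_eq hωℓ, mul_assoc]
  rw [← hm, ← h4]
  have h5 : G.neumannForm (starTest ω c J γ a) (starTest ω c J γ a) =
      ∑' e, ∫ x, deriv (G.onEdge (starTest ω c J γ a) e) x ^ 2 ∂(G.edgeMeasure e) := by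
    simp only [neumannForm, sq]
  rw [h5]
  refine hasSum_le (fun e => ?_) hu.summable_deriv_sq.hasSum h3
  refine integral_mono_ae (hu.integrable_deriv_sq e) (integrable_comp_pt h1 e) ?_
  have hr : LipschitzWith 1 (G.onEdge (radius c) e) := by
    simpa using onEdge_lipschitz zero_le_one (h.radius_lipschitz hℓ) e
  filter_upwards [ae_edge_of_ae_lengthMeasure (h.lengthMeasure_openArm hℓ hfin hL).2 e,
    ae_restrict_of_ae hr.ae_differentiableAt_real] with x hx hd
  obtain ⟨i, hi⟩ := hx
  rw [h.armSum_of_mem f hi]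
  have hev : G.onEdge (starTest ω c J γ a) e =ᶠ[𝓝 x]
      fun t => m + (a i - m) * Real.sin (ω * G.onEdge (radius c) e t) := by
    filter_upwards [(continuous_pt e).continuousAt.preimage_mem_nhds
      ((h.isOpen_openArm i).mem_nhds hi)] with t ht
    rw [onEdge_eq, onEdge_eq, h.starTest_of_mem a ht, hm]
  have hder := ((hd.hasDerivAt.const_mul ω).sin.const_mul (a i - m)).const_add m
  rw [hev.deriv_eq, hder.deriv]
  have hr1 : |deriv (G.onEdge (radius c) e) x| ≤ 1 := by
    simpa using norm_deriv_le_of_lipschitz (x₀ := x) hr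
  have hr2 : deriv (G.onEdge (radius c) e) x ^ 2 ≤ 1 := (sq_le_one_iff_abs_le_one _).2 hr1
  have e1 : ((a i - m) * (Real.cos (ω * G.onEdge (radius c) e x) *
      (ω * deriv (G.onEdge (radius c) e) x))) ^ 2 =
      f i (radius c (G.pt e x)) * deriv (G.onEdge (radius c) e) x ^ 2 := by
    rw [hf, onEdge_eq]
    ring
  rw [e1]
  exact mul_le_of_le_one_right (by positivity) hr2

end IsStarParam

/-- The bound is attained on equilateral stars. -/
theorem IsNeumannSpectrum.le_of_isEquilateralStar [Countable E] {μ : ℕ → ℝ} {k : ℕ} {ω ℓ : ℝ}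
    (hμ : G.IsNeumannSpectrum μ) (hfin : G.FiniteLength) (hk : 1 ≤ k) (hℓ : 0 < ℓ) (hω : 0 < ω)
    (hωℓ : ω * ℓ = Real.pi / 2) (hL : G.totalLength = k * ℓ) (hstar : G.IsEquilateralStar k) :
    μ (k - 1) ≤ ω ^ 2 := by
  obtain ⟨c, J, γ, h1, h2, h3, h4, h5⟩ := hstar
  have hk0 : (0 : ℝ) < k := by
    have : 0 < k := by omega
    exact_mod_cast this
  have hLk : G.totalLength / k = ℓ := by rw [hL, mul_div_cancel_left₀ _ hk0.ne']
  rw [hLk] at h1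
  have h : IsStarParam G ℓ c J γ := ⟨h1, h2, h3, h4, h5⟩
  refine hμ.le_of_test hk (starTest ω c J γ) (h.memH1_starTest hℓ hfin hω) (fun a ha => ?_) fun a _ => ?_
  · rw [h.l2Form_starTest hℓ hfin hL hωℓ hk a]
    obtain ⟨m, hm⟩ : ∃ m, m = (∑ i, a i) / k := ⟨_, rfl⟩
    rw [← hm]
    have hs : 0 ≤ ∑ i, (a i - m) ^ 2 := Finset.sum_nonneg fun i _ => sq_nonneg _
    rcases eq_or_ne m 0 with h0 | h0
    · have : 0 < ∑ i, (a i - m) ^ 2 := by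
        obtain ⟨i, hi⟩ := Function.ne_iff.1 ha
        refine Finset.sum_pos' (fun i _ => sq_nonneg _) ⟨i, Finset.mem_univ i, ?_⟩
        rw [h0, sub_zero]
        exact sq_pos_of_ne_zero hi
      positivity
    · positivity
  · rw [h.l2Form_starTest hℓ hfin hL hωℓ hk a]
    refine (h.neumannForm_starTest_le hℓ hfin hL hω hωℓ a).trans
      (mul_le_mul_of_nonneg_left ?_ (sq_nonneg ω))
    have : 0 ≤ (k : ℝ) * ((∑ i, a i) / k) ^ 2 * ℓ := by positivity
    linarith

end

end MetricGraph

end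

theorem mainTheorem3 {E : Type*} [Countable E] (G : MetricGraph E)
    (hlf : G.LocallyFinite) (hconn : G.Connected) (hfin : G.FiniteLength)
    (hpos : 0 < G.totalLength) :
    (∃ μ : ℕ → ℝ, G.IsNeumannSpectrum μ) ∧
    ∀ μ : ℕ → ℝ, G.IsNeumannSpectrum μ → ∀ k : ℕ, 2 ≤ k →
      Real.pi ^ 2 * (k : ℝ) ^ 2 / (4 * G.totalLength ^ 2) ≤ μ (k - 1) ∧
      (μ (k - 1) = Real.pi ^ 2 * (k : ℝ) ^ 2 / (4 * G.totalLength ^ 2) ↔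
        G.IsEquilateralStar k) := by
  refine ⟨MetricGraph.exists_neumannSpectrum hlf hconn hfin hpos, fun μ hμ k hk => ?_⟩
  obtain ⟨⟨S, hcard, hS⟩, hrigid⟩ := MetricGraph.dichotomy hlf hconn hfin hpos hk
  have hk0 : (0 : ℝ) < k := by
    have : 0 < k := by omega
    exact_mod_cast this
  have hω : Real.pi ^ 2 * (k : ℝ) ^ 2 / (4 * G.totalLength ^ 2) =
      (Real.pi * k / (2 * G.totalLength)) ^ 2 := by
    rw [div_pow, mul_pow, mul_pow]
    norm_num
  have hlower := hμ.le_of_isCutSet hS hcard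
  rw [hω]
  refine ⟨hlower, fun h => hrigid (hμ.hasRigidity h.le), fun h => le_antisymm ?_ hlower⟩
  refine hμ.le_of_isEquilateralStar hfin (by omega) (ℓ := G.totalLength / k) (by positivity)
    (by positivity) ?_ ?_ h
  · field_simp
  · field_simp
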